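/- Let $1\le d\le 3$, let $\Omega=\prod_{i=1}^d(a_i,b_i)$ be a bounded box, let $T>0$, and let $m\ge 0$ be an integer. For an integer $s\ge 0$ let $H^s_p(\Omega)$ be the Sobolev space of periodic functions on $\Omega$, with norm $\|v\|_s=\big(\sum_{|\alpha|\le s}\|D^\alpha v\|_{L^2(\Omega)}^2\big)^{1/2}$, and let $(\cdot,\cdot)$ be the inner product of $L^2(\Omega)$. Let $f=f(t,\xi,\eta)$ be a real-valued $C^2$ function of $t,\xi\in\mathbb R$ and $\eta\in\mathbb R^d$ such that: (i) (mild growth) there are numbers $p>0$ (with $p\le 2$ if $d=3$) and $C_f$ such that, for $h=f$ and for every first-order partial derivative $h$ of $f$, $$|\partial_\xi h(t,\xi,\eta)|\le C_f(1+|\xi|^p),\qquad |\partial_{\eta_i}h(t,\xi,\eta)|\le C_f(1+|\eta|^p)\qquad\text{for all } t,\xi,\eta \text{ and } 1\le i\le d;$$ (ii) (smoothness) for all $K_1,K_2>0$, the partial derivatives of $f$ of order at most $2$ are bounded on the set of all $(t,\xi,\eta)$ with $t\in[0,T]$, $|\xi|\le K_1$, $|\eta|\le K_2$. Let $u_0\in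 H^m_p(\Omega)$ be real-valued, and let $u$ be a real-valued solution of $$u_t=\Delta u+f(t,u,\nabla u)\ \text{ in }\Omega,\quad 0\le t\le T,\qquad u(0)=u_0,$$ with periodic boundary conditions, in the following sense: $u\in C([0,T];H^2_p(\Omega))$, $u$ is differentiable on $[0,T]$ as a function with values in $L^2(\Omega)$, and the equation holds in $L^2(\Omega)$ for every $t\in[0,T]$. Assume that $u(t)\in H^m_p(\Omega)$ for all $t\in[0,T]$ and $\sup_{0\le t\le T}\|u(t)\|_m<\infty$. For positive even integers $N_1,\dots,N_d$ put $N=\max_j N_j$ and $$X_N=\operatorname{span}_{\mathbb C}\Big\{\prod_{j=1}^d e^{2\pi \mathrm i k_jx_j/(b_j-a_j)}\ :\ k\in\mathbb Z^d,\ -\tfrac{N_j}2\le k_j\le\tfrac{N_j}2-1\ (1\le j\le d)\Big\},$$ and let $P_N:L^2(\Omega)\to X_N$ be the $L^2$-orthogonal projection. A Fourier Galerkin semi-discrete solution is a differentiable function $u_N:[0,T]\to X_N$ with $$(u_{N,t},v)+(\nabla u_N,\nabla v)=(f(t,u_N,\nabla u_N),v)\quad\text{for all } v\in X_N,\ 0\le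 t\le T,\qquad u_N(0)=P_Nu_0,$$ where, for complex-valued $v$, $f(t,v,\nabla v)$ means $f(t,\operatorname{Re}v,\operatorname{Re}\nabla v)$. Then for every $\kappa\ge 1$ there are $N_0>0$ and $C>0$ such that for all positive even $N_1,\dots,N_d$ with $N\le\kappa N_j$ for every $j$ and with $N\ge N_0$, a semi-discrete solution $u_N$ on $[0,T]$ exists, and every such $u_N$ satisfies $$\|u(t)-u_N(t)\|_0+N^{-1}\|u(t)-u_N(t)\|_1\le C\,N^{-m}\qquad\text{for all } t\in[0,T].$$ In particular, $C$ does not depend on $N$. -/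

import Mathlib

namespace FourierGalerkin

/-- The open box with corners `a` and `b`. -/
def box {d : ℕ} (a b : Fin d → ℝ) : Set (EuclideanSpace ℝ (Fin d)) :=
  {x | ∀ i, a i < x i ∧ x i < b i}

/-- Lebesgue measure on the box. -/
noncomputable def boxMeasure {d : ℕ} (a b : Fin d → ℝ) :
    MeasureTheory.Measure (EuclideanSpace ℝ (Fin d)) :=
  MeasureTheory.volume.restrict (box a b)

/-! ### Periodic Sobolev spaces through weak derivatives -/

/-- The classical partial derivative in the `i`-th coordinate. -/
noncomputable def partialD {d : ℕ} (i : Fin d) (φ : EuclideanSpace ℝ (Fin d) → ℂ) :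
    EuclideanSpace ℝ (Fin d) → ℂ :=
  fun x => fderiv ℝ φ x (EuclideanSpace.single i 1)

/-- The classical derivative `D^α = ∂₁^{α₁} ⋯ ∂_d^{α_d}`. -/
noncomputable def multiD {d : ℕ} (α : Fin d → ℕ) (φ : EuclideanSpace ℝ (Fin d) → ℂ) :
    EuclideanSpace ℝ (Fin d) → ℂ :=
  (List.finRange d).foldr (fun i g => (partialD i)^[α i] g) φ

/-- Smooth functions on `ℝ^d` with period `b i - a i` in the `i`-th coordinate. -/
def IsPeriodicTest {d : ℕ} (a b : Fin d → ℝ) (φ : EuclideanSpace ℝ (Fin d) → ℂ) : Prop :=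
  ContDiff ℝ (⊤ : ℕ∞) φ ∧ ∀ i x, φ (x + EuclideanSpace.single i (b i - a i)) = φ x

/-- `g ∈ L²` is the weak derivative `D^α v` of `v ∈ L²` on the periodic box. Testing against all
smooth periodic functions (not only those with compact support in the box) is what encodes the
periodicity of the derivatives of lower order. -/
def IsWeakDeriv {d : ℕ} (a b : Fin d → ℝ) (α : Fin d → ℕ)
    (v g : EuclideanSpace ℝ (Fin d) → ℂ) : Prop :=
  MeasureTheory.MemLp v 2 (boxMeasure a b) ∧ MeasureTheory.MemLp g 2 (boxMeasure a b) ∧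
    ∀ φ, IsPeriodicTest a b φ →
      ∫ x, v x * multiD α φ x ∂(boxMeasure a b)
        = (-1 : ℂ) ^ (∑ i, α i) * ∫ x, g x * φ x ∂(boxMeasure a b)

/-- The periodic Sobolev space `H^s_p` of the box. -/
def MemHp {d : ℕ} (a b : Fin d → ℝ) (s : ℕ) (v : EuclideanSpace ℝ (Fin d) → ℂ) : Prop :=
  ∀ α : Fin d → ℕ, ∑ i, α i ≤ s → ∃ g, IsWeakDeriv a b α v g

open Classical in
/-- The weak derivative `D^α v` (determined almost everywhere on the box); `0` if there is none. -/
noncomputable def weakDeriv {d : ℕ} (a b : Fin d → ℝ) (α : Fin d → ℕ)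
    (v : EuclideanSpace ℝ (Fin d) → ℂ) : EuclideanSpace ℝ (Fin d) → ℂ :=
  if h : ∃ g, IsWeakDeriv a b α v g then h.choose else 0

/-- The multi-indices of order at most `s`. -/
def multiIndices (d s : ℕ) : Finset (Fin d → ℕ) :=
  (Fintype.piFinset fun _ => Finset.range (s + 1)).filter fun α => ∑ i, α i ≤ s

/-- The norm `‖v‖_s = (∑_{|α| ≤ s} ‖D^α v‖²)^{1/2}` of `v ∈ H^s_p`. -/
noncomputable def sobolevNorm {d : ℕ} (a b : Fin d → ℝ) (s : ℕ)
    (v : EuclideanSpace ℝ (Fin d) → ℂ) : ℝ :=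
  Real.sqrt (∑ α ∈ multiIndices d s, ∫ x, ‖weakDeriv a b α v x‖ ^ 2 ∂(boxMeasure a b))

/-- The `L²` inner product `(w, v)`. -/
noncomputable def l2Inner {d : ℕ} (a b : Fin d → ℝ)
    (w v : EuclideanSpace ℝ (Fin d) → ℂ) : ℂ :=
  ∫ x, w x * (starRingEnd ℂ) (v x) ∂(boxMeasure a b)

/-- The bilinear form `a(w, v) = ∫ ∇w · ∇v`. -/
noncomputable def dirichletForm {d : ℕ} (a b : Fin d → ℝ)
    (w v : EuclideanSpace ℝ (Fin d) → ℂ) : ℂ :=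
  ∑ i, l2Inner a b (weakDeriv a b (Pi.single i 1) w) (weakDeriv a b (Pi.single i 1) v)

/-! ### The reaction term -/

/-- The coordinate directions of the variables `(t, ξ, η)`. -/
noncomputable def argDir {d : ℕ} :
    Unit ⊕ Unit ⊕ Fin d → ℝ × ℝ × EuclideanSpace ℝ (Fin d)
  | Sum.inl _ => (1, 0, 0)
  | Sum.inr (Sum.inl _) => (0, 1, 0)
  | Sum.inr (Sum.inr i) => (0, 0, EuclideanSpace.single i 1)

/-- The partial derivative of a function of `(t, ξ, η)` in one of its variables. -/
noncomputable def argD {d : ℕ} (c : Unit ⊕ Unit ⊕ Fin d)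
    (f : ℝ × ℝ × EuclideanSpace ℝ (Fin d) → ℝ) :
    ℝ × ℝ × EuclideanSpace ℝ (Fin d) → ℝ :=
  fun z => fderiv ℝ f z (argDir c)

/-- `∂/∂ξ`. -/
noncomputable def xiD {d : ℕ} (f : ℝ × ℝ × EuclideanSpace ℝ (Fin d) → ℝ) :
    ℝ × ℝ × EuclideanSpace ℝ (Fin d) → ℝ :=
  argD (Sum.inr (Sum.inl ())) f

/-- `∂/∂η_i`. -/
noncomputable def etaD {d : ℕ} (i : Fin d) (f : ℝ × ℝ × EuclideanSpace ℝ (Fin d) → ℝ) :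
    ℝ × ℝ × EuclideanSpace ℝ (Fin d) → ℝ :=
  argD (Sum.inr (Sum.inr i)) f

/-- The `ξ`- and `η`-derivatives of `h` grow at most like `1 + |ξ|^p` and `1 + |η|^p`. -/
def DerivGrowth {d : ℕ} (p : ℝ) (h : ℝ × ℝ × EuclideanSpace ℝ (Fin d) → ℝ) : Prop :=
  ∃ C : ℝ, ∀ (t ξ : ℝ) (η : EuclideanSpace ℝ (Fin d)),
    |xiD h (t, ξ, η)| ≤ C * (1 + |ξ| ^ p) ∧ ∀ i, |etaD i h (t, ξ, η)| ≤ C * (1 + ‖η‖ ^ p)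

/-- Mild growth of `f` and of all its first-order partial derivatives. -/
def MildGrowth {d : ℕ} (f : ℝ × ℝ × EuclideanSpace ℝ (Fin d) → ℝ) : Prop :=
  ∃ p : ℝ, 0 < p ∧ (d = 3 → p ≤ 2) ∧ DerivGrowth p f ∧ ∀ c, DerivGrowth p (argD c f)

/-- `f` is twice continuously differentiable, and its derivatives of order at most two are bounded
for bounded `ξ`, `η`, uniformly in `t ∈ [0, T]`. -/
def SmoothReaction {d : ℕ} (T : ℝ) (f : ℝ × ℝ × EuclideanSpace ℝ (Fin d) → ℝ) : Prop :=
  ContDiff ℝ 2 f ∧ ∀ K₁ > 0, ∀ K₂ > 0, ∃ C : ℝ, ∀ t ∈ Set.Icc 0 T, ∀ ξ : ℝ, |ξ| ≤ K₁ →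
    ∀ η : EuclideanSpace ℝ (Fin d), ‖η‖ ≤ K₂ →
      |f (t, ξ, η)| + ∑ c, |argD c f (t, ξ, η)| + ∑ c, ∑ c', |argD c (argD c' f) (t, ξ, η)| ≤ C

/-- The function `x ↦ f(t, v(x), ∇v(x))`. Since `f` takes real arguments, it is evaluated at the
real parts of `v` and `∇v`; for real-valued `v` these are `v` and `∇v` themselves. -/
noncomputable def reaction {d : ℕ} (a b : Fin d → ℝ)
    (f : ℝ × ℝ × EuclideanSpace ℝ (Fin d) → ℝ) (t : ℝ)
    (v : EuclideanSpace ℝ (Fin d) → ℂ) : EuclideanSpace ℝ (Fin d) → ℂ :=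
  fun x => (f (t, (v x).re,
    WithLp.toLp 2 fun i => (weakDeriv a b (Pi.single i 1) v x).re) : ℂ)

/-! ### The exact solution -/

/-- A real-valued function, seen as a complex-valued one. -/
def cplx {d : ℕ} (u : EuclideanSpace ℝ (Fin d) → ℝ) : EuclideanSpace ℝ (Fin d) → ℂ :=
  fun x => (u x : ℂ)

/-- `u` is a (strict) solution of `u_t = Δu + f(t, u, ∇u)`, `u(0) = u₀`, with periodic boundary
conditions: it is continuous on `[0, T]` with values in `H²_p`, differentiable on `[0, T]` with
values in `L²`, and the equation holds in `L²` for every `t ∈ [0, T]`. -/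
structure IsExactSolution {d : ℕ} (a b : Fin d → ℝ) (T : ℝ)
    (f : ℝ × ℝ × EuclideanSpace ℝ (Fin d) → ℝ) (u₀ : EuclideanSpace ℝ (Fin d) → ℝ)
    (u : ℝ → EuclideanSpace ℝ (Fin d) → ℝ) : Prop where
  memHp : ∀ t ∈ Set.Icc 0 T, MemHp a b 2 (cplx (u t))
  continuous : ∀ t ∈ Set.Icc 0 T,
    Filter.Tendsto (fun s => sobolevNorm a b 2 (cplx (u s) - cplx (u t)))
      (nhdsWithin t (Set.Icc 0 T)) (nhds 0)
  equation : ∃ u' : ℝ → EuclideanSpace ℝ (Fin d) → ℝ, ∀ t ∈ Set.Icc 0 T,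
    Filter.Tendsto
      (fun s => MeasureTheory.eLpNorm (fun x => (s - t)⁻¹ * (u s x - u t x) - u' t x) 2
        (boxMeasure a b))
      (nhdsWithin t (Set.Icc 0 T \ {t})) (nhds 0) ∧
    ∀ᵐ x ∂(boxMeasure a b), (u' t x : ℂ)
      = ∑ i, weakDeriv a b (Pi.single i 2) (cplx (u t)) x + reaction a b f t (cplx (u t)) x
  initial : u 0 =ᵐ[boxMeasure a b] u₀

/-! ### The Fourier Galerkin semi-discretization -/

/-- The basis function `φ_k(x) = ∏_j exp(2πi k_j x_j / (b_j - a_j))`. -/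
noncomputable def fourierMode {d : ℕ} (a b : Fin d → ℝ) (k : Fin d → ℤ) :
    EuclideanSpace ℝ (Fin d) → ℂ :=
  fun x => ∏ j, Complex.exp
    (Complex.I * ((2 * Real.pi * (k j : ℝ) / (b j - a j) * x j : ℝ) : ℂ))

/-- The frequencies `-N_j/2 ≤ k_j ≤ N_j/2 - 1` (for even `N_j`). -/
def freqSet {d : ℕ} (Nv : Fin d → ℕ) : Set (Fin d → ℤ) :=
  {k | ∀ j, -((Nv j / 2 : ℕ) : ℤ) ≤ k j ∧ k j ≤ ((Nv j / 2 : ℕ) : ℤ) - 1}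

/-- The Fourier approximation space `X_N`. -/
noncomputable def fourierSpace {d : ℕ} (a b : Fin d → ℝ) (Nv : Fin d → ℕ) :
    Submodule ℂ (EuclideanSpace ℝ (Fin d) → ℂ) :=
  Submodule.span ℂ (fourierMode a b '' freqSet Nv)

/-- `N = max_j N_j`. -/
def gridSize {d : ℕ} (Nv : Fin d → ℕ) : ℕ := Finset.univ.sup Nv

/-- `w = P_N v`, the `L²`-orthogonal projection of `v` onto `X_N`. -/
def IsL2Projection {d : ℕ} (a b : Fin d → ℝ) (Nv : Fin d → ℕ)
    (v w : EuclideanSpace ℝ (Fin d) → ℂ) : Prop :=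
  w ∈ fourierSpace a b Nv ∧ ∀ χ ∈ fourierSpace a b Nv, l2Inner a b (w - v) χ = 0

/-- `uN` solves the semi-discrete problem
`(u_{N,t}, v) + a(u_N, v) = (f(t, u_N, ∇u_N), v)` for all `v ∈ X_N` and `t ∈ [0, T]`,
`u_N(0) = P_N u₀`. -/
structure IsGalerkinSolution {d : ℕ} (a b : Fin d → ℝ) (T : ℝ)
    (f : ℝ × ℝ × EuclideanSpace ℝ (Fin d) → ℝ) (u₀ : EuclideanSpace ℝ (Fin d) → ℝ)
    (Nv : Fin d → ℕ) (uN : ℝ → EuclideanSpace ℝ (Fin d) → ℂ) : Prop where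
  mem : ∀ t ∈ Set.Icc 0 T, uN t ∈ fourierSpace a b Nv
  equation : ∃ uN' : ℝ → EuclideanSpace ℝ (Fin d) → ℂ, ∀ t ∈ Set.Icc 0 T,
    (∀ x, HasDerivWithinAt (fun s => uN s x) (uN' t x) (Set.Icc 0 T) t) ∧
    ∀ v ∈ fourierSpace a b Nv,
      l2Inner a b (uN' t) v + dirichletForm a b (uN t) v
        = l2Inner a b (reaction a b f t (uN t)) v
  initial : IsL2Projection a b Nv (cplx u₀) (uN 0)

end FourierGalerkin

/-! Everything is done on Fourier coefficients. By Parseval, Sobolev norms become ℓ² norms with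
weight 1+|ω_k|², the Laplacian becomes a multiplier, and the Galerkin problem becomes a finite
system of ODEs. The error splits into u − P_N u and θ = P_N u − u_N. The first part is O(N^{s−m}) in
H^s, since quasi-uniformity makes every discarded frequency at least of order N. The second part
lies in X_N. An L² energy estimate has to bound it by N^{−m}, and the inverse inequality then gives
its H¹ norm.

The nonlinearity. Mild growth makes f locally Lipschitz, with factors |∇v|^n in the gradient
variable. Since u is continuous into H² on a compact time interval, its Fourier tails are uniformly
small (`StrongSolution.exists_tail_le`). So ∇u is a bounded function plus a part of H¹ size τ, with
τ as small as desired (`exists_ctrl`). With H¹ ⊆ L^q (`exists_sobolev_bound`; q = 6 and n = 2 for d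
= 3), the pairing of a difference of reaction terms with θ is at most ‖v−v'‖₁ (C'‖θ‖₀ + C τ^n ‖θ‖₁)
(`exists_react_sub_pairing_le`). Here C does not depend on the bounded part, so a small τ lets the
dissipation absorb the last term. The gradient of u_N admits the same control as long as ‖θ‖₂ is
small, and on X_N this follows from N²‖θ‖₀ being small. The energy estimate is therefore a bootstrap
(`StrongSolution.exists_energy_le`, `le_of_deriv_le_below`), which closes once the consistency error
is a small multiple of N^{−2}.

Consistency: f(u,∇u) − f(P_N u,∇P_N u) is tested against X_N. For m ≥ 3 the gradients are bounded
and f is expanded by Taylor. The term linear in ∇(u−P_N u) is integrated by parts and costs only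
‖u−P_N u‖₀. The quadratic terms cost ‖u−P_N u‖₁‖u−P_N u‖₂. Both are O(N^{−m})
(`SmoothReaction.exists_pairing_le`). For m = 2, parabolic smoothing, proved with spatial difference
quotients, puts u into L²(0,T;H³) (`StrongSolution.exists_integral_H3_le`). Then the time integral
of ‖u−P_N u‖₁² is N^{−4} times the tail of a convergent series. This gives the rate and also the
smallness that the bootstrap needs (`StrongSolution.exists_consistency_H2`). The case m < 2 follows
from m = 2, because the solution lies in H² in any case.

Existence. The ODE system is made globally Lipschitz by truncation and solved on all of [0,T]. The
energy estimate uses the equation only below the truncation level and shows that the level is never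
exceeded. It assumes no bound on u_N, so it also applies to every given Galerkin solution. -/

namespace FourierGalerkin

open MeasureTheory Filter Topology
open scoped ENNReal NNReal ComplexConjugate

variable {d : ℕ} {a b : Fin d → ℝ}

/-- The space in which the box lies. -/
abbrev Sp (d : ℕ) := EuclideanSpace ℝ (Fin d)


/-! ### The box and the torus -/

/-- The volume of the box. -/
noncomputable def boxVol (a b : Fin d → ℝ) : ℝ := ∏ j, (b j - a j)

lemma boxVol_pos (hab : ∀ i, a i < b i) : 0 < boxVol a b :=
  Finset.prod_pos fun i _ => sub_pos.2 (hab i)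

/-- The product of the uniform probability measures on the circles. -/
noncomputable def torusMeasure (d : ℕ) : Measure (UnitAddTorus (Fin d)) :=
  Measure.pi fun _ => AddCircle.haarAddCircle

/-- The uniform probability measure on the box. -/
noncomputable def boxProb (a b : Fin d → ℝ) : Measure (Sp d) :=
  ENNReal.ofReal (boxVol a b)⁻¹ • boxMeasure a b

/-- The covering map to the torus, scaled so that the box is a fundamental domain. -/
noncomputable def toTorus (a b : Fin d → ℝ) (x : Sp d) : UnitAddTorus (Fin d) :=
  fun j => ((x j * (b j - a j)⁻¹ : ℝ) : UnitAddCircle)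

/-- The section of the covering map with values in the (half-open) box. -/
noncomputable def ofTorus (a b : Fin d → ℝ) (y : UnitAddTorus (Fin d)) : Sp d :=
  WithLp.toLp 2 fun j => (AddCircle.equivIoc 1 (a j * (b j - a j)⁻¹) (y j) : ℝ) * (b j - a j)

/-- One coordinate of the covering map. Scaling turns the interval into a fundamental domain of the
unit circle; the open and the half-open interval differ by a null set. -/
lemma measurePreserving_scaled_mk {α β : ℝ} (h : α < β) :
    MeasurePreserving (fun x : ℝ => ((x * (β - α)⁻¹ : ℝ) : UnitAddCircle))
      (ENNReal.ofReal (β - α)⁻¹ • volume.restrict (Set.Ioo α β)) AddCircle.haarAddCircle := by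
  have hL : 0 < β - α := sub_pos.2 h
  have h1 : MeasurePreserving (fun x : ℝ => x * (β - α)⁻¹)
      (ENNReal.ofReal (β - α)⁻¹ • (volume : Measure ℝ)) volume := by
    refine ⟨by fun_prop, ?_⟩
    have := Real.smul_map_volume_mul_right (a := (β - α)⁻¹) (by positivity)
    rw [abs_of_pos (by positivity)] at this
    rw [Measure.map_smul]; exact this
  have h2 := h1.restrict_preimage
    (s := Set.Ioc (α * (β - α)⁻¹) (α * (β - α)⁻¹ + 1)) measurableSet_Ioc
  have h3 : (fun x : ℝ => x * (β - α)⁻¹) ⁻¹' Set.Ioc (α * (β - α)⁻¹) (α * (β - α)⁻¹ + 1)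
      = Set.Ioc α β := by
    have hp : 0 < (β - α)⁻¹ := by positivity
    have : α * (β - α)⁻¹ + 1 = β * (β - α)⁻¹ := by field_simp; ring
    rw [this]
    ext x
    simp [Set.mem_Ioc, mul_lt_mul_iff_left₀ hp, mul_le_mul_iff_left₀ hp]
  rw [h3, Measure.restrict_smul, ← Measure.restrict_congr_set Ioo_ae_eq_Ioc] at h2
  have h4 := (AddCircle.measurePreserving_mk 1 (α * (β - α)⁻¹)).comp h2
  rw [AddCircle.volume_eq_smul_haarAddCircle, ENNReal.ofReal_one, one_smul] at h4
  exact h4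

lemma box_eq_preimage : box a b
    = (WithLp.ofLp : Sp d → (Fin d → ℝ)) ⁻¹' Set.univ.pi fun j => Set.Ioo (a j) (b j) := by
  ext x; simp [box, Set.mem_pi]

lemma measurableSet_box : MeasurableSet (box a b) := by
  rw [box_eq_preimage]
  exact (WithLp.measurable_ofLp 2 _) (MeasurableSet.univ_pi fun _ => measurableSet_Ioo)

lemma measurePreserving_ofLp_box : MeasurePreserving (WithLp.ofLp : Sp d → (Fin d → ℝ))
    (boxMeasure a b) (Measure.pi fun j => volume.restrict (Set.Ioo (a j) (b j))) := by
  have h := (PiLp.volume_preserving_ofLp (Fin d)).restrict_preimage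
    (s := Set.univ.pi fun j => Set.Ioo (a j) (b j))
    (MeasurableSet.univ_pi fun _ => measurableSet_Ioo)
  rw [← box_eq_preimage, volume_pi, Measure.restrict_pi_pi] at h
  exact h

lemma pi_smul_restrict (hab : ∀ i, a i < b i) :
    (Measure.pi fun j => ENNReal.ofReal (b j - a j)⁻¹ • volume.restrict (Set.Ioo (a j) (b j)))
      = ENNReal.ofReal (boxVol a b)⁻¹ •
        Measure.pi fun j => volume.restrict (Set.Ioo (a j) (b j)) := by
  have (j : Fin d) : IsFiniteMeasure
      (ENNReal.ofReal (b j - a j)⁻¹ • (volume : Measure ℝ).restrict (Set.Ioo (a j) (b j))) :=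
    Measure.smul_finite _ ENNReal.ofReal_ne_top
  refine Measure.pi_eq fun s hs => ?_
  rw [Measure.smul_apply, Measure.pi_pi]
  simp only [Measure.smul_apply, smul_eq_mul]
  rw [Finset.prod_mul_distrib, boxVol, ← Finset.prod_inv_distrib, ENNReal.ofReal_prod_of_nonneg]
  exact fun i _ => inv_nonneg.2 (sub_pos.2 (hab i)).le

lemma measurePreserving_toTorus (hab : ∀ i, a i < b i) :
    MeasurePreserving (toTorus a b) (boxProb a b) (torusMeasure d) := by
  have h1 := measurePreserving_pi (f := fun j (x : ℝ) => ((x * (b j - a j)⁻¹ : ℝ) : UnitAddCircle))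
    (fun j => ENNReal.ofReal (b j - a j)⁻¹ • volume.restrict (Set.Ioo (a j) (b j)))
    (fun _ => AddCircle.haarAddCircle) fun j => measurePreserving_scaled_mk (hab j)
  rw [pi_smul_restrict hab] at h1
  exact h1.comp (measurePreserving_ofLp_box.smul_measure _)

lemma toTorus_ofTorus (hab : ∀ i, a i < b i) (y : UnitAddTorus (Fin d)) :
    toTorus a b (ofTorus a b y) = y := by
  ext j
  have : b j - a j ≠ 0 := (sub_pos.2 (hab j)).ne'
  simp [toTorus, ofTorus, this]

lemma ofTorus_toTorus (hab : ∀ i, a i < b i) {x : Sp d} (hx : x ∈ box a b) :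
    ofTorus a b (toTorus a b x) = x := by
  ext j
  have hj := sub_pos.2 (hab j)
  have hm : x j * (b j - a j)⁻¹ ∈ Set.Ioc (a j * (b j - a j)⁻¹) (a j * (b j - a j)⁻¹ + 1) := by
    have hp : 0 < (b j - a j)⁻¹ := by positivity
    have : a j * (b j - a j)⁻¹ + 1 = b j * (b j - a j)⁻¹ := by field_simp; ring
    rw [this]
    exact ⟨mul_lt_mul_of_pos_right (hx j).1 hp, mul_le_mul_of_nonneg_right (hx j).2.le hp.le⟩
  simp only [toTorus, ofTorus]
  rw [AddCircle.equivIoc_coe_of_mem hm]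
  field_simp

lemma measurable_ofTorus : Measurable (ofTorus a b) := by
  refine (WithLp.measurable_toLp 2 _).comp (measurable_pi_lambda _ fun j => ?_)
  exact ((measurable_subtype_coe.comp
    (AddCircle.measurableEquivIoc 1 _).measurable).comp (measurable_pi_apply j)).mul_const _

lemma ae_mem_box : ∀ᵐ x ∂(boxMeasure a b), x ∈ box a b :=
  ae_restrict_mem measurableSet_box

lemma ae_boxProb_iff (hab : ∀ i, a i < b i) {p : Sp d → Prop} :
    (∀ᵐ x ∂(boxProb a b), p x) ↔ ∀ᵐ x ∂(boxMeasure a b), p x := by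
  rw [boxProb, Measure.ae_ennreal_smul_measure_iff]
  simpa using boxVol_pos hab

/-- The section inverts the covering map almost everywhere on the box, so it pushes the measure
back. Composition with it transports L² functions on the box, together with Parseval, to and from
the torus. -/
lemma measurePreserving_ofTorus (hab : ∀ i, a i < b i) :
    MeasurePreserving (ofTorus a b) (torusMeasure d) (boxProb a b) := by
  refine ⟨measurable_ofTorus, ?_⟩
  have h := measurePreserving_toTorus hab
  rw [← h.map_eq, Measure.map_map measurable_ofTorus h.measurable]
  conv_rhs => rw [← Measure.map_id (μ := boxProb a b)]
  refine Measure.map_congr ?_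
  filter_upwards [(ae_boxProb_iff hab).2 ae_mem_box] with x hx
  exact ofTorus_toTorus hab hx

instance : IsProbabilityMeasure (torusMeasure d) := by
  unfold torusMeasure; infer_instance

lemma isProbabilityMeasure_boxProb (hab : ∀ i, a i < b i) : IsProbabilityMeasure (boxProb a b) := by
  rw [← (measurePreserving_ofTorus hab).map_eq]
  exact Measure.isProbabilityMeasure_map measurable_ofTorus.aemeasurable

lemma boxMeasure_eq_smul (hab : ∀ i, a i < b i) :
    boxMeasure a b = ENNReal.ofReal (boxVol a b) • boxProb a b := by
  rw [boxProb, smul_smul, ← ENNReal.ofReal_mul (boxVol_pos hab).le,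
    mul_inv_cancel₀ (boxVol_pos hab).ne', ENNReal.ofReal_one, one_smul]

lemma isFiniteMeasure_boxMeasure (hab : ∀ i, a i < b i) : IsFiniteMeasure (boxMeasure a b) := by
  have := isProbabilityMeasure_boxProb hab
  rw [boxMeasure_eq_smul hab]
  exact Measure.smul_finite _ ENNReal.ofReal_ne_top

lemma memLp_boxProb_iff (hab : ∀ i, a i < b i) {F : Type*} [NormedAddCommGroup F] {v : Sp d → F}
    {p : ℝ≥0∞} : MemLp v p (boxProb a b) ↔ MemLp v p (boxMeasure a b) := by
  constructor
  · intro h; rw [boxMeasure_eq_smul hab]; exact h.smul_measure ENNReal.ofReal_ne_top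
  · intro h; exact h.smul_measure ENNReal.ofReal_ne_top

lemma integral_boxProb (hab : ∀ i, a i < b i) {F : Type*} [NormedAddCommGroup F] [NormedSpace ℝ F]
    (v : Sp d → F) :
    ∫ x, v x ∂(boxProb a b) = (boxVol a b)⁻¹ • ∫ x, v x ∂(boxMeasure a b) := by
  rw [boxProb, integral_smul_measure, ENNReal.toReal_ofReal (inv_pos.2 (boxVol_pos hab)).le]

lemma integral_torus (hab : ∀ i, a i < b i) {F : Type*} [NormedAddCommGroup F] [NormedSpace ℝ F]
    {v : Sp d → F} (hv : AEStronglyMeasurable v (boxMeasure a b)) :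
    ∫ y, v (ofTorus a b y) ∂(torusMeasure d)
      = (boxVol a b)⁻¹ • ∫ x, v x ∂(boxMeasure a b) := by
  have h := measurePreserving_ofTorus hab
  rw [← integral_boxProb hab, ← h.map_eq, integral_map h.measurable.aemeasurable]
  rw [h.map_eq]; exact hv.smul_measure _

/-! ### Translations -/

/-- The translation by `h`, modulo the periods, as a map of the box. -/
noncomputable def shift (a b : Fin d → ℝ) (h x : Sp d) : Sp d :=
  ofTorus a b (toTorus a b x + toTorus a b h)

/-- A rotation of the torus, conjugated by the covering map and its section. Translations are thus
available for functions that matter only on the box; the smoothing argument needs them for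
difference quotients. -/
lemma measurePreserving_shift (hab : ∀ i, a i < b i) (h : Sp d) :
    MeasurePreserving (shift a b h) (boxMeasure a b) (boxMeasure a b) := by
  have hadd : MeasurePreserving (fun y : UnitAddTorus (Fin d) => y + toTorus a b h)
      (torusMeasure d) (torusMeasure d) :=
    measurePreserving_pi (f := fun j (y : UnitAddCircle) => y + toTorus a b h j)
      (fun _ => AddCircle.haarAddCircle) (fun _ => AddCircle.haarAddCircle)
      fun j => measurePreserving_add_right _ _
  have := ((measurePreserving_ofTorus hab).comp (hadd.comp (measurePreserving_toTorus hab)))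
  rw [boxMeasure_eq_smul hab]
  exact this.smul_measure _

/-! ### Fourier modes -/

/-- The frequency vector of the mode with index `k`. -/
noncomputable def freq (a b : Fin d → ℝ) (k : Fin d → ℤ) (j : Fin d) : ℝ :=
  2 * Real.pi * (k j : ℝ) / (b j - a j)

lemma fourierMode_eq_exp (k : Fin d → ℤ) (x : Sp d) :
    fourierMode a b k x = Complex.exp (Complex.I * ((∑ j, freq a b k j * x j : ℝ) : ℂ)) := by
  rw [fourierMode, ← Complex.exp_sum]
  simp only [freq, Complex.ofReal_sum, Finset.mul_sum]

lemma norm_fourierMode (k : Fin d → ℤ) (x : Sp d) : ‖fourierMode a b k x‖ = 1 := by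
  rw [fourierMode_eq_exp, mul_comm, Complex.norm_exp_ofReal_mul_I]

lemma mFourier_toTorus (k : Fin d → ℤ) (x : Sp d) :
    UnitAddTorus.mFourier k (toTorus a b x) = fourierMode a b k x := by
  simp only [UnitAddTorus.mFourier, ContinuousMap.coe_mk, toTorus, fourierMode]
  refine Finset.prod_congr rfl fun j _ => ?_
  rw [fourier_coe_apply]
  congr 1
  push_cast
  ring

lemma fourierMode_ofTorus (hab : ∀ i, a i < b i) (k : Fin d → ℤ) (y : UnitAddTorus (Fin d)) :
    fourierMode a b k (ofTorus a b y) = UnitAddTorus.mFourier k y := by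
  rw [← mFourier_toTorus, toTorus_ofTorus hab]

lemma fourierMode_shift (hab : ∀ i, a i < b i) (k : Fin d → ℤ) (h x : Sp d) :
    fourierMode a b k (shift a b h x) = fourierMode a b k h * fourierMode a b k x := by
  rw [shift, fourierMode_ofTorus hab, ← mFourier_toTorus, ← mFourier_toTorus, mul_comm]
  simp only [UnitAddTorus.mFourier, ContinuousMap.coe_mk, Pi.add_apply, fourier_apply,
    smul_add, AddCircle.toCircle_add, Circle.coe_mul, Finset.prod_mul_distrib]

lemma fourierMode_neg (k : Fin d → ℤ) (x : Sp d) :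
    fourierMode a b (-k) x = conj (fourierMode a b k x) := by
  rw [← mFourier_toTorus, ← mFourier_toTorus, UnitAddTorus.mFourier_neg]

lemma continuous_fourierMode (k : Fin d → ℤ) : Continuous (fourierMode a b k) := by
  unfold fourierMode; fun_prop

/-! ### Fourier coefficients and the Parseval identity -/

/-- The Fourier coefficient of `v` on the box. -/
noncomputable def fc (a b : Fin d → ℝ) (v : Sp d → ℂ) (k : Fin d → ℤ) : ℂ :=
  (boxVol a b : ℂ)⁻¹ * ∫ x, v x * conj (fourierMode a b k x) ∂(boxMeasure a b)

section Parseval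

-- With Haar probability as the volume of the circle, the product volume on the torus is
-- definitionally `torusMeasure`, for which the modes are orthonormal.
noncomputable local instance circleMeasureSpace : MeasureSpace UnitAddCircle := ⟨AddCircle.haarAddCircle⟩

lemma volume_torus : (volume : Measure (UnitAddTorus (Fin d))) = torusMeasure d := rfl

lemma mFourierCoeff_comp_ofTorus (hab : ∀ i, a i < b i) {v : Sp d → ℂ}
    (hv : AEStronglyMeasurable v (boxMeasure a b)) (k : Fin d → ℤ) :
    UnitAddTorus.mFourierCoeff (fun y => v (ofTorus a b y)) k = fc a b v k := by
  have h := integral_torus hab (v := fun x => v x * conj (fourierMode a b k x))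
    (hv.mul (by
      have := continuous_fourierMode (a := a) (b := b) k
      exact (Complex.continuous_conj.comp this).aestronglyMeasurable))
  rw [fc, ← Complex.ofReal_inv, ← Complex.real_smul, ← h, UnitAddTorus.mFourierCoeff, volume_torus]
  refine integral_congr_ae (Eventually.of_forall fun y => ?_)
  simp only [UnitAddTorus.mFourier_neg, fourierMode_ofTorus hab, smul_eq_mul, mul_comm]

/-- Parseval on the torus, transported to the box. The bilinear form is kept, not only the norm
identity, because integration by parts is later read off from it. -/
lemma hasSum_fc_mul_conj (hab : ∀ i, a i < b i) {v w : Sp d → ℂ}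
    (hv : MemLp v 2 (boxMeasure a b)) (hw : MemLp w 2 (boxMeasure a b)) :
    HasSum (fun k => fc a b v k * conj (fc a b w k))
      ((boxVol a b : ℂ)⁻¹ * ∫ x, v x * conj (w x) ∂(boxMeasure a b)) := by
  have hσ := measurePreserving_ofTorus hab
  have hv' : MemLp (fun y => v (ofTorus a b y)) 2 (torusMeasure d) :=
    ((memLp_boxProb_iff hab).2 hv).comp_measurePreserving hσ
  have hw' : MemLp (fun y => w (ofTorus a b y)) 2 (torusMeasure d) :=
    ((memLp_boxProb_iff hab).2 hw).comp_measurePreserving hσ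
  rw [← volume_torus] at hv' hw'
  have h := UnitAddTorus.hasSum_prod_mFourierCoeff (hw'.toLp _) (hv'.toLp _)
  have e : ∀ {z : Sp d → ℂ} (hz : MemLp z 2 (boxMeasure a b))
      (hz' : MemLp (fun y => z (ofTorus a b y)) 2 volume) (k : Fin d → ℤ),
      UnitAddTorus.mFourierCoeff (hz'.toLp _) k = fc a b z k := by
    intro z hz hz' k
    rw [← mFourierCoeff_comp_ofTorus hab hz.1, UnitAddTorus.mFourierCoeff,
      UnitAddTorus.mFourierCoeff]
    refine integral_congr_ae ?_
    filter_upwards [hz'.coeFn_toLp] with y hy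
    rw [hy]
  simp only [e hv, e hw] at h
  have h2 := integral_torus hab (v := fun x => v x * conj (w x))
    (hv.1.mul (Complex.continuous_conj.comp_aestronglyMeasurable hw.1))
  rw [← Complex.ofReal_inv, ← Complex.real_smul, ← h2]
  convert! h using 1
  · ext k; rw [mul_comm]
  · rw [← volume_torus]
    refine integral_congr_ae ?_
    filter_upwards [hv'.coeFn_toLp, hw'.coeFn_toLp] with y hy1 hy2
    rw [hy1, hy2, mul_comm]

lemma hasSum_sq_fc (hab : ∀ i, a i < b i) {v : Sp d → ℂ} (hv : MemLp v 2 (boxMeasure a b)) :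
    HasSum (fun k => ‖fc a b v k‖ ^ 2) ((boxVol a b)⁻¹ * ∫ x, ‖v x‖ ^ 2 ∂(boxMeasure a b)) := by
  have h := hasSum_fc_mul_conj hab hv hv
  simp only [Complex.mul_conj'] at h
  rw [← Complex.hasSum_ofReal]
  convert! h using 1
  · simp
  · rw [Complex.ofReal_mul, Complex.ofReal_inv]
    congr 1
    rw [← integral_complex_ofReal]
    simp

end Parseval

/-! ### Derivatives of Fourier modes -/

lemma freq_neg (k : Fin d → ℤ) (j : Fin d) : freq a b (-k) j = -freq a b k j := by
  simp [freq, neg_div]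

lemma hasFDerivAt_fourierMode (k : Fin d → ℤ) (x : Sp d) :
    HasFDerivAt (fourierMode a b k) (fourierMode a b k x • (Complex.I •
      (Complex.ofRealCLM.comp (∑ j, freq a b k j • (EuclideanSpace.proj j : Sp d →L[ℝ] ℝ))))) x := by
  have h1 : HasFDerivAt (fun x : Sp d => ∑ j, freq a b k j * x j)
      (∑ j, freq a b k j • (EuclideanSpace.proj j : Sp d →L[ℝ] ℝ)) x := by
    refine HasFDerivAt.fun_sum fun j _ => ?_
    exact ((EuclideanSpace.proj j : Sp d →L[ℝ] ℝ).hasFDerivAt).const_mul _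
  have h2 := ((Complex.ofRealCLM.hasFDerivAt.comp x h1).const_mul Complex.I).cexp
  have e : fourierMode a b k
      = fun x => Complex.exp (Complex.I * ((∑ j, freq a b k j * x j : ℝ) : ℂ)) :=
    funext fun x => fourierMode_eq_exp k x
  rw [e]
  exact h2

lemma contDiff_fourierMode (k : Fin d → ℤ) {n : WithTop ℕ∞} :
    ContDiff ℝ n (fourierMode a b k) := by
  unfold fourierMode
  refine contDiff_prod fun j _ => ?_
  refine ContDiff.cexp (contDiff_const.mul ?_)
  refine Complex.ofRealCLM.contDiff.comp ?_
  exact contDiff_const.mul (EuclideanSpace.proj j : Sp d →L[ℝ] ℝ).contDiff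

lemma partialD_const_mul_fourierMode (c : ℂ) (k : Fin d → ℤ) (i : Fin d) :
    partialD i (fun x => c * fourierMode a b k x)
      = fun x => (c * (Complex.I * freq a b k i)) * fourierMode a b k x := by
  ext x
  rw [partialD, ((hasFDerivAt_fourierMode k x).const_mul c).fderiv]
  simp
  ring

lemma iterate_partialD_fourierMode (c : ℂ) (k : Fin d → ℤ) (i : Fin d) (n : ℕ) :
    (partialD i)^[n] (fun x => c * fourierMode a b k x)
      = fun x => (c * (Complex.I * freq a b k i) ^ n) * fourierMode a b k x := by
  induction n generalizing c with
  | zero => simp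
  | succ n ih =>
    rw [Function.iterate_succ_apply, partialD_const_mul_fourierMode, ih]
    ext x; ring

/-- The Fourier symbol of `D^α`. -/
noncomputable def symbol (a b : Fin d → ℝ) (α : Fin d → ℕ) (k : Fin d → ℤ) : ℂ :=
  ∏ i, (Complex.I * freq a b k i) ^ α i

lemma multiD_fourierMode (α : Fin d → ℕ) (k : Fin d → ℤ) :
    multiD α (fourierMode a b k) = fun x => symbol a b α k * fourierMode a b k x := by
  have key : ∀ l : List (Fin d),
      l.foldr (fun i g => (partialD i)^[α i] g) (fourierMode a b k)
        = fun x => (l.map fun i => (Complex.I * (freq a b k i : ℂ)) ^ α i).prod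
          * fourierMode a b k x := by
    intro l
    induction l with
    | nil => simp
    | cons i l ih =>
      rw [List.foldr_cons, ih, iterate_partialD_fourierMode]
      ext x
      rw [List.map_cons, List.prod_cons, mul_comm (List.prod _)]
  rw [multiD, key, symbol, Fin.prod_univ_def]

lemma multiD_zero (φ : Sp d → ℂ) : multiD 0 φ = φ := by
  have key : ∀ l : List (Fin d),
      l.foldr (fun i g => (partialD i)^[(0 : Fin d → ℕ) i] g) φ = φ := by
    intro l
    induction l with
    | nil => rfl
    | cons i l ih => rw [List.foldr_cons, ih]; rfl
  exact key _

lemma multiD_single (i : Fin d) (φ : Sp d → ℂ) :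
    multiD (Pi.single i 1) φ = partialD i φ := by
  have key : ∀ l : List (Fin d), l.Nodup →
      l.foldr (fun j g => (partialD j)^[(Pi.single i 1 : Fin d → ℕ) j] g) φ
        = if i ∈ l then partialD i φ else φ := by
    intro l
    induction l with
    | nil => simp
    | cons j l ih =>
      intro hl
      rw [List.nodup_cons] at hl
      rw [List.foldr_cons, ih hl.2]
      by_cases hj : i = j
      · subst hj; simp [hl.1]
      · rw [Pi.single_eq_of_ne (Ne.symm hj)]; simp [hj]
  rw [multiD, key _ (List.nodup_finRange d)]
  simp

lemma isPeriodicTest_fourierMode (hab : ∀ i, a i < b i) (k : Fin d → ℤ) :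
    IsPeriodicTest a b (fourierMode a b k) := by
  refine ⟨contDiff_fourierMode k, fun i x => ?_⟩
  have hi := (sub_pos.2 (hab i)).ne'
  rw [← mFourier_toTorus, ← mFourier_toTorus]
  congr 1
  ext j
  by_cases hj : j = i
  · subst hj
    simp only [toTorus, PiLp.add_apply, PiLp.single_apply, if_true]
    rw [add_mul, mul_inv_cancel₀ hi]
    simp
  · simp [toTorus, hj]

/-! ### Weights and weighted norms of Fourier coefficients -/

/-- The weight `1 + |ω_k|²`. -/
noncomputable def wt (a b : Fin d → ℝ) (k : Fin d → ℤ) : ℝ := 1 + ∑ j, freq a b k j ^ 2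

lemma one_le_wt (k : Fin d → ℤ) : 1 ≤ wt a b k :=
  le_add_of_nonneg_right (Finset.sum_nonneg fun _ _ => sq_nonneg _)

lemma wt_pos (k : Fin d → ℤ) : 0 < wt a b k := zero_lt_one.trans_le (one_le_wt k)

lemma one_add_freq_sq_le_wt (k : Fin d → ℤ) (i : Fin d) : 1 + freq a b k i ^ 2 ≤ wt a b k :=
  add_le_add_right (Finset.single_le_sum (f := fun j => freq a b k j ^ 2)
    (fun _ _ => sq_nonneg _) (Finset.mem_univ i)) _

lemma freq_sq_le_wt (k : Fin d → ℤ) (i : Fin d) : freq a b k i ^ 2 ≤ wt a b k :=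
  (le_add_of_nonneg_left zero_le_one).trans (one_add_freq_sq_le_wt k i)

/-- Finiteness of the weighted norm of order `s`. -/
def Hmem (a b : Fin d → ℝ) (s : ℕ) (c : (Fin d → ℤ) → ℂ) : Prop :=
  Summable fun k => wt a b k ^ s * ‖c k‖ ^ 2

/-- The square of the weighted norm of order `s`. -/
noncomputable def hs (a b : Fin d → ℝ) (s : ℕ) (c : (Fin d → ℤ) → ℂ) : ℝ :=
  ∑' k, wt a b k ^ s * ‖c k‖ ^ 2

lemma hs_term_nonneg (s : ℕ) (c : (Fin d → ℤ) → ℂ) (k : Fin d → ℤ) :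
    0 ≤ wt a b k ^ s * ‖c k‖ ^ 2 :=
  mul_nonneg (pow_nonneg (wt_pos k).le _) (sq_nonneg _)

lemma hs_nonneg (s : ℕ) (c : (Fin d → ℤ) → ℂ) : 0 ≤ hs a b s c :=
  tsum_nonneg fun k => hs_term_nonneg s c k

lemma Hmem.of_le {s s' : ℕ} {c c' : (Fin d → ℤ) → ℂ} {C : ℝ} (h : Hmem a b s' c')
    (hle : ∀ k, wt a b k ^ s * ‖c k‖ ^ 2 ≤ C * (wt a b k ^ s' * ‖c' k‖ ^ 2)) :
    Hmem a b s c ∧ hs a b s c ≤ C * hs a b s' c' := by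
  have h1 : Hmem a b s c := Summable.of_nonneg_of_le (hs_term_nonneg s c) hle (h.mul_left C)
  refine ⟨h1, ?_⟩
  rw [hs, hs, ← tsum_mul_left]
  exact h1.tsum_le_tsum hle (h.mul_left C)

lemma Hmem.mono {s s' : ℕ} {c c' : (Fin d → ℤ) → ℂ} (h : Hmem a b s' c') (hs' : s ≤ s')
    (hle : ∀ k, ‖c k‖ ≤ ‖c' k‖) : Hmem a b s c ∧ hs a b s c ≤ hs a b s' c' := by
  have := Hmem.of_le (s := s) (c := c) (C := 1) h fun k => by
    rw [one_mul]
    have := one_le_wt (a := a) (b := b) k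
    have := hle k
    gcongr
  simpa using this

lemma Hmem.freq_mul {s : ℕ} {c : (Fin d → ℤ) → ℂ} (h : Hmem a b (s + 1) c) (i : Fin d) :
    Hmem a b s (fun k => Complex.I * freq a b k i * c k) ∧
      hs a b s (fun k => Complex.I * freq a b k i * c k) ≤ hs a b (s + 1) c := by
  have := Hmem.of_le (s := s) (c := fun k => Complex.I * freq a b k i * c k) (C := 1) h fun k => by
    have e : ‖Complex.I * freq a b k i * c k‖ ^ 2 = freq a b k i ^ 2 * ‖c k‖ ^ 2 := by
      rw [norm_mul, norm_mul, Complex.norm_I, one_mul, Complex.norm_real, mul_pow,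
        Real.norm_eq_abs, sq_abs]
    have := freq_sq_le_wt (a := a) (b := b) k i
    have := wt_pos (a := a) (b := b) k
    rw [one_mul, e, pow_succ (wt a b k) s, mul_assoc (wt a b k ^ s)]
    exact mul_le_mul_of_nonneg_left (mul_le_mul_of_nonneg_right ‹_› (sq_nonneg _))
      (pow_nonneg this.le _)
  simpa using this

lemma Hmem.add {s : ℕ} {c c' : (Fin d → ℤ) → ℂ} (h : Hmem a b s c) (h' : Hmem a b s c') :
    Hmem a b s (c + c') ∧ hs a b s (c + c') ≤ 2 * hs a b s c + 2 * hs a b s c' := by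
  have hle : ∀ k, wt a b k ^ s * ‖(c + c') k‖ ^ 2
      ≤ 2 * (wt a b k ^ s * ‖c k‖ ^ 2) + 2 * (wt a b k ^ s * ‖c' k‖ ^ 2) := fun k => by
    have h1 : ‖(c + c') k‖ ^ 2 ≤ 2 * ‖c k‖ ^ 2 + 2 * ‖c' k‖ ^ 2 := by
      have := norm_add_le (c k) (c' k)
      have h0 := norm_nonneg (c k + c' k)
      rw [Pi.add_apply]
      nlinarith [sq_nonneg (‖c k‖ - ‖c' k‖)]
    calc _ ≤ wt a b k ^ s * (2 * ‖c k‖ ^ 2 + 2 * ‖c' k‖ ^ 2) :=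
          mul_le_mul_of_nonneg_left h1 (pow_nonneg (wt_pos k).le _)
      _ = _ := by ring
  have hsum := (h.mul_left 2).add (h'.mul_left 2)
  have h1 : Hmem a b s (c + c') := Summable.of_nonneg_of_le (hs_term_nonneg s _) hle hsum
  refine ⟨h1, ?_⟩
  rw [hs, hs, hs, ← tsum_mul_left, ← tsum_mul_left, ← (h.mul_left 2).tsum_add (h'.mul_left 2)]
  exact h1.tsum_le_tsum hle hsum

lemma Hmem.neg {s : ℕ} {c : (Fin d → ℤ) → ℂ} (h : Hmem a b s c) :
    Hmem a b s (-c) ∧ hs a b s (-c) ≤ hs a b s c :=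
  h.mono le_rfl fun k => by simp

lemma Hmem.sub {s : ℕ} {c c' : (Fin d → ℤ) → ℂ} (h : Hmem a b s c) (h' : Hmem a b s c') :
    Hmem a b s (c - c') ∧ hs a b s (c - c') ≤ 2 * hs a b s c + 2 * hs a b s c' := by
  rw [sub_eq_add_neg]
  refine ⟨(h.add h'.neg.1).1, (h.add h'.neg.1).2.trans ?_⟩
  linarith [h'.neg.2]

lemma Hmem.sum_le {s : ℕ} {c : (Fin d → ℤ) → ℂ} (h : Hmem a b s c) (S : Finset (Fin d → ℤ)) :
    ∑ k ∈ S, wt a b k ^ s * ‖c k‖ ^ 2 ≤ hs a b s c :=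
  Summable.sum_le_tsum S (fun k _ => hs_term_nonneg s c k) h

/-! ### Fourier coefficients -/

lemma memLp_conj_fourierMode (hab : ∀ i, a i < b i) (k : Fin d → ℤ) {p : ℝ≥0∞} :
    MemLp (fun x => conj (fourierMode a b k x)) p (boxMeasure a b) := by
  have := isFiniteMeasure_boxMeasure hab
  refine MemLp.of_bound
    (Complex.continuous_conj.comp (continuous_fourierMode k)).aestronglyMeasurable 1 ?_
  exact Eventually.of_forall fun x => by rw [RCLike.norm_conj, norm_fourierMode]

lemma memLp_fourierMode (hab : ∀ i, a i < b i) (k : Fin d → ℤ) {p : ℝ≥0∞} :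
    MemLp (fourierMode a b k) p (boxMeasure a b) := by
  have := isFiniteMeasure_boxMeasure hab
  refine MemLp.of_bound (continuous_fourierMode k).aestronglyMeasurable 1 ?_
  exact Eventually.of_forall fun x => by rw [norm_fourierMode]

lemma integrable_mul_of_memLp_two {v w : Sp d → ℂ} {μ : Measure (Sp d)} (hv : MemLp v 2 μ)
    (hw : MemLp w 2 μ) : Integrable (fun x => v x * w x) μ :=
  hv.integrable_mul hw

lemma memLp_conj {v : Sp d → ℂ} {p : ℝ≥0∞} {μ : Measure (Sp d)} (hv : MemLp v p μ) :
    MemLp (fun x => conj (v x)) p μ :=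
  hv.of_le (Complex.continuous_conj.comp_aestronglyMeasurable hv.1)
    (Eventually.of_forall fun x => by simp)

lemma fc_congr {v w : Sp d → ℂ} (h : v =ᵐ[boxMeasure a b] w) : fc a b v = fc a b w := by
  ext k
  rw [fc, fc]
  congr 1
  refine integral_congr_ae ?_
  filter_upwards [h] with x hx
  rw [hx]

lemma fc_add (hab : ∀ i, a i < b i) {v w : Sp d → ℂ} (hv : MemLp v 2 (boxMeasure a b))
    (hw : MemLp w 2 (boxMeasure a b)) : fc a b (v + w) = fc a b v + fc a b w := by
  ext k
  simp only [fc, Pi.add_apply, add_mul]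
  rw [integral_add (integrable_mul_of_memLp_two hv (memLp_conj_fourierMode hab k))
    (integrable_mul_of_memLp_two hw (memLp_conj_fourierMode hab k)), mul_add]

lemma fc_const_mul (c : ℂ) (v : Sp d → ℂ) :
    fc a b (fun x => c * v x) = fun k => c * fc a b v k := by
  ext k
  simp only [fc, mul_assoc]
  rw [integral_const_mul]
  ring

lemma fc_neg (v : Sp d → ℂ) : fc a b (-v) = -fc a b v := by
  ext k
  simp only [fc, Pi.neg_apply, neg_mul, integral_neg, mul_neg]

lemma fc_sub (hab : ∀ i, a i < b i) {v w : Sp d → ℂ} (hv : MemLp v 2 (boxMeasure a b))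
    (hw : MemLp w 2 (boxMeasure a b)) : fc a b (v - w) = fc a b v - fc a b w := by
  rw [sub_eq_add_neg, fc_add hab hv hw.neg, fc_neg, sub_eq_add_neg]

lemma orthonormal_modes_integral (k l : Fin d → ℤ) :
    ∫ y, UnitAddTorus.mFourier k y * conj (UnitAddTorus.mFourier l y) ∂(torusMeasure d)
      = if k = l then 1 else 0 := by
  simp only [UnitAddTorus.mFourier, ContinuousMap.coe_mk, map_prod, ← Finset.prod_mul_distrib]
  rw [torusMeasure, integral_fintype_prod_eq_prod (𝕜 := ℂ)
    (f := fun i (y : UnitAddCircle) => fourier (k i) y * conj (fourier (l i) y))]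
  have h1 : ∀ i, ∫ y : UnitAddCircle, fourier (k i) y * conj (fourier (l i) y)
      ∂AddCircle.haarAddCircle = if k i = l i then 1 else 0 := by
    intro i
    have := orthonormal_iff_ite.mp (orthonormal_fourier (T := 1)) (l i) (k i)
    rw [ContinuousMap.inner_toLp] at this
    rw [show (if k i = l i then (1 : ℂ) else 0) = if l i = k i then 1 else 0 by simp [eq_comm],
      ← this]
  simp only [h1]
  by_cases h : k = l
  · simp [h]
  · obtain ⟨i, hi⟩ := Function.ne_iff.mp h
    rw [if_neg h]
    exact Finset.prod_eq_zero (Finset.mem_univ i) (by simp [hi])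

lemma fc_fourierMode (hab : ∀ i, a i < b i) (k l : Fin d → ℤ) :
    fc a b (fourierMode a b k) l = if k = l then 1 else 0 := by
  have h := integral_torus hab (v := fun x => fourierMode a b k x * conj (fourierMode a b l x))
    ((continuous_fourierMode k).mul
      (Complex.continuous_conj.comp (continuous_fourierMode l))).aestronglyMeasurable
  rw [fc, ← Complex.ofReal_inv, ← Complex.real_smul, ← h, ← orthonormal_modes_integral k l]
  simp only [fourierMode_ofTorus hab]

lemma fc_shift (hab : ∀ i, a i < b i) {v : Sp d → ℂ} (hv : AEStronglyMeasurable v (boxMeasure a b))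
    (h : Sp d) (k : Fin d → ℤ) :
    fc a b (fun x => v (shift a b h x)) k = fourierMode a b k h * fc a b v k := by
  have hp := measurePreserving_shift hab h
  have e : ∫ x, v (shift a b h x) * conj (fourierMode a b k (shift a b h x)) ∂(boxMeasure a b)
      = ∫ x, v x * conj (fourierMode a b k x) ∂(boxMeasure a b) := by
    conv_rhs => rw [← hp.map_eq]
    rw [integral_map hp.measurable.aemeasurable]
    rw [hp.map_eq]
    exact hv.mul (Complex.continuous_conj.comp (continuous_fourierMode k)).aestronglyMeasurable
  have hz : fourierMode a b k h * conj (fourierMode a b k h) = 1 := by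
    rw [Complex.mul_conj', norm_fourierMode]; simp
  rw [fc, fc, ← e, mul_left_comm]
  conv_rhs => rw [← integral_const_mul]
  refine congrArg ((boxVol a b : ℂ)⁻¹ * ·) (integral_congr_ae (Eventually.of_forall fun x => ?_))
  simp only [fourierMode_shift hab, map_mul]
  calc _ = (fourierMode a b k h * conj (fourierMode a b k h))
        * (v (shift a b h x) * conj (fourierMode a b k x)) := by rw [hz, one_mul]
    _ = _ := by ring

lemma integral_norm_sq_eq (hab : ∀ i, a i < b i) {v : Sp d → ℂ}
    (hv : MemLp v 2 (boxMeasure a b)) :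
    Hmem a b 0 (fc a b v) ∧ ∫ x, ‖v x‖ ^ 2 ∂(boxMeasure a b) = boxVol a b * hs a b 0 (fc a b v) := by
  have h := hasSum_sq_fc hab hv
  have h' : HasSum (fun k => wt a b k ^ 0 * ‖fc a b v k‖ ^ 2)
    ((boxVol a b)⁻¹ * ∫ x, ‖v x‖ ^ 2 ∂(boxMeasure a b)) := by simpa using h
  refine ⟨h'.summable, ?_⟩
  rw [hs, h'.tsum_eq, mul_inv_cancel_left₀ (boxVol_pos hab).ne']

/-! ### Weak derivatives through Fourier coefficients -/

lemma symbol_neg (α : Fin d → ℕ) (k : Fin d → ℤ) :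
    symbol a b α (-k) = (-1) ^ (∑ i, α i) * symbol a b α k := by
  simp only [symbol, freq_neg]
  rw [← Finset.prod_pow_eq_pow_sum, ← Finset.prod_mul_distrib]
  refine Finset.prod_congr rfl fun i _ => ?_
  rw [← mul_pow]; push_cast; ring

/-- The test function is the mode of index −k, the conjugate of mode k. The sign of its symbol
cancels the sign in the definition of the weak derivative. -/
lemma IsWeakDeriv.fc_eq (hab : ∀ i, a i < b i) {α : Fin d → ℕ} {v g : Sp d → ℂ}
    (h : IsWeakDeriv a b α v g) (k : Fin d → ℤ) :
    fc a b g k = symbol a b α k * fc a b v k := by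
  have h1 := h.2.2 _ (isPeriodicTest_fourierMode hab (-k))
  rw [multiD_fourierMode, symbol_neg] at h1
  simp only [fourierMode_neg] at h1
  have hsq : ((-1 : ℂ) ^ (∑ i, α i)) * (-1) ^ (∑ i, α i) = 1 := by
    rw [← mul_pow]; simp
  have h2 : ∫ x, g x * conj (fourierMode a b k x) ∂(boxMeasure a b)
      = symbol a b α k * ∫ x, v x * conj (fourierMode a b k x) ∂(boxMeasure a b) := by
    rw [← one_mul (∫ x, g x * _ ∂_), ← hsq, mul_assoc, ← h1, ← integral_const_mul,
      ← integral_const_mul]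
    congr 1
    ext x
    calc _ = ((-1 : ℂ) ^ (∑ i, α i) * (-1) ^ (∑ i, α i)) * (symbol a b α k *
          (v x * conj (fourierMode a b k x))) := by ring
      _ = _ := by rw [hsq, one_mul]
  rw [fc, fc, h2]
  ring

lemma weakDeriv_spec {α : Fin d → ℕ} {v : Sp d → ℂ} (h : ∃ g, IsWeakDeriv a b α v g) :
    IsWeakDeriv a b α v (weakDeriv a b α v) := by
  rw [weakDeriv, dif_pos h]; exact h.choose_spec

/-- Parseval for the difference. This makes the weak derivative picked by choice interchangeable
with an explicit one. -/
lemma ae_eq_of_fc_eq (hab : ∀ i, a i < b i) {v w : Sp d → ℂ} (hv : MemLp v 2 (boxMeasure a b))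
    (hw : MemLp w 2 (boxMeasure a b)) (h : fc a b v = fc a b w) : v =ᵐ[boxMeasure a b] w := by
  have h1 := (integral_norm_sq_eq hab (hv.sub hw)).2
  rw [fc_sub hab hv hw, h, sub_self] at h1
  have h2 : hs a b 0 (0 : (Fin d → ℤ) → ℂ) = 0 := by simp [hs]
  rw [h2, mul_zero, integral_eq_zero_iff_of_nonneg (fun x => by positivity)
    ((hv.sub hw).integrable_norm_pow (by norm_num))] at h1
  filter_upwards [h1] with x hx
  simpa [sub_eq_zero] using hx

lemma exists_box_subset_closedBall (a b : Fin d → ℝ) :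
    ∃ R, box a b ⊆ Metric.closedBall (0 : Sp d) R := by
  refine ⟨∑ j, (|a j| + |b j|), fun x hx => ?_⟩
  rw [mem_closedBall_zero_iff]
  calc ‖x‖ = ‖∑ j, PiLp.single 2 j (x j)‖ := by
        congr 1; ext i; simp
    _ ≤ ∑ j, ‖(PiLp.single 2 j (x j) : Sp d)‖ := norm_sum_le _ _
    _ ≤ _ := by
      refine Finset.sum_le_sum fun j _ => ?_
      rw [PiLp.norm_single, Real.norm_eq_abs]
      have := hx j
      rcases abs_cases (x j) with h | h <;> rcases abs_cases (a j) with h' | h' <;>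
        rcases abs_cases (b j) with h'' | h'' <;> linarith

lemma memLp_of_continuous (hab : ∀ i, a i < b i) {F : Type*} [NormedAddCommGroup F]
    [SecondCountableTopology F] {ψ : Sp d → F} {p : ℝ≥0∞} (hψ : Continuous ψ) :
    MemLp ψ p (boxMeasure a b) := by
  have := isFiniteMeasure_boxMeasure hab
  obtain ⟨R, hR⟩ := exists_box_subset_closedBall a b
  obtain ⟨C, hC⟩ := (isCompact_closedBall (0 : Sp d) R).exists_bound_of_continuousOn
    hψ.continuousOn
  refine MemLp.of_bound hψ.aestronglyMeasurable C ?_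
  filter_upwards [ae_mem_box] with x hx
  exact hC x (hR hx)

lemma IsWeakDeriv.sub (hab : ∀ i, a i < b i) {α : Fin d → ℕ} {v g w g' : Sp d → ℂ}
    (h : IsWeakDeriv a b α v g) (h' : IsWeakDeriv a b α w g')
    (hcont : ∀ φ, IsPeriodicTest a b φ → Continuous (multiD α φ)) :
    IsWeakDeriv a b α (v - w) (g - g') := by
  refine ⟨h.1.sub h'.1, h.2.1.sub h'.2.1, fun φ hφ => ?_⟩
  have h1 := memLp_of_continuous hab (p := 2) (hcont φ hφ)
  have h2 := memLp_of_continuous hab (p := 2) hφ.1.continuous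
  simp only [Pi.sub_apply, sub_mul]
  rw [integral_sub (integrable_mul_of_memLp_two h.1 h1) (integrable_mul_of_memLp_two h'.1 h1),
    integral_sub (integrable_mul_of_memLp_two h.2.1 h2) (integrable_mul_of_memLp_two h'.2.1 h2),
    h.2.2 φ hφ, h'.2.2 φ hφ, mul_sub]

/-! ### Integration by parts for periodic functions -/

/-- Divergence theorem for a field with the single component i: the opposite faces differ by one
period, so their contributions cancel. -/
lemma integral_partialD_eq_zero (hab : ∀ i, a i < b i) {ψ : Sp d → ℂ} (hψ : ContDiff ℝ 1 ψ)
    (i : Fin d) (hper : ∀ x, ψ (x + EuclideanSpace.single i (b i - a i)) = ψ x) :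
    ∫ x, partialD i ψ x ∂(boxMeasure a b) = 0 := by
  obtain _ | n := d
  · exact i.elim0
  let e : (Fin (n + 1) → ℝ) →L[ℝ] Sp (n + 1) :=
    (EuclideanSpace.equiv (Fin (n + 1)) ℝ).symm.toContinuousLinearMap
  have he : ∀ x, e x = WithLp.toLp 2 x := fun x => rfl
  have hcont : Continuous (partialD i ψ) :=
    (hψ.continuous_fderiv one_ne_zero).clm_apply continuous_const
  have h1 : ∫ x, partialD i ψ x ∂(boxMeasure a b)
      = ∫ y in Set.Icc a b, partialD i ψ (e y) := by
    have hp := measurePreserving_ofLp_box (a := a) (b := b)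
    have h2 : ∫ y, partialD i ψ (e y) ∂(Measure.pi fun j => volume.restrict (Set.Ioo (a j) (b j)))
        = ∫ x, partialD i ψ x ∂(boxMeasure a b) := by
      rw [← hp.map_eq, integral_map hp.measurable.aemeasurable]
      · rfl
      · exact (hcont.comp e.continuous).aestronglyMeasurable
    rw [← h2, ← Measure.restrict_pi_pi, ← volume_pi]
    exact setIntegral_congr_set Measure.univ_pi_Ioo_ae_eq_Icc
  have hg : ∀ y, HasFDerivAt (fun y => ψ (e y)) ((fderiv ℝ ψ (e y)).comp e) y := fun y =>
    ((hψ.differentiable one_ne_zero).differentiableAt.hasFDerivAt).comp y e.hasFDerivAt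
  have h3 := integral_divergence_of_hasFDerivAt_off_countable' a b (fun j => (hab j).le)
    (fun j y => if j = i then ψ (e y) else 0)
    (fun j y => if j = i then (fderiv ℝ ψ (e y)).comp e else 0) ∅ Set.countable_empty
    (fun j => by
      by_cases hj : j = i
      · simp only [hj, if_true]
        exact (hψ.continuous.comp e.continuous).continuousOn
      · simp only [hj, if_false]; exact continuousOn_const)
    (fun x _ j => by
      by_cases hj : j = i
      · simp only [hj, if_true]; exact hg x
      · simp only [hj, if_false]; exact hasFDerivAt_const _ _)
    (by
      refine Continuous.integrableOn_Icc ?_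
      refine continuous_finsetSum _ fun j _ => ?_
      by_cases hj : j = i
      · simp only [hj, if_true]
        exact (((hψ.continuous_fderiv one_ne_zero).comp e.continuous).clm_comp
          continuous_const).clm_apply continuous_const
      · simp only [hj, if_false]; exact continuous_const)
  have h4 : ∀ y, ∑ j, (if j = i then (fderiv ℝ ψ (e y)).comp e else 0) (Pi.single j 1)
      = partialD i ψ (e y) := by
    intro y
    rw [Finset.sum_eq_single i]
    · rw [if_pos rfl]; rfl
    · intro j _ hj; rw [if_neg hj]; rfl
    · simp
  rw [h1]
  simp only [h4] at h3
  rw [h3]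
  refine Finset.sum_eq_zero fun j _ => ?_
  by_cases hj : j = i
  · subst hj
    simp only [if_true]
    rw [sub_eq_zero]
    refine integral_congr_ae (Eventually.of_forall fun x => ?_)
    simp only [he]
    rw [← hper (WithLp.toLp 2 (j.insertNth (a j) x))]
    congr 1
    ext l
    refine Fin.succAboveCases j ?_ (fun l' => ?_) l
    · simp
    · simp
  · simp [hj]

/-- Periodicity with the periods of the box. -/
def IsPeriodic (a b : Fin d → ℝ) (ψ : Sp d → ℂ) : Prop :=
  ∀ i x, ψ (x + EuclideanSpace.single i (b i - a i)) = ψ x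

lemma partialD_mul {v w : Sp d → ℂ} (hv : ContDiff ℝ 1 v) (hw : ContDiff ℝ 1 w) (i : Fin d)
    (x : Sp d) :
    partialD i (fun y => v y * w y) x = v x * partialD i w x + w x * partialD i v x := by
  rw [partialD, fderiv_fun_mul (hv.differentiable one_ne_zero).differentiableAt
    (hw.differentiable one_ne_zero).differentiableAt]
  rfl

lemma continuous_partialD {v : Sp d → ℂ} (hv : ContDiff ℝ 1 v) (i : Fin d) :
    Continuous (partialD i v) :=
  (hv.continuous_fderiv one_ne_zero).clm_apply continuous_const

lemma integral_by_parts (hab : ∀ i, a i < b i) {v w : Sp d → ℂ} (hv : ContDiff ℝ 1 v)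
    (hw : ContDiff ℝ 1 w) (hvp : IsPeriodic a b v) (hwp : IsPeriodic a b w) (i : Fin d) :
    ∫ x, v x * partialD i w x ∂(boxMeasure a b)
      = -∫ x, partialD i v x * w x ∂(boxMeasure a b) := by
  have h := integral_partialD_eq_zero hab (hv.mul hw) i fun x => by rw [hvp, hwp]
  simp only [partialD_mul hv hw] at h
  rw [integral_add] at h
  · rw [eq_neg_iff_add_eq_zero, ← h]
    simp only [mul_comm]
  · exact integrable_mul_of_memLp_two (memLp_of_continuous hab hv.continuous)
      (memLp_of_continuous hab (continuous_partialD hw i))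
  · exact integrable_mul_of_memLp_two (memLp_of_continuous hab hw.continuous)
      (memLp_of_continuous hab (continuous_partialD hv i))

lemma isPeriodic_fourierMode (hab : ∀ i, a i < b i) (k : Fin d → ℤ) :
    IsPeriodic a b (fourierMode a b k) :=
  (isPeriodicTest_fourierMode hab k).2

lemma partialD_fourierMode (k : Fin d → ℤ) (i : Fin d) (x : Sp d) :
    partialD i (fourierMode a b k) x = Complex.I * freq a b k i * fourierMode a b k x := by
  have := congrFun (partialD_const_mul_fourierMode (a := a) (b := b) 1 k i) x
  simpa using this

lemma fc_partialD (hab : ∀ i, a i < b i) {v : Sp d → ℂ} (hv : ContDiff ℝ 1 v)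
    (hvp : IsPeriodic a b v) (i : Fin d) (k : Fin d → ℤ) :
    fc a b (partialD i v) k = Complex.I * freq a b k i * fc a b v k := by
  have h := integral_by_parts hab hv (contDiff_fourierMode (a := a) (b := b) (-k)) hvp
    (isPeriodic_fourierMode hab (-k)) i
  simp only [partialD_fourierMode, fourierMode_neg, freq_neg] at h
  rw [fc, fc, eq_comm, mul_left_comm, ← neg_neg (∫ x, partialD i v x * _ ∂_), ← h,
    ← integral_const_mul, ← integral_neg]
  refine congrArg ((boxVol a b : ℂ)⁻¹ * ·) (integral_congr_ae (Eventually.of_forall fun x => ?_))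
  push_cast
  ring

/-! ### Functions with a square-integrable gradient -/

/-- `g` is the gradient of `v` on the torus, with square-integrable components. -/
structure IsGrad (a b : Fin d → ℝ) (v : Sp d → ℂ) (g : Fin d → Sp d → ℂ) : Prop where
  memLp : MemLp v 2 (boxMeasure a b)
  grad_memLp : ∀ i, MemLp (g i) 2 (boxMeasure a b)
  fc_grad : ∀ i k, fc a b (g i) k = Complex.I * freq a b k i * fc a b v k

lemma IsGrad.sub (hab : ∀ i, a i < b i) {v w : Sp d → ℂ} {g g' : Fin d → Sp d → ℂ}
    (h : IsGrad a b v g) (h' : IsGrad a b w g') :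
    IsGrad a b (v - w) (g - g') where
  memLp := h.memLp.sub h'.memLp
  grad_memLp i := (h.grad_memLp i).sub (h'.grad_memLp i)
  fc_grad i k := by
    rw [Pi.sub_apply, fc_sub hab (h.grad_memLp i) (h'.grad_memLp i), fc_sub hab h.memLp h'.memLp,
      Pi.sub_apply, Pi.sub_apply, h.fc_grad, h'.fc_grad]
    ring

lemma IsGrad.shift (hab : ∀ i, a i < b i) {v : Sp d → ℂ} {g : Fin d → Sp d → ℂ}
    (h : IsGrad a b v g) (y : Sp d) :
    IsGrad a b (fun x => v (shift a b y x)) (fun i x => g i (shift a b y x)) where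
  memLp := h.memLp.comp_measurePreserving (measurePreserving_shift hab y)
  grad_memLp i := (h.grad_memLp i).comp_measurePreserving (measurePreserving_shift hab y)
  fc_grad i k := by
    rw [fc_shift hab (h.grad_memLp i).1, fc_shift hab h.memLp.1, h.fc_grad]
    ring

lemma IsGrad.hs_grad {v : Sp d → ℂ} {g : Fin d → Sp d → ℂ} (h : IsGrad a b v g) {s : ℕ}
    (hm : Hmem a b (s + 1) (fc a b v)) (i : Fin d) :
    Hmem a b s (fc a b (g i)) ∧ hs a b s (fc a b (g i)) ≤ hs a b (s + 1) (fc a b v) := by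
  have e : fc a b (g i) = fun k => Complex.I * freq a b k i * fc a b v k :=
    funext fun k => h.fc_grad i k
  rw [e]
  exact hm.freq_mul i

/-- Parseval turns both sides into the same series, so v needs only a square-integrable gradient.
Since the pairing conjugates its second argument, it is applied to the conjugate of G. -/
lemma IsGrad.integral_grad_mul (hab : ∀ i, a i < b i) {v : Sp d → ℂ} {g : Fin d → Sp d → ℂ}
    (h : IsGrad a b v g) {G : Sp d → ℂ} (hG : ContDiff ℝ 1 G) (hGp : IsPeriodic a b G)
    (i : Fin d) :
    ∫ x, g i x * G x ∂(boxMeasure a b) = -∫ x, v x * partialD i G x ∂(boxMeasure a b) := by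
  have hV : (boxVol a b : ℂ) ≠ 0 := by exact_mod_cast (boxVol_pos hab).ne'
  have hH : ContDiff ℝ 1 (fun x => conj (G x)) := Complex.conjCLE.contDiff.comp hG
  have hHp : IsPeriodic a b (fun x => conj (G x)) := fun j x => congrArg conj (hGp j x)
  have hpd : ∀ x, partialD i (fun x => conj (G x)) x = conj (partialD i G x) := by
    intro x
    have := (Complex.conjCLE.toContinuousLinearMap.hasFDerivAt.comp x
      (hG.differentiable one_ne_zero x).hasFDerivAt).fderiv
    rw [partialD]
    exact congrArg (fun L : Sp d →L[ℝ] ℂ => L (EuclideanSpace.single i 1)) this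
  have h1 := hasSum_fc_mul_conj hab (h.grad_memLp i)
    (memLp_of_continuous hab (p := 2) hH.continuous)
  have h2 := hasSum_fc_mul_conj hab h.memLp
    (memLp_of_continuous hab (p := 2) (continuous_partialD hH i))
  simp only [fc_partialD hab hH hHp, h.fc_grad, hpd, Complex.conj_conj] at h1 h2
  have h3 := h1.unique (h2.neg.congr_fun fun k => by
    simp only [map_mul, Complex.conj_I, Complex.conj_ofReal]; ring)
  rw [← mul_neg] at h3
  exact mul_left_cancel₀ (inv_ne_zero hV) h3

/-! ### Trigonometric polynomials -/

/-- The trigonometric polynomial with frequencies in `S` and coefficients `c`. -/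
noncomputable def trig (a b : Fin d → ℝ) (S : Finset (Fin d → ℤ)) (c : (Fin d → ℤ) → ℂ) :
    Sp d → ℂ :=
  fun x => ∑ k ∈ S, c k * fourierMode a b k x

/-- The gradient of `trig a b S c`. -/
noncomputable def trigGrad (a b : Fin d → ℝ) (S : Finset (Fin d → ℤ)) (c : (Fin d → ℤ) → ℂ)
    (i : Fin d) : Sp d → ℂ :=
  trig a b S fun k => Complex.I * freq a b k i * c k

lemma contDiff_trig (S : Finset (Fin d → ℤ)) (c : (Fin d → ℤ) → ℂ) {n : WithTop ℕ∞} :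
    ContDiff ℝ n (trig a b S c) :=
  ContDiff.sum fun k _ => contDiff_const.mul (contDiff_fourierMode k)

lemma continuous_trig (S : Finset (Fin d → ℤ)) (c : (Fin d → ℤ) → ℂ) :
    Continuous (trig a b S c) :=
  (contDiff_trig S c (n := 1)).continuous

lemma isPeriodic_trig (hab : ∀ i, a i < b i) (S : Finset (Fin d → ℤ)) (c : (Fin d → ℤ) → ℂ) :
    IsPeriodic a b (trig a b S c) := fun i x => by
  simp only [trig, isPeriodic_fourierMode hab _ i x]

lemma partialD_trig (S : Finset (Fin d → ℤ)) (c : (Fin d → ℤ) → ℂ) (i : Fin d) :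
    partialD i (trig a b S c) = trigGrad a b S c i := by
  ext x
  have h : HasFDerivAt (trig a b S c) (∑ k ∈ S, c k • fderiv ℝ (fourierMode a b k) x) x := by
    refine HasFDerivAt.fun_sum fun k _ => ?_
    exact (((contDiff_fourierMode k (n := 1)).differentiable one_ne_zero x).hasFDerivAt).const_mul _
  rw [partialD, h.fderiv, trigGrad, trig]
  simp only [FunLike.coe_sum, Finset.sum_apply, FunLike.coe_smul,
    Pi.smul_apply, smul_eq_mul]
  refine Finset.sum_congr rfl fun k _ => ?_
  have := partialD_fourierMode (a := a) (b := b) k i x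
  rw [partialD] at this
  rw [this]; ring

lemma memLp_trig (hab : ∀ i, a i < b i) (S : Finset (Fin d → ℤ)) (c : (Fin d → ℤ) → ℂ)
    {p : ℝ≥0∞} : MemLp (trig a b S c) p (boxMeasure a b) :=
  memLp_of_continuous hab (continuous_trig S c)

open Classical in
lemma fc_trig (hab : ∀ i, a i < b i) (S : Finset (Fin d → ℤ)) (c : (Fin d → ℤ) → ℂ) :
    fc a b (trig a b S c) = fun k => if k ∈ S then c k else 0 := by
  induction S using Finset.induction_on with
  | empty => ext k; simp [trig, fc]
  | insert l S hl ih =>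
    have e : trig a b (insert l S) c = (fun x => c l * fourierMode a b l x) + trig a b S c := by
      ext x; simp [trig, Finset.sum_insert hl]
    rw [e, fc_add hab ((memLp_fourierMode hab l).const_mul _) (memLp_trig hab S c), fc_const_mul,
      ih]
    ext k
    simp only [Pi.add_apply, fc_fourierMode hab]
    by_cases hk : k = l
    · subst hk; simp [hl]
    · simp [hk, Ne.symm hk]

lemma isGrad_trig (hab : ∀ i, a i < b i) (S : Finset (Fin d → ℤ)) (c : (Fin d → ℤ) → ℂ) :
    IsGrad a b (trig a b S c) (trigGrad a b S c) where
  memLp := memLp_trig hab S c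
  grad_memLp i := memLp_trig hab S _
  fc_grad i k := by
    rw [trigGrad, fc_trig hab, fc_trig hab]
    by_cases hk : k ∈ S <;> simp [hk]

lemma norm_trig_le (S : Finset (Fin d → ℤ)) (c : (Fin d → ℤ) → ℂ) (x : Sp d) :
    ‖trig a b S c x‖ ≤ ∑ k ∈ S, ‖c k‖ := by
  refine (norm_sum_le _ _).trans (Finset.sum_le_sum fun k _ => ?_)
  rw [norm_mul, norm_fourierMode, mul_one]

lemma trig_sub (S : Finset (Fin d → ℤ)) (c c' : (Fin d → ℤ) → ℂ) :
    trig a b S c - trig a b S c' = trig a b S (c - c') := by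
  ext x
  simp only [trig, Pi.sub_apply, sub_mul, Finset.sum_sub_distrib]

lemma trig_congr {S : Finset (Fin d → ℤ)} {c c' : (Fin d → ℤ) → ℂ} (h : ∀ k ∈ S, c k = c' k) :
    trig a b S c = trig a b S c' := by
  ext x
  exact Finset.sum_congr rfl fun k hk => by rw [h k hk]

lemma Hmem_trig (hab : ∀ i, a i < b i) (s : ℕ) (S : Finset (Fin d → ℤ)) (c : (Fin d → ℤ) → ℂ) :
    Hmem a b s (fc a b (trig a b S c)) ∧
      hs a b s (fc a b (trig a b S c)) = ∑ k ∈ S, wt a b k ^ s * ‖c k‖ ^ 2 := by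
  classical
  have h0 : ∀ k ∉ S, wt a b k ^ s * ‖fc a b (trig a b S c) k‖ ^ 2 = 0 := fun k hk => by
    rw [fc_trig hab]; simp [hk]
  refine ⟨summable_of_ne_finset_zero (s := S) h0, ?_⟩
  rw [hs, tsum_eq_sum h0]
  refine Finset.sum_congr rfl fun k hk => ?_
  rw [fc_trig hab]; simp [hk]

lemma isWeakDeriv_zero_order {v : Sp d → ℂ} (hv : MemLp v 2 (boxMeasure a b)) :
    IsWeakDeriv a b 0 v v :=
  ⟨hv, hv, fun φ _ => by simp [multiD_zero]⟩

lemma isWeakDeriv_trig (hab : ∀ i, a i < b i) (S : Finset (Fin d → ℤ)) (c : (Fin d → ℤ) → ℂ)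
    (i : Fin d) :
    IsWeakDeriv a b (Pi.single i 1) (trig a b S c) (trigGrad a b S c i) := by
  refine ⟨memLp_trig hab S c, memLp_trig hab S _, fun φ hφ => ?_⟩
  have hφ1 : ContDiff ℝ 1 φ := hφ.1.of_le (by exact_mod_cast le_top)
  rw [multiD_single, integral_by_parts hab (contDiff_trig S c) hφ1 (isPeriodic_trig hab S c) hφ.2,
    partialD_trig]
  simp

/-! ### Sobolev norms through Fourier coefficients -/

lemma IsWeakDeriv.isGrad (hab : ∀ i, a i < b i) {v : Sp d → ℂ} {g : Fin d → Sp d → ℂ}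
    (hv : MemLp v 2 (boxMeasure a b)) (h : ∀ i, IsWeakDeriv a b (Pi.single i 1) v (g i)) :
    IsGrad a b v g where
  memLp := hv
  grad_memLp i := (h i).2.1
  fc_grad i k := by
    rw [(h i).fc_eq hab k]
    congr 1
    rw [symbol, Finset.prod_eq_single i]
    · simp
    · intro j _ hj; simp [hj]
    · simp

lemma MemHp.memLp {s : ℕ} {v : Sp d → ℂ} (h : MemHp a b s v) : MemLp v 2 (boxMeasure a b) := by
  obtain ⟨g, hg⟩ := h 0 (by simp)
  exact hg.1

lemma MemHp.isGrad (hab : ∀ i, a i < b i) {s : ℕ} {v : Sp d → ℂ} (h : MemHp a b s v)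
    (h1 : 1 ≤ s) : IsGrad a b v fun i => weakDeriv a b (Pi.single i 1) v :=
  IsWeakDeriv.isGrad hab h.memLp fun i => weakDeriv_spec (h _ (by simpa using h1))

lemma memHp_one_of_grad {v : Sp d → ℂ} {g : Fin d → Sp d → ℂ} (hv : MemLp v 2 (boxMeasure a b))
    (h : ∀ i, IsWeakDeriv a b (Pi.single i 1) v (g i)) : MemHp a b 1 v := by
  intro α hα
  by_cases h0 : α = 0
  · subst h0; exact ⟨v, isWeakDeriv_zero_order hv⟩
  · obtain ⟨i, hi⟩ := Function.ne_iff.1 h0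
    have : α = Pi.single i 1 := by
      have h1 := Finset.add_sum_erase Finset.univ α (Finset.mem_univ i)
      have hi' : 1 ≤ α i := Nat.one_le_iff_ne_zero.2 hi
      have h2 : ∑ j ∈ Finset.univ.erase i, α j = 0 := by omega
      ext j
      by_cases hj : j = i
      · subst hj; rw [Pi.single_eq_same]; omega
      · rw [Pi.single_eq_of_ne hj]
        exact Finset.sum_eq_zero_iff.1 h2 j (by simp [hj])
    exact ⟨g i, this ▸ h i⟩

lemma IsWeakDeriv.integral_sq (hab : ∀ i, a i < b i) {α : Fin d → ℕ} {v g : Sp d → ℂ}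
    (h : IsWeakDeriv a b α v g) :
    (Summable fun k => ‖symbol a b α k‖ ^ 2 * ‖fc a b v k‖ ^ 2) ∧
    ∫ x, ‖g x‖ ^ 2 ∂(boxMeasure a b)
      = boxVol a b * ∑' k, ‖symbol a b α k‖ ^ 2 * ‖fc a b v k‖ ^ 2 := by
  have h1 := hasSum_sq_fc hab h.2.1
  simp only [h.fc_eq hab, norm_mul, mul_pow] at h1
  exact ⟨h1.summable, by rw [h1.tsum_eq, mul_inv_cancel_left₀ (boxVol_pos hab).ne']⟩

lemma norm_symbol_sq (α : Fin d → ℕ) (k : Fin d → ℤ) :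
    ‖symbol a b α k‖ ^ 2 = ∏ i, (freq a b k i ^ 2) ^ α i := by
  rw [symbol, norm_prod, ← Finset.prod_pow]
  refine Finset.prod_congr rfl fun i _ => ?_
  rw [norm_pow, norm_mul, Complex.norm_I, one_mul, Complex.norm_real, Real.norm_eq_abs, ← pow_mul,
    mul_comm, pow_mul, sq_abs]

lemma norm_symbol_sq_le {α : Fin d → ℕ} {s : ℕ} (hα : ∑ i, α i ≤ s) (k : Fin d → ℤ) :
    ‖symbol a b α k‖ ^ 2 ≤ wt a b k ^ s := by
  rw [norm_symbol_sq]
  calc ∏ i, (freq a b k i ^ 2) ^ α i ≤ ∏ i, wt a b k ^ α i :=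
        Finset.prod_le_prod (fun i _ => by positivity)
          fun i _ => pow_le_pow_left₀ (sq_nonneg _) (freq_sq_le_wt k i) _
    _ = wt a b k ^ ∑ i, α i := Finset.prod_pow_eq_pow_sum _ _ _
    _ ≤ _ := pow_le_pow_right₀ (one_le_wt k) hα

lemma mem_multiIndices {s : ℕ} {α : Fin d → ℕ} :
    α ∈ multiIndices d s ↔ ∑ i, α i ≤ s := by
  rw [multiIndices, Finset.mem_filter, Fintype.mem_piFinset]
  refine ⟨fun h => h.2, fun h => ⟨fun i => ?_, h⟩⟩
  rw [Finset.mem_range]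
  have := Finset.single_le_sum (f := α) (fun _ _ => Nat.zero_le _) (Finset.mem_univ i)
  omega

lemma sobolevNorm_sq (s : ℕ) (v : Sp d → ℂ) : sobolevNorm a b s v ^ 2
    = ∑ α ∈ multiIndices d s, ∫ x, ‖weakDeriv a b α v x‖ ^ 2 ∂(boxMeasure a b) :=
  Real.sq_sqrt (Finset.sum_nonneg fun _ _ => integral_nonneg fun _ => by positivity)

lemma MemHp.sobolevNorm_sq_le (hab : ∀ i, a i < b i) {s : ℕ} {v : Sp d → ℂ} (h : MemHp a b s v)
    (hm : Hmem a b s (fc a b v)) :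
    sobolevNorm a b s v ^ 2
      ≤ ((multiIndices d s).card * boxVol a b) * hs a b s (fc a b v) := by
  rw [sobolevNorm_sq, mul_assoc, ← nsmul_eq_mul]
  refine Finset.sum_le_card_nsmul _ _ _ fun α hα => ?_
  have hα' := mem_multiIndices.1 hα
  obtain ⟨h1, h2⟩ := (weakDeriv_spec (h α hα')).integral_sq hab
  rw [h2]
  refine mul_le_mul_of_nonneg_left ?_ (boxVol_pos hab).le
  exact h1.tsum_le_tsum (fun k => mul_le_mul_of_nonneg_right (norm_symbol_sq_le hα' k)
    (sq_nonneg _)) hm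

/-- If some frequency exceeds 1, the largest one dominates the weight. Hence the function and its
pure derivatives of order m already control the weighted norm, and no mixed derivative is needed for
the equivalence of norms. -/
lemma wt_pow_le (m : ℕ) (k : Fin d → ℤ) :
    wt a b k ^ m ≤ (1 + d) ^ m * (1 + ∑ i, (freq a b k i ^ 2) ^ m) := by
  have hs0 : 0 ≤ ∑ i, (freq a b k i ^ 2) ^ m := Finset.sum_nonneg fun _ _ => by positivity
  by_cases h : ∀ i, freq a b k i ^ 2 ≤ 1
  · have h1 : wt a b k ≤ 1 + d := by
      rw [wt]
      have := Finset.sum_le_card_nsmul Finset.univ (fun i => freq a b k i ^ 2) 1 fun i _ => h i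
      simp at this
      linarith
    calc wt a b k ^ m ≤ (1 + d) ^ m := pow_le_pow_left₀ (wt_pos k).le h1 _
      _ ≤ _ := le_mul_of_one_le_right (by positivity) (by linarith)
  · push Not at h
    obtain ⟨i0, hi0⟩ := h
    obtain ⟨i, -, hi⟩ := Finset.exists_max_image Finset.univ (fun i => freq a b k i ^ 2)
      ⟨i0, Finset.mem_univ _⟩
    have h1 : wt a b k ≤ (1 + d) * freq a b k i ^ 2 := by
      rw [wt]
      have := Finset.sum_le_card_nsmul Finset.univ (fun i => freq a b k i ^ 2)
        (freq a b k i ^ 2) fun j hj => hi j hj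
      simp at this
      have := hi i0 (Finset.mem_univ _)
      nlinarith
    calc wt a b k ^ m ≤ ((1 + d) * freq a b k i ^ 2) ^ m := pow_le_pow_left₀ (wt_pos k).le h1 _
      _ = (1 + d) ^ m * (freq a b k i ^ 2) ^ m := mul_pow _ _ _
      _ ≤ _ := by
        gcongr
        have := Finset.single_le_sum (f := fun i => (freq a b k i ^ 2) ^ m)
          (fun _ _ => by positivity) (Finset.mem_univ i)
        linarith

lemma MemHp.hs_le (hab : ∀ i, a i < b i) {s : ℕ} {v : Sp d → ℂ} (h : MemHp a b s v) :
    Hmem a b s (fc a b v) ∧ hs a b s (fc a b v)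
      ≤ ((1 + d) ^ (s + 1) * (boxVol a b)⁻¹) * sobolevNorm a b s v ^ 2 := by
  have hV := boxVol_pos hab
  have hα : ∀ α ∈ multiIndices d s, (Summable fun k => ‖symbol a b α k‖ ^ 2 * ‖fc a b v k‖ ^ 2) ∧
      ∑' k, ‖symbol a b α k‖ ^ 2 * ‖fc a b v k‖ ^ 2
        ≤ (boxVol a b)⁻¹ * sobolevNorm a b s v ^ 2 := by
    intro α hα
    obtain ⟨h1, h2⟩ := (weakDeriv_spec (h α (mem_multiIndices.1 hα))).integral_sq hab
    refine ⟨h1, ?_⟩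
    rw [sobolevNorm_sq, ← div_eq_inv_mul, le_div_iff₀' hV, ← h2]
    exact Finset.single_le_sum (f := fun α => ∫ x, ‖weakDeriv a b α v x‖ ^ 2 ∂(boxMeasure a b))
      (fun _ _ => integral_nonneg fun _ => by positivity) hα
  have h0 := hα 0 (mem_multiIndices.2 (by simp))
  have hi : ∀ i : Fin d, _ := fun i => hα (Pi.single i s) (mem_multiIndices.2 (by simp))
  have e0 : ∀ k, ‖symbol a b 0 k‖ ^ 2 = 1 := fun k => by simp [norm_symbol_sq]
  have ei : ∀ (i : Fin d) k, ‖symbol a b (Pi.single i s) k‖ ^ 2 = (freq a b k i ^ 2) ^ s := by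
    intro i k
    rw [norm_symbol_sq, Finset.prod_eq_single i]
    · simp
    · intro j _ hj; simp [hj]
    · simp
  simp only [e0, one_mul] at h0
  simp only [ei] at hi
  have hsum := (h0.1.add (summable_sum (s := Finset.univ) fun i _ => (hi i).1)).mul_left
    ((1 + d : ℝ) ^ s)
  have hle : ∀ k, wt a b k ^ s * ‖fc a b v k‖ ^ 2 ≤ (1 + d : ℝ) ^ s * (‖fc a b v k‖ ^ 2 +
      ∑ i, (freq a b k i ^ 2) ^ s * ‖fc a b v k‖ ^ 2) := fun k => by
    calc _ ≤ ((1 + d) ^ s * (1 + ∑ i, (freq a b k i ^ 2) ^ s)) * ‖fc a b v k‖ ^ 2 :=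
          mul_le_mul_of_nonneg_right (wt_pow_le s k) (sq_nonneg _)
      _ = _ := by rw [← Finset.sum_mul]; ring
  have hm : Hmem a b s (fc a b v) := Summable.of_nonneg_of_le (hs_term_nonneg s _) hle hsum
  refine ⟨hm, (hm.tsum_le_tsum hle hsum).trans ?_⟩
  rw [tsum_mul_left, h0.1.tsum_add (summable_sum (s := Finset.univ) fun i _ => (hi i).1),
    Summable.tsum_finsetSum fun i _ => (hi i).1]
  have := Finset.sum_le_card_nsmul Finset.univ _ _ fun i _ => (hi i).2
  simp only [Finset.card_univ, Fintype.card_fin, nsmul_eq_mul] at this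
  calc _ ≤ (1 + d : ℝ) ^ s * ((boxVol a b)⁻¹ * sobolevNorm a b s v ^ 2
        + d * ((boxVol a b)⁻¹ * sobolevNorm a b s v ^ 2)) := by gcongr; exact h0.2
    _ = _ := by ring

/-! ### Lattice sums -/

lemma exists_wt_lower (hab : ∀ i, a i < b i) :
    ∃ c > 0, ∀ (k : Fin d → ℤ) (j : Fin d), c * (1 + |(k j : ℝ)|) ^ 2 ≤ wt a b k := by
  obtain ⟨c, hc, hcj⟩ : ∃ c > 0, ∀ j : Fin d, c ≤ min 1 ((2 * Real.pi / (b j - a j)) ^ 2) := by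
    have hpos : ∀ j : Fin d, 0 < min 1 ((2 * Real.pi / (b j - a j)) ^ 2) := fun j => by
      have := sub_pos.2 (hab j)
      have := Real.pi_pos
      positivity
    rcases isEmpty_or_nonempty (Fin d) with h | h
    · exact ⟨1, one_pos, fun j => h.elim j⟩
    · obtain ⟨i, hi⟩ := Finite.exists_min fun j => min 1 ((2 * Real.pi / (b j - a j)) ^ 2)
      exact ⟨_, hpos i, hi⟩
  refine ⟨c / 2, by positivity, fun k j => ?_⟩
  have h1 := one_add_freq_sq_le_wt (a := a) (b := b) k j
  have h2 : freq a b k j ^ 2 = (2 * Real.pi / (b j - a j)) ^ 2 * |(k j : ℝ)| ^ 2 := by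
    rw [sq_abs, freq]; ring
  have h3 := le_min_iff.1 (hcj j)
  have h4 : c * |(k j : ℝ)| ^ 2 ≤ freq a b k j ^ 2 := by
    rw [h2]; exact mul_le_mul_of_nonneg_right h3.2 (sq_nonneg _)
  nlinarith [sq_nonneg (1 - |(k j : ℝ)|)]

lemma finite_wt_le (hab : ∀ i, a i < b i) (R : ℝ) : {k | wt a b k ≤ R}.Finite := by
  obtain ⟨c, hc, h⟩ := exists_wt_lower hab
  refine (Set.Finite.pi' (t := fun _ : Fin d => Set.Icc (-⌈R / c⌉) ⌈R / c⌉)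
    fun _ => Set.finite_Icc _ _).subset fun k hk j => ?_
  have h1 : |(k j : ℝ)| ≤ R / c := by
    rw [le_div_iff₀ hc]
    have := (h k j).trans hk
    nlinarith [abs_nonneg (k j : ℝ), sq_nonneg |(k j : ℝ)|]
  have h2 : ((|k j| : ℤ) : ℝ) ≤ (⌈R / c⌉ : ℤ) := by
    rw [Int.cast_abs]; exact h1.trans (Int.le_ceil _)
  exact abs_le.1 (by exact_mod_cast h2)

/-- The finite set of frequencies of weight at most `R`. -/
noncomputable def wtBall (hab : ∀ i, a i < b i) (R : ℝ) : Finset (Fin d → ℤ) :=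
  (finite_wt_le hab R).toFinset

lemma mem_wtBall (hab : ∀ i, a i < b i) {R : ℝ} {k : Fin d → ℤ} :
    k ∈ wtBall hab R ↔ wt a b k ≤ R := by simp [wtBall]

lemma sum_prod_le (u : Finset (Fin d → ℤ)) (A : Finset ℤ) (hu : ∀ k ∈ u, ∀ j, k j ∈ A)
    (g : ℤ → ℝ) (hg : ∀ n, 0 ≤ g n) :
    ∑ k ∈ u, ∏ j, g (k j) ≤ (∑ n ∈ A, g n) ^ d := by
  have h := Finset.prod_univ_sum (fun _ : Fin d => A) fun _ n => g n
  rw [Finset.prod_const, Finset.card_univ, Fintype.card_fin] at h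
  rw [h]
  exact Finset.sum_le_sum_of_subset_of_nonneg
    (fun k hk => Fintype.mem_piFinset.2 fun j => hu k hk j)
    fun k _ _ => Finset.prod_nonneg fun j _ => hg _

/-- The weight dominates each coordinate separately, hence also the geometric mean over coordinates.
This factorizes lattice sums into one-dimensional ones. -/
lemma exists_wt_rpow_le (hd : 1 ≤ d) (hab : ∀ i, a i < b i) {s : ℝ} (hs : 0 ≤ s) :
    ∃ C > 0, ∀ k : Fin d → ℤ, wt a b k ^ (-s) ≤ C * ∏ j, (1 + |(k j : ℝ)|) ^ (-(2 * s / d)) := by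
  obtain ⟨c, hc, h⟩ := exists_wt_lower hab
  have hd0 : (0 : ℝ) < d := by exact_mod_cast hd
  refine ⟨c ^ (-s), by positivity, fun k => ?_⟩
  have h1 : ∏ j : Fin d, (c * (1 + |(k j : ℝ)|) ^ 2) ^ (s / d) ≤ wt a b k ^ s := by
    calc _ ≤ ∏ _j : Fin d, wt a b k ^ (s / d) :=
          Finset.prod_le_prod (fun j _ => by positivity)
            fun j _ => Real.rpow_le_rpow (by positivity) (h k j) (by positivity)
      _ = _ := by
        rw [Finset.prod_const, Finset.card_univ, Fintype.card_fin, ← Real.rpow_natCast,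
          ← Real.rpow_mul (wt_pos k).le]
        congr 1; field_simp
  have h2 : ∏ j : Fin d, (c * (1 + |(k j : ℝ)|) ^ 2) ^ (s / d)
      = c ^ s * ∏ j, (1 + |(k j : ℝ)|) ^ (2 * s / d) := by
    have e : ∀ j, (c * (1 + |(k j : ℝ)|) ^ 2) ^ (s / d)
        = c ^ (s / d) * (1 + |(k j : ℝ)|) ^ (2 * s / d) := fun j => by
      rw [Real.mul_rpow hc.le (by positivity), ← Real.rpow_natCast, ← Real.rpow_mul (by positivity)]
      congr 2; push_cast; ring
    simp only [e, Finset.prod_mul_distrib, Finset.prod_const, Finset.card_univ, Fintype.card_fin]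
    rw [← Real.rpow_natCast, ← Real.rpow_mul hc.le]
    congr 2; field_simp
  rw [h2] at h1
  have hprod : 0 < ∏ j, (1 + |(k j : ℝ)|) ^ (2 * s / d) :=
    Finset.prod_pos fun j _ => by positivity
  have e3 : ∏ j, (1 + |(k j : ℝ)|) ^ (-(2 * s / d)) = (∏ j, (1 + |(k j : ℝ)|) ^ (2 * s / d))⁻¹ := by
    rw [← Finset.prod_inv_distrib]
    exact Finset.prod_congr rfl fun j _ => Real.rpow_neg (by positivity) _
  rw [e3, Real.rpow_neg (wt_pos k).le, Real.rpow_neg hc.le, ← mul_inv]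
  exact inv_anti₀ (by positivity) h1

lemma summable_one_add_abs_rpow {s : ℝ} (hs : 1 < s) :
    Summable fun n : ℤ => (1 + |(n : ℝ)|) ^ (-s) := by
  have h : Summable fun n : ℕ => (1 + (n : ℝ)) ^ (-s) := by
    have := (summable_nat_add_iff 1).2 (Real.summable_nat_rpow.2 (neg_lt_neg hs))
    refine this.congr fun n => ?_
    push_cast; rw [add_comm]
  refine Summable.of_nat_of_neg ?_ ?_ <;> simpa using h

/-- After factorization the one-dimensional exponent is 4/d, which exceeds 1 exactly for d ≤ 3. This
is the embedding of H² into L^∞ in disguise. -/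
lemma summable_wt_inv_sq (hd : 1 ≤ d) (hd3 : d ≤ 3) (hab : ∀ i, a i < b i) :
    Summable fun k => (wt a b k ^ 2)⁻¹ := by
  obtain ⟨C, hC, h⟩ := exists_wt_rpow_le hd hab (s := 2) (by norm_num)
  have hd0 : (0 : ℝ) < d := by exact_mod_cast hd
  have hd3' : (d : ℝ) ≤ 3 := by exact_mod_cast hd3
  have h1 : Summable fun n : ℤ => (1 + |(n : ℝ)|) ^ (-(2 * 2 / d : ℝ)) :=
    summable_one_add_abs_rpow (by rw [lt_div_iff₀ hd0]; linarith)
  refine summable_of_sum_le (c := C * (∑' n : ℤ, (1 + |(n : ℝ)|) ^ (-(2 * 2 / d : ℝ))) ^ d)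
    (fun k => by have := wt_pos (a := a) (b := b) k; positivity) fun u => ?_
  have e : ∀ k, (wt a b k ^ 2)⁻¹ = wt a b k ^ (-(2 : ℝ)) := fun k => by
    rw [Real.rpow_neg (wt_pos k).le]; norm_cast
  calc ∑ k ∈ u, (wt a b k ^ 2)⁻¹ ≤ ∑ k ∈ u, C * ∏ j, (1 + |(k j : ℝ)|) ^ (-(2 * 2 / d : ℝ)) :=
        Finset.sum_le_sum fun k _ => by rw [e]; exact h k
    _ = C * ∑ k ∈ u, ∏ j, (1 + |(k j : ℝ)|) ^ (-(2 * 2 / d : ℝ)) := by rw [Finset.mul_sum]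
    _ ≤ C * (∑ n ∈ u.biUnion (fun k => Finset.univ.image k),
          (1 + |(n : ℝ)|) ^ (-(2 * 2 / d : ℝ))) ^ d := by
        refine mul_le_mul_of_nonneg_left (sum_prod_le u _ (fun k hk j => ?_)
          (fun n : ℤ => (1 + |(n : ℝ)|) ^ (-(2 * 2 / d : ℝ))) fun n => by positivity) hC.le
        exact Finset.mem_biUnion.2 ⟨k, hk, Finset.mem_image_of_mem _ (Finset.mem_univ j)⟩
    _ ≤ _ := by
        gcongr
        exact h1.sum_le_tsum _ fun n _ => by positivity

/-- Telescoping: by Bernoulli's inequality for exponents in (0,1], each term is at most δ⁻¹ times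
the increment of x^δ. -/
lemma sum_range_rpow_le {δ : ℝ} (h0 : 0 < δ) (h1 : δ ≤ 1) (J : ℕ) :
    ∑ j ∈ Finset.range J, (1 + (j : ℝ)) ^ (δ - 1) ≤ δ⁻¹ * (J : ℝ) ^ δ := by
  induction J with
  | zero => simp [h0.ne']
  | succ J ih =>
    rw [Finset.sum_range_succ]
    have hJ : (0 : ℝ) < 1 + J := by positivity
    have h2 := rpow_one_add_le_one_add_mul_self (s := -(1 / (1 + J : ℝ)))
      (by rw [neg_le_neg_iff, div_le_one hJ]; linarith [(Nat.cast_nonneg J : (0 : ℝ) ≤ J)])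
      h0.le h1
    have h3 : (J : ℝ) ^ δ = (1 + J) ^ δ * (1 + -(1 / (1 + J : ℝ))) ^ δ := by
      rw [← Real.mul_rpow hJ.le]
      · congr 1; field_simp; ring
      · have : 1 / (1 + J : ℝ) ≤ 1 := by
          rw [div_le_one hJ]; linarith [(Nat.cast_nonneg J : (0 : ℝ) ≤ J)]
        linarith
    have h4 : (1 + (J : ℝ)) ^ (δ - 1) = (1 + J) ^ δ * (1 / (1 + J)) := by
      rw [Real.rpow_sub_one hJ.ne']; ring
    have h5 : δ * (1 + (J : ℝ)) ^ (δ - 1) ≤ (1 + J) ^ δ - (J : ℝ) ^ δ := by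
      rw [h3, h4]
      have := mul_le_mul_of_nonneg_left h2 (Real.rpow_nonneg hJ.le δ)
      nlinarith
    have h6 : (1 + (J : ℝ)) ^ (δ - 1) ≤ δ⁻¹ * ((1 + J) ^ δ - (J : ℝ) ^ δ) := by
      rw [← div_eq_inv_mul, le_div_iff₀' h0]; exact h5
    push_cast
    rw [add_comm (J : ℝ) 1]
    linarith

lemma sum_int_rpow_le {δ : ℝ} (h0 : 0 < δ) (h1 : δ ≤ 1) (J : ℕ) :
    ∑ n ∈ Finset.Ioo (-(J : ℤ)) J, (1 + |(n : ℝ)|) ^ (δ - 1) ≤ 2 * δ⁻¹ * (J : ℝ) ^ δ := by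
  have hsub : Finset.Ioo (-(J : ℤ)) J ⊆ (Finset.range J).image (fun j : ℕ => (j : ℤ))
      ∪ (Finset.range J).image (fun j : ℕ => -(j : ℤ)) := by
    intro n hn
    rw [Finset.mem_Ioo] at hn
    rw [Finset.mem_union, Finset.mem_image, Finset.mem_image]
    rcases le_total 0 n with h | h
    · exact Or.inl ⟨n.toNat, by rw [Finset.mem_range]; omega, by omega⟩
    · exact Or.inr ⟨(-n).toNat, by rw [Finset.mem_range]; omega, by omega⟩
  have hpos : ∀ n : ℤ, 0 ≤ (1 + |(n : ℝ)|) ^ (δ - 1) := fun n => by positivity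
  have e1 : ∑ n ∈ (Finset.range J).image (fun j : ℕ => (j : ℤ)), (1 + |(n : ℝ)|) ^ (δ - 1)
      = ∑ j ∈ Finset.range J, (1 + (j : ℝ)) ^ (δ - 1) := by
    rw [Finset.sum_image fun x _ y _ h => by simpa using h]
    simp
  have e2 : ∑ n ∈ (Finset.range J).image (fun j : ℕ => -(j : ℤ)), (1 + |(n : ℝ)|) ^ (δ - 1)
      = ∑ j ∈ Finset.range J, (1 + (j : ℝ)) ^ (δ - 1) := by
    rw [Finset.sum_image fun x _ y _ h => by simpa using h]
    simp
  have h2 := sum_range_rpow_le h0 h1 J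
  calc _ ≤ _ := Finset.sum_le_sum_of_subset_of_nonneg hsub fun n _ _ => hpos n
    _ ≤ _ := Finset.sum_union_inter (f := fun n : ℤ => (1 + |(n : ℝ)|) ^ (δ - 1)) ▸
        le_add_of_nonneg_right (Finset.sum_nonneg fun n _ => hpos n)
    _ = 2 * ∑ j ∈ Finset.range J, (1 + (j : ℝ)) ^ (δ - 1) := by rw [e1, e2]; ring
    _ ≤ _ := by linarith

lemma exists_sum_wt_inv_le (hd : 1 ≤ d) (hab : ∀ i, a i < b i) {ε : ℝ} (hε : 0 < ε)
    (hε1 : ε ≤ 1 / 2) (hdε : (d : ℝ) - 2 ≤ 2 * ε) :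
    ∃ C > 0, ∀ R > 0, ∑ k ∈ wtBall hab R, (wt a b k)⁻¹ ≤ C * R ^ ε := by
  obtain ⟨C, hC, h⟩ := exists_wt_rpow_le hd hab (s := 1) (by norm_num)
  obtain ⟨c, hc, hcw⟩ := exists_wt_lower hab
  have hd0 : (0 : ℝ) < d := by exact_mod_cast hd
  have hd1 : (1 : ℝ) ≤ d := by exact_mod_cast hd
  -- The exponent ε is spread evenly over the coordinates. The sum runs over |k_j| of order R^{1/2},
  -- each coordinate gives R^{δ/2}, and the d-th power is R^ε. The condition d − 2 ≤ 2ε says that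
  -- −2/d ≤ δ − 1.
  set δ : ℝ := 2 * ε / d with hδ
  have hδ0 : 0 < δ := by positivity
  have hδ1 : δ ≤ 1 := by rw [hδ, div_le_one hd0]; linarith
  have hδ2 : -(2 * 1 / d : ℝ) ≤ δ - 1 := by
    rw [hδ, neg_le_sub_iff_le_add, ← add_div, le_div_iff₀ hd0]; linarith
  refine ⟨C * (2 * δ⁻¹ * 2 ^ δ) ^ d * (c⁻¹) ^ ε, by positivity, fun R hR => ?_⟩
  set M : ℝ := (R / c) ^ (1 / 2 : ℝ) with hM
  have hM0 : 0 < M := by positivity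
  rcases (wtBall hab R).eq_empty_or_nonempty with he | ⟨k0, hk0⟩
  · rw [he]; simp; positivity
  have hkM : ∀ k ∈ wtBall hab R, ∀ j, 1 + |(k j : ℝ)| ≤ M := fun k hk j => by
    have h1 : (1 + |(k j : ℝ)|) ^ 2 ≤ R / c := by
      rw [le_div_iff₀' hc]; exact (hcw k j).trans ((mem_wtBall hab).1 hk)
    rw [hM, ← Real.sqrt_eq_rpow]
    exact Real.le_sqrt_of_sq_le h1
  have hM1 : 1 ≤ M := by
    have := hkM k0 hk0 ⟨0, hd⟩
    linarith [abs_nonneg (k0 ⟨0, hd⟩ : ℝ)]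
  have hJ : (⌈M⌉₊ : ℝ) ≤ 2 * M := by linarith [Nat.ceil_lt_add_one hM0.le]
  have hmem : ∀ k ∈ wtBall hab R, ∀ j, k j ∈ Finset.Ioo (-(⌈M⌉₊ : ℤ)) ⌈M⌉₊ := fun k hk j => by
    have h1 : |(k j : ℝ)| < (⌈M⌉₊ : ℝ) := by linarith [hkM k hk j, Nat.le_ceil M]
    have h2 : |k j| < (⌈M⌉₊ : ℤ) := by exact_mod_cast h1
    rw [Finset.mem_Ioo]; exact abs_lt.1 h2
  calc ∑ k ∈ wtBall hab R, (wt a b k)⁻¹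
      ≤ ∑ k ∈ wtBall hab R, C * ∏ j, (1 + |(k j : ℝ)|) ^ (δ - 1) := by
        refine Finset.sum_le_sum fun k _ => ?_
        rw [← Real.rpow_neg_one]
        refine (h k).trans (mul_le_mul_of_nonneg_left ?_ hC.le)
        refine Finset.prod_le_prod (fun j _ => by positivity) fun j _ => ?_
        exact Real.rpow_le_rpow_of_exponent_le (by linarith [abs_nonneg (k j : ℝ)]) hδ2
    _ = C * ∑ k ∈ wtBall hab R, ∏ j, (1 + |(k j : ℝ)|) ^ (δ - 1) := by rw [Finset.mul_sum]
    _ ≤ C * (∑ n ∈ Finset.Ioo (-(⌈M⌉₊ : ℤ)) ⌈M⌉₊, (1 + |(n : ℝ)|) ^ (δ - 1)) ^ d :=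
        mul_le_mul_of_nonneg_left (sum_prod_le _ _ hmem
          (fun n : ℤ => (1 + |(n : ℝ)|) ^ (δ - 1)) fun n => by positivity) hC.le
    _ ≤ C * (2 * δ⁻¹ * (2 * M) ^ δ) ^ d := by
        gcongr
        refine (sum_int_rpow_le hδ0 hδ1 _).trans ?_
        gcongr
    _ = _ := by
        rw [Real.mul_rpow (by norm_num) hM0.le, ← mul_assoc, mul_pow _ (M ^ δ) d,
          ← Real.rpow_natCast (M ^ δ), ← Real.rpow_mul hM0.le, hM,
          ← Real.rpow_mul (by positivity)]
        have : 1 / 2 * (δ * d) = ε := by rw [hδ]; field_simp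
        rw [this, div_eq_mul_inv, Real.mul_rpow hR.le (by positivity)]
        ring

/-! ### Sobolev embeddings -/

/-- Cauchy–Schwarz with the weight split as inverse square root times square root. The sum on the
left bounds the supremum of a trigonometric polynomial. -/
lemma sum_norm_le_sqrt {S : Finset (Fin d → ℤ)} {s : ℕ} {c : (Fin d → ℤ) → ℂ} {W H : ℝ}
    (hW : ∑ k ∈ S, (wt a b k ^ s)⁻¹ ≤ W) (hH : ∑ k ∈ S, wt a b k ^ s * ‖c k‖ ^ 2 ≤ H) :
    ∑ k ∈ S, ‖c k‖ ≤ √W * √H := by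
  have h := Finset.sum_mul_sq_le_sq_mul_sq S (fun k => √(wt a b k ^ s)⁻¹)
    (fun k => √(wt a b k ^ s) * ‖c k‖)
  have hp : ∀ k, 0 < wt a b k ^ s := fun k => pow_pos (wt_pos k) s
  have e1 : ∀ k, √(wt a b k ^ s)⁻¹ * (√(wt a b k ^ s) * ‖c k‖) = ‖c k‖ := fun k => by
    rw [Real.sqrt_inv, inv_mul_cancel_left₀ (Real.sqrt_pos.2 (hp k)).ne']
  have e2 : ∀ k, √(wt a b k ^ s)⁻¹ ^ 2 = (wt a b k ^ s)⁻¹ := fun k =>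
    Real.sq_sqrt (inv_pos.2 (hp k)).le
  have e3 : ∀ k, (√(wt a b k ^ s) * ‖c k‖) ^ 2 = wt a b k ^ s * ‖c k‖ ^ 2 := fun k => by
    rw [mul_pow, Real.sq_sqrt (hp k).le]
  simp only [e1, e2, e3] at h
  have hW0 : 0 ≤ W := le_trans (Finset.sum_nonneg fun k _ => (inv_pos.2 (hp k)).le) hW
  rw [← Real.sqrt_mul hW0]
  refine Real.le_sqrt_of_sq_le (h.trans (mul_le_mul hW hH ?_ hW0))
  exact Finset.sum_nonneg fun k _ => hs_term_nonneg s c k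

lemma ofReal_tsum_ite (hab : ∀ i, a i < b i) {v : Sp d → ℂ} (hv : MemLp v 2 (boxMeasure a b))
    (S : Finset (Fin d → ℤ)) [DecidablePred (· ∈ S)] :
    ∫⁻ x, ENNReal.ofReal (‖v x - trig a b S (fc a b v) x‖ ^ 2) ∂(boxMeasure a b)
      = ∑' k, ENNReal.ofReal (boxVol a b * if k ∈ S then 0 else ‖fc a b v k‖ ^ 2) := by
  have hr := hv.sub (memLp_trig hab S (fc a b v) (p := 2))
  have h1 := hasSum_sq_fc hab hr
  have h2 := h1.mul_left (boxVol a b)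
  rw [mul_inv_cancel_left₀ (boxVol_pos hab).ne'] at h2
  have e : ∀ k, ‖fc a b (v - trig a b S (fc a b v)) k‖ ^ 2
      = if k ∈ S then 0 else ‖fc a b v k‖ ^ 2 := fun k => by
    rw [fc_sub hab hv (memLp_trig hab S _), fc_trig hab, Pi.sub_apply]
    by_cases hk : k ∈ S <;> simp [hk]
  simp only [e] at h2
  rw [← ENNReal.ofReal_tsum_of_nonneg _ h2.summable, h2.tsum_eq,
    ofReal_integral_eq_lintegral_ofReal]
  · rfl
  · exact hr.integrable_norm_pow (by norm_num)
  · exact Eventually.of_forall fun x => by positivity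
  · intro k
    have := (boxVol_pos hab).le
    split_ifs <;> positivity

/-- Splitting into low and high frequencies: where |v| exceeds M + δ the high part exceeds δ, and
Chebyshev with Parseval bounds that set. Both embeddings below follow by choosing S. -/
lemma meas_lt_norm_le (hab : ∀ i, a i < b i) {v : Sp d → ℂ} (hv : MemLp v 2 (boxMeasure a b))
    (S : Finset (Fin d → ℤ)) [DecidablePred (· ∈ S)] {M δ : ℝ} (hδ : 0 < δ)
    (hM : ∑ k ∈ S, ‖fc a b v k‖ ≤ M) :
    boxMeasure a b {x | M + δ < ‖v x‖} ≤
      ∑' k, ENNReal.ofReal ((δ ^ 2)⁻¹ * (boxVol a b * if k ∈ S then 0 else ‖fc a b v k‖ ^ 2)) := by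
  have hr := hv.sub (memLp_trig hab S (fc a b v) (p := 2))
  have h0 : (ENNReal.ofReal (δ ^ 2)) ≠ 0 := by simpa using hδ.ne'
  have h1 := meas_ge_le_lintegral_div (μ := boxMeasure a b)
    (f := fun x => ENNReal.ofReal (‖v x - trig a b S (fc a b v) x‖ ^ 2))
    (hr.1.norm.aemeasurable.pow_const 2).ennreal_ofReal h0 ENNReal.ofReal_ne_top
  refine (measure_mono ?_).trans (h1.trans_eq ?_)
  · intro x hx
    rw [Set.mem_ofPred_eq] at hx ⊢
    refine ENNReal.ofReal_le_ofReal (pow_le_pow_left₀ hδ.le ?_ 2)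
    have h2 := (norm_trig_le (a := a) (b := b) S (fc a b v) x).trans hM
    have h3 := norm_sub_norm_le (v x) (trig a b S (fc a b v) x)
    linarith
  · rw [ofReal_tsum_ite hab hv, ENNReal.div_eq_inv_mul, ← ENNReal.ofReal_inv_of_pos (by positivity),
      ← ENNReal.tsum_mul_left]
    refine tsum_congr fun k => ?_
    rw [← ENNReal.ofReal_mul (by positivity)]

lemma exists_sup_bound (hd : 1 ≤ d) (hd3 : d ≤ 3) (hab : ∀ i, a i < b i) :
    ∃ C > 0, ∀ (c : (Fin d → ℤ) → ℂ) (S : Finset (Fin d → ℤ)), Hmem a b 2 c →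
      ∑ k ∈ S, ‖c k‖ ≤ C * √(hs a b 2 c) := by
  have h := summable_wt_inv_sq hd hd3 hab
  refine ⟨√(∑' k, (wt a b k ^ 2)⁻¹) + 1, by positivity, fun c S hc => ?_⟩
  refine (sum_norm_le_sqrt (h.sum_le_tsum S fun k _ => ?_) (hc.sum_le S)).trans ?_
  · exact (inv_pos.2 (pow_pos (wt_pos k) 2)).le
  · gcongr; linarith

/-- `H² ⊆ L^∞`. -/
lemma exists_ae_bound (hd : 1 ≤ d) (hd3 : d ≤ 3) (hab : ∀ i, a i < b i) :
    ∃ C > 0, ∀ v : Sp d → ℂ, MemLp v 2 (boxMeasure a b) → Hmem a b 2 (fc a b v) →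
      ∀ᵐ x ∂(boxMeasure a b), ‖v x‖ ≤ C * √(hs a b 2 (fc a b v)) := by
  classical
  obtain ⟨C, hC, h⟩ := exists_sup_bound hd hd3 hab
  refine ⟨C, hC, fun v hv hm => ?_⟩
  set M := C * √(hs a b 2 (fc a b v))
  -- The supremum bound on partial sums holds for every S, while the tail on the right tends to zero
  -- as S grows.
  have key : ∀ n : ℕ, boxMeasure a b {x | M + 1 / ((n : ℝ) + 1) < ‖v x‖} = 0 := by
    intro n
    set δ : ℝ := 1 / ((n : ℝ) + 1)
    have hδ : 0 < δ := by positivity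
    refine nonpos_iff_eq_zero.1 (le_of_forall_pos_le_add fun ε hε => ?_)
    have hsum : Summable fun k => (δ ^ 2)⁻¹ * (boxVol a b * ‖fc a b v k‖ ^ 2) :=
      ((hasSum_sq_fc hab hv).summable.mul_left _).mul_left _
    have htop : ∑' k, ENNReal.ofReal ((δ ^ 2)⁻¹ * (boxVol a b * ‖fc a b v k‖ ^ 2)) ≠ ∞ := by
      rw [← ENNReal.ofReal_tsum_of_nonneg _ hsum]
      · exact ENNReal.ofReal_ne_top
      · intro k; have := (boxVol_pos hab).le; positivity
    have ht := ENNReal.tendsto_tsum_compl_atTop_zero htop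
    obtain ⟨S, hS⟩ := ((ENNReal.tendsto_nhds_zero.1 ht) ε hε).exists
    rw [zero_add]
    refine (meas_lt_norm_le hab hv S hδ (h _ S hm)).trans (le_trans (le_of_eq ?_) hS)
    rw [← tsum_subtype_eq_of_support_subset (s := {k | k ∉ S})]
    · exact tsum_congr fun ⟨k, hk⟩ => by rw [if_neg hk]
    · intro k hk
      by_contra hk'
      simp only [Set.mem_ofPred_eq, not_not] at hk'
      simp [hk'] at hk
  have h2 : ∀ᵐ x ∂(boxMeasure a b), ∀ n : ℕ, ‖v x‖ ≤ M + 1 / ((n : ℝ) + 1) := by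
    rw [ae_all_iff]
    intro n
    rw [ae_iff]
    simpa only [not_le] using key n
  filter_upwards [h2] with x hx
  have ht : Tendsto (fun n : ℕ => M + 1 / ((n : ℝ) + 1)) atTop (𝓝 (M + 0)) :=
    tendsto_const_nhds.add tendsto_one_div_add_atTop_nhds_zero_nat
  rw [add_zero] at ht
  exact ge_of_tendsto' ht hx

/-- `H¹ ⊆ L^q` for `6 ≤ q < ∞`, with `q = 6` in dimension three. -/
lemma exists_sobolev_bound (hd : 1 ≤ d) (hab : ∀ i, a i < b i) {q : ℕ} (hq : 6 ≤ q)
    (hdq : d ≤ 2 ∨ d = 3 ∧ q = 6) :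
    ∃ C > 0, ∀ (v : Sp d → ℂ) (A : ℝ), 0 < A → MemLp v 2 (boxMeasure a b) →
      Hmem a b 1 (fc a b v) → hs a b 1 (fc a b v) ≤ A ^ 2 →
      ∫⁻ x, ENNReal.ofReal (‖v x‖ ^ q) ∂(boxMeasure a b) ≤ ENNReal.ofReal (C * A ^ q) := by
  classical
  have hq' : (6 : ℝ) ≤ q := by exact_mod_cast hq
  have hq2 : (0 : ℝ) < (q : ℝ) - 2 := by linarith
  -- With this ε the cut-off R below satisfies R^ε = (ℓ/B)². For d = 3 and q = 6 it is the endpoint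
  -- ε = 1/2 of the lattice sum.
  obtain ⟨C₀, hC₀, hW⟩ := exists_sum_wt_inv_le hd hab (ε := 2 / ((q : ℝ) - 2)) (by positivity)
    (by rw [div_le_iff₀ hq2]; linarith) (by
      rcases hdq with h | ⟨h, h'⟩
      · have : (d : ℝ) ≤ 2 := by exact_mod_cast h
        have : 0 < 2 * (2 / ((q : ℝ) - 2)) := by positivity
        linarith
      · rw [h, h']; norm_num)
  have hV := boxVol_pos hab
  refine ⟨q * (4 * boxVol a b * (2 * √C₀) ^ (q - 2)), by positivity, fun v A hA hv hm hsA => ?_⟩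
  have hC' : 0 < √C₀ := Real.sqrt_pos.2 hC₀
  -- The frequency cut-off R = (ℓ/B)^{q−2} depends on the level ℓ. The factor 2√C₀·A makes the low
  -- part at most ℓ/2. A frequency k is beyond the cut-off exactly for ℓ < L k, so exchanging sum
  -- and integral leaves an integral over (0, L k) for each k.
  set B : ℝ := 2 * √C₀ * A with hB
  have hB0 : 0 < B := by positivity
  set L : (Fin d → ℤ) → ℝ := fun k => B * wt a b k ^ (1 / ((q : ℝ) - 2)) with hL
  have hL0 : ∀ k, 0 < L k := fun k => by have := wt_pos (a := a) (b := b) k; positivity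
  have hLpow : ∀ k, L k ^ (q - 2) = B ^ (q - 2) * wt a b k := fun k => by
    rw [hL, mul_pow, ← Real.rpow_natCast (wt a b k ^ _), ← Real.rpow_mul (wt_pos k).le,
      Nat.cast_sub (by omega)]
    rw [Nat.cast_ofNat, one_div, inv_mul_cancel₀ hq2.ne', Real.rpow_one]
  have hpt : ∀ ℓ ∈ Set.Ioi (0 : ℝ), boxMeasure a b {x | ℓ < ‖v x‖} * ENNReal.ofReal (ℓ ^ ((q : ℝ) - 1))
      ≤ ∑' k, (Set.Iio (L k)).indicator (fun ℓ => ENNReal.ofReal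
        (4 * boxVol a b * ‖fc a b v k‖ ^ 2 * ℓ ^ (q - 3))) ℓ := by
    intro ℓ hℓ
    have hℓ0 : 0 < ℓ := hℓ
    set R : ℝ := (ℓ / B) ^ (q - 2) with hR
    have hR0 : 0 < R := by positivity
    have h1 : ∑ k ∈ wtBall hab R, ‖fc a b v k‖ ≤ ℓ / 2 := by
      refine (sum_norm_le_sqrt (a := a) (b := b) (s := 1) (W := C₀ * R ^ (2 / ((q : ℝ) - 2)))
        (H := A ^ 2) (by simpa using hW R hR0) ((hm.sum_le _).trans hsA)).trans (le_of_eq ?_)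
      have e1 : R ^ (2 / ((q : ℝ) - 2)) = (ℓ / B) ^ 2 := by
        rw [hR, ← Real.rpow_natCast, ← Real.rpow_mul (by positivity), Nat.cast_sub (by omega)]
        norm_num
        rw [mul_div_cancel₀ _ hq2.ne']
        norm_cast
      rw [e1, Real.sqrt_mul hC₀.le, Real.sqrt_sq (by positivity), Real.sqrt_sq hA.le, hB]
      field_simp
    have h2 := meas_lt_norm_le hab hv (wtBall hab R) (δ := ℓ / 2) (by positivity) h1
    rw [add_halves] at h2
    refine (mul_le_mul_left h2 _).trans ?_
    rw [← ENNReal.tsum_mul_right]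
    refine ENNReal.tsum_le_tsum fun k => ?_
    by_cases hk : k ∈ wtBall hab R
    · simp [hk]
    · have hk' : ℓ < L k := by
        rw [mem_wtBall, not_le] at hk
        have : ℓ ^ (q - 2) < L k ^ (q - 2) := by
          rw [hLpow]
          rw [hR, div_pow, div_lt_iff₀' (by positivity)] at hk
          exact hk
        exact lt_of_pow_lt_pow_left₀ _ (hL0 k).le this
      rw [Set.indicator_of_mem (show ℓ ∈ Set.Iio (L k) from hk'), if_neg hk,
        ← ENNReal.ofReal_mul (by positivity)]
      refine ENNReal.ofReal_le_ofReal (le_of_eq ?_)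
      have e2 : ℓ ^ ((q : ℝ) - 1) = ℓ ^ (q - 3) * ℓ ^ 2 := by
        rw [← pow_add, ← Real.rpow_natCast]
        congr 1
        rw [show q - 3 + 2 = q - 1 by omega, Nat.cast_sub (by omega)]
        norm_num
      rw [e2]
      field_simp
      ring
  have hlc := lintegral_rpow_eq_lintegral_meas_lt_mul (boxMeasure a b) (f := fun x => ‖v x‖)
    (Eventually.of_forall fun x => norm_nonneg _) hv.1.norm.aemeasurable
    (p := q) (by linarith)
  simp only [Real.rpow_natCast] at hlc
  rw [hlc]
  have hint : ∀ k, ∫⁻ ℓ in Set.Ioi (0 : ℝ), (Set.Iio (L k)).indicator (fun ℓ => ENNReal.ofReal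
        (4 * boxVol a b * ‖fc a b v k‖ ^ 2 * ℓ ^ (q - 3))) ℓ
      ≤ ENNReal.ofReal (4 * boxVol a b * B ^ (q - 2) * (wt a b k ^ 1 * ‖fc a b v k‖ ^ 2)) := by
    intro k
    rw [setLIntegral_indicator measurableSet_Iio]
    have hset : Set.Iio (L k) ∩ Set.Ioi 0 = Set.Ioo 0 (L k) := by ext; simp [and_comm]
    rw [hset]
    -- Length of the interval times the largest value of the integrand: this gives L k ^ (q−2),
    -- which is linear in the weight.
    calc _ ≤ ∫⁻ _ in Set.Ioo 0 (L k), ENNReal.ofReal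
          (4 * boxVol a b * ‖fc a b v k‖ ^ 2 * L k ^ (q - 3)) := by
          refine setLIntegral_mono measurable_const fun ℓ hℓ => ENNReal.ofReal_le_ofReal ?_
          have := hℓ.1.le
          have := hℓ.2.le
          gcongr
      _ = _ := by
          rw [setLIntegral_const, Real.volume_Ioo, sub_zero, ← ENNReal.ofReal_mul (by
            have := hL0 k; positivity)]
          congr 1
          have : L k ^ (q - 3) * L k = B ^ (q - 2) * wt a b k := by
            rw [← hLpow, ← pow_succ]; congr 1; omega
          rw [mul_assoc, this]; ring
  calc _ ≤ ENNReal.ofReal q * ∫⁻ ℓ in Set.Ioi (0 : ℝ), ∑' k, (Set.Iio (L k)).indicator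
        (fun ℓ => ENNReal.ofReal (4 * boxVol a b * ‖fc a b v k‖ ^ 2 * ℓ ^ (q - 3))) ℓ :=
        mul_le_mul_right (setLIntegral_mono' measurableSet_Ioi hpt) _
    _ = ENNReal.ofReal q * ∑' k, ∫⁻ ℓ in Set.Ioi (0 : ℝ), (Set.Iio (L k)).indicator
        (fun ℓ => ENNReal.ofReal (4 * boxVol a b * ‖fc a b v k‖ ^ 2 * ℓ ^ (q - 3))) ℓ := by
        rw [lintegral_tsum fun k => ?_]
        refine (Measurable.indicator ?_ measurableSet_Iio).aemeasurable
        fun_prop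
    _ ≤ ENNReal.ofReal q * ∑' k,
        ENNReal.ofReal (4 * boxVol a b * B ^ (q - 2) * (wt a b k ^ 1 * ‖fc a b v k‖ ^ 2)) :=
        mul_le_mul_right (ENNReal.tsum_le_tsum hint) _
    _ = ENNReal.ofReal (q * (4 * boxVol a b * B ^ (q - 2) * hs a b 1 (fc a b v))) := by
        rw [← ENNReal.ofReal_tsum_of_nonneg _ (hm.mul_left _), tsum_mul_left, hs,
          ← ENNReal.ofReal_mul (by positivity)]
        intro k
        have := hs_term_nonneg (a := a) (b := b) 1 (fc a b v) k
        positivity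
    _ ≤ _ := by
        refine ENNReal.ofReal_le_ofReal ?_
        calc _ ≤ (q : ℝ) * (4 * boxVol a b * B ^ (q - 2) * A ^ 2) := by gcongr
          _ = _ := by
            have : A ^ q = A ^ (q - 2) * A ^ 2 := by rw [← pow_add]; congr 1; omega
            rw [this, hB]; ring

/-! ### Weighted estimates -/

lemma exists_integral_pow_le (hd : 1 ≤ d) (hab : ∀ i, a i < b i) {q : ℕ} (hq : 6 ≤ q)
    (hdq : d ≤ 2 ∨ d = 3 ∧ q = 6) :
    ∃ C > 0, ∀ (v : Sp d → ℂ) (A : ℝ), 0 < A → MemLp v 2 (boxMeasure a b) →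
      Hmem a b 1 (fc a b v) → hs a b 1 (fc a b v) ≤ A ^ 2 →
      Integrable (fun x => ‖v x‖ ^ q) (boxMeasure a b) ∧
        ∫ x, ‖v x‖ ^ q ∂(boxMeasure a b) ≤ C * A ^ q := by
  obtain ⟨C, hC, h⟩ := exists_sobolev_bound hd hab hq hdq
  refine ⟨C, hC, fun v A hA hv hm hle => ?_⟩
  have h1 := h v A hA hv hm hle
  have hmeas : AEStronglyMeasurable (fun x => ‖v x‖ ^ q) (boxMeasure a b) := hv.1.norm.pow q
  have hnn : 0 ≤ᵐ[boxMeasure a b] fun x => ‖v x‖ ^ q := Eventually.of_forall fun x => by positivity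
  have hint : Integrable (fun x => ‖v x‖ ^ q) (boxMeasure a b) :=
    (lintegral_ofReal_ne_top_iff_integrable hmeas hnn).1 (h1.trans_lt ENNReal.ofReal_lt_top).ne
  refine ⟨hint, ?_⟩
  rw [← ENNReal.ofReal_le_ofReal_iff (by positivity), ofReal_integral_eq_lintegral_ofReal hint hnn]
  exact h1

/-- Young's inequality with exponents 3/2 and 3, without constants, by comparing x^n with y². -/
lemma pow_mul_sq_le {x : ℝ} (hx : 0 ≤ x) (y : ℝ) (n : ℕ) :
    x ^ (2 * n) * y ^ 2 ≤ x ^ (3 * n) + y ^ 6 := by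
  have hX : 0 ≤ x ^ n := by positivity
  have e1 : x ^ (2 * n) = (x ^ n) ^ 2 := by ring
  have e2 : x ^ (3 * n) = (x ^ n) ^ 3 := by ring
  have e3 : y ^ 6 = (y ^ 2) ^ 3 := by ring
  have hY : 0 ≤ y ^ 2 := by positivity
  rw [e1, e2, e3]
  rcases le_total (x ^ n) (y ^ 2) with h | h
  · nlinarith [pow_le_pow_left₀ hX h 2, pow_nonneg hX 3]
  · nlinarith [mul_le_mul_of_nonneg_left h (sq_nonneg (x ^ n)), pow_nonneg hY 3]

/-- The exponents that the growth condition allows after rounding up. -/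
def AdmissibleExponent (d n : ℕ) : Prop := 2 ≤ n ∧ (d ≤ 2 ∨ d = 3 ∧ n = 2)

/-- Hölder between L^{3n} and L^6, obtained from Young's inequality after dividing each function by
the bound for its H¹ norm. For d = 3 and n = 2 both exponents equal 6, the critical one. -/
lemma exists_integral_pow_mul_sq_le (hd : 1 ≤ d) (hab : ∀ i, a i < b i) {n : ℕ}
    (hn : AdmissibleExponent d n) :
    ∃ C > 0, ∀ (s c : Sp d → ℂ) (τ : ℝ), 0 < τ →
      MemLp s 2 (boxMeasure a b) → Hmem a b 1 (fc a b s) → hs a b 1 (fc a b s) ≤ τ ^ 2 →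
      MemLp c 2 (boxMeasure a b) → Hmem a b 1 (fc a b c) →
      Integrable (fun x => ‖s x‖ ^ (2 * n) * ‖c x‖ ^ 2) (boxMeasure a b) ∧
        ∫ x, ‖s x‖ ^ (2 * n) * ‖c x‖ ^ 2 ∂(boxMeasure a b)
          ≤ C * τ ^ (2 * n) * hs a b 1 (fc a b c) := by
  obtain ⟨hn2, hdn⟩ := hn
  obtain ⟨C₁, hC₁, h1⟩ := exists_integral_pow_le hd hab (q := 3 * n) (by omega) (by omega)
  obtain ⟨C₂, hC₂, h2⟩ := exists_integral_pow_le hd hab (q := 6) le_rfl (by omega)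
  refine ⟨C₁ + C₂, by positivity, fun s c τ hτ hs1 hs2 hs3 hc1 hc2 => ?_⟩
  have key : ∀ D : ℝ, 0 < D → hs a b 1 (fc a b c) ≤ D ^ 2 →
      Integrable (fun x => ‖s x‖ ^ (2 * n) * ‖c x‖ ^ 2) (boxMeasure a b) ∧
        ∫ x, ‖s x‖ ^ (2 * n) * ‖c x‖ ^ 2 ∂(boxMeasure a b)
          ≤ (C₁ + C₂) * τ ^ (2 * n) * D ^ 2 := by
    intro D hD hle
    obtain ⟨i1, j1⟩ := h1 s τ hτ hs1 hs2 hs3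
    obtain ⟨i2, j2⟩ := h2 c D hD hc1 hc2 hle
    have hpt : ∀ x, ‖s x‖ ^ (2 * n) * ‖c x‖ ^ 2 ≤ τ ^ (2 * n) * D ^ 2 *
        ((τ ^ (3 * n))⁻¹ * ‖s x‖ ^ (3 * n) + (D ^ 6)⁻¹ * ‖c x‖ ^ 6) := fun x => by
      have := pow_mul_sq_le (x := ‖s x‖ / τ) (by positivity) (‖c x‖ / D) n
      calc _ = τ ^ (2 * n) * D ^ 2 * ((‖s x‖ / τ) ^ (2 * n) * (‖c x‖ / D) ^ 2) := by
            rw [div_pow, div_pow]; field_simp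
        _ ≤ τ ^ (2 * n) * D ^ 2 * ((‖s x‖ / τ) ^ (3 * n) + (‖c x‖ / D) ^ 6) := by gcongr
        _ = _ := by simp only [div_pow]; ring
    have hdom : Integrable (fun x => τ ^ (2 * n) * D ^ 2 *
        ((τ ^ (3 * n))⁻¹ * ‖s x‖ ^ (3 * n) + (D ^ 6)⁻¹ * ‖c x‖ ^ 6)) (boxMeasure a b) :=
      ((i1.const_mul _).add (i2.const_mul _)).const_mul _
    have hint : Integrable (fun x => ‖s x‖ ^ (2 * n) * ‖c x‖ ^ 2) (boxMeasure a b) :=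
      hdom.mono' ((hs1.1.norm.pow _).mul (hc1.1.norm.pow _)) (Eventually.of_forall fun x => by
        rw [Real.norm_of_nonneg (by positivity)]; exact hpt x)
    refine ⟨hint, (integral_mono hint hdom hpt).trans ?_⟩
    rw [integral_const_mul, integral_add (i1.const_mul _) (i2.const_mul _), integral_const_mul,
      integral_const_mul]
    calc _ ≤ τ ^ (2 * n) * D ^ 2 * ((τ ^ (3 * n))⁻¹ * (C₁ * τ ^ (3 * n))
          + (D ^ 6)⁻¹ * (C₂ * D ^ 6)) := by gcongr
      _ = _ := by field_simp
  have h0 := hs_nonneg (a := a) (b := b) 1 (fc a b c)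
  refine ⟨(key (√(hs a b 1 (fc a b c) + 1)) (by positivity)
    (by rw [Real.sq_sqrt (by positivity)]; linarith)).1, ?_⟩
  -- The normalization needs a positive D while the norm of c may vanish, so D² exceeds it by an
  -- arbitrarily small amount.
  refine le_of_forall_pos_le_add fun ε hε => ?_
  have hK : 0 < (C₁ + C₂) * τ ^ (2 * n) := by positivity
  have := (key (√(hs a b 1 (fc a b c) + ε / ((C₁ + C₂) * τ ^ (2 * n)))) (by positivity)
    (by rw [Real.sq_sqrt (by positivity)]; linarith [div_pos hε hK])).2
  rw [Real.sq_sqrt (by positivity), mul_add, mul_div_cancel₀ _ hK.ne'] at this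
  exact this

/-- `g` is bounded by `B`, up to an error of size `τ` in `H¹`. -/
def GradCtrl (a b : Fin d → ℝ) (B τ : ℝ) (g : Fin d → Sp d → ℂ) : Prop :=
  (∀ i, AEStronglyMeasurable (g i) (boxMeasure a b)) ∧ ∃ s : Fin d → Sp d → ℂ,
    (∀ i, MemLp (s i) 2 (boxMeasure a b) ∧ Hmem a b 1 (fc a b (s i)) ∧
      hs a b 1 (fc a b (s i)) ≤ τ ^ 2) ∧
    ∀ i, ∀ᵐ x ∂(boxMeasure a b), ‖g i x‖ ≤ B + ‖s i x‖

/-- The bounded part of the weight costs only the L² norm of c; the H¹ part costs the H¹ norm but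
carries the factor τ^{2n}. That C depends on neither B nor τ is what makes absorption possible
later. -/
lemma exists_weighted_le (hd : 1 ≤ d) (hab : ∀ i, a i < b i) {n : ℕ}
    (hn : AdmissibleExponent d n) :
    ∃ C > 0, ∀ (B τ : ℝ) (g : Fin d → Sp d → ℂ) (c : Sp d → ℂ), 0 ≤ B → 0 < τ →
      GradCtrl a b B τ g → MemLp c 2 (boxMeasure a b) → Hmem a b 1 (fc a b c) →
      Integrable (fun x => (1 + ∑ i, ‖g i x‖ ^ n) ^ 2 * ‖c x‖ ^ 2) (boxMeasure a b) ∧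
        ∫ x, (1 + ∑ i, ‖g i x‖ ^ n) ^ 2 * ‖c x‖ ^ 2 ∂(boxMeasure a b)
          ≤ C * ((1 + B ^ (2 * n)) * hs a b 0 (fc a b c)
            + τ ^ (2 * n) * hs a b 1 (fc a b c)) := by
  obtain ⟨C₁, hC₁, h1⟩ := exists_integral_pow_mul_sq_le hd hab hn
  have hV := boxVol_pos hab
  set E : ℝ := (d + 1) * 2 ^ (2 * n) * d with hE
  have hE0 : 0 ≤ E := by positivity
  refine ⟨(d + 1) * boxVol a b + E * boxVol a b + E * C₁, by positivity,
    fun B τ g c hB hτ ⟨hgm, s, hsi, hgs⟩ hc hcm => ?_⟩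
  have hpt : ∀ᵐ x ∂(boxMeasure a b), (1 + ∑ i, ‖g i x‖ ^ n) ^ 2 * ‖c x‖ ^ 2
      ≤ (d + 1) * ‖c x‖ ^ 2 + (d + 1) * 2 ^ (2 * n) *
        ∑ i, (B ^ (2 * n) * ‖c x‖ ^ 2 + ‖s i x‖ ^ (2 * n) * ‖c x‖ ^ 2) := by
    filter_upwards [ae_all_iff.2 hgs] with x hx
    have e1 : (1 + ∑ i, ‖g i x‖ ^ n) ^ 2 ≤ (d + 1) * (1 + ∑ i, ‖g i x‖ ^ (2 * n)) := by
      have := sq_sum_le_card_mul_sum_sq (s := (Finset.univ : Finset (Option (Fin d))))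
        (f := fun o => o.elim (1 : ℝ) fun i => ‖g i x‖ ^ n)
      simp only [Fintype.sum_option, Option.elim, Finset.card_univ, Fintype.card_option,
        Fintype.card_fin, one_pow, ← pow_mul, mul_comm n 2] at this
      exact_mod_cast this
    have e2 : ∀ i, ‖g i x‖ ^ (2 * n) ≤ 2 ^ (2 * n) * (B ^ (2 * n) + ‖s i x‖ ^ (2 * n)) := by
      intro i
      calc ‖g i x‖ ^ (2 * n) ≤ (B + ‖s i x‖) ^ (2 * n) :=
            pow_le_pow_left₀ (norm_nonneg _) (hx i) _
        _ ≤ 2 ^ (2 * n - 1) * (B ^ (2 * n) + ‖s i x‖ ^ (2 * n)) :=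
            add_pow_le hB (norm_nonneg _) _
        _ ≤ _ := by
          gcongr
          · norm_num
          · omega
    calc _ ≤ ((d + 1) * (1 + ∑ i, 2 ^ (2 * n) * (B ^ (2 * n) + ‖s i x‖ ^ (2 * n)))) * ‖c x‖ ^ 2 := by
          refine mul_le_mul_of_nonneg_right (e1.trans ?_) (sq_nonneg _)
          gcongr with i
          exact e2 i
      _ = _ := by
        simp only [← add_mul]
        rw [← Finset.sum_mul, ← Finset.mul_sum]
        ring
  have hc2 := hc.integrable_norm_pow (p := 2) (by norm_num)
  have hk : ∀ i, _ := fun i => h1 (s i) c τ hτ (hsi i).1 (hsi i).2.1 (hsi i).2.2 hc hcm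
  have hI : ∀ i, Integrable (fun x => B ^ (2 * n) * ‖c x‖ ^ 2 + ‖s i x‖ ^ (2 * n) * ‖c x‖ ^ 2)
      (boxMeasure a b) := fun i => (hc2.const_mul _).add (hk i).1
  have hI2 : Integrable (fun x => ∑ i, (B ^ (2 * n) * ‖c x‖ ^ 2 + ‖s i x‖ ^ (2 * n) * ‖c x‖ ^ 2))
      (boxMeasure a b) := integrable_finsetSum _ fun i _ => hI i
  have hdom := (hc2.const_mul ((d : ℝ) + 1)).add (hI2.const_mul ((d + 1) * 2 ^ (2 * n)))
  have hmeas : AEStronglyMeasurable (fun x => (1 + ∑ i, ‖g i x‖ ^ n) ^ 2 * ‖c x‖ ^ 2)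
      (boxMeasure a b) := by
    refine ((aestronglyMeasurable_const.add ?_).pow 2).mul (hc.1.norm.pow 2)
    exact Finset.aestronglyMeasurable_fun_sum _ fun i _ => (hgm i).norm.pow n
  have hint : Integrable (fun x => (1 + ∑ i, ‖g i x‖ ^ n) ^ 2 * ‖c x‖ ^ 2) (boxMeasure a b) :=
    hdom.mono' hmeas (by
      filter_upwards [hpt] with x hx
      rw [Real.norm_of_nonneg (by positivity)]; exact hx)
  refine ⟨hint, (integral_mono_ae hint hdom hpt).trans ?_⟩
  have e := integral_norm_sq_eq hab hc
  have h0 := hs_nonneg (a := a) (b := b) 0 (fc a b c)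
  have h0' := hs_nonneg (a := a) (b := b) 1 (fc a b c)
  have hsum : ∫ x, ∑ i, (B ^ (2 * n) * ‖c x‖ ^ 2 + ‖s i x‖ ^ (2 * n) * ‖c x‖ ^ 2) ∂(boxMeasure a b)
      ≤ d * (B ^ (2 * n) * (boxVol a b * hs a b 0 (fc a b c))
        + C₁ * τ ^ (2 * n) * hs a b 1 (fc a b c)) := by
    rw [integral_finsetSum _ fun i _ => hI i]
    have := Finset.sum_le_card_nsmul Finset.univ
      (fun i => ∫ x, (B ^ (2 * n) * ‖c x‖ ^ 2 + ‖s i x‖ ^ (2 * n) * ‖c x‖ ^ 2) ∂(boxMeasure a b))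
      (B ^ (2 * n) * (boxVol a b * hs a b 0 (fc a b c))
        + C₁ * τ ^ (2 * n) * hs a b 1 (fc a b c)) fun i _ => by
        rw [integral_add (hc2.const_mul _) (hk i).1, integral_const_mul, e.2]
        linarith [(hk i).2]
    simpa only [Finset.card_univ, Fintype.card_fin, nsmul_eq_mul] using this
  simp only [Pi.add_apply]
  rw [integral_add (hc2.const_mul _) (hI2.const_mul _), integral_const_mul, integral_const_mul, e.2]
  have hfin : (d + 1) * (boxVol a b * hs a b 0 (fc a b c)) + (d + 1) * 2 ^ (2 * n) *
      (d * (B ^ (2 * n) * (boxVol a b * hs a b 0 (fc a b c))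
        + C₁ * τ ^ (2 * n) * hs a b 1 (fc a b c)))
      = (d + 1) * boxVol a b * hs a b 0 (fc a b c)
        + E * boxVol a b * (B ^ (2 * n) * hs a b 0 (fc a b c))
        + E * C₁ * (τ ^ (2 * n) * hs a b 1 (fc a b c)) := by rw [hE]; ring
  refine (add_le_add_right (mul_le_mul_of_nonneg_left hsum (by positivity)) _).trans ?_
  rw [hfin]
  set X := hs a b 0 (fc a b c)
  set Y := τ ^ (2 * n) * hs a b 1 (fc a b c) with hY
  set Z := B ^ (2 * n) * X with hZ
  have hY0 : 0 ≤ Y := by positivity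
  have hZ0 : 0 ≤ Z := by positivity
  have : (1 + B ^ (2 * n)) * X = X + Z := by rw [hZ]; ring
  rw [this]
  have t1 : 0 ≤ (d + 1) * boxVol a b * Z := by positivity
  have t2 : 0 ≤ (d + 1) * boxVol a b * Y := by positivity
  have t3 : 0 ≤ E * boxVol a b * X := by positivity
  have t4 : 0 ≤ E * boxVol a b * Y := by positivity
  have t5 : 0 ≤ E * C₁ * X := by positivity
  have t6 : 0 ≤ E * C₁ * Z := by positivity
  linarith

/-! ### The reaction term -/

/-- The function `x ↦ f(t, v(x), g(x))`, evaluated at real parts. -/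
noncomputable def react (f : ℝ × ℝ × Sp d → ℝ) (t : ℝ) (v : Sp d → ℂ) (g : Fin d → Sp d → ℂ) :
    Sp d → ℂ :=
  fun x => (f (t, (v x).re, WithLp.toLp 2 fun i => (g i x).re) : ℂ)

lemma norm_le_sum_abs (y : Sp d) : ‖y‖ ≤ ∑ j, |y j| := by
  calc ‖y‖ = ‖∑ j, PiLp.single 2 j (y j)‖ := by congr 1; ext i; simp
    _ ≤ ∑ j, ‖(PiLp.single 2 j (y j) : Sp d)‖ := norm_sum_le _ _
    _ = _ := by simp [PiLp.norm_single]

lemma norm_pow_le_sum (y : Sp d) (n : ℕ) : ‖y‖ ^ n ≤ 1 + d ^ n * ∑ j, |y j| ^ n := by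
  have h0 : 0 ≤ ∑ j, |y j| ^ n := Finset.sum_nonneg fun _ _ => by positivity
  rcases isEmpty_or_nonempty (Fin d) with h | h
  · have : ‖y‖ ≤ 0 := by simpa using norm_le_sum_abs y
    have h1 : ‖y‖ ^ n ≤ 1 := pow_le_one₀ (norm_nonneg _) (this.trans zero_le_one)
    have : (0 : ℝ) ≤ d ^ n * ∑ j, |y j| ^ n := by positivity
    linarith
  · obtain ⟨i, hi⟩ := Finite.exists_max fun j => |y j|
    have h1 : ‖y‖ ≤ d * |y i| := by
      refine (norm_le_sum_abs y).trans ?_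
      simpa using Finset.sum_le_card_nsmul Finset.univ (fun j => |y j|) |y i| fun j _ => hi j
    have h2 : |y i| ^ n ≤ ∑ j, |y j| ^ n :=
      Finset.single_le_sum (f := fun j => |y j| ^ n) (fun _ _ => by positivity) (Finset.mem_univ i)
    calc ‖y‖ ^ n ≤ (d * |y i|) ^ n := pow_le_pow_left₀ (norm_nonneg _) h1 n
      _ = d ^ n * |y i| ^ n := mul_pow _ _ _
      _ ≤ d ^ n * ∑ j, |y j| ^ n := by gcongr
      _ ≤ _ := by linarith

lemma rpow_le_one_add_pow {x p : ℝ} {n : ℕ} (hx : 0 ≤ x) (hp : 0 ≤ p) (hpn : p ≤ n) :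
    x ^ p ≤ 1 + x ^ n := by
  rcases le_total x 1 with h | h
  · have := Real.rpow_le_one hx h hp
    have : 0 ≤ x ^ n := by positivity
    linarith
  · have := Real.rpow_le_rpow_of_exponent_le h hpn
    rw [Real.rpow_natCast] at this
    linarith

lemma norm_pow_segment_le {F : Type*} [NormedAddCommGroup F] [NormedSpace ℝ F] (x y : F) (n : ℕ)
    {s : ℝ} (h0 : 0 ≤ s) (h1 : s ≤ 1) : ‖x + s • (y - x)‖ ^ n ≤ ‖x‖ ^ n + ‖y‖ ^ n := by
  have h : ‖x + s • (y - x)‖ ≤ max ‖x‖ ‖y‖ := by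
    have e : x + s • (y - x) = (1 - s) • x + s • y := by module
    rw [e]
    refine (norm_add_le _ _).trans ?_
    rw [norm_smul, norm_smul, Real.norm_of_nonneg h0, Real.norm_of_nonneg (by linarith)]
    nlinarith [le_max_left ‖x‖ ‖y‖, le_max_right ‖x‖ ‖y‖]
  refine (pow_le_pow_left₀ (norm_nonneg _) h n).trans ?_
  rcases max_choice ‖x‖ ‖y‖ with e | e <;> rw [e]
  · linarith [pow_nonneg (norm_nonneg y) n]
  · linarith [pow_nonneg (norm_nonneg x) n]

/-- The local Lipschitz estimate that the growth of the first derivatives implies. -/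
def LocallyLipschitzGrowth (n : ℕ) (L : ℝ) (f : ℝ × ℝ × Sp d → ℝ) : Prop :=
  ∀ (t ξ ξ' : ℝ) (η η' : Sp d), |f (t, ξ, η) - f (t, ξ', η')|
    ≤ L * ((1 + |ξ| ^ n + |ξ'| ^ n) * |ξ - ξ'|
      + (1 + ∑ i, |η i| ^ n + ∑ i, |η' i| ^ n) * ∑ j, |η j - η' j|)

/-- Mean value inequality along a segment in ξ, then along one in η, with powers at intermediate
points bounded by those at the endpoints. -/
lemma exists_lipschitzGrowth (hd3 : d ≤ 3) {f : ℝ × ℝ × Sp d → ℝ}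
    (hf : MildGrowth f) (hfc : ContDiff ℝ 1 f) :
    ∃ n L, AdmissibleExponent d n ∧ 0 < L ∧ LocallyLipschitzGrowth n L f := by
  obtain ⟨p, hp, hpd, ⟨C, hC⟩, -⟩ := hf
  have hC0 : 0 ≤ C := by
    have h1 := (abs_nonneg _).trans (hC 0 0 0).1
    simpa [Real.zero_rpow hp.ne'] using h1
  -- For d ≤ 2 every exponent is allowed and p is rounded up; for d = 3 the assumption p ≤ 2 fits n
  -- = 2. The lower bound n ≥ 2 ensures 3n ≥ 6.
  obtain ⟨n, hn, hpn⟩ : ∃ n : ℕ, AdmissibleExponent d n ∧ p ≤ n := by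
    by_cases h3 : d = 3
    · exact ⟨2, ⟨le_rfl, Or.inr ⟨h3, rfl⟩⟩, by exact_mod_cast hpd h3⟩
    · refine ⟨max 2 ⌈p⌉₊, ⟨le_max_left _ _, Or.inl (by omega)⟩, ?_⟩
      exact (Nat.le_ceil p).trans (by exact_mod_cast le_max_right _ _)
  refine ⟨n, d * (C * (4 + 2 * d ^ n)) + 2 * C + 1, hn, by positivity, fun t ξ ξ' η η' => ?_⟩
  have hdiff := hfc.differentiable one_ne_zero
  have h1 : |f (t, ξ, η) - f (t, ξ', η)| ≤ 2 * C * (1 + |ξ| ^ n + |ξ'| ^ n) * |ξ - ξ'| := by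
    have hd1 : ∀ s ∈ Set.Icc (0 : ℝ) 1, HasDerivWithinAt
        (fun s : ℝ => f (t, ξ' + s • (ξ - ξ'), η))
        ((ξ - ξ') * xiD f (t, ξ' + s • (ξ - ξ'), η)) (Set.Icc 0 1) s := by
      intro s _
      have hpath : HasDerivAt (fun s : ℝ => ((t, ξ' + s • (ξ - ξ'), η) : ℝ × ℝ × Sp d))
          (0, ξ - ξ', 0) s := by
        refine (hasDerivAt_const s t).prodMk (HasDerivAt.prodMk ?_ (hasDerivAt_const s η))
        simpa using ((hasDerivAt_id s).smul_const (ξ - ξ')).const_add ξ'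
      have := (hdiff (t, ξ' + s • (ξ - ξ'), η)).hasFDerivAt.comp_hasDerivAt s hpath
      refine (this.congr_deriv ?_).hasDerivWithinAt
      have e : ((0, ξ - ξ', 0) : ℝ × ℝ × Sp d) = (ξ - ξ') • (0, 1, 0) := by simp
      rw [e, map_smul]; rfl
    have := norm_image_sub_le_of_norm_deriv_le_segment_01'
      (C := 2 * C * (1 + |ξ| ^ n + |ξ'| ^ n) * |ξ - ξ'|) hd1 (fun s hs => by
        rw [norm_mul, Real.norm_eq_abs, Real.norm_eq_abs, mul_comm]
        refine mul_le_mul_of_nonneg_right ((hC t _ η).1.trans ?_) (abs_nonneg _)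
        have e1 := rpow_le_one_add_pow (abs_nonneg (ξ' + s • (ξ - ξ'))) hp.le hpn
        have e2 := norm_pow_segment_le ξ' ξ n hs.1 hs.2.le
        rw [Real.norm_eq_abs, Real.norm_eq_abs, Real.norm_eq_abs] at e2
        have e3 : 0 ≤ |ξ| ^ n + |ξ'| ^ n := by positivity
        nlinarith)
    simpa using this
  have h2 : |f (t, ξ', η) - f (t, ξ', η')| ≤ d * (C * (4 + 2 * d ^ n)) *
      ((1 + ∑ i, |η i| ^ n + ∑ i, |η' i| ^ n) * ∑ j, |η j - η' j|) := by
    have hs1 : 0 ≤ ∑ i, |η i| ^ n := Finset.sum_nonneg fun _ _ => by positivity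
    have hs2 : 0 ≤ ∑ i, |η' i| ^ n := Finset.sum_nonneg fun _ _ => by positivity
    have hs3 : 0 ≤ ∑ j, |η j - η' j| := Finset.sum_nonneg fun _ _ => by positivity
    have hd1 : ∀ s ∈ Set.Icc (0 : ℝ) 1, HasDerivWithinAt
        (fun s : ℝ => f (t, ξ', η' + s • (η - η')))
        (∑ j, (η j - η' j) * etaD j f (t, ξ', η' + s • (η - η'))) (Set.Icc 0 1) s := by
      intro s _
      have hpath : HasDerivAt (fun s : ℝ => ((t, ξ', η' + s • (η - η')) : ℝ × ℝ × Sp d))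
          (0, 0, η - η') s := by
        refine (hasDerivAt_const s t).prodMk ((hasDerivAt_const s ξ').prodMk ?_)
        simpa using ((hasDerivAt_id s).smul_const (η - η')).const_add η'
      have := (hdiff (t, ξ', η' + s • (η - η'))).hasFDerivAt.comp_hasDerivAt s hpath
      refine (this.congr_deriv ?_).hasDerivWithinAt
      have e : ((0, 0, η - η') : ℝ × ℝ × Sp d)
          = ∑ j, (η j - η' j) • ((0, 0, EuclideanSpace.single j 1) : ℝ × ℝ × Sp d) := by
        rw [Prod.ext_iff, Prod.ext_iff]
        refine ⟨by simp [Prod.fst_sum], by simp [Prod.fst_sum, Prod.snd_sum], ?_⟩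
        rw [Prod.snd_sum, Prod.snd_sum]
        ext i
        simp [Pi.single_apply]
      rw [e, map_sum]
      simp only [map_smul, smul_eq_mul]
      rfl
    have := norm_image_sub_le_of_norm_deriv_le_segment_01'
      (C := d * (C * (4 + 2 * d ^ n)) *
      ((1 + ∑ i, |η i| ^ n + ∑ i, |η' i| ^ n) * ∑ j, |η j - η' j|)) hd1 (fun s hs => by
        have hb : ∀ j, |etaD j f (t, ξ', η' + s • (η - η'))|
            ≤ C * (4 + 2 * d ^ n) * (1 + ∑ i, |η i| ^ n + ∑ i, |η' i| ^ n) := fun j => by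
          refine ((hC t ξ' _).2 j).trans ?_
          have e1 := rpow_le_one_add_pow (norm_nonneg (η' + s • (η - η'))) hp.le hpn
          have e2 := norm_pow_segment_le η' η n hs.1 hs.2.le
          have e3 := norm_pow_le_sum η n
          have e4 := norm_pow_le_sum η' n
          rw [mul_assoc]
          refine mul_le_mul_of_nonneg_left ?_ hC0
          have e5 : 0 ≤ (d : ℝ) ^ n := by positivity
          nlinarith
        rw [Real.norm_eq_abs]
        refine (Finset.abs_sum_le_sum_abs _ _).trans ?_
        have hX : 0 ≤ C * (4 + 2 * (d : ℝ) ^ n) * (1 + ∑ i, |η i| ^ n + ∑ i, |η' i| ^ n) := by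
          positivity
        have hle : ∀ j ∈ Finset.univ, |(η j - η' j) * etaD j f (t, ξ', η' + s • (η - η'))|
            ≤ (C * (4 + 2 * d ^ n) * (1 + ∑ i, |η i| ^ n + ∑ i, |η' i| ^ n))
              * ∑ j, |η j - η' j| := fun j _ => by
          rw [abs_mul, mul_comm]
          exact mul_le_mul (hb j) (Finset.single_le_sum (f := fun j => |η j - η' j|)
            (fun _ _ => abs_nonneg _) (Finset.mem_univ j)) (abs_nonneg _) hX
        refine (Finset.sum_le_card_nsmul _ _ _ hle).trans (le_of_eq ?_)
        simp only [Finset.card_univ, Fintype.card_fin, nsmul_eq_mul]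
        ring)
    simpa using this
  have h3 := abs_sub_le (f (t, ξ, η)) (f (t, ξ', η)) (f (t, ξ', η'))
  have q1 : 0 ≤ (1 + |ξ| ^ n + |ξ'| ^ n) * |ξ - ξ'| := by positivity
  have q2 : 0 ≤ (1 + ∑ i, |η i| ^ n + ∑ i, |η' i| ^ n) * ∑ j, |η j - η' j| := by positivity
  have q3 : 0 ≤ d * (C * (4 + 2 * (d : ℝ) ^ n)) := by positivity
  nlinarith [mul_nonneg q3 q1, mul_nonneg hC0 q2]

/-! ### Differences of reaction terms -/

lemma integrable_sq_iff_memLp {g : Sp d → ℝ} {μ : Measure (Sp d)} (hg : AEStronglyMeasurable g μ) :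
    Integrable (fun x => g x ^ 2) μ ↔ MemLp g 2 μ :=
  (memLp_two_iff_integrable_sq hg).symm

lemma integral_mul_le_sqrt {f g : Sp d → ℝ} {μ : Measure (Sp d)} (hf : MemLp f 2 μ)
    (hg : MemLp g 2 μ) :
    Integrable (fun x => f x * g x) μ ∧
      ∫ x, f x * g x ∂μ ≤ √(∫ x, f x ^ 2 ∂μ) * √(∫ x, g x ^ 2 ∂μ) := by
  have hi : Integrable (fun x => f x * g x) μ := hf.integrable_mul hg
  refine ⟨hi, ?_⟩
  have h1 : ∫ x, f x * g x ∂μ ≤ ∫ x, |f x| * |g x| ∂μ :=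
    integral_mono hi (by simpa only [abs_mul] using hi.abs) fun x => by
      simpa only [abs_mul] using le_abs_self (f x * g x)
  refine h1.trans ?_
  have h2 := integral_mul_le_Lp_mul_Lq_of_nonneg (μ := μ) Real.HolderConjugate.two_two
    (f := fun x => |f x|) (g := fun x => |g x|)
    (Eventually.of_forall fun x => abs_nonneg _) (Eventually.of_forall fun x => abs_nonneg _)
    (by rw [show ENNReal.ofReal 2 = 2 by simp]; exact hf.abs)
    (by rw [show ENNReal.ofReal 2 = 2 by simp]; exact hg.abs)
  simpa [Real.sqrt_eq_rpow] using h2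

lemma aestronglyMeasurable_react {f : ℝ × ℝ × Sp d → ℝ} (hf : Continuous f) (t : ℝ) {v : Sp d → ℂ}
    {g : Fin d → Sp d → ℂ} {μ : Measure (Sp d)} (hv : AEStronglyMeasurable v μ)
    (hg : ∀ i, AEStronglyMeasurable (g i) μ) : AEStronglyMeasurable (react f t v g) μ := by
  refine Complex.continuous_ofReal.comp_aestronglyMeasurable (hf.comp_aestronglyMeasurable ?_)
  refine aestronglyMeasurable_const.prodMk
    ((Complex.continuous_re.comp_aestronglyMeasurable hv).prodMk ?_)
  refine AEMeasurable.aestronglyMeasurable ((WithLp.measurable_toLp 2 _).comp_aemeasurable ?_)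
  exact aemeasurable_pi_lambda _ fun i =>
    (Complex.continuous_re.comp_aestronglyMeasurable (hg i)).aemeasurable

lemma norm_react_sub_le {n : ℕ} {L : ℝ} {f : ℝ × ℝ × Sp d → ℝ} (hL : 0 ≤ L)
    (hf : LocallyLipschitzGrowth n L f) (t : ℝ) {v v' : Sp d → ℂ} (g g' : Fin d → Sp d → ℂ)
    {K : ℝ} {x : Sp d} (hv : ‖v x‖ ≤ K) (hv' : ‖v' x‖ ≤ K) :
    ‖react f t v g x - react f t v' g' x‖ ≤ L * ((1 + 2 * K ^ n) * ‖v x - v' x‖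
      + ((1 + ∑ i, ‖g i x‖ ^ n) + (1 + ∑ i, ‖g' i x‖ ^ n)) * ∑ j, ‖g j x - g' j x‖) := by
  rw [react, react, ← Complex.ofReal_sub, Complex.norm_real, Real.norm_eq_abs]
  refine (hf t _ _ _ _).trans ?_
  have hre : ∀ z : ℂ, |z.re| ≤ ‖z‖ := Complex.abs_re_le_norm
  have hp : ∀ (z : ℂ), |z.re| ^ n ≤ ‖z‖ ^ n := fun z => pow_le_pow_left₀ (abs_nonneg _) (hre z) n
  have h1 : |(v x).re| ^ n ≤ K ^ n := (hp _).trans (pow_le_pow_left₀ (norm_nonneg _) hv n)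
  have h2 : |(v' x).re| ^ n ≤ K ^ n := (hp _).trans (pow_le_pow_left₀ (norm_nonneg _) hv' n)
  have h3 : |(v x).re - (v' x).re| ≤ ‖v x - v' x‖ := by simpa using hre (v x - v' x)
  have h4 : ∑ j, |(g j x).re - (g' j x).re| ≤ ∑ j, ‖g j x - g' j x‖ :=
    Finset.sum_le_sum fun j _ => by simpa using hre (g j x - g' j x)
  have h5 : ∑ i, |(g i x).re| ^ n ≤ ∑ i, ‖g i x‖ ^ n := Finset.sum_le_sum fun i _ => hp _
  have h6 : ∑ i, |(g' i x).re| ^ n ≤ ∑ i, ‖g' i x‖ ^ n := Finset.sum_le_sum fun i _ => hp _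
  have h7 : 0 ≤ ∑ j, |(g j x).re - (g' j x).re| := Finset.sum_nonneg fun _ _ => abs_nonneg _
  have hK : 0 ≤ K ^ n := pow_nonneg ((norm_nonneg _).trans hv) n
  refine mul_le_mul_of_nonneg_left (add_le_add ?_ ?_) hL
  · exact mul_le_mul (by linarith) h3 (abs_nonneg _) (by linarith)
  · have h8 : 0 ≤ ∑ i, ‖g i x‖ ^ n := Finset.sum_nonneg fun _ _ => by positivity
    have h9 : 0 ≤ ∑ i, ‖g' i x‖ ^ n := Finset.sum_nonneg fun _ _ => by positivity
    exact mul_le_mul (by linarith) h4 h7 (by linarith)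

/-- The data of a bounded function with controlled gradient. -/
structure Ctrl (a b : Fin d → ℝ) (K B τ : ℝ) (v : Sp d → ℂ) (g : Fin d → Sp d → ℂ) : Prop where
  isGrad : IsGrad a b v g
  bound : ∀ᵐ x ∂(boxMeasure a b), ‖v x‖ ≤ K
  grad : GradCtrl a b B τ g

lemma exists_weighted_pair_le (hd : 1 ≤ d) (hab : ∀ i, a i < b i) {n : ℕ}
    (hn : AdmissibleExponent d n) :
    ∃ C > 0, ∀ (B τ : ℝ) (g g' : Fin d → Sp d → ℂ) (c : Sp d → ℂ), 0 ≤ B → 0 < τ →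
      GradCtrl a b B τ g → GradCtrl a b B τ g' → MemLp c 2 (boxMeasure a b) →
      Hmem a b 1 (fc a b c) →
      MemLp (fun x => ((1 + ∑ i, ‖g i x‖ ^ n) + (1 + ∑ i, ‖g' i x‖ ^ n)) * ‖c x‖) 2
        (boxMeasure a b) ∧
      ∫ x, (((1 + ∑ i, ‖g i x‖ ^ n) + (1 + ∑ i, ‖g' i x‖ ^ n)) * ‖c x‖) ^ 2 ∂(boxMeasure a b)
          ≤ C * ((1 + B ^ (2 * n)) * hs a b 0 (fc a b c)
            + τ ^ (2 * n) * hs a b 1 (fc a b c)) := by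
  obtain ⟨C, hC, h⟩ := exists_weighted_le hd hab hn
  refine ⟨4 * C, by positivity, fun B τ g g' c hB hτ hg hg' hc hcm => ?_⟩
  obtain ⟨i1, j1⟩ := h B τ g c hB hτ hg hc hcm
  obtain ⟨i2, j2⟩ := h B τ g' c hB hτ hg' hc hcm
  have hmeas : AEStronglyMeasurable
      (fun x => ((1 + ∑ i, ‖g i x‖ ^ n) + (1 + ∑ i, ‖g' i x‖ ^ n)) * ‖c x‖) (boxMeasure a b) := by
    refine AEStronglyMeasurable.mul (AEStronglyMeasurable.add ?_ ?_) hc.1.norm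
    · exact aestronglyMeasurable_const.add
        (Finset.aestronglyMeasurable_fun_sum _ fun i _ => (hg.1 i).norm.pow n)
    · exact aestronglyMeasurable_const.add
        (Finset.aestronglyMeasurable_fun_sum _ fun i _ => (hg'.1 i).norm.pow n)
  have hdom := (i1.const_mul 2).add (i2.const_mul 2)
  have hpt : ∀ x, (((1 + ∑ i, ‖g i x‖ ^ n) + (1 + ∑ i, ‖g' i x‖ ^ n)) * ‖c x‖) ^ 2
      ≤ 2 * ((1 + ∑ i, ‖g i x‖ ^ n) ^ 2 * ‖c x‖ ^ 2)
        + 2 * ((1 + ∑ i, ‖g' i x‖ ^ n) ^ 2 * ‖c x‖ ^ 2) := fun x => by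
    rw [mul_pow, ← mul_add, ← add_mul, ← mul_assoc]
    refine mul_le_mul_of_nonneg_right ?_ (sq_nonneg _)
    nlinarith [sq_nonneg ((1 + ∑ i, ‖g i x‖ ^ n) - (1 + ∑ i, ‖g' i x‖ ^ n))]
  have hint : Integrable (fun x =>
      (((1 + ∑ i, ‖g i x‖ ^ n) + (1 + ∑ i, ‖g' i x‖ ^ n)) * ‖c x‖) ^ 2) (boxMeasure a b) :=
    hdom.mono' (hmeas.pow 2) (Eventually.of_forall fun x => by
      rw [Real.norm_of_nonneg (sq_nonneg _)]; exact hpt x)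
  refine ⟨(integrable_sq_iff_memLp hmeas).1 hint, (integral_mono hint hdom hpt).trans ?_⟩
  simp only [Pi.add_apply]
  rw [integral_add (i1.const_mul _) (i2.const_mul _), integral_const_mul, integral_const_mul]
  linarith

lemma hs_mono_order {s s' : ℕ} (h : s ≤ s') {c : (Fin d → ℤ) → ℂ} (hc : Hmem a b s' c) :
    hs a b s c ≤ hs a b s' c :=
  (hc.mono h fun _ => le_rfl).2

/-- The `L²` estimate for differences of reaction terms. -/
lemma exists_react_sub_sq_le (hd : 1 ≤ d) (hab : ∀ i, a i < b i) {n : ℕ}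
    (hn : AdmissibleExponent d n) {L : ℝ} (hL : 0 < L) {f : ℝ × ℝ × Sp d → ℝ} (hfc : Continuous f)
    (hf : LocallyLipschitzGrowth n L f) :
    ∃ C > 0, ∀ K B : ℝ, 0 ≤ K → 0 ≤ B → ∃ C' > 0, ∀ (τ t : ℝ) (v v' : Sp d → ℂ)
      (g g' : Fin d → Sp d → ℂ), 0 < τ → Ctrl a b K B τ v g → Ctrl a b K B τ v' g' →
      Hmem a b 2 (fc a b (v - v')) →
      MemLp (react f t v g - react f t v' g') 2 (boxMeasure a b) ∧
      ∫ x, ‖react f t v g x - react f t v' g' x‖ ^ 2 ∂(boxMeasure a b)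
        ≤ C' * hs a b 1 (fc a b (v - v')) + C * τ ^ (2 * n) * hs a b 2 (fc a b (v - v')) := by
  obtain ⟨C₁, hC₁, h1⟩ := exists_weighted_pair_le hd hab hn
  have hV := boxVol_pos hab
  have hd0 : (0 : ℝ) < d := by exact_mod_cast hd
  -- The factor of τ^{2n} is fixed before K and B: later τ is chosen from it, and B depends on τ.
  refine ⟨2 * L ^ 2 * d ^ 2 * C₁, by positivity, fun K B hK hB =>
    ⟨2 * L ^ 2 * (1 + 2 * K ^ n) ^ 2 * boxVol a b + 2 * L ^ 2 * d ^ 2 * C₁ * (1 + B ^ (2 * n)),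
      by positivity, fun τ t v v' g g' hτ hv hv' hm => ?_⟩⟩
  have hw := hv.isGrad.sub hab hv'.isGrad
  set w : Sp d → ℂ := v - v' with hwdef
  set wg : Fin d → Sp d → ℂ := g - g' with hwgdef
  set P : Sp d → ℝ := fun x => (1 + ∑ i, ‖g i x‖ ^ n) + (1 + ∑ i, ‖g' i x‖ ^ n) with hP
  have hgj : ∀ j, _ := fun j => hw.hs_grad (s := 1) hm j
  have hk : ∀ j, _ := fun j => h1 B τ g g' (wg j) hB hτ hv.grad hv'.grad (hw.grad_memLp j) (hgj j).1
  have hIj : ∀ j, Integrable (fun x => (P x * ‖wg j x‖) ^ 2) (boxMeasure a b) := fun j =>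
    (integrable_sq_iff_memLp (hk j).1.1).2 (hk j).1
  have hw2 : Integrable (fun x => ‖w x‖ ^ 2) (boxMeasure a b) := by
    simpa using hw.memLp.integrable_norm_pow (p := 2) (by norm_num)
  have hpt : ∀ᵐ x ∂(boxMeasure a b), ‖react f t v g x - react f t v' g' x‖ ^ 2
      ≤ 2 * L ^ 2 * (1 + 2 * K ^ n) ^ 2 * ‖w x‖ ^ 2
        + 2 * L ^ 2 * d * ∑ j, (P x * ‖wg j x‖) ^ 2 := by
    filter_upwards [hv.bound, hv'.bound] with x hx hx'
    have e1 := norm_react_sub_le hL.le hf t g g' hx hx'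
    have e2 : (∑ j, ‖wg j x‖) ^ 2 ≤ d * ∑ j, ‖wg j x‖ ^ 2 := by
      simpa using sq_sum_le_card_mul_sum_sq (s := Finset.univ) (f := fun j => ‖wg j x‖)
    have e3 : ∑ j, (P x * ‖wg j x‖) ^ 2 = P x ^ 2 * ∑ j, ‖wg j x‖ ^ 2 := by
      simp only [mul_pow, Finset.mul_sum]
    have e4 : ‖react f t v g x - react f t v' g' x‖ ≤ L * ((1 + 2 * K ^ n) * ‖w x‖
      + P x * ∑ j, ‖wg j x‖) := e1
    rw [e3]
    calc _ ≤ (L * ((1 + 2 * K ^ n) * ‖w x‖ + P x * ∑ j, ‖wg j x‖)) ^ 2 :=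
          pow_le_pow_left₀ (norm_nonneg _) e4 2
      _ ≤ 2 * L ^ 2 * ((1 + 2 * K ^ n) * ‖w x‖) ^ 2
          + 2 * L ^ 2 * (P x ^ 2 * (∑ j, ‖wg j x‖) ^ 2) := by
          have := mul_nonneg (sq_nonneg L)
            (sq_nonneg ((1 + 2 * K ^ n) * ‖w x‖ - P x * ∑ j, ‖wg j x‖))
          nlinarith
      _ ≤ 2 * L ^ 2 * ((1 + 2 * K ^ n) * ‖w x‖) ^ 2
          + 2 * L ^ 2 * (P x ^ 2 * (d * ∑ j, ‖wg j x‖ ^ 2)) := by gcongr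
      _ = _ := by ring
  have hdom := (hw2.const_mul (2 * L ^ 2 * (1 + 2 * K ^ n) ^ 2)).add
    ((integrable_finsetSum Finset.univ fun j _ => hIj j).const_mul (2 * L ^ 2 * d))
  have hmeas : AEStronglyMeasurable (react f t v g - react f t v' g') (boxMeasure a b) :=
    (aestronglyMeasurable_react hfc t hv.isGrad.memLp.1 hv.grad.1).sub
      (aestronglyMeasurable_react hfc t hv'.isGrad.memLp.1 hv'.grad.1)
  have hint : Integrable (fun x => ‖react f t v g x - react f t v' g' x‖ ^ 2) (boxMeasure a b) :=
    hdom.mono' (hmeas.norm.pow 2) (by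
      filter_upwards [hpt] with x hx
      rw [Real.norm_of_nonneg (sq_nonneg _)]; exact hx)
  refine ⟨(memLp_two_iff_integrable_sq_norm hmeas).2 hint, (integral_mono_ae hint hdom hpt).trans ?_⟩
  simp only [Pi.add_apply]
  rw [integral_add (hw2.const_mul _)
    ((integrable_finsetSum Finset.univ fun j _ => hIj j).const_mul _), integral_const_mul,
    integral_const_mul, integral_finsetSum _ fun j _ => hIj j, (integral_norm_sq_eq hab hw.memLp).2]
  have hm1 := (hm.mono (s := 1) one_le_two fun _ => le_rfl).1
  have hsum := Finset.sum_le_card_nsmul Finset.univ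
    (fun j => ∫ x, (P x * ‖wg j x‖) ^ 2 ∂(boxMeasure a b))
    (C₁ * ((1 + B ^ (2 * n)) * hs a b 1 (fc a b w) + τ ^ (2 * n) * hs a b 2 (fc a b w)))
    fun j _ => (hk j).2.trans (by
      have h0 := (hw.hs_grad (s := 0) hm1 j).2
      have h2 := (hgj j).2
      simp only [Nat.zero_add, Nat.reduceAdd] at h0 h2
      gcongr)
  simp only [Finset.card_univ, Fintype.card_fin, nsmul_eq_mul] at hsum
  have h01 := hs_mono_order (a := a) (b := b) zero_le_one hm1
  calc _ ≤ 2 * L ^ 2 * (1 + 2 * K ^ n) ^ 2 * (boxVol a b * hs a b 1 (fc a b w))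
        + 2 * L ^ 2 * d * (d * (C₁ * ((1 + B ^ (2 * n)) * hs a b 1 (fc a b w)
          + τ ^ (2 * n) * hs a b 2 (fc a b w)))) := by gcongr
    _ = _ := by ring

/-- The duality estimate for differences of reaction terms. -/
lemma exists_react_sub_pairing_le (hd : 1 ≤ d) (hab : ∀ i, a i < b i) {n : ℕ}
    (hn : AdmissibleExponent d n) {L : ℝ} (hL : 0 < L) {f : ℝ × ℝ × Sp d → ℝ}
    (hf : LocallyLipschitzGrowth n L f) :
    ∃ C > 0, ∀ K B : ℝ, 0 ≤ K → 0 ≤ B → ∃ C' > 0, ∀ (τ t : ℝ) (v v' θ : Sp d → ℂ)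
      (g g' : Fin d → Sp d → ℂ), 0 < τ → Ctrl a b K B τ v g → Ctrl a b K B τ v' g' →
      Hmem a b 1 (fc a b (v - v')) → MemLp θ 2 (boxMeasure a b) → Hmem a b 1 (fc a b θ) →
      ‖∫ x, (react f t v g x - react f t v' g' x) * conj (θ x) ∂(boxMeasure a b)‖
        ≤ √(hs a b 1 (fc a b (v - v'))) *
          (C' * √(hs a b 0 (fc a b θ)) + C * τ ^ n * √(hs a b 1 (fc a b θ))) := by
  obtain ⟨C₁, hC₁, h1⟩ := exists_weighted_pair_le hd hab hn
  have hV := boxVol_pos hab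
  have hd0 : (0 : ℝ) < d := by exact_mod_cast hd
  refine ⟨L * d * √(boxVol a b) * √C₁, by positivity, fun K B hK hB =>
    ⟨L * (1 + 2 * K ^ n) * boxVol a b + L * d * √(boxVol a b) * √C₁ * (1 + B ^ n),
      by positivity, fun τ t v v' θ g g' hτ hv hv' hm hθ hθm => ?_⟩⟩
  have hw := hv.isGrad.sub hab hv'.isGrad
  set w : Sp d → ℂ := v - v' with hwdef
  set wg : Fin d → Sp d → ℂ := g - g' with hwgdef
  set P : Sp d → ℝ := fun x => (1 + ∑ i, ‖g i x‖ ^ n) + (1 + ∑ i, ‖g' i x‖ ^ n) with hP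
  obtain ⟨hP1, hP2⟩ := h1 B τ g g' θ hB hτ hv.grad hv'.grad hθ hθm
  have q0 := integral_mul_le_sqrt hw.memLp.norm hθ.norm
  -- Cauchy–Schwarz leaves the gradient weight with θ, so only the H¹ norm of the difference v − v'
  -- enters.
  have qj : ∀ j, _ := fun j => integral_mul_le_sqrt (hw.grad_memLp j).norm hP1
  have hpt : ∀ᵐ x ∂(boxMeasure a b), ‖(react f t v g x - react f t v' g' x) * conj (θ x)‖
      ≤ L * (1 + 2 * K ^ n) * (‖w x‖ * ‖θ x‖) + L * ∑ j, ‖wg j x‖ * (P x * ‖θ x‖) := by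
    filter_upwards [hv.bound, hv'.bound] with x hx hx'
    have e1 : ‖react f t v g x - react f t v' g' x‖ ≤ L * ((1 + 2 * K ^ n) * ‖w x‖
      + P x * ∑ j, ‖wg j x‖) := norm_react_sub_le hL.le hf t g g' hx hx'
    rw [norm_mul, RCLike.norm_conj, ← Finset.sum_mul]
    calc _ ≤ (L * ((1 + 2 * K ^ n) * ‖w x‖ + P x * ∑ j, ‖wg j x‖)) * ‖θ x‖ := by gcongr
      _ = _ := by ring
  have hdom := (q0.1.const_mul (L * (1 + 2 * K ^ n))).add
    ((integrable_finsetSum Finset.univ fun j _ => (qj j).1).const_mul L)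
  refine (norm_integral_le_of_norm_le hdom hpt).trans ?_
  simp only [Pi.add_apply]
  rw [integral_add (q0.1.const_mul _)
    ((integrable_finsetSum Finset.univ fun j _ => (qj j).1).const_mul _), integral_const_mul,
    integral_const_mul, integral_finsetSum _ fun j _ => (qj j).1]
  have hm0 := hs_mono_order (a := a) (b := b) zero_le_one hm
  have n0 := hs_nonneg (a := a) (b := b) 0 (fc a b θ)
  have n1 := hs_nonneg (a := a) (b := b) 1 (fc a b θ)
  set X := √(hs a b 1 (fc a b w)) with hX
  set Y := √(hs a b 0 (fc a b θ)) with hY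
  set Z := √(hs a b 1 (fc a b θ)) with hZ
  have r0 : ∫ x, ‖w x‖ * ‖θ x‖ ∂(boxMeasure a b) ≤ boxVol a b * (X * Y) := by
    refine q0.2.trans ?_
    rw [(integral_norm_sq_eq hab hw.memLp).2, (integral_norm_sq_eq hab hθ).2,
      Real.sqrt_mul hV.le, Real.sqrt_mul hV.le]
    calc _ = (√(boxVol a b) * √(boxVol a b)) * (√(hs a b 0 (fc a b w)) * Y) := by ring
      _ ≤ boxVol a b * (X * Y) := by
        rw [Real.mul_self_sqrt hV.le]
        exact mul_le_mul_of_nonneg_left (mul_le_mul_of_nonneg_right (Real.sqrt_le_sqrt hm0)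
          (Real.sqrt_nonneg _)) hV.le
  have rP : √(∫ x, (P x * ‖θ x‖) ^ 2 ∂(boxMeasure a b)) ≤ √C₁ * ((1 + B ^ n) * Y + τ ^ n * Z) := by
    refine Real.sqrt_le_iff.2 ⟨by positivity, hP2.trans ?_⟩
    rw [mul_pow, Real.sq_sqrt hC₁.le]
    refine mul_le_mul_of_nonneg_left ?_ hC₁.le
    have e1 : hs a b 0 (fc a b θ) = Y ^ 2 := (Real.sq_sqrt n0).symm
    have e2 : hs a b 1 (fc a b θ) = Z ^ 2 := (Real.sq_sqrt n1).symm
    have hB' : 0 ≤ B ^ n := by positivity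
    have hτ' : 0 ≤ τ ^ n := by positivity
    have hY0 : 0 ≤ Y := Real.sqrt_nonneg _
    have hZ0 : 0 ≤ Z := Real.sqrt_nonneg _
    rw [e1, e2]
    calc (1 + B ^ (2 * n)) * Y ^ 2 + τ ^ (2 * n) * Z ^ 2
        = (1 + (B ^ n) ^ 2) * Y ^ 2 + (τ ^ n * Z) ^ 2 := by ring
      _ ≤ ((1 + B ^ n) * Y) ^ 2 + (τ ^ n * Z) ^ 2 := by
          rw [mul_pow]; gcongr; nlinarith
      _ ≤ _ := by
          have : 0 ≤ ((1 + B ^ n) * Y) * (τ ^ n * Z) := by positivity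
          nlinarith
  have rj : ∀ j ∈ Finset.univ, ∫ x, ‖wg j x‖ * (P x * ‖θ x‖) ∂(boxMeasure a b)
      ≤ √(boxVol a b) * X * (√C₁ * ((1 + B ^ n) * Y + τ ^ n * Z)) := fun j _ => by
    refine (qj j).2.trans ?_
    refine mul_le_mul ?_ rP (Real.sqrt_nonneg _) (by positivity)
    rw [(integral_norm_sq_eq hab (hw.grad_memLp j)).2, Real.sqrt_mul hV.le]
    exact mul_le_mul_of_nonneg_left (Real.sqrt_le_sqrt (hw.hs_grad (s := 0) hm j).2)
      (Real.sqrt_nonneg _)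
  have hsum := Finset.sum_le_card_nsmul _ _ _ rj
  simp only [Finset.card_univ, Fintype.card_fin, nsmul_eq_mul] at hsum
  calc _ ≤ L * (1 + 2 * K ^ n) * (boxVol a b * (X * Y))
        + L * (d * (√(boxVol a b) * X * (√C₁ * ((1 + B ^ n) * Y + τ ^ n * Z)))) := by gcongr
    _ = _ := by ring

/-! ### Strong solutions in Fourier variables -/

open Classical in
/-- The coefficients of `c` outside of `K`. -/
noncomputable def tailCoeff (K : Finset (Fin d → ℤ)) (c : (Fin d → ℤ) → ℂ) : (Fin d → ℤ) → ℂ :=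
  fun k => if k ∈ K then 0 else c k

lemma norm_tailCoeff_le (K : Finset (Fin d → ℤ)) (c : (Fin d → ℤ) → ℂ) (k : Fin d → ℤ) :
    ‖tailCoeff K c k‖ ≤ ‖c k‖ := by
  unfold tailCoeff; split_ifs <;> simp

lemma norm_tailCoeff_le_of_norm_le (K : Finset (Fin d → ℤ)) {c c' : (Fin d → ℤ) → ℂ}
    (h : ∀ k, ‖c k‖ ≤ ‖c' k‖) (k : Fin d → ℤ) : ‖tailCoeff K c k‖ ≤ ‖tailCoeff K c' k‖ := by
  unfold tailCoeff; split_ifs <;> simp [h k]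

lemma tailCoeff_sub (K : Finset (Fin d → ℤ)) (c c' : (Fin d → ℤ) → ℂ) :
    tailCoeff K (c - c') = tailCoeff K c - tailCoeff K c' := by
  ext k; simp only [tailCoeff, Pi.sub_apply]; split_ifs <;> simp

lemma tailCoeff_add (K : Finset (Fin d → ℤ)) (c c' : (Fin d → ℤ) → ℂ) :
    tailCoeff K (c + c') = tailCoeff K c + tailCoeff K c' := by
  ext k; simp only [tailCoeff, Pi.add_apply]; split_ifs <;> simp

lemma fc_sub_trig (hab : ∀ i, a i < b i) {v : Sp d → ℂ} (hv : MemLp v 2 (boxMeasure a b))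
    (K : Finset (Fin d → ℤ)) : fc a b (v - trig a b K (fc a b v)) = tailCoeff K (fc a b v) := by
  rw [fc_sub hab hv (memLp_trig hab _ _), fc_trig hab]
  ext k; simp only [Pi.sub_apply, tailCoeff]; split_ifs <;> simp

lemma Hmem.hs_eq_sum_add {s : ℕ} {c : (Fin d → ℤ) → ℂ} (h : Hmem a b s c)
    (K : Finset (Fin d → ℤ)) :
    hs a b s c = ∑ k ∈ K, wt a b k ^ s * ‖c k‖ ^ 2 + hs a b s (tailCoeff K c) := by
  classical
  have h1 : Summable fun k => if k ∈ K then wt a b k ^ s * ‖c k‖ ^ 2 else 0 :=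
    summable_of_ne_finset_zero (s := K) fun k hk => by simp [hk]
  have h2 : (∑' k, if k ∈ K then wt a b k ^ s * ‖c k‖ ^ 2 else 0)
      = ∑ k ∈ K, wt a b k ^ s * ‖c k‖ ^ 2 := by
    rw [tsum_eq_sum (s := K) fun k hk => by simp [hk]]
    exact Finset.sum_congr rfl fun k hk => by simp [hk]
  have h3 : Hmem a b s (tailCoeff K c) := (h.mono le_rfl (norm_tailCoeff_le K c)).1
  rw [← h2, hs, hs, ← h1.tsum_add h3]
  congr 1; ext k
  simp only [tailCoeff]; split_ifs <;> simp

lemma Hmem.exists_tail_le {s : ℕ} {c : (Fin d → ℤ) → ℂ} (h : Hmem a b s c) {ε : ℝ} (hε : 0 < ε) :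
    ∃ K : Finset (Fin d → ℤ), hs a b s (tailCoeff K c) ≤ ε := by
  have h1 : ∀ᶠ K in atTop, hs a b s c - ε < ∑ k ∈ K, wt a b k ^ s * ‖c k‖ ^ 2 :=
    h.hasSum.eventually (lt_mem_nhds (sub_lt_self _ hε))
  obtain ⟨K, hK⟩ := h1.exists
  exact ⟨K, by linarith [h.hs_eq_sum_add K]⟩

lemma hs_tail_anti {s : ℕ} {c : (Fin d → ℤ) → ℂ} (h : Hmem a b s c) {K K' : Finset (Fin d → ℤ)}
    (hK : K ⊆ K') : hs a b s (tailCoeff K' c) ≤ hs a b s (tailCoeff K c) := by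
  refine ((h.mono le_rfl (norm_tailCoeff_le K c)).1.mono le_rfl fun k => ?_).2
  simp only [tailCoeff]
  split_ifs with h1 h2 h2 <;> simp
  exact absurd (hK h2) h1

/-- Control of a function and of its gradient by a bound in `H²` and a bound on the tail. -/
lemma exists_ctrl (hd : 1 ≤ d) (hd3 : d ≤ 3) (hab : ∀ i, a i < b i) (M : ℝ)
    (K : Finset (Fin d → ℤ)) :
    ∃ A B : ℝ, 0 ≤ A ∧ 0 ≤ B ∧ ∀ (τ : ℝ) (v : Sp d → ℂ) (g : Fin d → Sp d → ℂ), IsGrad a b v g →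
      Hmem a b 2 (fc a b v) → hs a b 2 (fc a b v) ≤ M →
      hs a b 2 (tailCoeff K (fc a b v)) ≤ τ ^ 2 → Ctrl a b A B τ v g := by
  obtain ⟨C, hC, h⟩ := exists_ae_bound (a := a) (b := b) hd hd3 hab
  -- A comes from the embedding of H² into L^∞. B bounds the gradient of the partial sum over K,
  -- whose coefficients are at most √M each; the rest of the gradient has H¹ size τ. Neither
  -- constant depends on τ.
  refine ⟨C * √M, K.card * √M, by positivity, by positivity, fun τ v g hg hm hM hτ => ⟨hg, ?_, ?_⟩⟩
  · filter_upwards [h v hg.memLp hm] with x hx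
    exact hx.trans (mul_le_mul_of_nonneg_left (Real.sqrt_le_sqrt hM) hC.le)
  · have hs := hg.sub hab (isGrad_trig hab K (fc a b v))
    have ht := fc_sub_trig hab hg.memLp K
    have hm2 : Hmem a b 2 (fc a b (v - trig a b K (fc a b v))) := by
      rw [ht]; exact (hm.mono le_rfl (norm_tailCoeff_le K _)).1
    refine ⟨fun i => (hg.grad_memLp i).1, g - trigGrad a b K (fc a b v), fun i => ?_,
      fun i => Eventually.of_forall fun x => ?_⟩
    · obtain ⟨h1, h2⟩ := hs.hs_grad (s := 1) hm2 i
      exact ⟨hs.grad_memLp i, h1, h2.trans (by rw [ht]; exact hτ)⟩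
    have h3 : ‖trigGrad a b K (fc a b v) i x‖ ≤ K.card * √M := by
      refine (norm_trig_le _ _ _).trans ?_
      rw [← nsmul_eq_mul]
      refine Finset.sum_le_card_nsmul _ _ _ fun k _ => ?_
      refine Real.le_sqrt_of_sq_le (le_trans ?_ ((hm.sum_le {k}).trans hM))
      rw [Finset.sum_singleton, norm_mul, mul_pow]
      refine mul_le_mul_of_nonneg_right ?_ (sq_nonneg _)
      simp only [norm_mul, Complex.norm_I, one_mul, Complex.norm_real, Real.norm_eq_abs, sq_abs]
      have := one_le_wt (a := a) (b := b) k
      nlinarith [freq_sq_le_wt (a := a) (b := b) k i]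
    calc ‖g i x‖ = ‖trigGrad a b K (fc a b v) i x + (g - trigGrad a b K (fc a b v)) i x‖ := by
          simp
      _ ≤ _ := (norm_add_le _ _).trans (add_le_add_left h3 _)

lemma Hmem.of_norm_le {s : ℕ} {c c' : (Fin d → ℤ) → ℂ} (h : Hmem a b s c')
    (hle : ∀ k, ‖c k‖ ≤ ‖c' k‖) : Hmem a b s c := (h.mono le_rfl hle).1

/-- Comparison with the zero function, whose reaction term is the constant f(t,0,0). No smallness is
involved, so K may be empty and τ large. -/
lemma memLp_react (hd : 1 ≤ d) (hd3 : d ≤ 3) (hab : ∀ i, a i < b i) {n : ℕ}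
    (hn : AdmissibleExponent d n) {L : ℝ} (hL : 0 < L) {f : ℝ × ℝ × Sp d → ℝ} (hfc : Continuous f)
    (hf : LocallyLipschitzGrowth n L f) (t : ℝ) {v : Sp d → ℂ} {g : Fin d → Sp d → ℂ}
    (hg : IsGrad a b v g) (hm : Hmem a b 2 (fc a b v)) :
    MemLp (react f t v g) 2 (boxMeasure a b) := by
  obtain ⟨C, hC, h⟩ := exists_react_sub_sq_le hd hab hn hL hfc hf
  obtain ⟨A, B, hA, hB, hctrl⟩ := exists_ctrl hd hd3 hab (hs a b 2 (fc a b v)) ∅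
  obtain ⟨C', hC', h'⟩ := h A B hA hB
  have h0 : IsGrad a b (0 : Sp d → ℂ) 0 := by simpa using hg.sub hab hg
  have hz : fc a b (0 : Sp d → ℂ) = 0 := by ext k; simp [fc]
  have hs0 : ∀ s, hs a b s (0 : (Fin d → ℤ) → ℂ) = 0 := fun s => by simp [hs]
  set τ := 1 + hs a b 2 (fc a b v) with hτ
  have hnn := hs_nonneg (a := a) (b := b) 2 (fc a b v)
  have hτ0 : 0 < τ := by positivity
  have c1 : Ctrl a b A B τ v g := hctrl τ v g hg hm le_rfl
    ((hm.mono le_rfl (norm_tailCoeff_le ∅ _)).2.trans (by nlinarith))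
  have c2 : Ctrl a b A B τ 0 0 := hctrl τ 0 0 h0 (hm.of_norm_le (by simp [hz]))
    (by rw [hz, hs0]; exact hnn) (by
      rw [hz, show tailCoeff ∅ (0 : (Fin d → ℤ) → ℂ) = 0 by ext; simp [tailCoeff], hs0]
      positivity)
  have h1 := (h' τ t v 0 g 0 hτ0 c1 c2 (by simpa using hm)).1
  have h2 : MemLp (react f t (0 : Sp d → ℂ) 0) 2 (boxMeasure a b) := by
    have := isFiniteMeasure_boxMeasure hab
    exact memLp_const (μ := boxMeasure a b) ((f (t, 0, WithLp.toLp 2 fun _ => 0) : ℝ) : ℂ)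
  simpa using h1.add h2

/-- A strong solution of the equation, in terms of its Fourier coefficients. -/
structure StrongSolution (a b : Fin d → ℝ) (T : ℝ) (f : ℝ × ℝ × Sp d → ℝ) (U : ℝ → Sp d → ℂ)
    (G : ℝ → Fin d → Sp d → ℂ) : Prop where
  isGrad : ∀ t ∈ Set.Icc 0 T, IsGrad a b (U t) (G t)
  hmem : ∀ t ∈ Set.Icc 0 T, Hmem a b 2 (fc a b (U t))
  deriv : ∀ t ∈ Set.Icc 0 T, ∀ k, HasDerivWithinAt (fun s => fc a b (U s) k)
    (-((wt a b k - 1 : ℝ) : ℂ) * fc a b (U t) k + fc a b (react f t (U t) (G t)) k) (Set.Icc 0 T) t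
  tendsto : ∀ t ∈ Set.Icc 0 T, Tendsto (fun s => hs a b 2 (fc a b (U s) - fc a b (U t)))
    (𝓝[Set.Icc 0 T] t) (𝓝 0)

lemma norm_fc_sq_le (hab : ∀ i, a i < b i) {v : Sp d → ℂ} (hv : MemLp v 2 (boxMeasure a b))
    (k : Fin d → ℤ) :
    ‖fc a b v k‖ ^ 2 ≤ (boxVol a b)⁻¹ * (eLpNorm v 2 (boxMeasure a b)).toReal ^ 2 := by
  have h1 : ‖fc a b v k‖ ^ 2 ≤ (boxVol a b)⁻¹ * ∫ x, ‖v x‖ ^ 2 ∂(boxMeasure a b) :=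
    le_hasSum (hasSum_sq_fc hab hv) k fun _ _ => sq_nonneg _
  have h2 : (eLpNorm v 2 (boxMeasure a b)).toReal ^ 2 = ∫ x, ‖v x‖ ^ 2 ∂(boxMeasure a b) := by
    have h0 : 0 ≤ ∫ x, ‖v x‖ ^ 2 ∂(boxMeasure a b) := integral_nonneg fun _ => sq_nonneg _
    rw [hv.eLpNorm_eq_integral_rpow_norm (by norm_num) (by norm_num),
      ENNReal.toReal_ofReal (by positivity)]
    simp only [ENNReal.toReal_ofNat, Real.rpow_ofNat]
    rw [← Real.rpow_natCast, ← Real.rpow_mul h0]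
    norm_num
  rwa [h2]

lemma symbol_single_two (i : Fin d) (k : Fin d → ℤ) :
    symbol a b (Pi.single i 2) k = -((freq a b k i ^ 2 : ℝ) : ℂ) := by
  classical
  rw [symbol, Finset.prod_eq_single i (fun j _ hj => by simp [hj]) (by simp)]
  simp [mul_pow]

lemma fc_sum (hab : ∀ i, a i < b i) {ι : Type*} (s : Finset ι) {v : ι → Sp d → ℂ}
    (hv : ∀ i, MemLp (v i) 2 (boxMeasure a b)) (k : Fin d → ℤ) :
    fc a b (fun x => ∑ i ∈ s, v i x) k = ∑ i ∈ s, fc a b (v i) k := by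
  classical
  induction s using Finset.induction_on with
  | empty => simp [fc]
  | insert j s hj ih =>
    rw [Finset.sum_insert hj, ← ih]
    have : (fun x => ∑ i ∈ insert j s, v i x) = v j + fun x => ∑ i ∈ s, v i x := by
      ext x; simp [Finset.sum_insert hj]
    rw [this, fc_add hab (hv j) (memLp_finsetSum _ fun i _ => hv i)]
    rfl

lemma contDiff_partialD {φ : Sp d → ℂ} (hφ : ContDiff ℝ (⊤ : ℕ∞) φ) (i : Fin d) :
    ContDiff ℝ (⊤ : ℕ∞) (partialD i φ) :=
  (hφ.fderiv_right (m := (⊤ : ℕ∞)) (by simp)).clm_apply contDiff_const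

lemma contDiff_multiD {φ : Sp d → ℂ} (hφ : ContDiff ℝ (⊤ : ℕ∞) φ) (α : Fin d → ℕ) :
    ContDiff ℝ (⊤ : ℕ∞) (multiD α φ) := by
  unfold multiD
  induction List.finRange d with
  | nil => exact hφ
  | cons i l ih =>
    simp only [List.foldr_cons]
    induction α i with
    | zero => exact ih
    | succ n ih' =>
      rw [Function.iterate_succ_apply']
      exact contDiff_partialD ih' i

lemma MemHp.sub (hab : ∀ i, a i < b i) {s : ℕ} {v w : Sp d → ℂ} (hv : MemHp a b s v)
    (hw : MemHp a b s w) : MemHp a b s (v - w) := fun α hα => by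
  obtain ⟨g, hg⟩ := hv α hα
  obtain ⟨g', hg'⟩ := hw α hα
  exact ⟨g - g', hg.sub hab hg' fun φ hφ => (contDiff_multiD hφ.1 α).continuous⟩

/-- A Fourier coefficient is a continuous functional on L², so the L² difference quotients and the
equation pass to each mode. Continuity in H² transfers by the equivalence of norms. -/
lemma IsExactSolution.strongSolution (hd : 1 ≤ d) (hd3 : d ≤ 3) (hab : ∀ i, a i < b i) {n : ℕ}
    (hn : AdmissibleExponent d n) {L : ℝ} (hL : 0 < L) {f : ℝ × ℝ × Sp d → ℝ} (hfc : Continuous f)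
    (hf : LocallyLipschitzGrowth n L f) {T : ℝ} {u₀ : Sp d → ℝ} {u : ℝ → Sp d → ℝ}
    (hu : IsExactSolution a b T f u₀ u) :
    StrongSolution a b T f (fun t => cplx (u t))
      (fun t i => weakDeriv a b (Pi.single i 1) (cplx (u t))) := by
  have hG : ∀ t ∈ Set.Icc 0 T, _ := fun t ht => (hu.memHp t ht).isGrad hab one_le_two
  have hm : ∀ t ∈ Set.Icc 0 T, _ := fun t ht => ((hu.memHp t ht).hs_le hab).1
  have hL2 : ∀ t ∈ Set.Icc 0 T, MemLp (cplx (u t)) 2 (boxMeasure a b) := fun t ht => (hG t ht).memLp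
  refine ⟨hG, hm, fun t ht k => ?_, fun t ht => ?_⟩
  · obtain ⟨u', hu'⟩ := hu.equation
    obtain ⟨hq, he⟩ := hu' t ht
    have hF := memLp_react hd hd3 hab hn hL hfc hf t (hG t ht) (hm t ht)
    have hW : ∀ i : Fin d, IsWeakDeriv a b (Pi.single i 2) (cplx (u t))
        (weakDeriv a b (Pi.single i 2) (cplx (u t))) := fun i =>
      weakDeriv_spec (hu.memHp t ht _ (by simp))
    have hS : MemLp (fun x => ∑ i, weakDeriv a b (Pi.single i 2) (cplx (u t)) x) 2
        (boxMeasure a b) := memLp_finsetSum _ fun i _ => (hW i).2.1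
    have he' : cplx (u' t) =ᵐ[boxMeasure a b]
        (fun x => ∑ i, weakDeriv a b (Pi.single i 2) (cplx (u t)) x)
          + react f t (cplx (u t)) (fun i => weakDeriv a b (Pi.single i 1) (cplx (u t))) := by
      filter_upwards [he] with x hx
      exact hx
    have hu'2 : MemLp (cplx (u' t)) 2 (boxMeasure a b) := (hS.add hF).ae_eq he'.symm
    have hder : -((wt a b k - 1 : ℝ) : ℂ) * fc a b (cplx (u t)) k
        + fc a b (react f t (cplx (u t)) fun i => weakDeriv a b (Pi.single i 1) (cplx (u t))) k
        = fc a b (cplx (u' t)) k := by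
      rw [fc_congr he', fc_add hab hS hF, Pi.add_apply, fc_sum hab _ fun i => (hW i).2.1]
      congr 1
      simp only [fun i => (hW i).fc_eq hab k, symbol_single_two, ← Finset.sum_mul, wt]
      simp
    rw [hder, hasDerivWithinAt_iff_tendsto_slope]
    have hkey : ∀ s ∈ Set.Icc 0 T \ {t},
        ‖slope (fun s => fc a b (cplx (u s)) k) t s - fc a b (cplx (u' t)) k‖ ^ 2
          ≤ (boxVol a b)⁻¹ * (eLpNorm (fun x => (s - t)⁻¹ * (u s x - u t x) - u' t x) 2
            (boxMeasure a b)).toReal ^ 2 := fun s hst => by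
      have e1 : (cplx fun x => (s - t)⁻¹ * (u s x - u t x) - u' t x)
          = (fun x => (((s - t)⁻¹ : ℝ) : ℂ) * (cplx (u s) - cplx (u t)) x) - cplx (u' t) := by
        ext x; simp [cplx]
      have hd2 := ((hL2 s hst.1).sub (hL2 t ht)).const_mul (((s - t)⁻¹ : ℝ) : ℂ)
      have e2 : fc a b (cplx fun x => (s - t)⁻¹ * (u s x - u t x) - u' t x) k
          = slope (fun s => fc a b (cplx (u s)) k) t s - fc a b (cplx (u' t)) k := by
        rw [e1, fc_sub hab hd2 hu'2, fc_const_mul, fc_sub hab (hL2 s hst.1) (hL2 t ht)]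
        simp [slope]
      have h3 := norm_fc_sq_le hab (v := cplx fun x => (s - t)⁻¹ * (u s x - u t x) - u' t x)
        (by rw [e1]; exact hd2.sub hu'2) k
      rw [e2] at h3
      refine h3.trans_eq ?_
      congr 3
      refine eLpNorm_congr_norm_ae (Eventually.of_forall fun x => ?_)
      exact Complex.norm_real _
    have hz : Tendsto (fun s => (boxVol a b)⁻¹ *
        (eLpNorm (fun x => (s - t)⁻¹ * (u s x - u t x) - u' t x) 2 (boxMeasure a b)).toReal ^ 2)
        (𝓝[Set.Icc 0 T \ {t}] t) (𝓝 0) := by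
      have := (((ENNReal.tendsto_toReal ENNReal.zero_ne_top).comp hq).pow 2).const_mul
        (boxVol a b)⁻¹
      simpa using this
    have h4 : Tendsto (fun s => ‖slope (fun s => fc a b (cplx (u s)) k) t s
        - fc a b (cplx (u' t)) k‖ ^ 2) (𝓝[Set.Icc 0 T \ {t}] t) (𝓝 0) :=
      tendsto_of_tendsto_of_tendsto_of_le_of_le' tendsto_const_nhds hz
        (Eventually.of_forall fun _ => sq_nonneg _)
        (eventually_nhdsWithin_of_forall hkey)
    rw [tendsto_iff_norm_sub_tendsto_zero]
    have h5 := h4.sqrt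
    simpa using h5
  · have hc := (hu.continuous t ht).pow 2 |>.const_mul ((1 + (d : ℝ)) ^ (2 + 1) * (boxVol a b)⁻¹)
    simp only [ne_eq, OfNat.ofNat_ne_zero, not_false_eq_true, zero_pow, mul_zero] at hc
    refine tendsto_of_tendsto_of_tendsto_of_le_of_le' tendsto_const_nhds hc
      (Eventually.of_forall fun _ => hs_nonneg _ _) (eventually_nhdsWithin_of_forall fun s hst => ?_)
    rw [← fc_sub hab (hL2 s hst) (hL2 t ht)]
    exact (((hu.memHp s hst).sub hab (hu.memHp t ht)).hs_le hab).2

lemma hs_smul_sq {s : ℕ} {c c' : (Fin d → ℤ) → ℂ} (h : ∀ k, ‖c k‖ = ‖c' k‖) :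
    hs a b s c = hs a b s c' := by
  simp only [hs, h]

/-! ### Uniformity in time by compactness -/

namespace StrongSolution

variable {T : ℝ} {f : ℝ × ℝ × Sp d → ℝ} {U : ℝ → Sp d → ℂ} {G : ℝ → Fin d → Sp d → ℂ}

lemma continuousOn_coeff (h : StrongSolution a b T f U G) (k : Fin d → ℤ) :
    ContinuousOn (fun t => fc a b (U t) k) (Set.Icc 0 T) := fun t ht =>
  (h.deriv t ht k).continuousWithinAt

/-- Compactness of [0,T]: the bound holds near each time by continuity in H² and is stable under
unions. -/
lemma exists_hs_le (h : StrongSolution a b T f U G) :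
    ∃ M > 0, ∀ t ∈ Set.Icc 0 T, hs a b 2 (fc a b (U t)) ≤ M := by
  refine isCompact_Icc.induction_on (p := fun A => ∃ M > 0, ∀ t ∈ A, t ∈ Set.Icc 0 T →
    hs a b 2 (fc a b (U t)) ≤ M) ⟨1, one_pos, by simp⟩ ?_ ?_ ?_ |>.imp
      fun M hM => ⟨hM.1, fun t ht => hM.2 t ht ht⟩
  · rintro A A' hAA' ⟨M, hM, h1⟩
    exact ⟨M, hM, fun t ht => h1 t (hAA' ht)⟩
  · rintro A A' ⟨M, hM, h1⟩ ⟨M', hM', h2⟩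
    refine ⟨M + M', by positivity, fun t ht htT => ?_⟩
    rcases ht with ht | ht
    · linarith [h1 t ht htT]
    · linarith [h2 t ht htT]
  · intro t ht
    have h1 := (h.tendsto t ht).eventually (ge_mem_nhds (zero_lt_one' ℝ))
    refine ⟨_, h1, 2 * 1 + 2 * hs a b 2 (fc a b (U t)),
      by have := hs_nonneg (a := a) (b := b) 2 (fc a b (U t)); positivity, fun s hs1 hsT => ?_⟩
    have h2 := (((h.hmem s hsT).sub (h.hmem t ht)).1.add (h.hmem t ht)).2
    rw [sub_add_cancel] at h2
    have : hs a b 2 (fc a b (U s) - fc a b (U t)) ≤ 1 := hs1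
    linarith

/-- Trajectories continuous in H² have compact range, so one finite set serves all times. The
quarters compensate for the factors 2 of the squared triangle inequality. -/
lemma exists_tail_le (h : StrongSolution a b T f U G) {ε : ℝ} (hε : 0 < ε) :
    ∃ K : Finset (Fin d → ℤ), ∀ t ∈ Set.Icc 0 T, hs a b 2 (tailCoeff K (fc a b (U t))) ≤ ε := by
  classical
  refine isCompact_Icc.induction_on (p := fun A => ∃ K : Finset (Fin d → ℤ), ∀ t ∈ A,
    t ∈ Set.Icc 0 T → hs a b 2 (tailCoeff K (fc a b (U t))) ≤ ε) ⟨∅, by simp⟩ ?_ ?_ ?_ |>.imp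
      fun M hM => fun t ht => hM t ht ht
  · rintro A A' hAA' ⟨K, h1⟩
    exact ⟨K, fun t ht => h1 t (hAA' ht)⟩
  · rintro A A' ⟨K, h1⟩ ⟨K', h2⟩
    refine ⟨K ∪ K', fun t ht htT => ?_⟩
    rcases ht with ht | ht
    · exact (hs_tail_anti (h.hmem t htT) Finset.subset_union_left).trans (h1 t ht htT)
    · exact (hs_tail_anti (h.hmem t htT) Finset.subset_union_right).trans (h2 t ht htT)
  · intro t ht
    have h1 := (h.tendsto t ht).eventually (ge_mem_nhds (show 0 < ε / 4 by positivity))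
    obtain ⟨K, hK⟩ := (h.hmem t ht).exists_tail_le (show 0 < ε / 4 by positivity)
    refine ⟨_, h1, K, fun s hs1 hsT => ?_⟩
    have hd := (h.hmem s hsT).sub (h.hmem t ht)
    have h2 := ((hd.1.of_norm_le (norm_tailCoeff_le K _)).add
      ((h.hmem t ht).of_norm_le (norm_tailCoeff_le K _))).2
    rw [← tailCoeff_add, sub_add_cancel] at h2
    have h3 : hs a b 2 (fc a b (U s) - fc a b (U t)) ≤ ε / 4 := hs1
    have h4 := (hd.1.mono le_rfl (norm_tailCoeff_le K _)).2
    linarith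

lemma hasDerivWithinAt_norm_sq {c : ℝ → ℂ} {c' : ℂ} {s : Set ℝ} {t : ℝ}
    (h : HasDerivWithinAt c c' s t) :
    HasDerivWithinAt (fun t => ‖c t‖ ^ 2) (2 * (c' * conj (c t)).re) s t := by
  have h1 := h.norm_sq
  convert h1 using 2
  simp [Complex.inner]

end StrongSolution

/-! ### Translations and parabolic smoothing -/

lemma freq_single_mul (k : Fin d → ℤ) (i : Fin d) (h : ℝ) :
    fourierMode a b k (EuclideanSpace.single i h)
      = Complex.exp (Complex.I * ((freq a b k i * h : ℝ) : ℂ)) := by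
  classical
  rw [fourierMode_eq_exp]
  congr 3
  rw [Finset.sum_eq_single i] <;> simp +contextual

lemma norm_mode_sub_one_le (k : Fin d → ℤ) (i : Fin d) (h : ℝ) :
    ‖fourierMode a b k (EuclideanSpace.single i h) - 1‖ ^ 2 ≤ freq a b k i ^ 2 * h ^ 2 := by
  rw [freq_single_mul, ← mul_pow, ← sq_abs (_ * h)]
  exact pow_le_pow_left₀ (norm_nonneg _) (Real.norm_exp_I_mul_ofReal_sub_one_le) 2

/-- Jordan's inequality for the sine, with 2/π ≥ 1/2. It converts a difference quotient back into a
derivative on finitely many modes. -/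
lemma le_norm_mode_sub_one (k : Fin d → ℤ) (i : Fin d) {h : ℝ} (hk : |freq a b k i * h| ≤ 1) :
    freq a b k i ^ 2 * h ^ 2 ≤ 4 * ‖fourierMode a b k (EuclideanSpace.single i h) - 1‖ ^ 2 := by
  rw [freq_single_mul, Complex.norm_exp_I_mul_ofReal_sub_one]
  have h1 := Real.mul_abs_le_abs_sin (x := freq a b k i * h / 2) (by
    rw [abs_div, abs_two]; linarith [Real.pi_gt_three])
  have h2 : 1 / 2 ≤ 2 / Real.pi := by
    rw [div_le_div_iff₀ two_pos Real.pi_pos]; linarith [Real.pi_lt_four]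
  have h3 : 1 / 2 * |freq a b k i * h / 2| ≤ |Real.sin (freq a b k i * h / 2)| :=
    (mul_le_mul_of_nonneg_right h2 (abs_nonneg _)).trans h1
  rw [norm_mul, mul_pow, Real.norm_eq_abs, Real.norm_eq_abs, sq_abs]
  have h4 := pow_le_pow_left₀ (by positivity) h3 2
  rw [mul_pow, sq_abs] at h4
  nlinarith

namespace StrongSolution

variable {T : ℝ} {f : ℝ × ℝ × Sp d → ℝ} {U : ℝ → Sp d → ℂ} {G : ℝ → Fin d → Sp d → ℂ}

/-- Parabolic smoothing: the time integral of the square of the `H³` norm is finite. -/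
lemma exists_integral_H3_le (hd : 1 ≤ d) (hd3 : d ≤ 3) (hab : ∀ i, a i < b i) {n : ℕ}
    (hn : AdmissibleExponent d n) {L : ℝ} (hL : 0 < L) (hfc : Continuous f)
    (hf : LocallyLipschitzGrowth n L f) (hT : 0 < T) (h : StrongSolution a b T f U G) (i : Fin d) :
    ∃ C > 0, ∀ S₀ : Finset (Fin d → ℤ), ∑ k ∈ S₀, (wt a b k - 1) ^ 2 * freq a b k i ^ 2 *
      ∫ t in (0 : ℝ)..T, ‖fc a b (U t) k‖ ^ 2 ≤ C := by
  classical
  have hV := boxVol_pos hab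
  obtain ⟨C, hC, hreact⟩ := exists_react_sub_sq_le hd hab hn hL hfc hf
  obtain ⟨M, hM, hMt⟩ := h.exists_hs_le
  -- The H² part of the difference of reaction terms must take at most half of the dissipation J.
  -- The order of choices is τ, then K, then A and B, then C'.
  obtain ⟨τ, hτ, hτC⟩ : ∃ τ > 0, (boxVol a b)⁻¹ * (C * τ ^ (2 * n)) * 2 ≤ 1 / 2 := by
    have h1 : Tendsto (fun τ : ℝ => (boxVol a b)⁻¹ * (C * τ ^ (2 * n)) * 2) (𝓝[>] 0) (𝓝 0) := by
      have : Continuous fun τ : ℝ => (boxVol a b)⁻¹ * (C * τ ^ (2 * n)) * 2 := by fun_prop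
      have h2 := (this.tendsto 0).mono_left (nhdsWithin_le_nhds (s := Set.Ioi 0))
      have h3 : (2 * n) ≠ 0 := by have := hn.1; omega
      simpa [h3] using h2
    obtain ⟨τ, h2, h3⟩ := ((h1.eventually (ge_mem_nhds (show (0 : ℝ) < 1 / 2 by norm_num))).and
      self_mem_nhdsWithin).exists
    exact ⟨τ, h3, h2⟩
  obtain ⟨K, hK⟩ := h.exists_tail_le (show 0 < τ ^ 2 by positivity)
  obtain ⟨A, B, hA, hB, hctrl⟩ := exists_ctrl (a := a) (b := b) hd hd3 hab M K
  obtain ⟨C', hC', hreact'⟩ := hreact A B hA hB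
  set C'' := (boxVol a b)⁻¹ * (C' * M + C * τ ^ (2 * n) * (2 * M + 2)) with hC''
  have hC''0 : 0 ≤ C'' := by positivity
  refine ⟨4 * (2 * (C'' * T + M)), by positivity, fun S₀ => ?_⟩
  -- choice of the translation
  obtain ⟨η, hη, hη1⟩ : ∃ η > 0, ∀ k ∈ S₀, |freq a b k i * η| ≤ 1 := by
    refine ⟨(1 + ∑ k ∈ S₀, |freq a b k i|)⁻¹, by positivity, fun k hk => ?_⟩
    have h1 := Finset.single_le_sum (f := fun k => |freq a b k i|) (fun _ _ => abs_nonneg _) hk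
    have h2 : 0 < 1 + ∑ k ∈ S₀, |freq a b k i| := by positivity
    rw [abs_mul, abs_inv, abs_of_pos h2, ← div_eq_mul_inv, div_le_one h2]
    linarith
  set y : Sp d := EuclideanSpace.single i η with hy
  set z : (Fin d → ℤ) → ℂ := fun k => fourierMode a b k y with hz
  -- Modes outside S contribute at most 4·η²/4 to the squared H² norm of the difference, since |z k
  -- − 1| ≤ 2. The set K₁ depends on η, but the final constant does not.
  obtain ⟨K₁, hK₁⟩ := h.exists_tail_le (show 0 < η ^ 2 / 4 by positivity)
  set S := S₀ ∪ K₁ with hS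
  set lam : (Fin d → ℤ) → ℝ := fun k => wt a b k - 1 with hlam
  have hlam0 : ∀ k, 0 ≤ lam k := fun k => by
    simp only [hlam]; linarith [one_le_wt (a := a) (b := b) k]
  set J : ℝ → ℝ := fun t => ∑ k ∈ S, lam k ^ 2 * ‖z k - 1‖ ^ 2 * ‖fc a b (U t) k‖ ^ 2 with hJ
  set E : ℝ → ℝ := fun t => ∑ k ∈ S, lam k * ‖z k - 1‖ ^ 2 * ‖fc a b (U t) k‖ ^ 2 with hE
  have hzle : ∀ k, ‖z k - 1‖ ^ 2 ≤ freq a b k i ^ 2 * η ^ 2 := fun k => norm_mode_sub_one_le k i η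
  have hz2 : ∀ k, ‖z k - 1‖ ≤ 2 := fun k => by
    refine (norm_sub_le _ _).trans ?_
    simp only [hz, norm_fourierMode, norm_one]; norm_num
  set φ : ℝ → (Fin d → ℤ) → ℂ := fun t => fc a b (U t) with hφ
  -- the translated solution
  have hUs : ∀ t ∈ Set.Icc 0 T, IsGrad a b (fun x => U t (shift a b y x))
      (fun i x => G t i (shift a b y x)) := fun t ht => (h.isGrad t ht).shift hab y
  have hfs : ∀ t ∈ Set.Icc 0 T, fc a b (fun x => U t (shift a b y x)) = fun k => z k * φ t k :=
    fun t ht => funext fun k => fc_shift hab (h.isGrad t ht).memLp.1 y k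
  have hw : ∀ t ∈ Set.Icc 0 T, fc a b ((fun x => U t (shift a b y x)) - U t)
      = fun k => (z k - 1) * φ t k := fun t ht => by
    rw [fc_sub hab (hUs t ht).memLp (h.isGrad t ht).memLp, hfs t ht]
    ext k; simp only [Pi.sub_apply]; ring
  have hFmem : ∀ t ∈ Set.Icc 0 T, MemLp (react f t (U t) (G t)) 2 (boxMeasure a b) := fun t ht =>
    memLp_react hd hd3 hab hn hL hfc hf t (h.isGrad t ht) (h.hmem t ht)
  have hzn : ∀ t k, ‖z k * φ t k‖ = ‖φ t k‖ := fun t k => by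
    simp [hz, norm_fourierMode]
  have hcU : ∀ t ∈ Set.Icc 0 T, Ctrl a b A B τ (U t) (G t) := fun t ht =>
    hctrl τ _ _ (h.isGrad t ht) (h.hmem t ht) (hMt t ht) (hK t ht)
  have hcS : ∀ t ∈ Set.Icc 0 T, Ctrl a b A B τ (fun x => U t (shift a b y x))
      (fun i x => G t i (shift a b y x)) := fun t ht => by
    refine hctrl τ _ _ (hUs t ht) ?_ ?_ ?_
    · rw [hfs t ht]; exact (h.hmem t ht).of_norm_le fun k => (hzn t k).le
    · rw [hfs t ht, hs_smul_sq (hzn t)]; exact hMt t ht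
    · rw [hfs t ht]
      refine (((h.hmem t ht).of_norm_le (norm_tailCoeff_le K _)).mono le_rfl
        (norm_tailCoeff_le_of_norm_le K fun k => (hzn t k).le)).2.trans (hK t ht)
  have hw2 : ∀ t ∈ Set.Icc 0 T, Hmem a b 2 (fun k => (z k - 1) * φ t k) := fun t ht => by
    refine (Hmem.of_le (C := 4) (h.hmem t ht) fun k => ?_).1
    rw [norm_mul, mul_pow]
    have h1 : ‖z k - 1‖ ^ 2 ≤ 4 := by nlinarith [hz2 k, norm_nonneg (z k - 1)]
    have h2 := mul_le_mul_of_nonneg_right h1 (hs_term_nonneg (a := a) (b := b) 2 (φ t) k)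
    calc _ = ‖z k - 1‖ ^ 2 * (wt a b k ^ 2 * ‖φ t k‖ ^ 2) := by ring
      _ ≤ _ := h2
  have hw1 : ∀ t ∈ Set.Icc 0 T, hs a b 1 (fun k => (z k - 1) * φ t k) ≤ η ^ 2 * M := fun t ht => by
    refine (Hmem.of_le (C := η ^ 2) (s := 1) (h.hmem t ht) fun k => ?_).2.trans
      (mul_le_mul_of_nonneg_left (hMt t ht) (sq_nonneg _))
    rw [norm_mul, mul_pow, pow_one]
    have hk := wt_pos (a := a) (b := b) k
    calc wt a b k * (‖z k - 1‖ ^ 2 * ‖φ t k‖ ^ 2)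
        ≤ wt a b k * ((wt a b k * η ^ 2) * ‖φ t k‖ ^ 2) := by
          gcongr
          exact (hzle k).trans (mul_le_mul_of_nonneg_right (freq_sq_le_wt k i) (sq_nonneg _))
      _ = _ := by ring
  have hwH2 : ∀ t ∈ Set.Icc 0 T, hs a b 2 (fun k => (z k - 1) * φ t k)
      ≤ 2 * J t + (2 * M + 2) * η ^ 2 := fun t ht => by
    rw [(hw2 t ht).hs_eq_sum_add S]
    have hw1m : Hmem a b 1 (fun k => (z k - 1) * φ t k) :=
      ((hw2 t ht).mono one_le_two fun _ => le_rfl).1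
    have e1 : ∑ k ∈ S, wt a b k ^ 2 * ‖(z k - 1) * φ t k‖ ^ 2
        ≤ 2 * J t + 2 * hs a b 1 (fun k => (z k - 1) * φ t k) := by
      refine le_trans ?_ (add_le_add_right
        (mul_le_mul_of_nonneg_left (hw1m.sum_le S) zero_le_two) _)
      simp only [hJ, Finset.mul_sum, ← Finset.sum_add_distrib, norm_mul, mul_pow]
      refine Finset.sum_le_sum fun k _ => ?_
      have h1 : wt a b k ^ 2 ≤ 2 * lam k ^ 2 + 2 * wt a b k ^ 1 := by
        have := one_le_wt (a := a) (b := b) k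
        simp only [hlam]; nlinarith [sq_nonneg (wt a b k - 1)]
      have h2 := mul_le_mul_of_nonneg_right h1
        (mul_nonneg (sq_nonneg ‖z k - 1‖) (sq_nonneg ‖φ t k‖))
      simp only [hφ] at h2 ⊢
      linarith
    have e2 : hs a b 2 (tailCoeff S fun k => (z k - 1) * φ t k) ≤ η ^ 2 := by
      have h1 : hs a b 2 (tailCoeff S (φ t)) ≤ η ^ 2 / 4 :=
        (hs_tail_anti (h.hmem t ht) Finset.subset_union_right).trans (hK₁ t ht)
      refine (Hmem.of_le (C := 4) ((h.hmem t ht).of_norm_le (norm_tailCoeff_le S _))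
        fun k => ?_).2.trans (by linarith)
      simp only [tailCoeff]
      split_ifs
      · simp
      · rw [norm_mul, mul_pow]
        have h1 : ‖z k - 1‖ ^ 2 ≤ 4 := by nlinarith [hz2 k, norm_nonneg (z k - 1)]
        have h2 := mul_le_mul_of_nonneg_right h1 (hs_term_nonneg (a := a) (b := b) 2 (φ t) k)
        simp only [hφ] at h2 ⊢
        linarith
    have := hw1 t ht
    linarith [sq_nonneg η]
  -- the energy inequality
  have hR : ∀ t ∈ Set.Icc 0 T,
      ∑ k ∈ S, ‖(z k - 1) * fc a b (react f t (U t) (G t)) k‖ ^ 2 ≤ 1 / 2 * J t + C'' * η ^ 2 :=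
    fun t ht => by
    obtain ⟨i1, i2⟩ := hreact' τ t _ _ _ _ hτ (hcS t ht) (hcU t ht) (by rw [hw t ht]; exact hw2 t ht)
    rw [hw t ht] at i2
    have e1 : fc a b (react f t (fun x => U t (shift a b y x)) (fun i x => G t i (shift a b y x))
        - react f t (U t) (G t)) = fun k => (z k - 1) * fc a b (react f t (U t) (G t)) k := by
      -- Since f has no explicit dependence on x, the reaction term commutes with translations.
      have e0 : react f t (fun x => U t (shift a b y x)) (fun i x => G t i (shift a b y x))
          = fun x => react f t (U t) (G t) (shift a b y x) := rfl
      have e2 : MemLp (fun x => react f t (U t) (G t) (shift a b y x)) 2 (boxMeasure a b) :=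
        (hFmem t ht).comp_measurePreserving (measurePreserving_shift hab y)
      rw [e0, fc_sub hab e2 (hFmem t ht)]
      ext k
      rw [Pi.sub_apply, fc_shift hab (hFmem t ht).1]
      ring
    have h1 := hasSum_sq_fc hab i1
    rw [e1] at h1
    have h2 := sum_le_hasSum S (fun _ _ => sq_nonneg _) h1
    refine h2.trans ?_
    have hJ0 : 0 ≤ J t := Finset.sum_nonneg fun k _ => by positivity
    have hbd := hwH2 t ht
    have hc1 := hw1 t ht
    simp only [Pi.sub_apply]
    calc _ ≤ (boxVol a b)⁻¹ * (C' * (η ^ 2 * M)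
            + C * τ ^ (2 * n) * (2 * J t + (2 * M + 2) * η ^ 2)) := by
          refine mul_le_mul_of_nonneg_left (i2.trans ?_) (by positivity)
          gcongr
      _ = (boxVol a b)⁻¹ * (C * τ ^ (2 * n)) * 2 * J t + C'' * η ^ 2 := by rw [hC'']; ring
      _ ≤ _ := by gcongr
  have hEd : ∀ t ∈ Set.Icc 0 T, HasDerivWithinAt E (∑ k ∈ S, lam k * ‖z k - 1‖ ^ 2 *
      (2 * ((-(lam k : ℂ) * φ t k + fc a b (react f t (U t) (G t)) k) * conj (φ t k)).re))
      (Set.Icc 0 T) t := fun t ht => by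
    refine HasDerivWithinAt.fun_sum fun k _ => ?_
    exact (hasDerivWithinAt_norm_sq (h.deriv t ht k)).const_mul _
  have hEle : ∀ t ∈ Set.Icc 0 T, (∑ k ∈ S, lam k * ‖z k - 1‖ ^ 2 *
      (2 * ((-(lam k : ℂ) * φ t k + fc a b (react f t (U t) (G t)) k) * conj (φ t k)).re))
      ≤ -(1 / 2) * J t + C'' * η ^ 2 := fun t ht => by
    have e1 : (∑ k ∈ S, lam k * ‖z k - 1‖ ^ 2 *
      (2 * ((-(lam k : ℂ) * φ t k + fc a b (react f t (U t) (G t)) k) * conj (φ t k)).re))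
        ≤ -J t + ∑ k ∈ S, ‖(z k - 1) * fc a b (react f t (U t) (G t)) k‖ ^ 2 := by
      rw [hJ, ← Finset.sum_neg_distrib, ← Finset.sum_add_distrib]
      refine Finset.sum_le_sum fun k _ => ?_
      set r := fc a b (react f t (U t) (G t)) k
      have h1 : ((-(lam k : ℂ) * φ t k + r) * conj (φ t k)).re
          = -lam k * ‖φ t k‖ ^ 2 + (r * conj (φ t k)).re := by
        rw [add_mul, Complex.add_re, mul_assoc, Complex.mul_conj, Complex.normSq_eq_norm_sq]
        congr 1
        rw [← Complex.ofReal_neg, ← Complex.ofReal_mul, Complex.ofReal_re]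
      have h2 : (r * conj (φ t k)).re ≤ ‖r‖ * ‖φ t k‖ := by
        refine (Complex.re_le_norm _).trans_eq ?_
        rw [norm_mul, RCLike.norm_conj]
      rw [h1, norm_mul, mul_pow]
      -- Completing the square: the cross term with r takes one of the two copies of the
      -- dissipation.
      have h3 : 0 ≤ ‖z k - 1‖ ^ 2 * (lam k * ‖φ t k‖ - ‖r‖) ^ 2 := by positivity
      have h4 := mul_le_mul_of_nonneg_left h2
        (mul_nonneg (hlam0 k) (sq_nonneg ‖z k - 1‖))
      change lam k * ‖z k - 1‖ ^ 2 * (2 * (-lam k * ‖φ t k‖ ^ 2 + (r * conj (φ t k)).re)) ≤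
        -(lam k ^ 2 * ‖z k - 1‖ ^ 2 * ‖φ t k‖ ^ 2) + ‖z k - 1‖ ^ 2 * ‖r‖ ^ 2
      nlinarith
    linarith [hR t ht]
  have hcoef : ∀ k, ContinuousOn (fun t => ‖φ t k‖ ^ 2) (Set.Icc 0 T) := fun k =>
    (h.continuousOn_coeff k).norm.pow 2
  have hJc : ContinuousOn J (Set.Icc 0 T) :=
    continuousOn_finsetSum _ fun k _ => continuousOn_const.mul (hcoef k)
  have hEc : ContinuousOn E (Set.Icc 0 T) := fun t ht => (hEd t ht).continuousWithinAt
  have hφi : ∀ k, IntervalIntegrable (fun t => ‖φ t k‖ ^ 2) volume 0 T := fun k =>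
    ContinuousOn.intervalIntegrable (by rw [Set.uIcc_of_le hT.le]; exact hcoef k)
  have hJi : IntervalIntegrable J volume 0 T :=
    ContinuousOn.intervalIntegrable (by rw [Set.uIcc_of_le hT.le]; exact hJc)
  have hint : E T - E 0 ≤ ∫ t in (0 : ℝ)..T, (-(1 / 2) * J t + C'' * η ^ 2) := by
    refine intervalIntegral.sub_le_integral_of_hasDeriv_right_of_le hT.le hEc
      (fun t ht => ((hEd t (Set.Ioo_subset_Icc_self ht)).hasDerivAt
        (Icc_mem_nhds ht.1 ht.2)).hasDerivWithinAt) ?_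
      fun t ht => hEle t (Set.Ioo_subset_Icc_self ht)
    exact ((hJc.const_smul (-(1 / 2) : ℝ)).add continuousOn_const).integrableOn_Icc
  have hET : 0 ≤ E T := Finset.sum_nonneg fun k _ =>
    mul_nonneg (mul_nonneg (hlam0 k) (sq_nonneg _)) (sq_nonneg _)
  have hT0 : (0 : ℝ) ∈ Set.Icc 0 T := ⟨le_rfl, hT.le⟩
  have hE0 : E 0 ≤ η ^ 2 * M := by
    refine le_trans ?_ (mul_le_mul_of_nonneg_left (((h.hmem 0 hT0).sum_le S).trans (hMt 0 hT0))
      (sq_nonneg _))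
    rw [Finset.mul_sum]
    refine Finset.sum_le_sum fun k _ => ?_
    have h1 := freq_sq_le_wt (a := a) (b := b) k i
    have h2 : lam k ≤ wt a b k := by simp only [hlam]; linarith
    calc lam k * ‖z k - 1‖ ^ 2 * ‖fc a b (U 0) k‖ ^ 2
        ≤ wt a b k * (wt a b k * η ^ 2) * ‖fc a b (U 0) k‖ ^ 2 := by
          gcongr
          · exact (wt_pos k).le
          · exact (hzle k).trans (mul_le_mul_of_nonneg_right h1 (sq_nonneg _))
      _ = _ := by ring
  have hJint : ∫ t in (0 : ℝ)..T, J t ≤ 2 * (C'' * T + M) * η ^ 2 := by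
    rw [intervalIntegral.integral_add (hJi.const_mul _) (by simp),
      intervalIntegral.integral_const_mul, intervalIntegral.integral_const] at hint
    simp only [sub_zero, smul_eq_mul] at hint
    nlinarith
  have hJsum : ∫ t in (0 : ℝ)..T, J t
      = ∑ k ∈ S, lam k ^ 2 * ‖z k - 1‖ ^ 2 * ∫ t in (0 : ℝ)..T, ‖φ t k‖ ^ 2 := by
    rw [hJ, intervalIntegral.integral_finsetSum fun k _ => (hφi k).const_mul _]
    exact Finset.sum_congr rfl fun k _ => intervalIntegral.integral_const_mul _ _
  have hyk : ∀ k, 0 ≤ ∫ t in (0 : ℝ)..T, ‖φ t k‖ ^ 2 := fun k =>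
    intervalIntegral.integral_nonneg hT.le fun _ _ => sq_nonneg _
  -- The energy bound is of order η² with a constant independent of S₀ and η, so the division by η²
  -- yields a bound on derivatives.
  refine le_of_mul_le_mul_right ?_ (show 0 < η ^ 2 by positivity)
  calc _ = ∑ k ∈ S₀, lam k ^ 2 * (freq a b k i ^ 2 * η ^ 2) *
        ∫ t in (0 : ℝ)..T, ‖φ t k‖ ^ 2 := by
        rw [Finset.sum_mul]; exact Finset.sum_congr rfl fun k _ => by ring
    _ ≤ ∑ k ∈ S₀, lam k ^ 2 * (4 * ‖z k - 1‖ ^ 2) * ∫ t in (0 : ℝ)..T, ‖φ t k‖ ^ 2 :=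
        Finset.sum_le_sum fun k hk => mul_le_mul_of_nonneg_right (mul_le_mul_of_nonneg_left
          (le_norm_mode_sub_one k i (hη1 k hk)) (sq_nonneg _)) (hyk k)
    _ = 4 * ∑ k ∈ S₀, lam k ^ 2 * ‖z k - 1‖ ^ 2 * ∫ t in (0 : ℝ)..T, ‖φ t k‖ ^ 2 := by
        rw [Finset.mul_sum]; exact Finset.sum_congr rfl fun k _ => by ring
    _ ≤ 4 * ∫ t in (0 : ℝ)..T, J t := by
        rw [hJsum]
        refine mul_le_mul_of_nonneg_left (Finset.sum_le_sum_of_subset_of_nonneg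
          Finset.subset_union_left fun k _ _ => mul_nonneg (by positivity) (hyk k)) (by norm_num)
    _ ≤ _ := by linarith

end StrongSolution

/-! ### The Galerkin system in Fourier variables -/

/-- The frequencies of the approximation space. -/
noncomputable def freqFin (Nv : Fin d → ℕ) : Finset (Fin d → ℤ) :=
  Fintype.piFinset fun j => Finset.Icc (-((Nv j / 2 : ℕ) : ℤ)) (((Nv j / 2 : ℕ) : ℤ) - 1)

lemma mem_freqFin {Nv : Fin d → ℕ} {k : Fin d → ℤ} : k ∈ freqFin Nv ↔ k ∈ freqSet Nv := by
  simp [freqFin, freqSet]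

lemma trig_mem_fourierSpace (Nv : Fin d → ℕ) (c : (Fin d → ℤ) → ℂ) :
    trig a b (freqFin Nv) c ∈ fourierSpace a b Nv := by
  have : trig a b (freqFin Nv) c = ∑ k ∈ freqFin Nv, c k • fourierMode a b k := by
    ext x; simp [trig]
  rw [this]
  exact Submodule.sum_mem _ fun k hk => Submodule.smul_mem _ _
    (Submodule.subset_span ⟨k, mem_freqFin.1 hk, rfl⟩)

lemma fourierMode_mem_fourierSpace {Nv : Fin d → ℕ} {k : Fin d → ℤ} (hk : k ∈ freqFin Nv) :
    fourierMode a b k ∈ fourierSpace a b Nv :=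
  Submodule.subset_span ⟨k, mem_freqFin.1 hk, rfl⟩

lemma exists_trig_of_mem {Nv : Fin d → ℕ} {v : Sp d → ℂ} (hv : v ∈ fourierSpace a b Nv) :
    ∃ c, v = trig a b (freqFin Nv) c := by
  classical
  refine Submodule.span_induction ?_ ?_ ?_ ?_ hv
  · rintro _ ⟨k, hk, rfl⟩
    refine ⟨Pi.single k 1, ?_⟩
    ext x
    rw [trig, Finset.sum_eq_single k]
    · simp
    · intro l _ hl; simp [hl]
    · intro h; exact absurd (mem_freqFin.2 hk) h
  · exact ⟨0, by ext x; simp [trig]⟩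
  · rintro _ _ _ _ ⟨c, rfl⟩ ⟨c', rfl⟩
    exact ⟨c + c', by ext x; simp [trig, add_mul, Finset.sum_add_distrib]⟩
  · rintro r _ _ ⟨c, rfl⟩
    exact ⟨fun k => r * c k, by ext x; simp [trig, Finset.mul_sum, mul_assoc]⟩

lemma trig_fc_of_mem (hab : ∀ i, a i < b i) {Nv : Fin d → ℕ} {v : Sp d → ℂ}
    (hv : v ∈ fourierSpace a b Nv) : v = trig a b (freqFin Nv) (fc a b v) := by
  obtain ⟨c, rfl⟩ := exists_trig_of_mem hv
  rw [fc_trig hab]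
  exact trig_congr fun k hk => by simp [hk]

lemma l2Inner_trig (hab : ∀ i, a i < b i) {w : Sp d → ℂ} (hw : MemLp w 2 (boxMeasure a b))
    (S : Finset (Fin d → ℤ)) (c : (Fin d → ℤ) → ℂ) :
    l2Inner a b w (trig a b S c) = boxVol a b * ∑ k ∈ S, fc a b w k * conj (c k) := by
  have h1 := hasSum_fc_mul_conj hab hw (memLp_trig hab S c)
  have hV : (boxVol a b : ℂ) ≠ 0 := by exact_mod_cast (boxVol_pos hab).ne'
  have h2 : HasSum (fun k => fc a b w k * conj (fc a b (trig a b S c) k))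
      (∑ k ∈ S, fc a b w k * conj (c k)) := by
    rw [fc_trig hab]
    have : ∑ k ∈ S, fc a b w k * conj (c k)
        = ∑ k ∈ S, fc a b w k * conj (if k ∈ S then c k else 0) :=
      Finset.sum_congr rfl fun k hk => by simp [hk]
    rw [this]
    exact hasSum_sum_of_ne_finset_zero fun k hk => by simp [hk]
  rw [← h1.unique h2, l2Inner]
  field_simp

lemma dirichletForm_trig (hab : ∀ i, a i < b i) (S : Finset (Fin d → ℤ)) (c c' : (Fin d → ℤ) → ℂ) :
    dirichletForm a b (trig a b S c) (trig a b S c')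
      = boxVol a b * ∑ k ∈ S, ((wt a b k - 1 : ℝ) : ℂ) * c k * conj (c' k) := by
  have hspec : ∀ (c : (Fin d → ℤ) → ℂ) (i : Fin d), IsWeakDeriv a b (Pi.single i 1) (trig a b S c)
      (weakDeriv a b (Pi.single i 1) (trig a b S c)) := fun c i =>
    weakDeriv_spec ⟨_, isWeakDeriv_trig hab S c i⟩
  have hae : ∀ (c : (Fin d → ℤ) → ℂ) (i : Fin d), weakDeriv a b (Pi.single i 1) (trig a b S c)
      =ᵐ[boxMeasure a b] trigGrad a b S c i := fun c i =>
    ae_eq_of_fc_eq hab (hspec c i).2.1 (isWeakDeriv_trig hab S c i).2.1 (by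
      ext k; rw [(hspec c i).fc_eq hab, (isWeakDeriv_trig hab S c i).fc_eq hab])
  rw [dirichletForm]
  have h1 : ∀ i, l2Inner a b (weakDeriv a b (Pi.single i 1) (trig a b S c))
      (weakDeriv a b (Pi.single i 1) (trig a b S c'))
      = boxVol a b * ∑ k ∈ S, ((freq a b k i ^ 2 : ℝ) : ℂ) * c k * conj (c' k) := fun i => by
    have h2 : l2Inner a b (weakDeriv a b (Pi.single i 1) (trig a b S c))
      (weakDeriv a b (Pi.single i 1) (trig a b S c'))
      = l2Inner a b (trigGrad a b S c i) (trigGrad a b S c' i) := by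
      refine integral_congr_ae ?_
      filter_upwards [hae c i, hae c' i] with x h3 h4
      rw [h3, h4]
    rw [h2, trigGrad, trigGrad, l2Inner_trig hab (memLp_trig hab S _), fc_trig hab]
    congr 1
    refine Finset.sum_congr rfl fun k hk => ?_
    simp only [hk, if_true, map_mul, Complex.conj_I, Complex.conj_ofReal]
    push_cast
    linear_combination (-(freq a b k i : ℂ) ^ 2 * c k * conj (c' k)) * Complex.I_sq
  simp only [h1, ← Finset.mul_sum]
  congr 1
  rw [Finset.sum_comm]
  refine Finset.sum_congr rfl fun k _ => ?_
  simp only [wt, mul_assoc, ← Finset.sum_mul]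
  push_cast
  ring

/-- The right-hand side of the Galerkin system for the Fourier coefficients. -/
noncomputable def galerkinField (a b : Fin d → ℝ) (f : ℝ × ℝ × Sp d → ℝ) (S : Finset (Fin d → ℤ))
    (t : ℝ) (c : (Fin d → ℤ) → ℂ) (k : Fin d → ℤ) : ℂ :=
  -((wt a b k - 1 : ℝ) : ℂ) * c k + fc a b (react f t (trig a b S c) (trigGrad a b S c)) k

lemma reaction_trig_ae (hab : ∀ i, a i < b i) (f : ℝ × ℝ × Sp d → ℝ) (t : ℝ)
    (S : Finset (Fin d → ℤ)) (c : (Fin d → ℤ) → ℂ) :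
    reaction a b f t (trig a b S c) =ᵐ[boxMeasure a b]
      react f t (trig a b S c) (trigGrad a b S c) := by
  have hae : ∀ i : Fin d, weakDeriv a b (Pi.single i 1) (trig a b S c)
      =ᵐ[boxMeasure a b] trigGrad a b S c i := fun i => by
    have hspec : IsWeakDeriv a b (Pi.single i 1) (trig a b S c)
      (weakDeriv a b (Pi.single i 1) (trig a b S c)) := weakDeriv_spec ⟨_, isWeakDeriv_trig hab S c i⟩
    refine ae_eq_of_fc_eq hab hspec.2.1 (isWeakDeriv_trig hab S c i).2.1 (by
      ext k; rw [hspec.fc_eq hab, (isWeakDeriv_trig hab S c i).fc_eq hab])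
  filter_upwards [ae_all_iff.2 hae] with x hx
  simp only [reaction, react, hx]

lemma memLp_react_trig (hd : 1 ≤ d) (hd3 : d ≤ 3) (hab : ∀ i, a i < b i) {n : ℕ}
    (hn : AdmissibleExponent d n) {L : ℝ} (hL : 0 < L) {f : ℝ × ℝ × Sp d → ℝ} (hfc : Continuous f)
    (hf : LocallyLipschitzGrowth n L f) (t : ℝ) (S : Finset (Fin d → ℤ)) (c : (Fin d → ℤ) → ℂ) :
    MemLp (react f t (trig a b S c) (trigGrad a b S c)) 2 (boxMeasure a b) :=
  memLp_react hd hd3 hab hn hL hfc hf t (isGrad_trig hab S c) (Hmem_trig hab 2 S c).1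

lemma trig_injective (hab : ∀ i, a i < b i) {S : Finset (Fin d → ℤ)} {c c' : (Fin d → ℤ) → ℂ}
    (h : trig a b S c = trig a b S c') : ∀ k ∈ S, c k = c' k := fun k hk => by
  have := congrFun (congrArg (fc a b) h) k
  simpa [fc_trig hab, hk] using this

open Classical in
/-- The trigonometric polynomials with frequencies in `S`, parametrized by their coefficients. -/
noncomputable def trigLinear (a b : Fin d → ℝ) (S : Finset (Fin d → ℤ)) :
    (S → ℂ) →ₗ[ℂ] (Sp d → ℂ) where
  toFun c := fun x => ∑ k : S, c k * fourierMode a b k x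
  map_add' c c' := by ext x; simp [add_mul, Finset.sum_add_distrib]
  map_smul' r c := by ext x; simp [Finset.mul_sum, mul_assoc]

lemma trigLinear_restrict (S : Finset (Fin d → ℤ)) (c : (Fin d → ℤ) → ℂ) :
    trigLinear a b S (fun k => c k) = trig a b S c := by
  ext x
  simp only [trigLinear, LinearMap.coe_mk, AddHom.coe_mk, trig]
  exact Finset.sum_coe_sort S fun k => c k * fourierMode a b k x

/-- The coefficients embed linearly and injectively into functions with pointwise convergence. In
finite dimension this is a closed embedding, so the pointwise limit of difference quotients is again
a trigonometric polynomial and the coefficients converge. -/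
lemma hasDerivWithinAt_coeff (hab : ∀ i, a i < b i) {T : ℝ} (hT : 0 < T)
    {S : Finset (Fin d → ℤ)} {c : ℝ → (Fin d → ℤ) → ℂ} {t : ℝ} (ht : t ∈ Set.Icc 0 T)
    {v' : Sp d → ℂ}
    (h : ∀ x, HasDerivWithinAt (fun s => trig a b S (c s) x) (v' x) (Set.Icc 0 T) t) :
    ∃ c', v' = trig a b S c' ∧
      ∀ k ∈ S, HasDerivWithinAt (fun s => c s k) (c' k) (Set.Icc 0 T) t := by
  classical
  have hrep : ∀ e : S → ℂ, trigLinear a b S e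
      = trig a b S fun k => if hk : k ∈ S then e ⟨k, hk⟩ else 0 := fun e => by
    rw [← trigLinear_restrict]; congr 1; ext k; simp
  have hinj : LinearMap.ker (trigLinear a b S) = ⊥ := by
    rw [LinearMap.ker_eq_bot]
    intro c₁ c₂ h12
    rw [hrep, hrep] at h12
    ext k
    simpa using trig_injective hab h12 k k.2
  have hemb := LinearMap.isClosedEmbedding_of_injective hinj
  set l := 𝓝[Set.Icc 0 T \ {t}] t with hl
  have hne : l.NeBot := by
    have := (uniqueDiffOn_Icc hT t ht).accPt
    rw [accPt_iff_clusterPt, ClusterPt] at this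
    rw [hl, nhdsWithin, Set.sdiff_eq, ← Filter.inf_principal, inf_comm (𝓟 _)]
    exact this
  set q : ℝ → S → ℂ := fun s k => slope (fun s => c s k) t s with hq
  have hqt : ∀ s, trigLinear a b S (q s) = fun x => slope (fun s => trig a b S (c s) x) t s := by
    intro s
    ext x
    simp only [hq, slope, vsub_eq_sub, trigLinear, LinearMap.coe_mk, AddHom.coe_mk, trig]
    rw [← Finset.sum_sub_distrib, Finset.smul_sum,
      ← Finset.sum_coe_sort S fun k => (s - t)⁻¹ • (c s k * fourierMode a b k x
        - c t k * fourierMode a b k x)]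
    refine Finset.sum_congr rfl fun k _ => ?_
    rw [← sub_mul, smul_mul_assoc]
  have hlim : Tendsto (fun s => trigLinear a b S (q s)) l (𝓝 v') := by
    rw [tendsto_pi_nhds]
    intro x
    simp only [hqt]
    exact hasDerivWithinAt_iff_tendsto_slope.1 (h x)
  obtain ⟨e, he⟩ := hemb.isClosed_range.mem_of_tendsto hlim
    (Eventually.of_forall fun s => Set.mem_range_self _)
  rw [← he] at hlim
  have hq' := (hemb.isInducing.tendsto_nhds_iff (f := q)).2 hlim
  refine ⟨fun k => if hk : k ∈ S then e ⟨k, hk⟩ else 0, ?_, fun k hk => ?_⟩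
  · rw [← he, hrep]
  · rw [hasDerivWithinAt_iff_tendsto_slope]
    simpa [hk] using (tendsto_pi_nhds.1 hq') ⟨k, hk⟩

/-- A Galerkin solution, in terms of its Fourier coefficients. -/
lemma IsGalerkinSolution.coeff (hd : 1 ≤ d) (hd3 : d ≤ 3) (hab : ∀ i, a i < b i) {n : ℕ}
    (hn : AdmissibleExponent d n) {L : ℝ} (hL : 0 < L) {f : ℝ × ℝ × Sp d → ℝ} (hfc : Continuous f)
    (hf : LocallyLipschitzGrowth n L f) {T : ℝ} (hT : 0 < T) {u₀ : Sp d → ℝ}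
    (hu₀ : MemLp (cplx u₀) 2 (boxMeasure a b))
    {Nv : Fin d → ℕ} {uN : ℝ → Sp d → ℂ} (h : IsGalerkinSolution a b T f u₀ Nv uN) :
    ∃ c : ℝ → (Fin d → ℤ) → ℂ, (∀ t ∈ Set.Icc 0 T, uN t = trig a b (freqFin Nv) (c t)) ∧
      (∀ k ∈ freqFin Nv, c 0 k = fc a b (cplx u₀) k) ∧
      ∀ t ∈ Set.Icc 0 T, ∀ k ∈ freqFin Nv, HasDerivWithinAt (fun s => c s k)
        (galerkinField a b f (freqFin Nv) t (c t) k) (Set.Icc 0 T) t := by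
  have hV : (boxVol a b : ℂ) ≠ 0 := by exact_mod_cast (boxVol_pos hab).ne'
  set S := freqFin Nv with hS
  have htrig : ∀ t ∈ Set.Icc 0 T, uN t = trig a b S (fc a b (uN t)) := fun t ht =>
    trig_fc_of_mem hab (h.mem t ht)
  have hT0 : (0 : ℝ) ∈ Set.Icc 0 T := ⟨le_rfl, hT.le⟩
  have hmode : ∀ k ∈ S, ∃ e : (Fin d → ℤ) → ℂ, fourierMode a b k = trig a b S e ∧
      ∀ g : (Fin d → ℤ) → ℂ, ∑ l ∈ S, g l * conj (e l) = g k := fun k hk => by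
    classical
    refine ⟨fun l => if l = k then 1 else 0, ?_, fun g => ?_⟩
    · ext x
      simp [trig, hk]
    · simp [apply_ite, hk]
  refine ⟨fun t => fc a b (uN t), htrig, fun k hk => ?_, fun t ht => ?_⟩
  · obtain ⟨e, he, hsum⟩ := hmode k hk
    have h1 := h.initial.2 _ (fourierMode_mem_fourierSpace (a := a) (b := b) hk)
    have h2 : MemLp (uN 0) 2 (boxMeasure a b) := by rw [htrig 0 hT0]; exact memLp_trig hab _ _
    rw [he, l2Inner_trig hab (h2.sub hu₀), hsum, fc_sub hab h2 hu₀, mul_eq_zero] at h1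
    exact sub_eq_zero.1 (h1.resolve_left hV)
  · obtain ⟨uN', hN'⟩ := h.equation
    obtain ⟨h1, h2⟩ := hN' t ht
    have h3 : ∀ x, HasDerivWithinAt (fun s => trig a b S (fc a b (uN s)) x) (uN' t x)
        (Set.Icc 0 T) t := fun x =>
      (h1 x).congr (fun s hs => (congrFun (htrig s hs) x).symm) (congrFun (htrig t ht) x).symm
    obtain ⟨c', hc', hder⟩ := hasDerivWithinAt_coeff hab hT ht h3
    intro k hk
    have h4 := h2 _ (fourierMode_mem_fourierSpace (a := a) (b := b) hk)
    obtain ⟨e, he, hsum⟩ := hmode k hk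
    have hae := reaction_trig_ae hab f t S (fc a b (uN t))
    have hL2 := memLp_react_trig hd hd3 hab hn hL hfc hf t S (fc a b (uN t))
    rw [show reaction a b f t (trig a b S (fc a b (uN t))) = reaction a b f t (uN t) by
      rw [← htrig t ht]] at hae
    rw [he, hc', l2Inner_trig hab (memLp_trig hab _ _), hsum,
      l2Inner_trig hab (hL2.ae_eq hae.symm), hsum, fc_congr hae] at h4
    rw [show dirichletForm a b (uN t) (trig a b S e)
      = dirichletForm a b (trig a b S (fc a b (uN t))) (trig a b S e) by rw [← htrig t ht],
      dirichletForm_trig hab, hsum, fc_trig hab] at h4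
    beta_reduce at h4
    rw [if_pos hk, ← mul_add] at h4
    have h5 := mul_left_cancel₀ hV h4
    have h6 : c' k = galerkinField a b f S t (fc a b (uN t)) k := by
      rw [galerkinField, ← h5]
      ring
    rw [← h6]
    exact hder k hk

lemma isGalerkinSolution_of_coeff (hd : 1 ≤ d) (hd3 : d ≤ 3) (hab : ∀ i, a i < b i) {n : ℕ}
    (hn : AdmissibleExponent d n) {L : ℝ} (hL : 0 < L) {f : ℝ × ℝ × Sp d → ℝ} (hfc : Continuous f)
    (hf : LocallyLipschitzGrowth n L f) {T : ℝ} {u₀ : Sp d → ℝ}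
    (hu₀ : MemLp (cplx u₀) 2 (boxMeasure a b)) {Nv : Fin d → ℕ} {c : ℝ → (Fin d → ℤ) → ℂ}
    (h0 : ∀ k ∈ freqFin Nv, c 0 k = fc a b (cplx u₀) k)
    (h : ∀ t ∈ Set.Icc 0 T, ∀ k ∈ freqFin Nv, HasDerivWithinAt (fun s => c s k)
        (galerkinField a b f (freqFin Nv) t (c t) k) (Set.Icc 0 T) t) :
    IsGalerkinSolution a b T f u₀ Nv fun t => trig a b (freqFin Nv) (c t) := by
  set S := freqFin Nv with hS
  refine ⟨fun t _ => trig_mem_fourierSpace Nv _,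
    ⟨fun t => trig a b S (galerkinField a b f S t (c t)), fun t ht => ⟨fun x => ?_, fun v hv => ?_⟩⟩,
    trig_mem_fourierSpace Nv _, fun v hv => ?_⟩
  · exact HasDerivWithinAt.fun_sum fun k hk => (h t ht k hk).mul_const _
  · obtain ⟨e, rfl⟩ := exists_trig_of_mem hv
    have hae := reaction_trig_ae hab f t S (c t)
    have hL2 := memLp_react_trig hd hd3 hab hn hL hfc hf t S (c t)
    rw [l2Inner_trig hab (memLp_trig hab _ _), dirichletForm_trig hab,
      l2Inner_trig hab (hL2.ae_eq hae.symm), fc_congr hae, ← mul_add, ← Finset.sum_add_distrib,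
      fc_trig hab]
    congr 1
    refine Finset.sum_congr rfl fun k hk => ?_
    beta_reduce
    rw [if_pos hk, galerkinField]
    ring
  · obtain ⟨e, rfl⟩ := exists_trig_of_mem hv
    rw [l2Inner_trig hab ((memLp_trig hab _ _).sub hu₀), fc_sub hab (memLp_trig hab _ _) hu₀,
      fc_trig hab, Finset.sum_eq_zero, mul_zero]
    intro k hk
    simp [show k ∈ S from hk, h0 k hk]

/-! ### The energy estimate -/

/-- A Grönwall inequality that is only required as long as the function stays below a threshold. -/
lemma le_of_deriv_le_below {T A γ δ : ℝ} (hT : 0 < T) (hA : 0 < A) {Y Y' g : ℝ → ℝ}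
    (hY : ∀ t ∈ Set.Icc 0 T, HasDerivWithinAt Y (Y' t) (Set.Icc 0 T) t) (hg : Continuous g)
    (hg0 : ∀ t, 0 ≤ g t) (h0 : Y 0 ≤ 0)
    (h : ∀ t ∈ Set.Icc 0 T, Y t ≤ δ → Y' t ≤ A * (Y t + g t))
    (hγ : ∫ t in (0 : ℝ)..T, g t < γ) (hδ : Real.exp (A * T) * (A * γ) ≤ δ) :
    ∀ t ∈ Set.Icc 0 T, Y t ≤ Real.exp (A * T) * (A * γ) := by
  set I : ℝ → ℝ := fun t => ∫ s in (0 : ℝ)..t, g s with hI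
  have hId : ∀ t, HasDerivAt I (g t) t := fun t =>
    intervalIntegral.integral_hasDerivAt_right (hg.intervalIntegrable _ _)
      (hg.stronglyMeasurableAtFilter _ _) hg.continuousAt
  -- The gap between γ and the integral of g is spent on making B a strict supersolution whose value
  -- at T is the claimed bound.
  set ε := A * (γ - I T) / (1 + T) with hε
  have hε0 : 0 < ε := div_pos (mul_pos hA (sub_pos.2 hγ)) (by linarith)
  set B : ℝ → ℝ := fun t => Real.exp (A * t) * (A * I t + ε * (1 + t)) with hB
  have hBd : ∀ t, HasDerivAt B (A * B t + Real.exp (A * t) * (A * g t + ε)) t := fun t => by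
    have h1 : HasDerivAt (fun t => Real.exp (A * t)) (Real.exp (A * t) * A) t := by
      simpa using ((hasDerivAt_id t).const_mul A).exp
    have h2 : HasDerivAt (fun t => A * I t + ε * (1 + t)) (A * g t + ε * 1) t :=
      ((hId t).const_mul A).add (((hasDerivAt_id t).const_add 1).const_mul ε)
    refine (h1.mul h2).congr_deriv ?_
    simp only [hB]; ring
  have hBle : ∀ t ∈ Set.Icc 0 T, B t ≤ Real.exp (A * T) * (A * γ) := fun t ht => by
    have h1 : I t ≤ I T := intervalIntegral.integral_mono_interval le_rfl ht.1 ht.2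
      (Eventually.of_forall hg0) (hg.intervalIntegrable _ _)
    have h2 : 0 ≤ I t := intervalIntegral.integral_nonneg ht.1 fun s _ => hg0 s
    have h3 : A * I t + ε * (1 + t) ≤ A * γ := by
      have h4 : ε * (1 + t) ≤ ε * (1 + T) := by nlinarith [ht.2]
      have h5 : ε * (1 + T) = A * (γ - I T) := by
        rw [hε]; field_simp
      nlinarith
    have h6 : 0 ≤ A * I t + ε * (1 + t) := by have := ht.1; positivity
    exact mul_le_mul (Real.exp_le_exp.2 (mul_le_mul_of_nonneg_left ht.2 hA.le)) h3 h6
      (Real.exp_pos _).le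
  intro t ht
  -- The comparison asks for the derivative inequality only where Y = B. There B ≤ δ, so the
  -- threshold hypothesis applies and no continuation argument is needed.
  refine (image_le_of_deriv_right_lt_deriv_boundary (f := Y) (f' := Y') (a := 0) (b := T)
    (fun t ht => (hY t ht).continuousWithinAt)
    (fun t ht => ((hY t (Set.Ico_subset_Icc_self ht)).mono_of_mem_nhdsWithin
      (Icc_mem_nhdsGE_of_mem ht))) ?_ hBd (fun t ht hYB => ?_) ht).trans (hBle t ht)
  · simp only [hB, hI]
    simp only [intervalIntegral.integral_same]
    refine h0.trans ?_
    simp only [mul_zero, Real.exp_zero, zero_add, one_mul, add_zero, mul_one]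
    exact hε0.le
  · have htI := Set.Ico_subset_Icc_self ht
    have h1 := h t htI (hYB.le.trans ((hBle t htI).trans hδ))
    have h2 : 1 ≤ Real.exp (A * t) := Real.one_le_exp (mul_nonneg hA.le ht.1)
    have h3 : 0 ≤ A * g t + ε := by have := hg0 t; positivity
    rw [← hYB]
    nlinarith

set_option maxHeartbeats 800000 in
/-- The energy estimate for the difference of the projection of the solution and a solution of the
Galerkin system. The system is only required where the coefficients are bounded by `R`. -/
lemma StrongSolution.exists_energy_le (hd : 1 ≤ d) (hd3 : d ≤ 3) (hab : ∀ i, a i < b i) {n : ℕ}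
    (hn : AdmissibleExponent d n) {L : ℝ} (hL : 0 < L) {f : ℝ × ℝ × Sp d → ℝ} (hfc : Continuous f)
    (hf : LocallyLipschitzGrowth n L f) {T : ℝ} (hT : 0 < T) {U : ℝ → Sp d → ℂ}
    {G : ℝ → Fin d → Sp d → ℂ} (h : StrongSolution a b T f U G) :
    ∃ A τ R : ℝ, 0 < A ∧ 0 < τ ∧ 0 < R ∧ ∀ (S : Finset (Fin d → ℤ)) (g : ℝ → ℝ) (γ δ : ℝ)
      (c c' : ℝ → (Fin d → ℤ) → ℂ), Continuous g → (∀ t, 0 ≤ g t) →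
      (∀ t ∈ Set.Icc 0 T, ∀ θ : (Fin d → ℤ) → ℂ,
        ‖∫ x, (react f t (U t) (G t) x - react f t (trig a b S (fc a b (U t)))
          (trigGrad a b S (fc a b (U t))) x) * conj (trig a b S θ x) ∂(boxMeasure a b)‖
          ≤ √(g t) * √(∑ k ∈ S, wt a b k * ‖θ k‖ ^ 2)) →
      ∫ t in (0 : ℝ)..T, g t < γ → Real.exp (A * T) * (A * γ) ≤ δ → δ ≤ 1 →
      (∀ k ∈ S, wt a b k ^ 2 * δ ≤ τ ^ 2) →
      (∀ k ∈ S, c 0 k = fc a b (U 0) k) →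
      (∀ t ∈ Set.Icc 0 T, ∀ k ∈ S, HasDerivWithinAt (fun s => c s k) (c' t k) (Set.Icc 0 T) t) →
      (∀ t ∈ Set.Icc 0 T, (∀ k ∈ S, ‖c t k‖ ≤ R) →
        ∀ k ∈ S, c' t k = galerkinField a b f S t (c t) k) →
      ∀ t ∈ Set.Icc 0 T, (∑ k ∈ S, ‖fc a b (U t) k - c t k‖ ^ 2 ≤ Real.exp (A * T) * (A * γ)) ∧
        ∀ k ∈ S, ‖c t k‖ ≤ R := by
  have hV := boxVol_pos hab
  obtain ⟨C, hC, hpair⟩ := exists_react_sub_pairing_le hd hab hn hL hf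
  obtain ⟨M, hM, hMt⟩ := h.exists_hs_le
  -- The control of the Galerkin solution holds with 2τ, the sum of the tail of u and the error. The
  -- bound τ ≤ 1 keeps its squared H² norm below 2M + 2.
  obtain ⟨τ, hτ, hτ1, hτC⟩ : ∃ τ > 0, τ ≤ 1 ∧
      2 * (boxVol a b)⁻¹ * (C * (2 * τ) ^ n) ≤ 1 / 2 := by
    have h1 : Tendsto (fun τ : ℝ => 2 * (boxVol a b)⁻¹ * (C * (2 * τ) ^ n)) (𝓝[>] 0) (𝓝 0) := by
      have : Continuous fun τ : ℝ => 2 * (boxVol a b)⁻¹ * (C * (2 * τ) ^ n) := by fun_prop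
      have h2 := (this.tendsto 0).mono_left (nhdsWithin_le_nhds (s := Set.Ioi 0))
      have h3 : n ≠ 0 := by have := hn.1; omega
      simpa [h3] using h2
    obtain ⟨τ, ⟨h2, h4⟩, h3⟩ := (((h1.eventually
      (ge_mem_nhds (show (0 : ℝ) < 1 / 2 by norm_num))).and
      (mem_nhdsWithin_of_mem_nhds (ge_mem_nhds (zero_lt_one' ℝ)))).and self_mem_nhdsWithin).exists
    exact ⟨τ, h3, h4, h2⟩
  obtain ⟨K, hK⟩ := h.exists_tail_le (show 0 < τ ^ 2 by positivity)
  obtain ⟨A₁, B₁, hA₁, hB₁, hctrl⟩ := exists_ctrl (a := a) (b := b) hd hd3 hab (2 * M + 2) K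
  obtain ⟨C', hC', hpair'⟩ := hpair A₁ B₁ hA₁ hB₁
  set V := (boxVol a b)⁻¹ with hVdef
  have hV' : 0 < V := inv_pos.2 hV
  -- The constant A collects the Young constants below. Coefficients of u are at most √M and the
  -- error at most √δ ≤ 1, which gives R.
  refine ⟨2 + 2 * V ^ 2 * (1 + C' ^ 2), τ, √M + 1, by positivity, hτ, by positivity, ?_⟩
  set A := 2 + 2 * V ^ 2 * (1 + C' ^ 2) with hA
  intro S g γ δ c c' hg hg0 hgpair hγ hδ hδ1 hWδ hc0 hc hc'
  set φ : ℝ → (Fin d → ℤ) → ℂ := fun t => fc a b (U t) with hφ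
  set θ : ℝ → (Fin d → ℤ) → ℂ := fun t => φ t - c t with hθ
  set Y : ℝ → ℝ := fun t => ∑ k ∈ S, ‖φ t k - c t k‖ ^ 2 with hY
  set D : ℝ → ℝ := fun t => ∑ k ∈ S, wt a b k * ‖θ t k‖ ^ 2 with hD
  set F : ℝ → (Fin d → ℤ) → ℂ := fun t => fc a b (react f t (U t) (G t)) with hF
  have hYd : ∀ t ∈ Set.Icc 0 T, HasDerivWithinAt Y (∑ k ∈ S, 2 *
      ((-((wt a b k - 1 : ℝ) : ℂ) * φ t k + F t k - c' t k) * conj (φ t k - c t k)).re)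
      (Set.Icc 0 T) t := fun t ht => HasDerivWithinAt.fun_sum fun k hk =>
    StrongSolution.hasDerivWithinAt_norm_sq ((h.deriv t ht k).sub (hc t ht k hk))
  have hφM : ∀ t ∈ Set.Icc 0 T, ∀ k, ‖φ t k‖ ≤ √M := fun t ht k => by
    refine Real.le_sqrt_of_sq_le (le_trans ?_ (((h.hmem t ht).sum_le {k}).trans (hMt t ht)))
    rw [Finset.sum_singleton]
    have := one_le_pow₀ (n := 2) (one_le_wt (a := a) (b := b) k)
    exact le_mul_of_one_le_left (sq_nonneg _) this
  have hcR : ∀ t ∈ Set.Icc 0 T, Y t ≤ δ → ∀ k ∈ S, ‖c t k‖ ≤ √M + 1 := fun t ht hYt k hk => by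
    have h1 : ‖φ t k - c t k‖ ^ 2 ≤ Y t :=
      Finset.single_le_sum (f := fun k => ‖φ t k - c t k‖ ^ 2) (fun _ _ => sq_nonneg _) hk
    have h2 : ‖φ t k - c t k‖ ≤ 1 := by
      refine abs_le_of_sq_le_sq' ?_ zero_le_one |>.2
      linarith
    calc ‖c t k‖ = ‖φ t k - (φ t k - c t k)‖ := by simp
      _ ≤ _ := (norm_sub_le _ _).trans (add_le_add (hφM t ht k) h2)
  have hmain : ∀ t ∈ Set.Icc 0 T, Y t ≤ δ → (∑ k ∈ S, 2 *
      ((-((wt a b k - 1 : ℝ) : ℂ) * φ t k + F t k - c' t k) * conj (φ t k - c t k)).re)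
      ≤ A * (Y t + g t) := fun t ht hYt => by
    have hfield := hc' t ht (hcR t ht hYt)
    set q := trig a b S (φ t) with hq
    set w := trig a b S (c t) with hw
    set Θ := trig a b S (θ t) with hΘ
    have hqw : q - w = Θ := by rw [hq, hw, trig_sub, hΘ, hθ]
    have hΘ2 := (Hmem_trig hab 2 S (θ t)).2
    have hΘ1 := (Hmem_trig hab 1 S (θ t)).2
    have hΘ0 := (Hmem_trig hab 0 S (θ t)).2
    have hD1 : hs a b 1 (fc a b Θ) = D t := by rw [hΘ1]; simp [hD]
    have hY0 : hs a b 0 (fc a b Θ) = Y t := by rw [hΘ0]; simp [hY, hθ]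
    -- Inverse inequality on S: smallness in L² below the threshold δ gives smallness in H². The
    -- case δ = 0 is separate because of the quotient τ²/δ.
    have hH2 : hs a b 2 (fc a b Θ) ≤ τ ^ 2 := by
      rw [hΘ2]
      rcases eq_or_lt_of_le (show 0 ≤ δ from
        (Finset.sum_nonneg fun _ _ => sq_nonneg _).trans hYt) with h0 | h0
      · rw [Finset.sum_eq_zero]
        · positivity
        · intro k hk
          have h1 : ‖φ t k - c t k‖ ^ 2 ≤ Y t :=
            Finset.single_le_sum (f := fun k => ‖φ t k - c t k‖ ^ 2) (fun _ _ => sq_nonneg _) hk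
          have h2 : ‖θ t k‖ ^ 2 = 0 := le_antisymm (h1.trans (hYt.trans h0.ge)) (sq_nonneg _)
          rw [h2, mul_zero]
      · have h1 : ∀ k ∈ S, wt a b k ^ 2 * ‖θ t k‖ ^ 2 ≤ τ ^ 2 / δ * ‖θ t k‖ ^ 2 := fun k hk =>
          mul_le_mul_of_nonneg_right ((le_div_iff₀ h0).2 (hWδ k hk)) (sq_nonneg _)
        refine (Finset.sum_le_sum h1).trans ?_
        rw [← Finset.mul_sum]
        calc _ ≤ τ ^ 2 / δ * δ := mul_le_mul_of_nonneg_left hYt (by positivity)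
          _ = τ ^ 2 := by field_simp
    have hqφ : ∀ k, ‖fc a b q k‖ ≤ ‖φ t k‖ := fun k => by
      rw [hq, fc_trig hab]; beta_reduce; split_ifs <;> simp
    have hqm := (h.hmem t ht).mono le_rfl hqφ
    have hqtail := ((h.hmem t ht).of_norm_le (norm_tailCoeff_le K _)).mono le_rfl
      (norm_tailCoeff_le_of_norm_le K hqφ)
    have cq : Ctrl a b A₁ B₁ (2 * τ) q (trigGrad a b S (φ t)) := by
      refine hctrl _ _ _ (isGrad_trig hab _ _) (Hmem_trig hab 2 _ _).1 ?_ ?_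
      · have := hqm.2; have := hMt t ht; simp only [hφ] at *; linarith
      · have := hqtail.2; have := hK t ht; simp only [hφ] at *; nlinarith [sq_nonneg τ]
    have hwq : fc a b w = fc a b q - fc a b Θ := by
      rw [← fc_sub hab (memLp_trig hab _ _) (memLp_trig hab _ _), show q - Θ = w by
        rw [← hqw, sub_sub_cancel]]
    have hΘm := (Hmem_trig hab 2 S (θ t)).1
    have cw : Ctrl a b A₁ B₁ (2 * τ) w (trigGrad a b S (c t)) := by
      refine hctrl _ _ _ (isGrad_trig hab _ _) (Hmem_trig hab 2 _ _).1 ?_ ?_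
      · have h1 := (hqm.1.sub hΘm).2
        rw [← hwq] at h1
        have h2 := hqm.2; have h3 := hMt t ht; simp only [hφ] at *; nlinarith
      · have h1 := (hqtail.1.sub (hΘm.of_norm_le (norm_tailCoeff_le K _))).2
        rw [← tailCoeff_sub, ← hwq] at h1
        have h2 := hqtail.2; have h3 := hK t ht
        have h4 := (hΘm.mono le_rfl (norm_tailCoeff_le K _)).2
        simp only [hφ] at *; nlinarith
    have p1 := hpair' (2 * τ) t q w Θ _ _ (by positivity) cq cw (by
      rw [hqw]; exact (Hmem_trig hab 1 _ _).1) (memLp_trig hab _ _) (Hmem_trig hab 1 _ _).1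
    rw [hqw, hD1, hY0] at p1
    have p2 := hgpair t ht (θ t)
    have mU := memLp_react hd hd3 hab hn hL hfc hf t (h.isGrad t ht) (h.hmem t ht)
    have mq := memLp_react_trig hd hd3 hab hn hL hfc hf t S (φ t)
    have mw := memLp_react_trig hd hd3 hab hn hL hfc hf t S (c t)
    -- the pairing of the reaction terms
    have hsum : (boxVol a b : ℂ) * ∑ k ∈ S, (F t k
        - fc a b (react f t w (trigGrad a b S (c t))) k) * conj (θ t k)
        = (∫ x, (react f t (U t) (G t) x - react f t q (trigGrad a b S (φ t)) x)
            * conj (Θ x) ∂(boxMeasure a b))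
          + ∫ x, (react f t q (trigGrad a b S (φ t)) x - react f t w (trigGrad a b S (c t)) x)
            * conj (Θ x) ∂(boxMeasure a b) := by
      have h1 := l2Inner_trig hab (mU.sub mw) S (θ t)
      rw [fc_sub hab mU mw] at h1
      have h2 : ∑ k ∈ S, (F t k - fc a b (react f t w (trigGrad a b S (c t))) k) * conj (θ t k)
        = ∑ k ∈ S, (fc a b (react f t (U t) (G t)) - fc a b (react f t w (trigGrad a b S (c t)))) k
          * conj (θ t k) := rfl
      rw [h2, ← h1, l2Inner, ← integral_add]
      · refine integral_congr_ae (Eventually.of_forall fun x => ?_)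
        simp only [Pi.sub_apply]; ring
      · exact integrable_mul_of_memLp_two (mU.sub mq) (memLp_conj (memLp_trig hab _ _))
      · exact integrable_mul_of_memLp_two (mq.sub mw) (memLp_conj (memLp_trig hab _ _))
    have hre : (∑ k ∈ S, (F t k - fc a b (react f t w (trigGrad a b S (c t))) k)
        * conj (θ t k)).re ≤ V * (√(g t) * √(D t)
          + √(D t) * (C' * √(Y t) + C * (2 * τ) ^ n * √(D t))) := by
      have h1 := congrArg norm hsum
      rw [norm_mul, Complex.norm_real, Real.norm_of_nonneg hV.le] at h1
      have h2 := (h1.le.trans (norm_add_le _ _)).trans (add_le_add p2 p1)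
      refine (Complex.re_le_norm _).trans ?_
      rw [hVdef, ← div_eq_inv_mul, le_div_iff₀ hV, mul_comm]
      exact h2
    -- The multiplier is wt − 1 whereas D carries the full weight, hence the correction by Y.
    have hident : (∑ k ∈ S, 2 *
        ((-((wt a b k - 1 : ℝ) : ℂ) * φ t k + F t k - c' t k) * conj (φ t k - c t k)).re)
        = -2 * (D t - Y t) + 2 * (∑ k ∈ S, (F t k - fc a b (react f t w (trigGrad a b S (c t))) k)
        * conj (θ t k)).re := by
      rw [Complex.re_sum, hD, hY, ← Finset.sum_sub_distrib, Finset.mul_sum, Finset.mul_sum,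
        ← Finset.sum_add_distrib]
      refine Finset.sum_congr rfl fun k hk => ?_
      rw [hfield k hk, galerkinField]
      have h1 : (-((wt a b k - 1 : ℝ) : ℂ) * φ t k + F t k - (-((wt a b k - 1 : ℝ) : ℂ) * c t k
          + fc a b (react f t w (trigGrad a b S (c t))) k)) * conj (φ t k - c t k)
          = ((-(wt a b k - 1) * ‖θ t k‖ ^ 2 : ℝ) : ℂ)
            + (F t k - fc a b (react f t w (trigGrad a b S (c t))) k) * conj (θ t k) := by
        have h2 : (θ t k) * conj (θ t k) = ((‖θ t k‖ ^ 2 : ℝ) : ℂ) := by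
          rw [Complex.mul_conj, Complex.normSq_eq_norm_sq]
        push_cast at h2 ⊢
        rw [← h2]
        simp only [hθ, Pi.sub_apply, map_sub]
        ring
      rw [← hw, h1, Complex.add_re, Complex.ofReal_re]
      simp only [hθ, Pi.sub_apply]
      ring
    rw [hident]
    have hYn : 0 ≤ Y t := Finset.sum_nonneg fun _ _ => sq_nonneg _
    have hDn : 0 ≤ D t := Finset.sum_nonneg fun k _ =>
      mul_nonneg (wt_pos k).le (sq_nonneg _)
    have eY := Real.sq_sqrt hYn
    have eD := Real.sq_sqrt hDn
    have eg := Real.sq_sqrt (hg0 t)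
    set y := √(Y t)
    set z := √(D t)
    set r := √(g t)
    -- Each of the three terms of the pairing takes at most half a copy of D from the two available:
    -- two by Young's inequality, the third by the choice of τ.
    have q1 : 2 * V * (r * z) ≤ 1 / 2 * z ^ 2 + 2 * V ^ 2 * r ^ 2 := by
      nlinarith [sq_nonneg (z - 2 * V * r)]
    have q2 : 2 * V * (z * (C' * y)) ≤ 1 / 2 * z ^ 2 + 2 * V ^ 2 * C' ^ 2 * y ^ 2 := by
      nlinarith [sq_nonneg (z - 2 * V * C' * y)]
    have q3 := mul_le_mul_of_nonneg_right hτC (sq_nonneg z)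
    have q4 : 2 * (V * (r * z + z * (C' * y + C * (2 * τ) ^ n * z)))
        = 2 * V * (r * z) + 2 * V * (z * (C' * y)) + 2 * V * (C * (2 * τ) ^ n) * z ^ 2 := by ring
    have q5 : 0 ≤ (2 + 2 * V ^ 2 * C' ^ 2) * r ^ 2 := by positivity
    have q6 : 0 ≤ 2 * V ^ 2 * y ^ 2 := by positivity
    rw [← eY, ← eD, ← eg, hA]
    have hre2 := mul_le_mul_of_nonneg_left hre zero_le_two
    rw [q4] at hre2
    have q7 : (2 + 2 * V ^ 2 * (1 + C' ^ 2)) * (y ^ 2 + r ^ 2)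
        = 2 * y ^ 2 + 2 * V ^ 2 * C' ^ 2 * y ^ 2 + 2 * V ^ 2 * y ^ 2 + 2 * V ^ 2 * r ^ 2
          + (2 + 2 * V ^ 2 * C' ^ 2) * r ^ 2 := by ring
    rw [q7]
    linarith
  have hfinal := le_of_deriv_le_below hT (by positivity : 0 < A) hYd hg hg0
    (by simp only [hY]
        exact (Finset.sum_eq_zero fun k hk => by rw [hc0 k hk]; simp [hφ]).le) hmain hγ hδ
  exact fun t ht => ⟨hfinal t ht, hcR t ht ((hfinal t ht).trans hδ)⟩

/-! ### Global solutions of the truncated Galerkin system -/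

lemma exists_galerkinField_lipschitz (hd : 1 ≤ d) (hd3 : d ≤ 3) (hab : ∀ i, a i < b i) {n : ℕ}
    (hn : AdmissibleExponent d n) {L : ℝ} (hL : 0 < L) {f : ℝ × ℝ × Sp d → ℝ} (hfc : Continuous f)
    (hf : LocallyLipschitzGrowth n L f) (S : Finset (Fin d → ℤ)) (R : ℝ) :
    ∃ Q ≥ 0, ∀ (t δ : ℝ) (c c' : (Fin d → ℤ) → ℂ), 0 ≤ δ → (∀ k ∈ S, ‖c k‖ ≤ R) →
      (∀ k ∈ S, ‖c' k‖ ≤ R) → (∀ k ∈ S, ‖c k - c' k‖ ≤ δ) →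
      ∀ k ∈ S, ‖galerkinField a b f S t c k - galerkinField a b f S t c' k‖ ≤ Q * δ := by
  have hV := boxVol_pos hab
  obtain ⟨C, hC, h⟩ := exists_react_sub_sq_le hd hab hn hL hfc hf
  set W := ∑ k ∈ S, wt a b k ^ 2 with hW
  have hW0 : 0 ≤ W := Finset.sum_nonneg fun _ _ => sq_nonneg _
  -- With S itself as the finite set, the tails vanish and τ = 1 is admissible. W R² bounds the
  -- squared H² norm of a polynomial with coefficients at most R.
  obtain ⟨A, B, hA, hB, hctrl⟩ := exists_ctrl hd hd3 hab (W * R ^ 2) S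
  obtain ⟨C', hC', h'⟩ := h A B hA hB
  have hsq : ∀ (c : (Fin d → ℤ) → ℂ) (r : ℝ), (∀ k ∈ S, ‖c k‖ ≤ r) →
      hs a b 2 (fc a b (trig a b S c)) ≤ W * r ^ 2 := fun c r hc => by
    rw [(Hmem_trig hab 2 S c).2, hW, Finset.sum_mul]
    exact Finset.sum_le_sum fun k hk => mul_le_mul_of_nonneg_left
      (pow_le_pow_left₀ (norm_nonneg _) (hc k hk) 2) (sq_nonneg _)
  have hct : ∀ c : (Fin d → ℤ) → ℂ, (∀ k ∈ S, ‖c k‖ ≤ R) →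
      Ctrl a b A B 1 (trig a b S c) (trigGrad a b S c) := fun c hc => by
    refine hctrl 1 _ _ (isGrad_trig hab S c) (Hmem_trig hab 2 S c).1 (hsq c R hc) ?_
    have h0 : tailCoeff S (fc a b (trig a b S c)) = 0 := by
      ext k
      simp only [tailCoeff, fc_trig hab]
      split_ifs <;> simp
    rw [h0]; simp [hs]
  refine ⟨∑ k ∈ S, wt a b k + √((boxVol a b)⁻¹ * ((C' + C) * W)),
    add_nonneg (Finset.sum_nonneg fun k _ => (wt_pos k).le) (Real.sqrt_nonneg _),
    fun t δ c c' hδ hc hc' hcc k hk => ?_⟩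
  have hm := Hmem_trig hab 2 S (c - c')
  obtain ⟨i1, i2⟩ := h' 1 t (trig a b S c) (trig a b S c') _ _ one_pos (hct c hc) (hct c' hc')
    (by rw [trig_sub]; exact hm.1)
  rw [trig_sub] at i2
  have h2 := hsq (c - c') δ (by simpa using hcc)
  have h1 := hs_mono_order one_le_two hm.1
  have h3 : ‖fc a b (react f t (trig a b S c) (trigGrad a b S c)
      - react f t (trig a b S c') (trigGrad a b S c')) k‖ ^ 2
      ≤ (boxVol a b)⁻¹ * ((C' + C) * W) * δ ^ 2 := by
    refine (le_hasSum (hasSum_sq_fc hab i1) k fun _ _ => sq_nonneg _).trans ?_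
    rw [mul_assoc]
    refine mul_le_mul_of_nonneg_left ?_ (by positivity)
    simp only [Pi.sub_apply]
    refine i2.trans ?_
    rw [one_pow, mul_one]
    nlinarith
  have h4 : ‖fc a b (react f t (trig a b S c) (trigGrad a b S c)
      - react f t (trig a b S c') (trigGrad a b S c')) k‖
      ≤ √((boxVol a b)⁻¹ * ((C' + C) * W)) * δ := by
    have := Real.le_sqrt_of_sq_le h3
    rwa [Real.sqrt_mul (by positivity), Real.sqrt_sq hδ] at this
  rw [fc_sub hab (memLp_react_trig hd hd3 hab hn hL hfc hf t S c)
    (memLp_react_trig hd hd3 hab hn hL hfc hf t S c')] at h4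
  have h5 : galerkinField a b f S t c k - galerkinField a b f S t c' k
      = -((wt a b k - 1 : ℝ) : ℂ) * (c k - c' k)
        + (fc a b (react f t (trig a b S c) (trigGrad a b S c))
          - fc a b (react f t (trig a b S c') (trigGrad a b S c'))) k := by
    simp only [galerkinField, Pi.sub_apply]; ring
  rw [h5, add_mul]
  refine (norm_add_le _ _).trans (add_le_add ?_ h4)
  rw [norm_mul, norm_neg, Complex.norm_real, Real.norm_eq_abs,
    abs_of_nonneg (by linarith [one_le_wt (a := a) (b := b) k])]
  refine mul_le_mul ?_ (hcc k hk) (norm_nonneg _) (Finset.sum_nonneg fun k _ => (wt_pos k).le)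
  have := Finset.single_le_sum (f := fun k => wt a b k) (fun k _ => (wt_pos k).le) hk
  linarith

/-- Dominated convergence: the integrand is jointly continuous, hence bounded on the compact product
of [0,T] with a ball containing the box. -/
lemma continuousOn_galerkinField (hab : ∀ i, a i < b i) {f : ℝ × ℝ × Sp d → ℝ}
    (hfc : Continuous f) (S : Finset (Fin d → ℤ)) (c : (Fin d → ℤ) → ℂ) (T : ℝ)
    (k : Fin d → ℤ) :
    ContinuousOn (fun t => galerkinField a b f S t c k) (Set.Icc 0 T) := by
  refine continuousOn_const.add (continuousOn_const.mul ?_)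
  obtain ⟨ρ, hρ⟩ := exists_box_subset_closedBall a b
  have hcont : Continuous fun z : ℝ × Sp d =>
      react f z.1 (trig a b S c) (trigGrad a b S c) z.2 * conj (fourierMode a b k z.2) := by
    have h1 : Continuous fun z : ℝ × Sp d => trig a b S c z.2 :=
      (continuous_trig S c).comp continuous_snd
    have h2 : ∀ i, Continuous fun z : ℝ × Sp d => trigGrad a b S c i z.2 := fun i =>
      (continuous_trig S _).comp continuous_snd
    refine Continuous.mul (Complex.continuous_ofReal.comp (hfc.comp ?_))
      (Complex.continuous_conj.comp ((continuous_fourierMode k).comp continuous_snd))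
    refine continuous_fst.prodMk ((Complex.continuous_re.comp h1).prodMk ?_)
    exact (PiLp.continuous_toLp 2 _).comp
      (continuous_pi fun i => Complex.continuous_re.comp (h2 i))
  obtain ⟨C, hC⟩ := (isCompact_Icc.prod (isCompact_closedBall (0 : Sp d) ρ)).exists_bound_of_continuousOn
    (s := Set.Icc 0 T ×ˢ Metric.closedBall (0 : Sp d) ρ) hcont.continuousOn
  have := isFiniteMeasure_boxMeasure hab
  refine continuousOn_of_dominated (bound := fun _ => C) (fun t _ => ?_) (fun t ht => ?_)
    (integrable_const _) (Eventually.of_forall fun x => ?_)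
  · exact (hcont.comp (Continuous.prodMk_right t)).aestronglyMeasurable
  · filter_upwards [ae_mem_box (a := a) (b := b)] with x hx
    exact hC (t, x) ⟨ht, hρ hx⟩
  · exact (hcont.comp (Continuous.prodMk_left x)).continuousOn

/-- Truncation of the real and imaginary parts. -/
noncomputable def clampC (R : ℝ) (z : ℂ) : ℂ :=
  ⟨max (-R) (min R z.re), max (-R) (min R z.im)⟩

lemma abs_clamp_le {R x : ℝ} (hR : 0 ≤ R) : |max (-R) (min R x)| ≤ R :=
  abs_le.2 ⟨le_max_left _ _, max_le (by linarith) (min_le_left _ _)⟩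

lemma abs_clamp_sub_le (R x y : ℝ) : |max (-R) (min R x) - max (-R) (min R y)| ≤ |x - y| := by
  refine (abs_max_sub_max_le_max _ _ _ _).trans ?_
  rw [sub_self, abs_zero, max_eq_right (abs_nonneg _)]
  refine (abs_min_sub_min_le_max _ _ _ _).trans ?_
  rw [sub_self, abs_zero, max_eq_right (abs_nonneg _)]

lemma norm_clampC_le {R : ℝ} (hR : 0 ≤ R) (z : ℂ) : ‖clampC R z‖ ≤ 2 * R := by
  refine (Complex.norm_le_abs_re_add_abs_im _).trans ?_
  have h1 : |(clampC R z).re| ≤ R := abs_clamp_le hR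
  have h2 : |(clampC R z).im| ≤ R := abs_clamp_le hR
  linarith

lemma norm_clampC_sub_le (R : ℝ) (z w : ℂ) : ‖clampC R z - clampC R w‖ ≤ ‖z - w‖ := by
  rw [← sq_le_sq₀ (norm_nonneg _) (norm_nonneg _), ← Complex.normSq_eq_norm_sq,
    ← Complex.normSq_eq_norm_sq, Complex.normSq_apply, Complex.normSq_apply]
  have h1 := sq_le_sq.2 (abs_clamp_sub_le R z.re w.re)
  have h2 := sq_le_sq.2 (abs_clamp_sub_le R z.im w.im)
  simp only [clampC, Complex.sub_re, Complex.sub_im]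
  nlinarith

lemma clampC_eq {R : ℝ} {z : ℂ} (h : ‖z‖ ≤ R) : clampC R z = z := by
  have h1 := abs_le.1 ((Complex.abs_re_le_norm z).trans h)
  have h2 := abs_le.1 ((Complex.abs_im_le_norm z).trans h)
  apply Complex.ext
  · simp [clampC, h1.1, h1.2]
  · simp [clampC, h2.1, h2.2]

/-- The Galerkin system has global solutions after truncation. -/
lemma exists_truncated_solution (hd : 1 ≤ d) (hd3 : d ≤ 3) (hab : ∀ i, a i < b i) {n : ℕ}
    (hn : AdmissibleExponent d n) {L : ℝ} (hL : 0 < L) {f : ℝ × ℝ × Sp d → ℝ} (hfc : Continuous f)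
    (hf : LocallyLipschitzGrowth n L f) {T : ℝ} (hT : 0 < T) (S : Finset (Fin d → ℤ)) {R : ℝ}
    (hR : 0 ≤ R) (c₀ : (Fin d → ℤ) → ℂ) :
    ∃ c c' : ℝ → (Fin d → ℤ) → ℂ, (∀ k ∈ S, c 0 k = c₀ k) ∧
      (∀ t ∈ Set.Icc 0 T, ∀ k ∈ S, HasDerivWithinAt (fun s => c s k) (c' t k) (Set.Icc 0 T) t) ∧
      (∀ t ∈ Set.Icc 0 T, (∀ k ∈ S, ‖c t k‖ ≤ R) →
        ∀ k ∈ S, c' t k = galerkinField a b f S t (c t) k) := by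
  classical
  obtain ⟨Q, hQ, hlip⟩ := exists_galerkinField_lipschitz hd hd3 hab hn hL hfc hf S (2 * R)
  set ext : (S → ℂ) → (Fin d → ℤ) → ℂ := fun e k => if hk : k ∈ S then clampC R (e ⟨k, hk⟩) else 0
    with hext
  have hextb : ∀ e, ∀ k ∈ S, ‖ext e k‖ ≤ 2 * R := fun e k hk => by
    simp only [hext, hk, dif_pos]; exact norm_clampC_le hR _
  have hextl : ∀ e e', ∀ k ∈ S, ‖ext e k - ext e' k‖ ≤ ‖e - e'‖ := fun e e' k hk => by
    simp only [hext, hk, dif_pos]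
    exact (norm_clampC_sub_le R _ _).trans (norm_le_pi_norm (e - e') ⟨k, hk⟩)
  set v : ℝ → (S → ℂ) → (S → ℂ) := fun t e k => galerkinField a b f S t (ext e) k with hv
  have hvc : ∀ e, ContinuousOn (fun t => v t e) (Set.Icc 0 T) := fun e =>
    continuousOn_pi.2 fun k => continuousOn_galerkinField hab hfc S (ext e) T k
  have hvl : ∀ t e e', ‖v t e - v t e'‖ ≤ Q * ‖e - e'‖ := fun t e e' =>
    (pi_norm_le_iff_of_nonneg (by positivity)).2 fun k =>
      hlip t _ _ _ (norm_nonneg _) (hextb e) (hextb e') (hextl e e') k k.2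
  obtain ⟨P, hP⟩ := isCompact_Icc.exists_bound_of_continuousOn (hvc 0)
  have hvb : ∀ t ∈ Set.Icc 0 T, ∀ e, ‖v t e‖ ≤ |P| + Q * (4 * R) := fun t ht e => by
    have h1 : ‖v t e - v t 0‖ ≤ Q * (4 * R) :=
      (pi_norm_le_iff_of_nonneg (by positivity)).2 fun k =>
        hlip t _ _ _ (by positivity) (hextb e) (hextb 0) (fun k hk =>
          (norm_sub_le _ _).trans (by linarith [hextb e k hk, hextb 0 k hk])) k k.2
    calc ‖v t e‖ = ‖v t 0 + (v t e - v t 0)‖ := by simp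
      _ ≤ _ := (norm_add_le _ _).trans (add_le_add ((hP t ht).trans (le_abs_self P)) h1)
  have h0T : (0 : ℝ) ∈ Set.Icc 0 T := ⟨le_rfl, hT.le⟩
  -- The truncated field is globally bounded, so the radius is that bound times T, and
  -- Picard–Lindelöf reaches T in one step.
  have hpl : IsPicardLindelof v (tmin := 0) (tmax := T) ⟨0, h0T⟩ (fun k : S => c₀ k)
      ((|P| + Q * (4 * R)) * T).toNNReal 0 (|P| + Q * (4 * R)).toNNReal Q.toNNReal := by
    refine ⟨fun t _ => ?_, fun e _ => hvc e, fun t ht e _ => ?_, ?_⟩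
    · refine LipschitzOnWith.of_dist_le_mul fun e _ e' _ => ?_
      rw [dist_eq_norm, dist_eq_norm, Real.coe_toNNReal _ hQ]
      exact hvl t e e'
    · rw [Real.coe_toNNReal _ (by positivity)]
      exact hvb t ht e
    · rw [Real.coe_toNNReal _ (by positivity), Real.coe_toNNReal _ (by positivity)]
      simp [hT.le]
  obtain ⟨α, hα0, hα⟩ := hpl.exists_eq_forall_mem_Icc_hasDerivWithinAt₀
  refine ⟨fun t k => if hk : k ∈ S then α t ⟨k, hk⟩ else 0,
    fun t k => galerkinField a b f S t (ext (α t)) k, fun k hk => ?_, fun t ht k hk => ?_,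
    fun t ht hb k hk => ?_⟩
  · simp [hk, show α 0 = _ from hα0]
  · simpa [hk] using (hasDerivWithinAt_pi.1 (hα t ht)) ⟨k, hk⟩
  -- Below the level R the truncation is the identity, so the original field is recovered.
  · have : ext (α t) = fun k => if hk : k ∈ S then α t ⟨k, hk⟩ else 0 := by
      ext l
      simp only [hext]
      split_ifs with hl
      · exact clampC_eq (by simpa [hl] using hb l hl)
      · rfl
    simp only [this]

/-! ### Frequencies inside and outside of the approximation space -/

/-- The admissible discretization parameters. -/
def Quasiuniform (κ : ℝ) (Nv : Fin d → ℕ) : Prop :=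
  (∀ j, 0 < Nv j ∧ Even (Nv j)) ∧ ∀ j, (gridSize Nv : ℝ) ≤ κ * (Nv j : ℝ)

lemma Quasiuniform.one_le_gridSize (hd : 1 ≤ d) {κ : ℝ} {Nv : Fin d → ℕ}
    (h : Quasiuniform κ Nv) : 1 ≤ gridSize Nv :=
  (h.1 ⟨0, hd⟩).1.trans_le (Finset.le_sup (f := Nv) (Finset.mem_univ _))

/-- The source of every inverse inequality on the approximation space: frequencies there satisfy
|k_j| ≤ N. -/
lemma exists_wt_le_of_mem (a b : Fin d → ℝ) : ∃ C > 0, ∀ (κ : ℝ) (Nv : Fin d → ℕ),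
    1 ≤ gridSize Nv → Quasiuniform κ Nv → ∀ k ∈ freqFin Nv,
      wt a b k ≤ C * (gridSize Nv : ℝ) ^ 2 := by
  refine ⟨1 + ∑ j, (2 * Real.pi / (b j - a j)) ^ 2, by positivity, fun κ Nv hN h k hk => ?_⟩
  have hN1 : (1 : ℝ) ≤ gridSize Nv := by exact_mod_cast hN
  rw [wt, add_mul, one_mul, Finset.sum_mul]
  refine add_le_add (one_le_pow₀ hN1) (Finset.sum_le_sum fun j _ => ?_)
  have h1 := mem_freqFin.1 hk j
  have h2 : Nv j ≤ gridSize Nv := Finset.le_sup (f := Nv) (Finset.mem_univ j)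
  have h3 : |k j| ≤ (gridSize Nv : ℤ) := by
    rw [abs_le]; constructor <;> omega
  have h4 : |(k j : ℝ)| ≤ gridSize Nv := by exact_mod_cast h3
  have h5 : freq a b k j = 2 * Real.pi / (b j - a j) * k j := by rw [freq]; ring
  rw [h5, mul_pow, ← sq_abs (k j : ℝ)]
  gcongr

/-- Outside, some |k_j| is at least N_j/2 ≥ N/(2κ). Evenness of N_j makes the integer half exact.
The bound is for wt − 1, the eigenvalue of −Δ. -/
lemma exists_le_wt_of_notMem (hd : 1 ≤ d) (hab : ∀ i, a i < b i) {κ : ℝ} (hκ : 1 ≤ κ) :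
    ∃ c > 0, ∀ Nv : Fin d → ℕ, Quasiuniform κ Nv → ∀ k ∉ freqFin Nv,
      c * (gridSize Nv : ℝ) ^ 2 ≤ wt a b k - 1 := by
  have hne : (Finset.univ : Finset (Fin d)).Nonempty := ⟨⟨0, hd⟩, Finset.mem_univ _⟩
  set e := Finset.univ.inf' hne fun j => (2 * Real.pi / (b j - a j)) ^ 2 with he
  have he0 : 0 < e := by
    rw [he, Finset.lt_inf'_iff]
    exact fun j _ => pow_pos (div_pos (by positivity) (sub_pos.2 (hab j))) 2
  have hκ0 : 0 < κ := by linarith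
  refine ⟨e * (1 / (2 * κ)) ^ 2, by positivity, fun Nv h k hk => ?_⟩
  rw [mem_freqFin] at hk
  simp only [freqSet, Set.mem_ofPred_eq, not_forall, not_and_or] at hk
  obtain ⟨j, hj⟩ := hk
  have hev := (h.1 j).2.two_dvd
  have h1 : (Nv j : ℤ) ≤ 2 * |k j| := by
    rcases hj with hj | hj
    · have := neg_abs_le (k j); omega
    · have := le_abs_self (k j); omega
  have h2 : (Nv j : ℝ) ≤ 2 * |(k j : ℝ)| := by exact_mod_cast h1
  have h3 : 1 / (2 * κ) * gridSize Nv ≤ |(k j : ℝ)| := by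
    rw [div_mul_eq_mul_div, one_mul, div_le_iff₀ (by positivity)]
    calc (gridSize Nv : ℝ) ≤ κ * Nv j := h.2 j
      _ ≤ κ * (2 * |(k j : ℝ)|) := by gcongr
      _ = _ := by ring
  have h5 : freq a b k j = 2 * Real.pi / (b j - a j) * k j := by rw [freq]; ring
  calc e * (1 / (2 * κ)) ^ 2 * (gridSize Nv : ℝ) ^ 2
      = e * (1 / (2 * κ) * gridSize Nv) ^ 2 := by ring
    _ ≤ (2 * Real.pi / (b j - a j)) ^ 2 * |(k j : ℝ)| ^ 2 := by
        gcongr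
        exact Finset.inf'_le _ (Finset.mem_univ j)
    _ = freq a b k j ^ 2 := by rw [h5, mul_pow, sq_abs]
    _ ≤ wt a b k - 1 := by linarith [one_add_freq_sq_le_wt (a := a) (b := b) k j]

/-- The consistency bound needed for the energy estimate. -/
def Consistency (a b : Fin d → ℝ) (T : ℝ) (f : ℝ × ℝ × Sp d → ℝ) (U : ℝ → Sp d → ℂ)
    (G : ℝ → Fin d → Sp d → ℂ) (S : Finset (Fin d → ℤ)) (g : ℝ → ℝ) : Prop :=
  Continuous g ∧ (∀ t, 0 ≤ g t) ∧ ∀ t ∈ Set.Icc 0 T, ∀ θ : (Fin d → ℤ) → ℂ,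
    ‖∫ x, (react f t (U t) (G t) x - react f t (trig a b S (fc a b (U t)))
      (trigGrad a b S (fc a b (U t))) x) * conj (trig a b S θ x) ∂(boxMeasure a b)‖
      ≤ √(g t) * √(∑ k ∈ S, wt a b k * ‖θ k‖ ^ 2)

set_option maxHeartbeats 800000 in
/-- Consistency for solutions that are only continuous with values in `H²`. -/
lemma StrongSolution.exists_consistency_H2 (hd : 1 ≤ d) (hd3 : d ≤ 3) (hab : ∀ i, a i < b i)
    {n : ℕ} (hn : AdmissibleExponent d n) {L : ℝ} (hL : 0 < L) {f : ℝ × ℝ × Sp d → ℝ}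
    (hfc : Continuous f) (hf : LocallyLipschitzGrowth n L f) {T : ℝ} (hT : 0 < T)
    {U : ℝ → Sp d → ℂ} {G : ℝ → Fin d → Sp d → ℂ} (h : StrongSolution a b T f U G) {κ : ℝ}
    (hκ : 1 ≤ κ) {ε : ℝ} (hε : 0 < ε) :
    ∃ N₀ : ℕ, ∀ Nv : Fin d → ℕ, Quasiuniform κ Nv → N₀ ≤ gridSize Nv →
      ∃ g, Consistency a b T f U G (freqFin Nv) g ∧
        ∫ t in (0 : ℝ)..T, g t ≤ ε * ((gridSize Nv : ℝ) ^ 4)⁻¹ := by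
  classical
  obtain ⟨C, hC, hpair⟩ := exists_react_sub_pairing_le hd hab hn hL hf
  obtain ⟨M, hM, hMt⟩ := h.exists_hs_le
  obtain ⟨K, hK⟩ := h.exists_tail_le (show (0 : ℝ) < 1 ^ 2 by norm_num)
  obtain ⟨A₁, B₁, hA₁, hB₁, hctrl⟩ := exists_ctrl (a := a) (b := b) hd hd3 hab M K
  obtain ⟨C', hC', hpair'⟩ := hpair A₁ B₁ hA₁ hB₁
  obtain ⟨c, hc, hcN⟩ := exists_le_wt_of_notMem (a := a) (b := b) hd hab hκ
  set Q := C' + C with hQ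
  have hQ0 : 0 < Q := by positivity
  set φ : ℝ → (Fin d → ℤ) → ℂ := fun t => fc a b (U t) with hφ
  have hcoef : ∀ k, ContinuousOn (fun t => ‖φ t k‖ ^ 2) (Set.Icc 0 T) := fun k =>
    (h.continuousOn_coeff k).norm.pow 2
  -- summability of the time integrals
  choose D hD hDle using fun i => h.exists_integral_H3_le hd hd3 hab hn hL hfc hf hT i
  set y : (Fin d → ℤ) → ℝ := fun k => ∫ t in (0 : ℝ)..T, ‖φ t k‖ ^ 2 with hy
  have hy0 : ∀ k, 0 ≤ y k := fun k => intervalIntegral.integral_nonneg hT.le fun _ _ => sq_nonneg _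
  have hlam0 : ∀ k, 0 ≤ wt a b k - 1 := fun k => by linarith [one_le_wt (a := a) (b := b) k]
  have hsum : Summable fun k => (wt a b k - 1) ^ 3 * y k := by
    refine summable_of_sum_le (c := ∑ i, D i)
      (fun k => mul_nonneg (pow_nonneg (hlam0 k) 3) (hy0 k)) fun S₀ => ?_
    calc _ = ∑ i, ∑ k ∈ S₀, (wt a b k - 1) ^ 2 * freq a b k i ^ 2 * y k := by
          rw [Finset.sum_comm]
          refine Finset.sum_congr rfl fun k _ => ?_
          rw [← Finset.sum_mul, ← Finset.mul_sum]
          congr 1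
          have : ∑ i, freq a b k i ^ 2 = wt a b k - 1 := by rw [wt]; ring
          rw [this]; ring
      _ ≤ _ := Finset.sum_le_sum fun i _ => hDle i S₀
  -- The final bound is Q²(2c⁻²N⁻⁴ε₁ + ε₂T); ε₁ and ε₂ make each term εN⁻⁴/2.
  set ε₁ := ε * c ^ 2 / (4 * Q ^ 2) with hε₁
  have hε₁0 : 0 < ε₁ := by positivity
  -- The tail of the H³ series is small once K₀ is removed. This gains a small factor beyond the
  -- rate N⁻⁴.
  obtain ⟨K₀, hK₀⟩ := summable_iff_vanishing_norm.1 hsum ε₁ hε₁0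
  -- For larger N, the lower bound cN² for discarded frequencies exceeds both 1 and every weight on
  -- K₀. So K₀ lies in S, and wt ≤ 2(wt − 1) outside S.
  obtain ⟨N₁, hN₁⟩ := exists_nat_gt ((1 + ∑ k ∈ K₀, wt a b k) / c)
  refine ⟨N₁ + 1, fun Nv hNv hN => ?_⟩
  set S := freqFin Nv with hS
  set N : ℝ := ((gridSize Nv : ℕ) : ℝ) with hNdef
  have hN1 : (1 : ℝ) ≤ N := by
    rw [hNdef]; exact_mod_cast hNv.one_le_gridSize hd
  have hcN1 : 1 + ∑ k ∈ K₀, wt a b k ≤ c * N ^ 2 := by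
    have h1 : (N₁ : ℝ) ≤ N := by
      have : N₁ ≤ gridSize Nv := by omega
      rw [hNdef]; exact_mod_cast this
    have h2 := (div_lt_iff₀ hc).1 (hN₁.trans_le h1)
    nlinarith [mul_nonneg hc.le (mul_nonneg (by linarith : 0 ≤ N) (by linarith : 0 ≤ N - 1))]
  have hwt0 : 0 ≤ ∑ k ∈ K₀, wt a b k := Finset.sum_nonneg fun k _ => (wt_pos k).le
  have hKS : K₀ ⊆ S := fun k hk => by
    by_contra hkS
    have h1 := hcN Nv hNv k hkS
    have h2 := Finset.single_le_sum (f := fun k => wt a b k) (fun k _ => (wt_pos k).le) hk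
    linarith
  -- The bound g has to be continuous in time, so the tail series is replaced by a finite sum over
  -- K' \ S plus the constant ε₂.
  set ε₂ := ε / (2 * Q ^ 2 * T) * (N ^ 4)⁻¹ with hε₂
  have hε₂0 : 0 < ε₂ := by positivity
  obtain ⟨K', hK'⟩ := h.exists_tail_le hε₂0
  -- Projection of t onto [0,T] extends g to a continuous function on the line.
  set g : ℝ → ℝ := fun t => Q ^ 2 *
    (∑ k ∈ K' \ S, wt a b k * ‖φ (Set.projIcc 0 T hT.le t) k‖ ^ 2 + ε₂) with hg
  have hgt : ∀ t ∈ Set.Icc 0 T, g t = Q ^ 2 * (∑ k ∈ K' \ S, wt a b k * ‖φ t k‖ ^ 2 + ε₂) :=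
    fun t ht => by simp only [hg, Set.projIcc_of_mem hT.le ht]
  have hgc : Continuous g := by
    refine continuous_const.mul ((continuous_finsetSum _ fun k _ =>
      continuous_const.mul ?_).add continuous_const)
    exact (continuousOn_iff_continuous_domRestrict.1 (hcoef k)).comp continuous_projIcc
  refine ⟨g, ⟨hgc, fun t => ?_, fun t ht θ => ?_⟩, ?_⟩
  · refine mul_nonneg (sq_nonneg _) (add_nonneg (Finset.sum_nonneg fun k _ =>
      mul_nonneg (wt_pos k).le (sq_nonneg _)) hε₂0.le)
  · set q := trig a b S (φ t) with hq
    set Θ := trig a b S θ with hΘ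
    have hqφ : ∀ k, ‖fc a b q k‖ ≤ ‖φ t k‖ := fun k => by
      rw [hq, fc_trig hab]; beta_reduce; split_ifs <;> simp
    have cU := hctrl 1 _ _ (h.isGrad t ht) (h.hmem t ht) (hMt t ht) (hK t ht)
    have cq : Ctrl a b A₁ B₁ 1 q (trigGrad a b S (φ t)) := by
      refine hctrl _ _ _ (isGrad_trig hab _ _) (Hmem_trig hab 2 _ _).1 ?_ ?_
      · exact ((h.hmem t ht).mono le_rfl hqφ).2.trans (hMt t ht)
      · exact (((h.hmem t ht).of_norm_le (norm_tailCoeff_le K _)).mono le_rfl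
          (norm_tailCoeff_le_of_norm_le K hqφ)).2.trans (hK t ht)
    have hρ : fc a b (U t - q) = tailCoeff S (φ t) := fc_sub_trig hab (h.isGrad t ht).memLp S
    have hρ2 := (h.hmem t ht).of_norm_le (norm_tailCoeff_le S _)
    have hρ1 := (hρ2.mono one_le_two fun _ => le_rfl).1
    have p := hpair' 1 t (U t) q Θ _ _ one_pos cU cq (by rw [hρ]; exact hρ1) (memLp_trig hab _ _)
      (Hmem_trig hab 1 _ _).1
    rw [hρ, one_pow, mul_one] at p
    have hΘ1 : hs a b 1 (fc a b Θ) = ∑ k ∈ S, wt a b k * ‖θ k‖ ^ 2 := by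
      rw [(Hmem_trig hab 1 S θ).2]; simp
    have hΘ0 := hs_mono_order zero_le_one (Hmem_trig hab 1 S θ).1
    rw [← hΘ1]
    have hρle : hs a b 1 (tailCoeff S (φ t)) ≤ ∑ k ∈ K' \ S, wt a b k * ‖φ t k‖ ^ 2 + ε₂ := by
      rw [hρ1.hs_eq_sum_add (K' \ S)]
      refine add_le_add (Finset.sum_le_sum fun k hk => ?_) ?_
      · rw [pow_one]
        exact mul_le_mul_of_nonneg_left (pow_le_pow_left₀ (norm_nonneg _)
          (norm_tailCoeff_le S _ k) 2) (wt_pos k).le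
      · refine (Hmem.mono ((h.hmem t ht).of_norm_le (norm_tailCoeff_le K' _)) one_le_two
          fun k => ?_).2.trans (hK' t ht)
        simp only [tailCoeff, Finset.mem_sdiff]
        split_ifs <;> simp_all
    have hgs : Q * √(hs a b 1 (tailCoeff S (φ t))) ≤ √(g t) := by
      rw [hgt t ht, Real.sqrt_mul (sq_nonneg _), Real.sqrt_sq hQ0.le]
      exact mul_le_mul_of_nonneg_left (Real.sqrt_le_sqrt hρle) hQ0.le
    refine p.trans ?_
    have hs01 := Real.sqrt_le_sqrt hΘ0
    calc _ ≤ √(hs a b 1 (tailCoeff S (φ t))) * (C' * √(hs a b 1 (fc a b Θ))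
          + C * √(hs a b 1 (fc a b Θ))) :=
          mul_le_mul_of_nonneg_left (add_le_add_left
            (mul_le_mul_of_nonneg_left hs01 hC'.le) _) (Real.sqrt_nonneg _)
      _ = Q * √(hs a b 1 (tailCoeff S (φ t))) * √(hs a b 1 (fc a b Θ)) := by rw [hQ]; ring
      _ ≤ _ := mul_le_mul_of_nonneg_right hgs (Real.sqrt_nonneg _)
  · have hφi : ∀ k, IntervalIntegrable (fun t => ‖φ t k‖ ^ 2) volume 0 T := fun k =>
      ContinuousOn.intervalIntegrable (by rw [Set.uIcc_of_le hT.le]; exact hcoef k)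
    have hsi : IntervalIntegrable (fun t => ∑ k ∈ K' \ S, wt a b k * ‖φ t k‖ ^ 2) volume 0 T := by
      refine ContinuousOn.intervalIntegrable (continuousOn_finsetSum _ fun k _ =>
        continuousOn_const.mul ?_)
      rw [Set.uIcc_of_le hT.le]; exact hcoef k
    have hint : ∫ t in (0 : ℝ)..T, g t = Q ^ 2 * (∑ k ∈ K' \ S, wt a b k * y k + ε₂ * T) := by
      rw [intervalIntegral.integral_congr (g := fun t => Q ^ 2 *
        (∑ k ∈ K' \ S, wt a b k * ‖φ t k‖ ^ 2 + ε₂)) (fun t ht => by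
          rw [Set.uIcc_of_le hT.le] at ht; exact hgt t ht), intervalIntegral.integral_const_mul,
        intervalIntegral.integral_add hsi (by simp), intervalIntegral.integral_finsetSum fun k _ => (hφi k).const_mul _,
        intervalIntegral.integral_const]
      simp only [intervalIntegral.integral_const_mul, sub_zero, smul_eq_mul, hy]
      ring
    have hdisj : Disjoint (K' \ S) K₀ :=
      Finset.disjoint_of_subset_right hKS Finset.sdiff_disjoint
    have htail := hK₀ _ hdisj
    rw [Real.norm_of_nonneg (Finset.sum_nonneg fun k _ =>
      mul_nonneg (pow_nonneg (hlam0 k) 3) (hy0 k))] at htail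
    -- Two powers of wt − 1, each at least cN², are traded for the passage from the H¹ to the H³
    -- weight.
    have hterm : ∑ k ∈ K' \ S, wt a b k * y k
        ≤ 2 * (c ^ 2)⁻¹ * (N ^ 4)⁻¹ * ∑ k ∈ K' \ S, (wt a b k - 1) ^ 3 * y k := by
      rw [Finset.mul_sum]
      refine Finset.sum_le_sum fun k hk => ?_
      have h1 : c * N ^ 2 ≤ wt a b k - 1 := hcN Nv hNv k (Finset.mem_sdiff.1 hk).2
      rw [← mul_assoc]
      refine mul_le_mul_of_nonneg_right ?_ (hy0 k)
      have h2 : (c * N ^ 2) ^ 2 ≤ (wt a b k - 1) ^ 2 := pow_le_pow_left₀ (by positivity) h1 2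
      have h3 : wt a b k ≤ 2 * (wt a b k - 1) := by linarith
      have h4 : (c ^ 2)⁻¹ * (N ^ 4)⁻¹ = ((c * N ^ 2) ^ 2)⁻¹ := by
        rw [← mul_inv]; congr 1; ring
      rw [mul_assoc 2, h4]
      have h5 : 1 ≤ ((c * N ^ 2) ^ 2)⁻¹ * (wt a b k - 1) ^ 2 := by
        rw [← div_eq_inv_mul, one_le_div (by positivity)]; exact h2
      calc wt a b k ≤ 2 * (wt a b k - 1) * 1 := by linarith
        _ ≤ 2 * (wt a b k - 1) * (((c * N ^ 2) ^ 2)⁻¹ * (wt a b k - 1) ^ 2) := by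
          refine mul_le_mul_of_nonneg_left h5 ?_
          linarith [hlam0 k]
        _ = _ := by ring
    rw [hint]
    calc _ ≤ Q ^ 2 * (2 * (c ^ 2)⁻¹ * (N ^ 4)⁻¹ * ε₁ + ε₂ * T) := by
          gcongr
          exact hterm.trans (mul_le_mul_of_nonneg_left htail.le (by positivity))
      _ = ε * (N ^ 4)⁻¹ := by rw [hε₁, hε₂]; field_simp; ring

/-! ### Taylor expansion of the reaction term -/

lemma fderiv_argDir (h : ℝ × ℝ × Sp d → ℝ) (z : ℝ × ℝ × Sp d) (ξ : ℝ) (η : Sp d) :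
    fderiv ℝ h z (0, ξ, η) = ξ * xiD h z + ∑ i, η i * etaD i h z := by
  have h1 : ((0, ξ, η) : ℝ × ℝ × Sp d) = ξ • argDir (Sum.inr (Sum.inl ()))
      + ∑ i, η i • argDir (Sum.inr (Sum.inr i)) := by
    have h2 : ∑ i, η i • (argDir (Sum.inr (Sum.inr i)) : ℝ × ℝ × Sp d) = (0, 0, η) := by
      refine Prod.ext ?_ (Prod.ext ?_ ?_)
      · simp [argDir, Prod.fst_sum]
      · simp [argDir, Prod.fst_sum, Prod.snd_sum]
      · ext j
        simp [argDir, Prod.snd_sum, Finset.sum_apply, Pi.single_apply]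
    rw [h2]
    simp [argDir]
  rw [h1, map_add, map_sum, map_smul]
  simp only [map_smul, smul_eq_mul]
  rfl

lemma abs_fderiv_le (h : ℝ × ℝ × Sp d → ℝ) (z : ℝ × ℝ × Sp d) (ξ : ℝ) (η : Sp d) :
    |fderiv ℝ h z (0, ξ, η)| ≤ (∑ c, |argD c h z|) * (|ξ| + ∑ i, |η i|) := by
  have hle : ∀ c, |argD c h z| ≤ ∑ c, |argD c h z| := fun c =>
    Finset.single_le_sum (f := fun c => |argD c h z|) (fun _ _ => abs_nonneg _) (Finset.mem_univ c)
  rw [fderiv_argDir, mul_add, Finset.mul_sum]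
  refine (abs_add_le _ _).trans (add_le_add ?_ ((Finset.abs_sum_le_sum_abs _ _).trans
    (Finset.sum_le_sum fun i _ => ?_)))
  · rw [abs_mul, mul_comm]
    exact mul_le_mul_of_nonneg_right (hle _) (abs_nonneg _)
  · rw [abs_mul, mul_comm]
    exact mul_le_mul_of_nonneg_right (hle _) (abs_nonneg _)

lemma contDiff_argD {f : ℝ × ℝ × Sp d → ℝ} (hf : ContDiff ℝ 2 f) (c : Unit ⊕ Unit ⊕ Fin d) :
    ContDiff ℝ 1 (argD c f) :=
  (hf.fderiv_right (m := 1) (by norm_num)).clm_apply contDiff_const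

lemma SmoothReaction.exists_bound {T : ℝ} {f : ℝ × ℝ × Sp d → ℝ} (hf : SmoothReaction T f)
    {K : ℝ} (hK : 0 < K) : ∃ C > 0, ∀ t ∈ Set.Icc 0 T, ∀ ξ : ℝ, |ξ| ≤ K → ∀ η : Sp d, ‖η‖ ≤ K →
      (∀ c, |argD c f (t, ξ, η)| ≤ C) ∧ ∀ c, ∑ c', |argD c' (argD c f) (t, ξ, η)| ≤ C := by
  obtain ⟨C, hC⟩ := hf.2 K hK K hK
  refine ⟨|C| + 1, by positivity, fun t ht ξ hξ η hη => ?_⟩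
  have h := hC t ht ξ hξ η hη
  have h1 : 0 ≤ ∑ c, ∑ c', |argD c (argD c' f) (t, ξ, η)| :=
    Finset.sum_nonneg fun _ _ => Finset.sum_nonneg fun _ _ => abs_nonneg _
  have h2 : 0 ≤ ∑ c, |argD c f (t, ξ, η)| := Finset.sum_nonneg fun _ _ => abs_nonneg _
  have h3 := abs_nonneg (f (t, ξ, η))
  have h4 := le_abs_self C
  refine ⟨fun c => ?_, fun c => ?_⟩
  · have := Finset.single_le_sum (f := fun c => |argD c f (t, ξ, η)|) (fun _ _ => abs_nonneg _)
      (Finset.mem_univ c)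
    linarith
  · rw [Finset.sum_comm] at h h1
    have := Finset.single_le_sum (f := fun c => ∑ c', |argD c' (argD c f) (t, ξ, η)|)
      (fun _ _ => Finset.sum_nonneg fun _ _ => abs_nonneg _) (Finset.mem_univ c)
    linarith

/-- Two mean value inequalities along the segment: the directional derivative k changes by at most
C·A², and then so does f minus its linearization. The segment stays in the ball where second
derivatives are bounded. -/
lemma SmoothReaction.exists_taylor {T : ℝ} {f : ℝ × ℝ × Sp d → ℝ} (hf : SmoothReaction T f)
    {K : ℝ} (hK : 0 < K) : ∃ C > 0, ∀ t ∈ Set.Icc 0 T, ∀ ξ ξ' : ℝ, |ξ| ≤ K → |ξ'| ≤ K →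
      ∀ η η' : Sp d, ‖η‖ ≤ K → ‖η'‖ ≤ K →
      |f (t, ξ', η') - f (t, ξ, η) - ((ξ' - ξ) * xiD f (t, ξ, η)
        + ∑ i, (η' i - η i) * etaD i f (t, ξ, η))| ≤ C * (|ξ' - ξ| + ∑ i, |η' i - η i|) ^ 2 := by
  obtain ⟨C, hC, hb⟩ := hf.exists_bound hK
  refine ⟨C, hC, fun t ht ξ ξ' hξ hξ' η η' hη hη' => ?_⟩
  set z : ℝ × ℝ × Sp d := (t, ξ, η) with hz
  set Δ : ℝ × ℝ × Sp d := (0, ξ' - ξ, η' - η) with hΔ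
  set A := |ξ' - ξ| + ∑ i, |(η' - η) i| with hA
  have hA0 : 0 ≤ A := by positivity
  have hline : ∀ s : ℝ, HasDerivAt (fun s : ℝ => z + s • Δ) Δ s := fun s => by
    simpa using ((hasDerivAt_id s).smul_const Δ).const_add z
  have hseg : ∀ s ∈ Set.Icc (0 : ℝ) 1, ∀ c, ∑ c', |argD c' (argD c f) (z + s • Δ)| ≤ C :=
    fun s hs c => by
    have e : z + s • Δ = (t, ξ + s * (ξ' - ξ), η + s • (η' - η)) := by simp [hz, hΔ]
    rw [e]
    refine (hb t ht _ ?_ _ ?_).2 c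
    · have h1 : ξ + s * (ξ' - ξ) = (1 - s) * ξ + s * ξ' := by ring
      rw [h1]
      refine (abs_add_le _ _).trans ?_
      rw [abs_mul, abs_mul, abs_of_nonneg hs.1, abs_of_nonneg (sub_nonneg.2 hs.2)]
      nlinarith [hs.1, hs.2]
    · have h1 : η + s • (η' - η) = (1 - s) • η + s • η' := by module
      rw [h1]
      refine (norm_add_le _ _).trans ?_
      rw [norm_smul, norm_smul, Real.norm_of_nonneg hs.1, Real.norm_of_nonneg (sub_nonneg.2 hs.2)]
      nlinarith [hs.1, hs.2]
  set k : ℝ → ℝ := fun s => (ξ' - ξ) * xiD f (z + s • Δ) + ∑ i, (η' - η) i * etaD i f (z + s • Δ)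
    with hk
  have hcd : ∀ c s, HasDerivAt (fun s : ℝ => argD c f (z + s • Δ))
      (fderiv ℝ (argD c f) (z + s • Δ) Δ) s := fun c s =>
    (((contDiff_argD hf.1 c).differentiable one_ne_zero _).hasFDerivAt).comp_hasDerivAt s (hline s)
  have hcb : ∀ c, ∀ s ∈ Set.Icc (0 : ℝ) 1, |fderiv ℝ (argD c f) (z + s • Δ) Δ| ≤ C * A :=
    fun c s hs => (abs_fderiv_le _ _ _ _).trans (mul_le_mul_of_nonneg_right (hseg s hs c) hA0)
  have hkd : ∀ s, HasDerivAt k ((ξ' - ξ) * fderiv ℝ (xiD f) (z + s • Δ) Δ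
      + ∑ i, (η' - η) i * fderiv ℝ (etaD i f) (z + s • Δ) Δ) s := fun s =>
    ((hcd _ s).const_mul _).add (HasDerivAt.fun_sum fun i _ => (hcd _ s).const_mul _)
  have hkb : ∀ s ∈ Set.Ico (0 : ℝ) 1, ‖(ξ' - ξ) * fderiv ℝ (xiD f) (z + s • Δ) Δ
      + ∑ i, (η' - η) i * fderiv ℝ (etaD i f) (z + s • Δ) Δ‖ ≤ C * A ^ 2 := fun s hs => by
    have hs' := Set.Ico_subset_Icc_self hs
    rw [Real.norm_eq_abs]
    have h1 : C * A ^ 2 = |ξ' - ξ| * (C * A) + ∑ i, |(η' - η) i| * (C * A) := by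
      rw [← Finset.sum_mul, ← add_mul, ← hA]; ring
    rw [h1]
    refine (abs_add_le _ _).trans (add_le_add ?_ ((Finset.abs_sum_le_sum_abs _ _).trans
      (Finset.sum_le_sum fun i _ => ?_)))
    · rw [abs_mul]; exact mul_le_mul_of_nonneg_left (hcb _ s hs') (abs_nonneg _)
    · rw [abs_mul]; exact mul_le_mul_of_nonneg_left (hcb _ s hs') (abs_nonneg _)
  have hk0 : ∀ s ∈ Set.Icc (0 : ℝ) 1, ‖k s - k 0‖ ≤ C * A ^ 2 := fun s hs => by
    have h1 := norm_image_sub_le_of_norm_deriv_le_segment' (fun s _ => (hkd s).hasDerivWithinAt)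
      hkb s hs
    have h2 : 0 ≤ C * A ^ 2 := by positivity
    refine h1.trans ?_
    nlinarith [hs.1, hs.2]
  have hfd : ∀ s, HasDerivAt (fun s : ℝ => f (z + s • Δ) - s * k 0) (k s - 1 * k 0) s := fun s => by
    have h1 : HasDerivAt (fun s : ℝ => f (z + s • Δ)) (fderiv ℝ f (z + s • Δ) Δ) s :=
      ((hf.1.differentiable two_ne_zero _).hasFDerivAt).comp_hasDerivAt s (hline s)
    rw [hΔ, fderiv_argDir] at h1
    exact h1.sub ((hasDerivAt_id s).mul_const _)
  have hfin := norm_image_sub_le_of_norm_deriv_le_segment_01'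
    (fun s _ => (hfd s).hasDerivWithinAt) (C := C * A ^ 2)
    fun s hs => by simpa using hk0 s (Set.Ico_subset_Icc_self hs)
  have e1 : z + (1 : ℝ) • Δ = (t, ξ', η') := by simp [hz, hΔ]
  rw [e1, zero_smul, add_zero, Real.norm_eq_abs] at hfin
  convert hfin using 2
  · simp only [hk, zero_smul, add_zero, PiLp.sub_apply]
    ring
  · simp [hA]

/-- The coefficient `∂f/∂η_l` along a trigonometric polynomial. -/
noncomputable def etaCoeff (a b : Fin d → ℝ) (f : ℝ × ℝ × Sp d → ℝ) (t : ℝ)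
    (S : Finset (Fin d → ℤ)) (c : (Fin d → ℤ) → ℂ) (l : Fin d) : Sp d → ℂ :=
  fun x => (etaD l f (t, (trig a b S c x).re,
    WithLp.toLp 2 fun i => (trigGrad a b S c i x).re) : ℝ)

lemma contDiff_realArg (t : ℝ) (S : Finset (Fin d → ℤ)) (c : (Fin d → ℤ) → ℂ) :
    ContDiff ℝ 1 fun x : Sp d => ((t, (trig a b S c x).re,
      WithLp.toLp 2 fun i => (trigGrad a b S c i x).re) : ℝ × ℝ × Sp d) := by
  refine contDiff_const.prodMk ((Complex.reCLM.contDiff.comp (contDiff_trig S c)).prodMk ?_)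
  rw [contDiff_piLp]
  exact fun i => Complex.reCLM.contDiff.comp (contDiff_trig S _)

lemma contDiff_etaCoeff {f : ℝ × ℝ × Sp d → ℝ} (hf : ContDiff ℝ 2 f) (t : ℝ)
    (S : Finset (Fin d → ℤ)) (c : (Fin d → ℤ) → ℂ) (l : Fin d) :
    ContDiff ℝ 1 (etaCoeff a b f t S c l) :=
  Complex.ofRealCLM.contDiff.comp ((contDiff_argD hf _).comp (contDiff_realArg t S c))

lemma isPeriodic_etaCoeff (hab : ∀ i, a i < b i) (f : ℝ × ℝ × Sp d → ℝ) (t : ℝ)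
    (S : Finset (Fin d → ℤ)) (c : (Fin d → ℤ) → ℂ) (l : Fin d) :
    IsPeriodic a b (etaCoeff a b f t S c l) := fun i x => by
  simp only [etaCoeff, trigGrad, isPeriodic_trig hab S _ i x]

lemma partialD_eq_of_hasDerivAt {v : Sp d → ℂ} (hv : Differentiable ℝ v) {i : Fin d} {x : Sp d}
    {v' : ℂ} (h : HasDerivAt (fun s : ℝ => v (x + s • EuclideanSpace.single i 1)) v' 0) :
    partialD i v x = v' := by
  have hline : HasDerivAt (fun s : ℝ => x + s • (EuclideanSpace.single i 1 : Sp d))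
      (EuclideanSpace.single i 1) 0 := by
    simpa using ((hasDerivAt_id (0 : ℝ)).smul_const (EuclideanSpace.single i (1 : ℝ))).const_add x
  have h1 : HasFDerivAt v (fderiv ℝ v x) (x + (0 : ℝ) • (EuclideanSpace.single i 1 : Sp d)) := by
    simpa using (hv x).hasFDerivAt
  exact (h1.comp_hasDerivAt (0 : ℝ) hline).unique h

lemma hasDerivAt_line {v : Sp d → ℂ} (hv : Differentiable ℝ v) (i : Fin d) (x : Sp d) :
    HasDerivAt (fun s : ℝ => v (x + s • EuclideanSpace.single i 1)) (partialD i v x) 0 := by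
  have hline : HasDerivAt (fun s : ℝ => x + s • (EuclideanSpace.single i 1 : Sp d))
      (EuclideanSpace.single i 1) 0 := by
    simpa using ((hasDerivAt_id (0 : ℝ)).smul_const (EuclideanSpace.single i (1 : ℝ))).const_add x
  have h1 : HasFDerivAt v (fderiv ℝ v x) (x + (0 : ℝ) • (EuclideanSpace.single i 1 : Sp d)) := by
    simpa using (hv x).hasFDerivAt
  exact h1.comp_hasDerivAt (0 : ℝ) hline

/-- Chain rule along a coordinate line. As t is frozen, only second derivatives of f in ξ and η
enter, multiplied by first and second derivatives of the polynomial. -/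
lemma norm_partialD_etaCoeff_le {f : ℝ × ℝ × Sp d → ℝ} (hf : ContDiff ℝ 2 f) (t : ℝ)
    (S : Finset (Fin d → ℤ)) (c : (Fin d → ℤ) → ℂ) (l j : Fin d) (x : Sp d) :
    ‖partialD j (etaCoeff a b f t S c l) x‖ ≤
      (∑ c', |argD c' (argD (Sum.inr (Sum.inr l)) f) (t, (trig a b S c x).re,
        WithLp.toLp 2 fun i => (trigGrad a b S c i x).re)|) * (‖trigGrad a b S c j x‖
        + ∑ i, ‖partialD j (trigGrad a b S c i) x‖) := by
  have hdiff : ∀ c : (Fin d → ℤ) → ℂ, Differentiable ℝ (trig a b S c) := fun c =>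
    (contDiff_trig S c (n := 1)).differentiable one_ne_zero
  have hre : ∀ c : (Fin d → ℤ) → ℂ, HasDerivAt
      (fun s : ℝ => (trig a b S c (x + s • EuclideanSpace.single j 1)).re)
      (partialD j (trig a b S c) x).re 0 := fun c =>
    Complex.reCLM.hasFDerivAt.comp_hasDerivAt (0 : ℝ) (hasDerivAt_line (hdiff c) j x)
  have hz : HasDerivAt (fun s : ℝ => ((t, (trig a b S c (x + s • EuclideanSpace.single j 1)).re,
      WithLp.toLp 2 fun i => (trigGrad a b S c i (x + s • EuclideanSpace.single j 1)).re) :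
        ℝ × ℝ × Sp d)) (0, (partialD j (trig a b S c) x).re,
          WithLp.toLp 2 fun i => (partialD j (trigGrad a b S c i) x).re) 0 := by
    refine (hasDerivAt_const _ _).prodMk ((hre c).prodMk ?_)
    exact (PiLp.continuousLinearEquiv 2 ℝ fun _ : Fin d => ℝ).symm.hasFDerivAt.comp_hasDerivAt
      (0 : ℝ) (hasDerivAt_pi.2 fun i => hre _)
  have hE := ((contDiff_argD hf (Sum.inr (Sum.inr l))).differentiable one_ne_zero
    (t, (trig a b S c (x + (0 : ℝ) • EuclideanSpace.single j 1)).re, WithLp.toLp 2 fun i =>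
      (trigGrad a b S c i (x + (0 : ℝ) • EuclideanSpace.single j 1)).re)).hasFDerivAt
  have h1 := Complex.ofRealCLM.hasFDerivAt.comp_hasDerivAt (0 : ℝ) (hE.comp_hasDerivAt (0 : ℝ) hz)
  rw [partialD_eq_of_hasDerivAt ((contDiff_etaCoeff hf t S c l).differentiable one_ne_zero) h1]
  simp only [zero_smul, add_zero]
  rw [Complex.ofRealCLM_apply, Complex.norm_real, Real.norm_eq_abs]
  refine (abs_fderiv_le _ _ _ _).trans (mul_le_mul_of_nonneg_left (add_le_add ?_
    (Finset.sum_le_sum fun i _ => ?_)) (Finset.sum_nonneg fun _ _ => abs_nonneg _))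
  · rw [partialD_trig]; exact Complex.abs_re_le_norm _
  · exact Complex.abs_re_le_norm _

/-! ### Consistency for regular solutions -/

/-- The elementary bound |s|² ≤ τ² + |s|⁴/τ² reduces the product estimate H¹·H¹ ⊆ L² to the weighted
one with exponent n = 2. -/
lemma exists_integral_sq_mul_sq_le (hd : 1 ≤ d) (hd3 : d ≤ 3) (hab : ∀ i, a i < b i) :
    ∃ C > 0, ∀ (s c : Sp d → ℂ) (τ : ℝ), 0 < τ →
      MemLp s 2 (boxMeasure a b) → Hmem a b 1 (fc a b s) → hs a b 1 (fc a b s) ≤ τ ^ 2 →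
      MemLp c 2 (boxMeasure a b) → Hmem a b 1 (fc a b c) →
      MemLp (fun x => ‖s x‖ * ‖c x‖) 2 (boxMeasure a b) ∧
        ∫ x, (‖s x‖ * ‖c x‖) ^ 2 ∂(boxMeasure a b) ≤ C * τ ^ 2 * hs a b 1 (fc a b c) := by
  have hn : AdmissibleExponent d 2 := ⟨le_rfl, by omega⟩
  obtain ⟨C, hC, h⟩ := exists_integral_pow_mul_sq_le hd hab hn
  have hV := boxVol_pos hab
  refine ⟨boxVol a b + C, by positivity, fun s c τ hτ hs2 hsm hsτ hc hcm => ?_⟩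
  obtain ⟨i1, i2⟩ := h s c τ hτ hs2 hsm hsτ hc hcm
  have hc2 : Integrable (fun x => ‖c x‖ ^ 2) (boxMeasure a b) := by
    simpa using hc.integrable_norm_pow (p := 2) (by norm_num)
  have hdom := (hc2.const_mul (τ ^ 2)).add (i1.const_mul ((τ ^ 2)⁻¹))
  have hmeas : AEStronglyMeasurable (fun x => ‖s x‖ * ‖c x‖) (boxMeasure a b) :=
    hs2.1.norm.mul hc.1.norm
  have hpt : ∀ x, (‖s x‖ * ‖c x‖) ^ 2
      ≤ τ ^ 2 * ‖c x‖ ^ 2 + (τ ^ 2)⁻¹ * (‖s x‖ ^ (2 * 2) * ‖c x‖ ^ 2) := fun x => by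
    rw [mul_pow, ← mul_assoc, ← add_mul]
    refine mul_le_mul_of_nonneg_right ?_ (sq_nonneg _)
    have h1 : 0 < τ ^ 2 := by positivity
    rw [← sub_nonneg]
    have h2 : τ ^ 2 + (τ ^ 2)⁻¹ * ‖s x‖ ^ (2 * 2) - ‖s x‖ ^ 2
        = (τ ^ 2)⁻¹ * ((τ ^ 2 - ‖s x‖ ^ 2) ^ 2 + τ ^ 2 * ‖s x‖ ^ 2) := by
      field_simp; ring
    rw [h2]; positivity
  have hint : Integrable (fun x => (‖s x‖ * ‖c x‖) ^ 2) (boxMeasure a b) :=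
    hdom.mono' (hmeas.pow 2) (Eventually.of_forall fun x => by
      rw [Real.norm_of_nonneg (sq_nonneg _)]; exact hpt x)
  refine ⟨(integrable_sq_iff_memLp hmeas).1 hint, (integral_mono hint hdom hpt).trans ?_⟩
  simp only [Pi.add_apply]
  rw [integral_add (hc2.const_mul _) (i1.const_mul _), integral_const_mul, integral_const_mul,
    (integral_norm_sq_eq hab hc).2]
  have h0 := hs_mono_order zero_le_one hcm
  calc _ ≤ τ ^ 2 * (boxVol a b * hs a b 1 (fc a b c))
        + (τ ^ 2)⁻¹ * (C * τ ^ (2 * 2) * hs a b 1 (fc a b c)) := by gcongr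
    _ = _ := by field_simp; ring

lemma Hmem_const_mul_freq {s : ℕ} {c : (Fin d → ℤ) → ℂ} (h : Hmem a b (s + 1) c) (i : Fin d)
    (S : Finset (Fin d → ℤ)) (hab : ∀ i, a i < b i) :
    hs a b s (fc a b (trigGrad a b S c i)) ≤ hs a b (s + 1) c := by
  rw [trigGrad, (Hmem_trig hab s S _).2]
  exact ((h.freq_mul i).1.sum_le S).trans (h.freq_mul i).2

/-- The derivative of a product with a coefficient of the linearized reaction term. -/
lemma SmoothReaction.exists_partialD_mul_le (hd : 1 ≤ d) (hd3 : d ≤ 3) (hab : ∀ i, a i < b i)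
    {T : ℝ} {f : ℝ × ℝ × Sp d → ℝ} (hf : SmoothReaction T f) (M K : ℝ) (hM : 0 ≤ M) (hK : 0 < K) :
    ∃ C > 0, ∀ t ∈ Set.Icc 0 T, ∀ (S S' : Finset (Fin d → ℤ)) (c θ : (Fin d → ℤ) → ℂ) (i : Fin d)
      (Θ : Sp d → ℂ), Hmem a b 3 c → hs a b 3 c ≤ M → (∀ x, ‖trig a b S c x‖ ≤ K) →
      (∀ x, ‖(WithLp.toLp 2 fun i => (trigGrad a b S c i x).re : Sp d)‖ ≤ K) →
      (∀ x, ‖trigGrad a b S c i x‖ ≤ K) → ContDiff ℝ 1 Θ →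
      (∀ x, ‖Θ x‖ = ‖trig a b S' θ x‖) → (∀ x, ‖partialD i Θ x‖ = ‖trigGrad a b S' θ i x‖) →
      ∫ x, ‖partialD i (fun x => etaCoeff a b f t S c i x * Θ x) x‖ ^ 2 ∂(boxMeasure a b)
        ≤ C * ∑ k ∈ S', wt a b k * ‖θ k‖ ^ 2 := by
  obtain ⟨C₀, hC₀, hb⟩ := hf.exists_bound hK
  obtain ⟨C₁, hC₁, hQ⟩ := exists_integral_sq_mul_sq_le (a := a) (b := b) hd hd3 hab
  have hV := boxVol_pos hab
  refine ⟨3 * C₀ ^ 2 * boxVol a b + 3 * C₀ ^ 2 * K ^ 2 * boxVol a b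
    + 3 * C₀ ^ 2 * d * (d * (C₁ * (M + 1))), by positivity,
    fun t ht S S' c θ i Θ hc hcM hq hgq hgi hΘ hΘn hΘd => ?_⟩
  set D := ∑ k ∈ S', wt a b k * ‖θ k‖ ^ 2 with hD
  set ϑ := trig a b S' θ with hϑ
  have hϑ1 : hs a b 1 (fc a b ϑ) = D := by rw [hϑ, (Hmem_trig hab 1 S' θ).2]; simp [hD]
  have hϑm := (Hmem_trig hab 1 S' θ).1
  have hϑ0 : hs a b 0 (fc a b ϑ) ≤ D := hϑ1 ▸ hs_mono_order zero_le_one hϑm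
  -- Second derivatives of the polynomial. They are not bounded pointwise, but the H³ bound controls
  -- them in H¹, so their products with Θ are square-integrable.
  set H : Fin d → Sp d → ℂ := fun l => trigGrad a b S (fun k => Complex.I * freq a b k l * c k) i
    with hH
  have hHl : ∀ l, partialD i (trigGrad a b S c l) = H l := fun l => partialD_trig S _ i
  have hHs : ∀ l, hs a b 1 (fc a b (H l)) ≤ √(M + 1) ^ 2 := fun l => by
    rw [Real.sq_sqrt (by linarith)]
    refine (Hmem_const_mul_freq (s := 1) (hc.freq_mul l).1 i S hab).trans ?_
    exact (hc.freq_mul l).2.trans (by linarith)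
  have hQl : ∀ l, _ := fun l => hQ (H l) ϑ (√(M + 1)) (by positivity) (memLp_trig hab _ _)
    (Hmem_trig hab 1 _ _).1 (hHs l) (memLp_trig hab _ _) hϑm
  have hIl : ∀ l, Integrable (fun x => (‖H l x‖ * ‖ϑ x‖) ^ 2) (boxMeasure a b) := fun l =>
    (integrable_sq_iff_memLp (hQl l).1.1).2 (hQl l).1
  have hϑi : Integrable (fun x => ‖ϑ x‖ ^ 2) (boxMeasure a b) := by
    simpa using (memLp_trig (p := 2) hab S' θ).integrable_norm_pow (p := 2) (by norm_num)
  have hgm : MemLp (trigGrad a b S' θ i) 2 (boxMeasure a b) := memLp_trig hab _ _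
  have hgi2 : Integrable (fun x => ‖trigGrad a b S' θ i x‖ ^ 2) (boxMeasure a b) := by
    simpa using hgm.integrable_norm_pow (p := 2) (by norm_num)
  have hA := contDiff_etaCoeff (a := a) (b := b) hf.1 t S c i
  have hzb : ∀ x, _ := fun x => hb t ht (trig a b S c x).re
    ((Complex.abs_re_le_norm _).trans (hq x)) _ (hgq x)
  have hAb : ∀ x, ‖etaCoeff a b f t S c i x‖ ≤ C₀ := fun x => by
    rw [etaCoeff, Complex.norm_real, Real.norm_eq_abs]
    exact (hzb x).1 _
  have hAd : ∀ x, ‖partialD i (etaCoeff a b f t S c i) x‖ ≤ C₀ * (K + ∑ l, ‖H l x‖) := fun x => by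
    refine (norm_partialD_etaCoeff_le hf.1 t S c i i x).trans ?_
    simp only [hHl]
    exact mul_le_mul ((hzb x).2 _) (add_le_add_left (hgi x) _) (by positivity) hC₀.le
  have hpt : ∀ x, ‖partialD i (fun x => etaCoeff a b f t S c i x * Θ x) x‖ ^ 2
      ≤ 3 * C₀ ^ 2 * ‖trigGrad a b S' θ i x‖ ^ 2 + 3 * C₀ ^ 2 * K ^ 2 * ‖ϑ x‖ ^ 2
        + 3 * C₀ ^ 2 * d * ∑ l, (‖H l x‖ * ‖ϑ x‖) ^ 2 := fun x => by
    rw [partialD_mul hA hΘ]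
    have h1 : ‖etaCoeff a b f t S c i x * partialD i Θ x
        + Θ x * partialD i (etaCoeff a b f t S c i) x‖
        ≤ C₀ * ‖trigGrad a b S' θ i x‖ + ‖ϑ x‖ * (C₀ * (K + ∑ l, ‖H l x‖)) := by
      refine (norm_add_le _ _).trans ?_
      rw [norm_mul, norm_mul, hΘn, hΘd]
      exact add_le_add (mul_le_mul_of_nonneg_right (hAb x) (norm_nonneg _))
        (mul_le_mul_of_nonneg_left (hAd x) (norm_nonneg _))
    have h2 : (∑ l, ‖H l x‖) ^ 2 ≤ d * ∑ l, ‖H l x‖ ^ 2 := by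
      simpa using sq_sum_le_card_mul_sum_sq (s := Finset.univ) (f := fun l => ‖H l x‖)
    have h3 : ∑ l, (‖H l x‖ * ‖ϑ x‖) ^ 2 = ‖ϑ x‖ ^ 2 * ∑ l, ‖H l x‖ ^ 2 := by
      rw [Finset.mul_sum]; exact Finset.sum_congr rfl fun l _ => by ring
    rw [h3]
    have h4 := pow_le_pow_left₀ (norm_nonneg _) h1 2
    refine h4.trans ?_
    set p := C₀ * ‖trigGrad a b S' θ i x‖ with hp
    set q := ‖ϑ x‖ * (C₀ * K) with hq'
    set r := ‖ϑ x‖ * (C₀ * ∑ l, ‖H l x‖) with hr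
    have h5 : p + ‖ϑ x‖ * (C₀ * (K + ∑ l, ‖H l x‖)) = p + q + r := by rw [hq', hr]; ring
    have h6 : (p + q + r) ^ 2 ≤ 3 * p ^ 2 + 3 * q ^ 2 + 3 * r ^ 2 := by
      nlinarith [sq_nonneg (p - q), sq_nonneg (p - r), sq_nonneg (q - r)]
    have h7 : r ^ 2 ≤ ‖ϑ x‖ ^ 2 * C₀ ^ 2 * (d * ∑ l, ‖H l x‖ ^ 2) := by
      have : r ^ 2 = ‖ϑ x‖ ^ 2 * C₀ ^ 2 * (∑ l, ‖H l x‖) ^ 2 := by rw [hr]; ring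
      rw [this]
      exact mul_le_mul_of_nonneg_left h2 (by positivity)
    rw [h5]
    refine h6.trans ?_
    have e1 : p ^ 2 = C₀ ^ 2 * ‖trigGrad a b S' θ i x‖ ^ 2 := by rw [hp]; ring
    have e2 : q ^ 2 = C₀ ^ 2 * K ^ 2 * ‖ϑ x‖ ^ 2 := by rw [hq']; ring
    rw [e1, e2]
    linarith
  have hsumi := (integrable_finsetSum Finset.univ fun l _ => hIl l).const_mul (3 * C₀ ^ 2 * d)
  have hfst : Integrable (fun x => 3 * C₀ ^ 2 * ‖trigGrad a b S' θ i x‖ ^ 2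
      + 3 * C₀ ^ 2 * K ^ 2 * ‖ϑ x‖ ^ 2) (boxMeasure a b) :=
    (hgi2.const_mul (3 * C₀ ^ 2)).add (hϑi.const_mul (3 * C₀ ^ 2 * K ^ 2))
  have hdom := hfst.add hsumi
  have hcont : Continuous (partialD i (fun x => etaCoeff a b f t S c i x * Θ x)) :=
    continuous_partialD (hA.mul hΘ) i
  have hint : Integrable (fun x => ‖partialD i (fun x => etaCoeff a b f t S c i x * Θ x) x‖ ^ 2)
      (boxMeasure a b) := hdom.mono' ((hcont.norm.pow 2).aestronglyMeasurable)
    (Eventually.of_forall fun x => by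
      rw [Real.norm_of_nonneg (sq_nonneg _)]; exact hpt x)
  refine (integral_mono hint hdom hpt).trans ?_
  simp only [Pi.add_apply]
  have e1 : ∫ x, (3 * C₀ ^ 2 * ‖trigGrad a b S' θ i x‖ ^ 2 + 3 * C₀ ^ 2 * K ^ 2 * ‖ϑ x‖ ^ 2
      + 3 * C₀ ^ 2 * d * ∑ l, (‖H l x‖ * ‖ϑ x‖) ^ 2) ∂(boxMeasure a b)
      = 3 * C₀ ^ 2 * (boxVol a b * hs a b 0 (fc a b (trigGrad a b S' θ i)))
        + 3 * C₀ ^ 2 * K ^ 2 * (boxVol a b * hs a b 0 (fc a b ϑ))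
        + 3 * C₀ ^ 2 * d * ∑ l, ∫ x, (‖H l x‖ * ‖ϑ x‖) ^ 2 ∂(boxMeasure a b) := by
    rw [integral_add hfst hsumi, integral_add (hgi2.const_mul _) (hϑi.const_mul _),
      integral_const_mul, integral_const_mul, integral_const_mul,
      integral_finsetSum _ fun l _ => hIl l, (integral_norm_sq_eq hab hgm).2,
      (integral_norm_sq_eq hab (memLp_trig hab S' θ)).2]
  rw [e1]
  have hg0 : hs a b 0 (fc a b (trigGrad a b S' θ i)) ≤ D := by
    have := ((isGrad_trig hab S' θ).hs_grad (s := 0) hϑm i).2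
    rwa [show trig a b S' θ = ϑ from rfl, hϑ1] at this
  have hsum := Finset.sum_le_card_nsmul Finset.univ
    (fun l => ∫ x, (‖H l x‖ * ‖ϑ x‖) ^ 2 ∂(boxMeasure a b)) (C₁ * (M + 1) * D) fun l _ => by
      have := (hQl l).2
      rwa [Real.sq_sqrt (by linarith), hϑ1] at this
  simp only [Finset.card_univ, Fintype.card_fin, nsmul_eq_mul] at hsum
  calc _ ≤ 3 * C₀ ^ 2 * (boxVol a b * D) + 3 * C₀ ^ 2 * K ^ 2 * (boxVol a b * D)
        + 3 * C₀ ^ 2 * d * (d * (C₁ * (M + 1) * D)) := by gcongr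
    _ = _ := by ring

lemma norm_integral_mul_le {v w : Sp d → ℂ} {μ : Measure (Sp d)} (hv : MemLp v 2 μ)
    (hw : MemLp w 2 μ) :
    ‖∫ x, v x * w x ∂μ‖ ≤ √(∫ x, ‖v x‖ ^ 2 ∂μ) * √(∫ x, ‖w x‖ ^ 2 ∂μ) := by
  refine (norm_integral_le_integral_norm _).trans ?_
  simp only [norm_mul]
  exact (integral_mul_le_sqrt hv.norm hw.norm).2

lemma partialD_conj {v : Sp d → ℂ} (hv : Differentiable ℝ v) (i : Fin d) (x : Sp d) :
    partialD i (fun x => conj (v x)) x = conj (partialD i v x) := by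
  have hc : Differentiable ℝ fun x => conj (v x) :=
    Complex.conjCLE.differentiable.comp hv
  refine partialD_eq_of_hasDerivAt hc ?_
  exact (Complex.conjCLE : ℂ →L[ℝ] ℂ).hasFDerivAt.comp_hasDerivAt (0 : ℝ) (hasDerivAt_line hv i x)

lemma norm_trig_grad_le {S : Finset (Fin d → ℤ)} {c : (Fin d → ℤ) → ℂ} {C M : ℝ}
    (hC : ∀ (c : (Fin d → ℤ) → ℂ) (S : Finset (Fin d → ℤ)), Hmem a b 2 c →
      ∑ k ∈ S, ‖c k‖ ≤ C * √(hs a b 2 c)) (hC0 : 0 ≤ C) (hm : Hmem a b 3 c)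
    (hM : hs a b 3 c ≤ M) (i : Fin d) (x : Sp d) : ‖trigGrad a b S c i x‖ ≤ C * √M :=
  (norm_trig_le _ _ _).trans ((hC _ S (hm.freq_mul i).1).trans
    (mul_le_mul_of_nonneg_left (Real.sqrt_le_sqrt ((hm.freq_mul i).2.trans hM)) hC0))

set_option maxHeartbeats 1600000 in
/-- The consistency error for functions in `H³`. -/
lemma SmoothReaction.exists_pairing_le (hd : 1 ≤ d) (hd3 : d ≤ 3) (hab : ∀ i, a i < b i)
    {T : ℝ} {f : ℝ × ℝ × Sp d → ℝ} (hf : SmoothReaction T f)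
    (hFm : ∀ (t : ℝ) (v : Sp d → ℂ) (g : Fin d → Sp d → ℂ), IsGrad a b v g →
      Hmem a b 2 (fc a b v) → MemLp (react f t v g) 2 (boxMeasure a b)) {M : ℝ} (hM : 0 ≤ M) :
    ∃ C > 0, ∀ t ∈ Set.Icc 0 T, ∀ (v : Sp d → ℂ) (g : Fin d → Sp d → ℂ)
      (S : Finset (Fin d → ℤ)) (θ : (Fin d → ℤ) → ℂ) (r₀ r₁ r₂ : ℝ), 0 < r₀ → 0 < r₁ → 0 < r₂ →
      IsGrad a b v g → Hmem a b 3 (fc a b v) → hs a b 3 (fc a b v) ≤ M →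
      hs a b 0 (tailCoeff S (fc a b v)) ≤ r₀ ^ 2 → hs a b 1 (tailCoeff S (fc a b v)) ≤ r₁ ^ 2 →
      hs a b 2 (tailCoeff S (fc a b v)) ≤ r₂ ^ 2 →
      ‖∫ x, (react f t v g x - react f t (trig a b S (fc a b v)) (trigGrad a b S (fc a b v)) x)
        * conj (trig a b S θ x) ∂(boxMeasure a b)‖
        ≤ C * (r₀ + r₁ * r₂) * √(∑ k ∈ S, wt a b k * ‖θ k‖ ^ 2) := by
  have hV := boxVol_pos hab
  obtain ⟨Ca, hCa, hae⟩ := exists_ae_bound (a := a) (b := b) hd hd3 hab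
  obtain ⟨Cs, hCs, hsup⟩ := exists_sup_bound (a := a) (b := b) hd hd3 hab
  -- B bounds v, its polynomial and all components of both gradients. The larger K also covers the
  -- Euclidean norm of the gradient vectors, so every argument of f lies in the ball of radius K.
  set B := (Ca + Cs) * √M with hB
  have hB0 : 0 ≤ B := by positivity
  set K := (d + 1) * B + 1 with hK
  have hK0 : 0 < K := by positivity
  have hBK : B ≤ K := by
    have : 0 ≤ (d : ℝ) * B := by positivity
    rw [hK]; linarith
  have hdBK : d * B ≤ K := by rw [hK]; linarith
  obtain ⟨C₀, hC₀, hbd⟩ := hf.exists_bound hK0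
  obtain ⟨C₁, hC₁, htay⟩ := hf.exists_taylor hK0
  obtain ⟨C₂, hC₂, hprod⟩ := hf.exists_partialD_mul_le hd hd3 hab M K hM hK0
  obtain ⟨C₃, hC₃, hQ⟩ := exists_integral_sq_mul_sq_le (a := a) (b := b) hd hd3 hab
  set E := C₀ + C₁ * (d + 1) * (2 * K + 1) with hE
  have hE0 : 0 < E := by positivity
  refine ⟨d * (√(boxVol a b) * √C₂) + E * (boxVol a b + d * (√(boxVol a b) * √C₃)),
    by positivity, fun t ht v g S θ r₀ r₁ r₂ hr₀ hr₁ hr₂ hg hm hmM h0 h1 h2 => ?_⟩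
  set D := ∑ k ∈ S, wt a b k * ‖θ k‖ ^ 2 with hD
  have hD0 : 0 ≤ D := Finset.sum_nonneg fun k _ => mul_nonneg (wt_pos k).le (sq_nonneg _)
  set φ := fc a b v with hφ
  set q := trig a b S φ with hq
  set gq := trigGrad a b S φ with hgq
  set Θ := trig a b S θ with hΘ
  have hΘ1 : hs a b 1 (fc a b Θ) = D := by rw [hΘ, (Hmem_trig hab 1 S θ).2]; simp [hD]
  have hΘm := (Hmem_trig hab 1 S θ).1
  have hΘ0 : hs a b 0 (fc a b Θ) ≤ D := hΘ1 ▸ hs_mono_order zero_le_one hΘm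
  have hΘ2 : MemLp Θ 2 (boxMeasure a b) := memLp_trig hab _ _
  have hqg := isGrad_trig hab S φ
  have hw := hg.sub hab hqg
  set ρ : Sp d → ℂ := v - q with hρ
  set σ : Fin d → Sp d → ℂ := g - gq with hσ
  have hρfc : fc a b ρ = tailCoeff S φ := fc_sub_trig hab hg.memLp S
  have hm2 : Hmem a b 2 φ := (hm.mono (by norm_num) fun _ => le_rfl).1
  have hρ2 : Hmem a b 2 (fc a b ρ) := by rw [hρfc]; exact hm2.of_norm_le (norm_tailCoeff_le S _)
  have hρ1 : Hmem a b 1 (fc a b ρ) := (hρ2.mono one_le_two fun _ => le_rfl).1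
  -- pointwise bounds
  have hMM : hs a b 2 φ ≤ M := (hs_mono_order (by norm_num) hm).trans hmM
  have hCaB : Ca * √M ≤ B := by rw [hB]; have := Real.sqrt_nonneg M; nlinarith
  have hCsB : Cs * √M ≤ B := by rw [hB]; have := Real.sqrt_nonneg M; nlinarith
  have hvB : ∀ᵐ x ∂(boxMeasure a b), ‖v x‖ ≤ B := by
    filter_upwards [hae v hg.memLp hm2] with x hx
    exact hx.trans ((mul_le_mul_of_nonneg_left (Real.sqrt_le_sqrt hMM) hCa.le).trans hCaB)
  have hgB : ∀ᵐ x ∂(boxMeasure a b), ∀ i, ‖g i x‖ ≤ B := by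
    refine ae_all_iff.2 fun i => ?_
    obtain ⟨e1, e2⟩ := hg.hs_grad (s := 2) hm i
    filter_upwards [hae (g i) (hg.grad_memLp i) e1] with x hx
    exact hx.trans ((mul_le_mul_of_nonneg_left (Real.sqrt_le_sqrt (e2.trans hmM)) hCa.le).trans hCaB)
  have hqB : ∀ x, ‖q x‖ ≤ B := fun x => (norm_trig_le _ _ _).trans ((hsup φ S hm2).trans
    ((mul_le_mul_of_nonneg_left (Real.sqrt_le_sqrt hMM) hCs.le).trans hCsB))
  have hgqB : ∀ i x, ‖gq i x‖ ≤ B := fun i x =>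
    (norm_trig_grad_le hsup hCs.le hm hmM i x).trans hCsB
  have hη : ∀ w : Fin d → ℂ, (∀ i, ‖w i‖ ≤ B) →
      ‖(WithLp.toLp 2 fun i => (w i).re : Sp d)‖ ≤ K := fun w hw => by
    refine (norm_le_sum_abs _).trans (le_trans ?_ hdBK)
    have := Finset.sum_le_card_nsmul Finset.univ (fun i => |(w i).re|) B
      fun i _ => (Complex.abs_re_le_norm _).trans (hw i)
    simpa using this
  have hre : ∀ z : ℂ, ‖z‖ ≤ B → |z.re| ≤ K := fun z hz =>
    (Complex.abs_re_le_norm _).trans (hz.trans hBK)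
  -- the linear terms in the gradient
  set A : Fin d → Sp d → ℂ := fun i => etaCoeff a b f t S φ i with hA
  have hAc : ∀ i, ContDiff ℝ 1 (A i) := fun i => contDiff_etaCoeff hf.1 t S φ i
  have hAb : ∀ i x, ‖A i x‖ ≤ C₀ := fun i x => by
    simp only [hA, etaCoeff]
    rw [Complex.norm_real, Real.norm_eq_abs]
    exact (hbd t ht _ (hre _ (hqB x)) _ (hη (fun i => gq i x) fun i => hgqB i x)).1 _
  have hΘc : ContDiff ℝ 1 Θ := contDiff_trig S θ
  have hΘcc : ContDiff ℝ 1 fun x => conj (Θ x) :=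
    (Complex.conjCLE : ℂ →L[ℝ] ℂ).contDiff.comp hΘc
  have hlin : ∀ (i : Fin d) (Θ' : Sp d → ℂ), ContDiff ℝ 1 Θ' → IsPeriodic a b Θ' →
      (∀ x, ‖Θ' x‖ = ‖Θ x‖) → (∀ x, ‖partialD i Θ' x‖ = ‖trigGrad a b S θ i x‖) →
      ‖∫ x, σ i x * (A i x * Θ' x) ∂(boxMeasure a b)‖ ≤ √(boxVol a b) * √C₂ * r₀ * √D :=
    fun i Θ' hc hp hn hdn => by
    have hGc : ContDiff ℝ 1 fun x => A i x * Θ' x := (hAc i).mul hc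
    -- Moving the derivative from the projection error onto the coefficient and Θ' is what gains the
    -- L² size r₀ in place of r₁.
    rw [hw.integral_grad_mul hab hGc (fun j x => by
      simp only [hA, isPeriodic_etaCoeff hab f t S φ i j x, hp j x]) i, norm_neg]
    refine (norm_integral_mul_le hw.memLp
      (memLp_of_continuous hab (continuous_partialD hGc i))).trans ?_
    have e1 := hprod t ht S S φ θ i Θ' hm hmM (fun x => (hqB x).trans hBK)
      (fun x => hη (fun i => gq i x) fun i => hgqB i x) (fun x => (hgqB i x).trans hBK) hc hn hdn
    have e2 : ∫ x, ‖ρ x‖ ^ 2 ∂(boxMeasure a b) ≤ boxVol a b * r₀ ^ 2 := by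
      rw [(integral_norm_sq_eq hab hw.memLp).2, hρfc]
      exact mul_le_mul_of_nonneg_left h0 hV.le
    calc _ ≤ √(boxVol a b * r₀ ^ 2) * √(C₂ * D) :=
          mul_le_mul (Real.sqrt_le_sqrt e2) (Real.sqrt_le_sqrt e1) (Real.sqrt_nonneg _)
            (Real.sqrt_nonneg _)
      _ = _ := by
          rw [Real.sqrt_mul hV.le, Real.sqrt_sq hr₀.le, Real.sqrt_mul hC₂.le]; ring
  have hmul2 : ∀ (i : Fin d) (Θ' : Sp d → ℂ), ContDiff ℝ 1 Θ' →
      MemLp (fun x => A i x * Θ' x) 2 (boxMeasure a b) := fun i Θ' hc =>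
    memLp_of_continuous hab ((hAc i).continuous.mul hc.continuous)
  -- The reaction term sees only Re σ, the mean of σ and its conjugate. As the coefficient A is
  -- real, the conjugate part is the conjugate of an integral with Θ in place of its conjugate; this
  -- is why `hlin` allows both test functions.
  have hlin1 : ∀ i, ‖∫ x, A i x * ((σ i x).re : ℂ) * conj (Θ x) ∂(boxMeasure a b)‖
      ≤ √(boxVol a b) * √C₂ * r₀ * √D := fun i => by
    have i1 := hlin i _ hΘcc (fun j x => by
      simp only [hΘ, isPeriodic_trig hab S θ j x]) (fun x => RCLike.norm_conj _) (fun x => by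
        rw [partialD_conj (hΘc.differentiable one_ne_zero), RCLike.norm_conj, hΘ, partialD_trig])
    have i2 := hlin i Θ hΘc (isPeriodic_trig hab S θ) (fun x => rfl) (fun x => by
      rw [hΘ, partialD_trig])
    have hAr : ∀ x, conj (A i x) = A i x := fun x => Complex.conj_ofReal _
    have e1 : ∀ x, A i x * ((σ i x).re : ℂ) * conj (Θ x)
        = (1 / 2 : ℂ) * (σ i x * (A i x * conj (Θ x)) + conj (σ i x * (A i x * Θ x))) := fun x => by
      have e2 : ((σ i x).re : ℂ) = (1 / 2 : ℂ) * (σ i x + conj (σ i x)) := by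
        rw [Complex.add_conj]; push_cast; ring
      rw [e2, map_mul, map_mul, hAr]; ring
    have j1 := integrable_mul_of_memLp_two (hw.grad_memLp i) (hmul2 i _ hΘcc)
    have j2 := integrable_mul_of_memLp_two (hw.grad_memLp i) (hmul2 i _ hΘc)
    have j3 : Integrable (fun x => conj (σ i x * (A i x * Θ x))) (boxMeasure a b) :=
      (Complex.conjCLE : ℂ →L[ℝ] ℂ).integrable_comp j2
    simp only [e1]
    rw [integral_const_mul, integral_add j1 j3, integral_conj]
    refine (norm_mul_le _ _).trans ?_
    have e4 := norm_add_le (∫ x, σ i x * (A i x * conj (Θ x)) ∂(boxMeasure a b))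
      (conj (∫ x, σ i x * (A i x * Θ x) ∂(boxMeasure a b)))
    rw [RCLike.norm_conj] at e4
    have e5 : ‖(1 / 2 : ℂ)‖ = 1 / 2 := by norm_num
    rw [e5]
    linarith
  -- the remaining terms
  set R : Sp d → ℂ := fun x => react f t v g x - react f t q gq x
    - ∑ i, A i x * ((σ i x).re : ℂ) with hR
  -- R consists of the Taylor remainder and the ξ-derivative term. The latter is already of size
  -- |ρ|, and |ρ|² ≤ 2K|ρ|.
  have hRle : ∀ᵐ x ∂(boxMeasure a b), ‖R x‖ ≤ E * (‖ρ x‖ + ∑ i, ‖σ i x‖ ^ 2) := by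
    filter_upwards [hvB, hgB] with x hx hgx
    have e1 := htay t ht (q x).re (v x).re (hre _ (hqB x)) (hre _ hx)
      (WithLp.toLp 2 fun i => (gq i x).re) (WithLp.toLp 2 fun i => (g i x).re)
      (hη (fun i => gq i x) fun i => hgqB i x) (hη (fun i => g i x) hgx)
    have e0 := (hbd t ht _ (hre _ (hqB x)) _ (hη (fun i => gq i x) fun i => hgqB i x)).1
      (Sum.inr (Sum.inl ()))
    set ξD := xiD f (t, (q x).re, WithLp.toLp 2 fun i => (gq i x).re) with hξD
    have e2 : R x = (((f (t, (v x).re, WithLp.toLp 2 fun i => (g i x).re)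
        - f (t, (q x).re, WithLp.toLp 2 fun i => (gq i x).re)
        - (((v x).re - (q x).re) * ξD + ∑ i, ((g i x).re - (gq i x).re)
          * etaD i f (t, (q x).re, WithLp.toLp 2 fun i => (gq i x).re)))
        + ((v x).re - (q x).re) * ξD : ℝ) : ℂ) := by
      simp only [hR, react, hA, etaCoeff, hσ, Pi.sub_apply, Complex.sub_re]
      push_cast
      simp only [mul_comm]
      ring
    have e3 : |(v x).re - (q x).re| ≤ ‖ρ x‖ := by
      simpa [hρ] using Complex.abs_re_le_norm (v x - q x)
    have e4 : ∀ i, |(g i x).re - (gq i x).re| ≤ ‖σ i x‖ := fun i => by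
      simpa [hσ] using Complex.abs_re_le_norm (g i x - gq i x)
    have e5 : (|(v x).re - (q x).re| + ∑ i, |(g i x).re - (gq i x).re|) ^ 2
        ≤ (d + 1) * (‖ρ x‖ ^ 2 + ∑ i, ‖σ i x‖ ^ 2) := by
      have s1 : |(v x).re - (q x).re| + ∑ i, |(g i x).re - (gq i x).re|
          ≤ ‖ρ x‖ + ∑ i, ‖σ i x‖ := add_le_add e3 (Finset.sum_le_sum fun i _ => e4 i)
      have s2 := pow_le_pow_left₀ (by positivity) s1 2
      refine s2.trans ?_
      have s3 := sq_sum_le_card_mul_sum_sq (s := (Finset.univ : Finset (Option (Fin d))))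
        (f := fun o => o.elim ‖ρ x‖ fun i => ‖σ i x‖)
      simpa [Fintype.sum_option] using s3
    have e6 : ‖ρ x‖ ≤ 2 * K := by
      refine (norm_sub_le _ _).trans ?_
      have := hqB x
      linarith
    have e7 : 0 ≤ ∑ i, ‖σ i x‖ ^ 2 := Finset.sum_nonneg fun _ _ => sq_nonneg _
    rw [e2, Complex.norm_real, Real.norm_eq_abs]
    refine (abs_add_le _ _).trans ?_
    have e8 : |((v x).re - (q x).re) * ξD| ≤ C₀ * ‖ρ x‖ := by
      rw [abs_mul, mul_comm]
      exact mul_le_mul e0 e3 (abs_nonneg _) hC₀.le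
    have e9 : ‖ρ x‖ ^ 2 ≤ 2 * K * ‖ρ x‖ := by
      rw [sq]; exact mul_le_mul_of_nonneg_right e6 (norm_nonneg _)
    calc _ ≤ C₁ * ((d + 1) * (‖ρ x‖ ^ 2 + ∑ i, ‖σ i x‖ ^ 2)) + C₀ * ‖ρ x‖ :=
          add_le_add (e1.trans (mul_le_mul_of_nonneg_left e5 hC₁.le)) e8
      _ ≤ C₁ * ((d + 1) * (2 * K * ‖ρ x‖ + ∑ i, ‖σ i x‖ ^ 2)) + C₀ * ‖ρ x‖ := by gcongr
      _ ≤ E * (‖ρ x‖ + ∑ i, ‖σ i x‖ ^ 2) := by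
          have n1 := norm_nonneg (ρ x)
          have p1 : 0 ≤ C₁ * (d + 1) * ‖ρ x‖ := by positivity
          have p2 : 0 ≤ C₁ * (d + 1) * (2 * K) * ∑ i, ‖σ i x‖ ^ 2 := by positivity
          have p3 : 0 ≤ C₀ * ∑ i, ‖σ i x‖ ^ 2 := by positivity
          rw [hE]; nlinarith
  have hσΘ : ∀ i, _ := fun i => by
    obtain ⟨e1, e2⟩ := hw.hs_grad (s := 1) hρ2 i
    exact hQ (σ i) Θ r₂ hr₂ (hw.grad_memLp i) e1 (e2.trans (by rw [hρfc]; exact h2)) hΘ2 hΘm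
  have hρΘ := integral_mul_le_sqrt hw.memLp.norm hΘ2.norm
  -- The quadratic term |σ|²|Θ| is read as |σ| times |σ||Θ|: the first factor gives r₁ in L², the
  -- second r₂ times the H¹ norm of Θ.
  have hσσ : ∀ i, _ := fun i => integral_mul_le_sqrt (hw.grad_memLp i).norm (hσΘ i).1
  have hv2 := hFm t v g hg hm2
  have hq2 := hFm t q gq hqg (Hmem_trig hab 2 S φ).1
  have hARi : ∀ i, Integrable (fun x => A i x * ((σ i x).re : ℂ) * conj (Θ x)) (boxMeasure a b) :=
    fun i => by
    have h3 : MemLp (fun x => ((σ i x).re : ℂ)) 2 (boxMeasure a b) :=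
      (hw.grad_memLp i).re.ofReal
    have := integrable_mul_of_memLp_two h3 (hmul2 i _ hΘcc)
    refine this.congr (Eventually.of_forall fun x => ?_)
    simp only; ring
  have hRi : Integrable (fun x => R x * conj (Θ x)) (boxMeasure a b) := by
    have i1 := integrable_mul_of_memLp_two (hv2.sub hq2) (memLp_conj hΘ2)
    refine (i1.sub (integrable_finsetSum Finset.univ fun i _ => hARi i)).congr
      (Eventually.of_forall fun x => ?_)
    simp only [Pi.sub_apply, hR]
    rw [sub_mul (react f t v g x - react f t q gq x) (∑ i, A i x * ((σ i x).re : ℂ)),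
      Finset.sum_mul]
  have hsplit : ∫ x, (react f t v g x - react f t q gq x) * conj (Θ x) ∂(boxMeasure a b)
      = ∑ i, (∫ x, A i x * ((σ i x).re : ℂ) * conj (Θ x) ∂(boxMeasure a b))
        + ∫ x, R x * conj (Θ x) ∂(boxMeasure a b) := by
    rw [← integral_finsetSum _ fun i _ => hARi i,
      ← integral_add (integrable_finsetSum Finset.univ fun i _ => hARi i) hRi]
    refine integral_congr_ae (Eventually.of_forall fun x => ?_)
    simp only [hR]
    rw [sub_mul _ (∑ i, _) (conj (Θ x)), Finset.sum_mul]
    ring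
  have hdomi := (hρΘ.1.add (integrable_finsetSum Finset.univ fun i _ => (hσσ i).1)).const_mul E
  have hRbound : ‖∫ x, R x * conj (Θ x) ∂(boxMeasure a b)‖
      ≤ E * ((boxVol a b * (r₀ * √D)) + d * (√(boxVol a b) * √C₃ * (r₁ * r₂) * √D)) := by
    refine (norm_integral_le_of_norm_le hdomi ?_).trans ?_
    · filter_upwards [hRle] with x hx
      rw [norm_mul, RCLike.norm_conj]
      calc _ ≤ E * (‖ρ x‖ + ∑ i, ‖σ i x‖ ^ 2) * ‖Θ x‖ :=
            mul_le_mul_of_nonneg_right hx (norm_nonneg _)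
        _ = _ := by
            simp only [Pi.add_apply]
            have e : (‖ρ x‖ + ∑ i, ‖σ i x‖ ^ 2) * ‖Θ x‖
                = ‖ρ x‖ * ‖Θ x‖ + ∑ i, ‖σ i x‖ * (‖σ i x‖ * ‖Θ x‖) := by
              rw [add_mul, Finset.sum_mul]
              congr 1
              exact Finset.sum_congr rfl fun i _ => by ring
            rw [mul_assoc, e]
    · rw [integral_const_mul]
      refine mul_le_mul_of_nonneg_left ?_ hE0.le
      simp only [Pi.add_apply]
      rw [integral_add hρΘ.1 (integrable_finsetSum Finset.univ fun i _ => (hσσ i).1),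
        integral_finsetSum _ fun i _ => (hσσ i).1]
      refine add_le_add (hρΘ.2.trans ?_) ?_
      · rw [(integral_norm_sq_eq hab hw.memLp).2, (integral_norm_sq_eq hab hΘ2).2, hρfc]
        calc _ ≤ √(boxVol a b * r₀ ^ 2) * √(boxVol a b * D) :=
              mul_le_mul (Real.sqrt_le_sqrt (mul_le_mul_of_nonneg_left h0 hV.le))
                (Real.sqrt_le_sqrt (mul_le_mul_of_nonneg_left hΘ0 hV.le)) (Real.sqrt_nonneg _)
                (Real.sqrt_nonneg _)
          _ = (√(boxVol a b) * √(boxVol a b)) * (r₀ * √D) := by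
              rw [Real.sqrt_mul hV.le, Real.sqrt_sq hr₀.le, Real.sqrt_mul hV.le]; ring
          _ = _ := by rw [Real.mul_self_sqrt hV.le]
      · have hterm : ∀ i ∈ Finset.univ, ∫ x, ‖σ i x‖ * (‖σ i x‖ * ‖Θ x‖) ∂(boxMeasure a b)
            ≤ √(boxVol a b) * √C₃ * (r₁ * r₂) * √D := fun i _ => by
          refine (hσσ i).2.trans ?_
          have e1 : ∫ x, ‖σ i x‖ ^ 2 ∂(boxMeasure a b) ≤ boxVol a b * r₁ ^ 2 := by
            rw [(integral_norm_sq_eq hab (hw.grad_memLp i)).2]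
            refine mul_le_mul_of_nonneg_left ((hw.hs_grad (s := 0) hρ1 i).2.trans ?_) hV.le
            rw [hρfc]; exact h1
          have e2 := (hσΘ i).2
          rw [hΘ1] at e2
          calc _ ≤ √(boxVol a b * r₁ ^ 2) * √(C₃ * r₂ ^ 2 * D) :=
                mul_le_mul (Real.sqrt_le_sqrt e1) (Real.sqrt_le_sqrt e2) (Real.sqrt_nonneg _)
                  (Real.sqrt_nonneg _)
            _ = _ := by
                rw [Real.sqrt_mul hV.le, Real.sqrt_sq hr₁.le, Real.sqrt_mul (by positivity),
                  Real.sqrt_mul hC₃.le, Real.sqrt_sq hr₂.le]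
                ring
        have := Finset.sum_le_card_nsmul _ _ _ hterm
        simpa using this
  rw [hsplit]
  have hsum : ‖∑ i, (∫ x, A i x * ((σ i x).re : ℂ) * conj (Θ x) ∂(boxMeasure a b))‖
      ≤ d * (√(boxVol a b) * √C₂ * r₀ * √D) := by
    refine (norm_sum_le _ _).trans ?_
    have := Finset.sum_le_card_nsmul Finset.univ _ _ fun i _ => hlin1 i
    simpa using this
  refine (norm_add_le _ _).trans ((add_le_add hsum hRbound).trans ?_)
  set s := √D
  have hs0 : 0 ≤ s := Real.sqrt_nonneg _
  set w₁ := √(boxVol a b) * √C₂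
  set w₂ := √(boxVol a b) * √C₃
  have hw1 : 0 ≤ w₁ := by positivity
  have hw2 : 0 ≤ w₂ := by positivity
  have k1 : d * (w₁ * r₀ * s) ≤ d * (w₁ * (r₀ + r₁ * r₂) * s) := by
    gcongr; linarith [mul_pos hr₁ hr₂]
  have k2 : E * ((boxVol a b * (r₀ * s)) + d * (w₂ * (r₁ * r₂) * s))
      ≤ E * ((boxVol a b * ((r₀ + r₁ * r₂) * s)) + d * (w₂ * (r₀ + r₁ * r₂) * s)) := by
    gcongr
    · linarith [mul_pos hr₁ hr₂]
    · linarith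
  refine (add_le_add k1 k2).trans_eq ?_
  ring

/-- Approximation by the Fourier projection. -/
lemma exists_hs_tail_le (hd : 1 ≤ d) (hab : ∀ i, a i < b i) {κ : ℝ} (hκ : 1 ≤ κ) :
    ∃ C > 0, ∀ Nv : Fin d → ℕ, Quasiuniform κ Nv → ∀ (s r : ℕ) (c : (Fin d → ℤ) → ℂ),
      Hmem a b (s + r) c →
      hs a b s (tailCoeff (freqFin Nv) c) ≤ ((C * (gridSize Nv : ℝ)⁻¹) ^ r) ^ 2 * hs a b (s + r) c := by
  obtain ⟨c₀, hc₀, hwt⟩ := exists_le_wt_of_notMem (a := a) (b := b) hd hab hκ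
  refine ⟨(√c₀)⁻¹, by positivity, fun Nv hNv s r c hc => ?_⟩
  have hN : (0 : ℝ) < gridSize Nv := by exact_mod_cast hNv.one_le_gridSize hd
  have hx : (((√c₀)⁻¹ * (gridSize Nv : ℝ)⁻¹) ^ r) ^ 2 = ((c₀ * (gridSize Nv : ℝ) ^ 2) ^ r)⁻¹ := by
    rw [← pow_mul, mul_comm r, pow_mul, mul_pow, inv_pow, inv_pow, Real.sq_sqrt hc₀.le, ← mul_inv,
      inv_pow]
  rw [hx, hs, hs, ← tsum_mul_left]
  refine Summable.tsum_le_tsum (fun k => ?_)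
    ((hc.mono (Nat.le_add_right s r) fun k => norm_tailCoeff_le _ c k).1) (Summable.mul_left _ hc)
  simp only [tailCoeff]
  have hw := wt_pos (a := a) (b := b) k
  split_ifs with hk
  · rw [norm_zero]
    have : 0 ≤ ((c₀ * (gridSize Nv : ℝ) ^ 2) ^ r)⁻¹ * (wt a b k ^ (s + r) * ‖c k‖ ^ 2) := by
      positivity
    simpa using this
  · rw [inv_mul_eq_div, le_div_iff₀ (by positivity), pow_add]
    have h1 : (c₀ * (gridSize Nv : ℝ) ^ 2) ^ r ≤ wt a b k ^ r :=
      pow_le_pow_left₀ (by positivity) (by linarith [hwt Nv hNv k hk]) r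
    calc _ ≤ wt a b k ^ s * ‖c k‖ ^ 2 * wt a b k ^ r := by gcongr
      _ = _ := by ring

/-- Consistency for solutions that are bounded in `H^m` for some `m ≥ 3`. -/
lemma StrongSolution.exists_consistency_of_regular (hd : 1 ≤ d) (hd3 : d ≤ 3)
    (hab : ∀ i, a i < b i) {n : ℕ} (hn : AdmissibleExponent d n) {L : ℝ} (hL : 0 < L)
    {f : ℝ × ℝ × Sp d → ℝ} (hf : LocallyLipschitzGrowth n L f) {T : ℝ} (hT : 0 < T)
    (hsm : SmoothReaction T f) {U : ℝ → Sp d → ℂ} {G : ℝ → Fin d → Sp d → ℂ}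
    (h : StrongSolution a b T f U G) {κ : ℝ} (hκ : 1 ≤ κ) {r : ℕ} {M : ℝ}
    (hm : ∀ t ∈ Set.Icc 0 T, Hmem a b (r + 3) (fc a b (U t)))
    (hM : ∀ t ∈ Set.Icc 0 T, hs a b (r + 3) (fc a b (U t)) ≤ M) :
    ∃ B > 0, ∀ Nv : Fin d → ℕ, Quasiuniform κ Nv →
      ∃ g, Consistency a b T f U G (freqFin Nv) g ∧
        ∫ t in (0 : ℝ)..T, g t ≤ B * ((gridSize Nv : ℝ) ^ (2 * (r + 3)))⁻¹ := by
  have hM0 : 0 ≤ M := (hs_nonneg _ _).trans (hM 0 ⟨le_rfl, hT.le⟩)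
  obtain ⟨C, hC, hpair⟩ := hsm.exists_pairing_le hd hd3 hab
    (fun t v g hg hv => memLp_react hd hd3 hab hn hL hsm.1.continuous hf t hg hv) hM0
  obtain ⟨D, hD, htail⟩ := exists_hs_tail_le (a := a) (b := b) hd hab hκ
  set E := C * (√(M + 1) + (M + 1) * D ^ r) * D ^ (r + 3) with hE
  have hE0 : 0 < E := by positivity
  refine ⟨T * E ^ 2, by positivity, fun Nv hNv => ?_⟩
  have hN1 : (1 : ℝ) ≤ gridSize Nv := by exact_mod_cast hNv.one_le_gridSize hd
  set y : ℝ := (gridSize Nv : ℝ)⁻¹ with hy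
  have hy0 : 0 < y := by positivity
  have hy1 : y ≤ 1 := inv_le_one_of_one_le₀ hN1
  -- M + 1 instead of M keeps the radii r₀, r₁, r₂ strictly positive.
  set q := √(M + 1) with hq
  have hq0 : 0 < q := by positivity
  have hqq : q ^ 2 = M + 1 := Real.sq_sqrt (by positivity)
  refine ⟨fun _ => (E * y ^ (r + 3)) ^ 2, ⟨continuous_const, fun _ => sq_nonneg _,
    fun t ht θ => ?_⟩, ?_⟩
  · have key : ∀ s k, s + k = r + 3 → hs a b s (tailCoeff (freqFin Nv) (fc a b (U t)))
        ≤ (q * (D * y) ^ k) ^ 2 := fun s k hsk => by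
      have h1 := htail Nv hNv s k (fc a b (U t)) (by rw [hsk]; exact hm t ht)
      rw [hsk] at h1
      refine h1.trans ?_
      rw [mul_pow q, hqq, mul_comm]
      exact mul_le_mul_of_nonneg_right (by linarith [hM t ht]) (by positivity)
    have h3 : Hmem a b 3 (fc a b (U t)) := ((hm t ht).mono (by omega) fun _ => le_rfl).1
    have p := hpair t ht (U t) (G t) (freqFin Nv) θ (q * (D * y) ^ (r + 3)) (q * (D * y) ^ (r + 2))
      (q * (D * y) ^ (r + 1)) (by positivity) (by positivity) (by positivity) (h.isGrad t ht) h3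
      ((hs_mono_order (by omega) (hm t ht)).trans (hM t ht)) (key 0 _ (by omega))
      (key 1 _ (by omega)) (key 2 _ (by omega))
    refine p.trans (mul_le_mul_of_nonneg_right ?_ (Real.sqrt_nonneg _))
    rw [Real.sqrt_sq (by positivity)]
    -- With m = r + 3, the quadratic contribution has order N^{−(2m−3)}, which is at most N^{−m}
    -- precisely because m ≥ 3.
    have e1 : q * (D * y) ^ (r + 2) * (q * (D * y) ^ (r + 1))
        = (M + 1) * (D ^ r * y ^ r) * (D ^ (r + 3) * y ^ (r + 3)) := by rw [← hqq]; ring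
    have e2 : y ^ r ≤ 1 := pow_le_one₀ hy0.le hy1
    rw [e1]
    calc _ ≤ C * (q * (D * y) ^ (r + 3) + (M + 1) * (D ^ r * 1) * (D ^ (r + 3) * y ^ (r + 3))) := by
          gcongr
      _ = _ := by rw [hE]; ring
  · rw [intervalIntegral.integral_const, sub_zero, smul_eq_mul, hy, inv_pow]
    apply le_of_eq
    ring

/-- Consistency in terms of the regularity of the solution. -/
lemma StrongSolution.exists_consistency (hd : 1 ≤ d) (hd3 : d ≤ 3)
    (hab : ∀ i, a i < b i) {n : ℕ} (hn : AdmissibleExponent d n) {L : ℝ} (hL : 0 < L)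
    {f : ℝ × ℝ × Sp d → ℝ} (hf : LocallyLipschitzGrowth n L f) {T : ℝ} (hT : 0 < T)
    (hsm : SmoothReaction T f) {U : ℝ → Sp d → ℂ} {G : ℝ → Fin d → Sp d → ℂ}
    (h : StrongSolution a b T f U G) {κ : ℝ} (hκ : 1 ≤ κ) {m : ℕ} (h2 : 2 ≤ m) {M : ℝ}
    (hm : ∀ t ∈ Set.Icc 0 T, Hmem a b m (fc a b (U t)))
    (hM : ∀ t ∈ Set.Icc 0 T, hs a b m (fc a b (U t)) ≤ M) {ε : ℝ} (hε : 0 < ε) :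
    ∃ B > 0, ∃ N₀ : ℕ, ∀ Nv : Fin d → ℕ, Quasiuniform κ Nv → N₀ ≤ gridSize Nv →
      ∃ g, Consistency a b T f U G (freqFin Nv) g ∧
        ∫ t in (0 : ℝ)..T, g t ≤ B * ((gridSize Nv : ℝ) ^ (2 * m))⁻¹ ∧
        ∫ t in (0 : ℝ)..T, g t ≤ ε * ((gridSize Nv : ℝ) ^ 4)⁻¹ := by
  rcases Nat.lt_or_ge m 3 with h3 | h3
  · obtain rfl : m = 2 := by omega
    obtain ⟨N₀, hN₀⟩ := h.exists_consistency_H2 hd hd3 hab hn hL hsm.1.continuous hf hT hκ hε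
    exact ⟨ε, hε, N₀, fun Nv hNv hN => let ⟨g, h1, h4⟩ := hN₀ Nv hNv hN; ⟨g, h1, h4, h4⟩⟩
  · obtain ⟨r, rfl⟩ := Nat.exists_eq_add_of_le' h3
    obtain ⟨B, hB, hcons⟩ := h.exists_consistency_of_regular hd hd3 hab hn hL hf hT hsm hκ hm hM
    -- For m ≥ 3 the rate exceeds N⁻⁴ by at least N⁻², which swallows B/ε for large N. For m = 2
    -- this smallness had to come from smoothing.
    obtain ⟨N₁, hN₁⟩ := exists_nat_ge (B / ε)
    refine ⟨B, hB, N₁, fun Nv hNv hN => ?_⟩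
    obtain ⟨g, h1, h4⟩ := hcons Nv hNv
    refine ⟨g, h1, h4, h4.trans ?_⟩
    have hN1 : (1 : ℝ) ≤ gridSize Nv := by exact_mod_cast hNv.one_le_gridSize hd
    have hBN : B ≤ ε * (gridSize Nv : ℝ) ^ 2 := by
      have e1 : (N₁ : ℝ) ≤ gridSize Nv := by exact_mod_cast hN
      have e2 := (div_le_iff₀ hε).1 (hN₁.trans e1)
      have e3 : (gridSize Nv : ℝ) ≤ (gridSize Nv : ℝ) ^ 2 := le_self_pow₀ hN1 two_ne_zero
      nlinarith
    have e5 : (gridSize Nv : ℝ) ^ 6 ≤ (gridSize Nv : ℝ) ^ (2 * (r + 3)) :=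
      pow_le_pow_right₀ hN1 (by omega)
    calc _ ≤ ε * (gridSize Nv : ℝ) ^ 2 * ((gridSize Nv : ℝ) ^ 6)⁻¹ := by gcongr
      _ = _ := by
        have : (gridSize Nv : ℝ) ≠ 0 := by positivity
        field_simp

/-! ### The error estimate -/

/-- Every solution of the truncated Galerkin system stays below the truncation level, and is close
to the Fourier projection of the exact solution. -/
lemma StrongSolution.exists_coeff_error_le (hd : 1 ≤ d) (hd3 : d ≤ 3)
    (hab : ∀ i, a i < b i) {n : ℕ} (hn : AdmissibleExponent d n) {L : ℝ} (hL : 0 < L)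
    {f : ℝ × ℝ × Sp d → ℝ} (hf : LocallyLipschitzGrowth n L f) {T : ℝ} (hT : 0 < T)
    (hsm : SmoothReaction T f) {U : ℝ → Sp d → ℂ} {G : ℝ → Fin d → Sp d → ℂ}
    (h : StrongSolution a b T f U G) {κ : ℝ} (hκ : 1 ≤ κ) {m : ℕ} (h2 : 2 ≤ m) {M : ℝ}
    (hm : ∀ t ∈ Set.Icc 0 T, Hmem a b m (fc a b (U t)))
    (hM : ∀ t ∈ Set.Icc 0 T, hs a b m (fc a b (U t)) ≤ M) :
    ∃ R > 0, ∃ C > 0, ∃ N₀ : ℕ, ∀ Nv : Fin d → ℕ, Quasiuniform κ Nv → N₀ ≤ gridSize Nv →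
      ∀ c c' : ℝ → (Fin d → ℤ) → ℂ, (∀ k ∈ freqFin Nv, c 0 k = fc a b (U 0) k) →
      (∀ t ∈ Set.Icc 0 T, ∀ k ∈ freqFin Nv,
        HasDerivWithinAt (fun s => c s k) (c' t k) (Set.Icc 0 T) t) →
      (∀ t ∈ Set.Icc 0 T, (∀ k ∈ freqFin Nv, ‖c t k‖ ≤ R) →
        ∀ k ∈ freqFin Nv, c' t k = galerkinField a b f (freqFin Nv) t (c t) k) →
      ∀ t ∈ Set.Icc 0 T,
        (∑ k ∈ freqFin Nv, ‖fc a b (U t) k - c t k‖ ^ 2 ≤ C * ((gridSize Nv : ℝ) ^ (2 * m))⁻¹) ∧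
          ∀ k ∈ freqFin Nv, ‖c t k‖ ≤ R := by
  obtain ⟨A, τ, R, hA, hτ, hR, henergy⟩ :=
    h.exists_energy_le hd hd3 hab hn hL hsm.1.continuous hf hT
  obtain ⟨W, hW, hwt⟩ := exists_wt_le_of_mem a b
  set X := Real.exp (A * T) with hX
  have hX0 : 0 < X := Real.exp_pos _
  -- The threshold is δ = eN⁻⁴. Weights in X_N are at most WN², so the condition wt²δ ≤ τ² amounts
  -- to e ≤ τ²/W². The definition of ε then makes the Grönwall bound fall below δ.
  set e := min 1 (τ ^ 2 / W ^ 2) with he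
  have he0 : 0 < e := lt_min one_pos (by positivity)
  set ε := e / (X * A) with hε
  have hε0 : 0 < ε := by positivity
  obtain ⟨B, hB, N₀, hcons⟩ := h.exists_consistency hd hd3 hab hn hL hf hT hsm hκ h2 hm hM
    (half_pos hε0)
  refine ⟨R, hR, X * (A * (2 * B)), by positivity, N₀, fun Nv hNv hN c c' hc0 hcd hcf => ?_⟩
  obtain ⟨g, ⟨hg1, hg2, hg3⟩, hg4, hg5⟩ := hcons Nv hNv hN
  set N : ℝ := ((gridSize Nv : ℕ) : ℝ) with hNdef
  have hN1 : (1 : ℝ) ≤ N := by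
    rw [hNdef]; exact_mod_cast hNv.one_le_gridSize hd
  have hN0 : 0 < N := by linarith
  have hE0 : 0 < (N ^ (2 * m))⁻¹ := by positivity
  have hF0 : 0 < (N ^ 4)⁻¹ := by positivity
  -- The first entry gives the rate, the second closes the bootstrap. The factor 2 here and the half
  -- in `half_pos` leave room for the strict inequality.
  set γ := min (2 * B * (N ^ (2 * m))⁻¹) (ε * (N ^ 4)⁻¹) with hγ
  have hgγ : ∫ t in (0 : ℝ)..T, g t < γ :=
    lt_min (hg4.trans_lt (by nlinarith [mul_pos hB hE0])) (hg5.trans_lt (by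
      nlinarith [mul_pos hε0 hF0]))
  have hδ : X * (A * γ) ≤ e * (N ^ 4)⁻¹ := by
    have h1 : X * (A * γ) ≤ X * (A * (ε * (N ^ 4)⁻¹)) := by
      gcongr
      exact min_le_right _ _
    refine h1.trans_eq ?_
    rw [hε]; field_simp
  have hδ1 : e * (N ^ 4)⁻¹ ≤ 1 :=
    mul_le_one₀ (min_le_left _ _) hF0.le (inv_le_one_of_one_le₀ (one_le_pow₀ hN1))
  intro t ht
  obtain ⟨r1, r2⟩ := henergy (freqFin Nv) g γ _ c c' hg1 hg2 hg3 hgγ hδ hδ1 (fun k hk => by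
    have h1 := hwt κ Nv (hNv.one_le_gridSize hd) hNv k hk
    calc wt a b k ^ 2 * (e * (N ^ 4)⁻¹) ≤ (W * N ^ 2) ^ 2 * (τ ^ 2 / W ^ 2 * (N ^ 4)⁻¹) := by
          have := (wt_pos (a := a) (b := b) k).le
          gcongr
          exact min_le_right _ _
      _ = τ ^ 2 := by field_simp) hc0 hcd hcf t ht
  refine ⟨r1.trans ?_, r2⟩
  calc X * (A * γ) ≤ X * (A * (2 * B * (N ^ (2 * m))⁻¹)) := by
        gcongr
        exact min_le_left _ _
    _ = _ := by ring

lemma memHp_trig (hab : ∀ i, a i < b i) (S : Finset (Fin d → ℤ)) (c : (Fin d → ℤ) → ℂ) :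
    MemHp a b 1 (trig a b S c) :=
  memHp_one_of_grad (memLp_trig hab S c) fun i => isWeakDeriv_trig hab S c i

/-- The error in terms of the error of the coefficients and of the projection error. -/
lemma exists_sobolevNorm_sub_trig_le (hd : 1 ≤ d) (hab : ∀ i, a i < b i) {κ : ℝ} (hκ : 1 ≤ κ)
    {m : ℕ} (h2 : 2 ≤ m) {Y M : ℝ} (hY : 0 ≤ Y) (hM : 0 ≤ M) :
    ∃ C > 0, ∀ Nv : Fin d → ℕ, Quasiuniform κ Nv → ∀ (c : (Fin d → ℤ) → ℂ) (v : Sp d → ℂ),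
      MemHp a b 2 v → Hmem a b m (fc a b v) → hs a b m (fc a b v) ≤ M →
      ∑ k ∈ freqFin Nv, ‖fc a b v k - c k‖ ^ 2 ≤ Y * ((gridSize Nv : ℝ) ^ (2 * m))⁻¹ →
      ∀ s ≤ 1, sobolevNorm a b s (v - trig a b (freqFin Nv) c) ^ 2
          ≤ C * ((gridSize Nv : ℝ) ^ (2 * m))⁻¹ * (gridSize Nv : ℝ) ^ (2 * s) := by
  have hV := boxVol_pos hab
  obtain ⟨W, hW, hwt⟩ := exists_wt_le_of_mem a b
  obtain ⟨D, hD, htail⟩ := exists_hs_tail_le (a := a) (b := b) hd hab hκ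
  set Q : ℝ := ((multiIndices d 0).card + (multiIndices d 1).card) * boxVol a b with hQ
  have hQ0 : 0 ≤ Q := by positivity
  refine ⟨Q * ((1 + W) * Y + (1 + D) ^ (2 * m) * M) + 1, by positivity,
    fun Nv hNv c v hv hm hvM hY' s hs1 => ?_⟩
  have hN1 : (1 : ℝ) ≤ gridSize Nv := by exact_mod_cast hNv.one_le_gridSize hd
  set N : ℝ := ((gridSize Nv : ℕ) : ℝ) with hNdef
  have hN0 : 0 < N := by linarith
  set S := freqFin Nv with hS
  have hw : MemHp a b s (v - trig a b S c) := fun α hα =>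
    MemHp.sub hab (fun β hβ => hv β (hβ.trans one_le_two)) (memHp_trig hab S c) α (hα.trans hs1)
  have hwm := (hw.hs_le hab).1
  have hfc : fc a b (v - trig a b S c) = fun k => fc a b v k - if k ∈ S then c k else 0 := by
    rw [fc_sub hab hv.memLp (memLp_trig hab _ _), fc_trig hab]; rfl
  have ht : tailCoeff S (fc a b (v - trig a b S c)) = tailCoeff S (fc a b v) := by
    rw [hfc]; ext k; simp only [tailCoeff]; split_ifs <;> simp
  -- Inside X_N the inverse inequality costs N^{2s}; outside, the error is the projection error of
  -- v.
  have e1 : ∑ k ∈ S, wt a b k ^ s * ‖fc a b (v - trig a b S c) k‖ ^ 2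
      ≤ (1 + W) * N ^ (2 * s) * (Y * (N ^ (2 * m))⁻¹) := by
    have hN2 : 0 ≤ (1 + W) * N ^ (2 * s) := by positivity
    refine le_trans ?_ (mul_le_mul_of_nonneg_left hY' hN2)
    rw [Finset.mul_sum]
    refine Finset.sum_le_sum fun k hk => ?_
    rw [hfc]
    simp only [hk, if_true]
    refine mul_le_mul_of_nonneg_right ?_ (sq_nonneg _)
    have h1 := hwt κ Nv (hNv.one_le_gridSize hd) hNv k hk
    have h0 := (wt_pos (a := a) (b := b) k).le
    interval_cases s
    · simp [hW.le]
    · simp only [pow_one, mul_one]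
      nlinarith [sq_nonneg N]
  have e2 : hs a b s (tailCoeff S (fc a b v)) ≤ (1 + D) ^ (2 * m) * M * ((N ^ (2 * m))⁻¹ * N ^ (2 * s)) := by
    have h1 := htail Nv hNv s (m - s) (fc a b v) (by rwa [Nat.add_sub_cancel' (by omega)])
    rw [Nat.add_sub_cancel' (by omega)] at h1
    have h3 : ((D * N⁻¹) ^ (m - s)) ^ 2 = D ^ (2 * (m - s)) * ((N ^ (2 * m))⁻¹ * N ^ (2 * s)) := by
      rw [← pow_mul, mul_pow, mul_comm (m - s), inv_pow]
      congr 1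
      have : N ^ (2 * m) = N ^ (2 * (m - s)) * N ^ (2 * s) := by
        rw [← pow_add]; congr 1; omega
      rw [this]; field_simp
    have h4 : D ^ (2 * (m - s)) ≤ (1 + D) ^ (2 * m) :=
      (pow_le_pow_left₀ hD.le (by linarith) _).trans
        (pow_le_pow_right₀ (by linarith) (by omega))
    calc _ ≤ _ := h1
      _ ≤ D ^ (2 * (m - s)) * ((N ^ (2 * m))⁻¹ * N ^ (2 * s)) * M := by rw [h3]; gcongr
      _ ≤ (1 + D) ^ (2 * m) * ((N ^ (2 * m))⁻¹ * N ^ (2 * s)) * M := by gcongr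
      _ = _ := by ring
  have hcard : ((multiIndices d s).card : ℝ) * boxVol a b ≤ Q := by
    refine mul_le_mul_of_nonneg_right ?_ hV.le
    interval_cases s <;> simp
  refine (hw.sobolevNorm_sq_le hab hwm).trans ?_
  rw [hwm.hs_eq_sum_add S, ht]
  have hp : 0 ≤ (N ^ (2 * m))⁻¹ * N ^ (2 * s) := by positivity
  calc _ ≤ Q * ((1 + W) * N ^ (2 * s) * (Y * (N ^ (2 * m))⁻¹)
        + (1 + D) ^ (2 * m) * M * ((N ^ (2 * m))⁻¹ * N ^ (2 * s))) := by
        refine mul_le_mul hcard (add_le_add e1 e2) (add_nonneg (Finset.sum_nonneg fun k _ =>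
          hs_term_nonneg s _ k) (hs_nonneg _ _)) hQ0
    _ = Q * ((1 + W) * Y + (1 + D) ^ (2 * m) * M) * ((N ^ (2 * m))⁻¹ * N ^ (2 * s)) := by ring
    _ ≤ _ := by rw [mul_assoc _ (N ^ (2 * m))⁻¹]; exact mul_le_mul_of_nonneg_right (by linarith) hp

/-- Convergence for regularity exponents at least two. -/
lemma IsExactSolution.exists_galerkin_error_le (hd : 1 ≤ d) (hd3 : d ≤ 3)
    (hab : ∀ i, a i < b i) {n : ℕ} (hn : AdmissibleExponent d n) {L : ℝ} (hL : 0 < L)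
    {f : ℝ × ℝ × Sp d → ℝ} (hf : LocallyLipschitzGrowth n L f) {T : ℝ} (hT : 0 < T)
    (hsm : SmoothReaction T f) {u₀ : Sp d → ℝ} (hu₀ : MemLp (cplx u₀) 2 (boxMeasure a b))
    {u : ℝ → Sp d → ℝ} (hu : IsExactSolution a b T f u₀ u) {κ : ℝ} (hκ : 1 ≤ κ)
    {m : ℕ} (h2 : 2 ≤ m) {M : ℝ} (hm : ∀ t ∈ Set.Icc 0 T, Hmem a b m (fc a b (cplx (u t))))
    (hM : ∀ t ∈ Set.Icc 0 T, hs a b m (fc a b (cplx (u t))) ≤ M) :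
    ∃ (N₀ : ℕ) (C : ℝ), 0 < C ∧ ∀ Nv : Fin d → ℕ, Quasiuniform κ Nv → N₀ ≤ gridSize Nv →
      (∃ uN, IsGalerkinSolution a b T f u₀ Nv uN) ∧
      ∀ uN, IsGalerkinSolution a b T f u₀ Nv uN → ∀ t ∈ Set.Icc 0 T,
        sobolevNorm a b 0 (cplx (u t) - uN t)
          + (gridSize Nv : ℝ)⁻¹ * sobolevNorm a b 1 (cplx (u t) - uN t)
          ≤ C * ((gridSize Nv : ℝ) ^ m)⁻¹ := by
  have hM0 : 0 ≤ M := (hs_nonneg _ _).trans (hM 0 ⟨le_rfl, hT.le⟩)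
  have hfc : Continuous f := hsm.1.continuous
  have h := hu.strongSolution hd hd3 hab hn hL hfc hf
  obtain ⟨R, hR, Y, hY, N₀, hcoef⟩ := h.exists_coeff_error_le hd hd3 hab hn hL hf hT hsm hκ h2 hm hM
  obtain ⟨C, hC, herr⟩ := exists_sobolevNorm_sub_trig_le (a := a) (b := b) hd hab hκ h2 hY.le hM0
  have hinit : fc a b (cplx u₀) = fc a b (cplx (u 0)) :=
    fc_congr (hu.initial.mono fun x hx => by simp [cplx, hx])
  refine ⟨N₀, 2 * √C, by positivity, fun Nv hNv hN => ⟨?_, fun uN huN t ht => ?_⟩⟩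
  -- Existence: the estimate shows that the truncated solution never reaches the level R, so it
  -- solves the Galerkin system itself.
  · obtain ⟨c, c', h0, hder, hfield⟩ := exists_truncated_solution hd hd3 hab hn hL hfc hf hT
      (freqFin Nv) hR.le (fc a b (cplx u₀))
    have hb := hcoef Nv hNv hN c c' (fun k hk => by rw [h0 k hk, hinit]) hder hfield
    exact ⟨_, isGalerkinSolution_of_coeff hd hd3 hab hn hL hfc hf hu₀ h0 fun t ht k hk => by
      rw [← hfield t ht (hb t ht).2 k hk]; exact hder t ht k hk⟩
  -- An arbitrary Galerkin solution satisfies the system without restriction, so the same estimate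
  -- applies without any a priori bound.
  · obtain ⟨c, hc, h0, hder⟩ := huN.coeff hd hd3 hab hn hL hfc hf hT hu₀
    have hb := (hcoef Nv hNv hN c _ (fun k hk => by rw [h0 k hk, hinit]) hder
      (fun _ _ _ _ _ => rfl) t ht).1
    have he := herr Nv hNv (c t) _ (hu.memHp t ht) (hm t ht) (hM t ht) hb
    rw [← hc t ht] at he
    have hN0 : (0 : ℝ) < gridSize Nv := by exact_mod_cast hNv.one_le_gridSize hd
    set N : ℝ := ((gridSize Nv : ℕ) : ℝ) with hNdef
    have hCsq : √C ^ 2 = C := Real.sq_sqrt hC.le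
    have e0 : sobolevNorm a b 0 (cplx (u t) - uN t) ≤ √C * (N ^ m)⁻¹ := by
      refine abs_le_of_sq_le_sq' ?_ (by positivity) |>.2
      refine (he 0 zero_le_one).trans_eq ?_
      rw [mul_pow, hCsq, inv_pow, ← pow_mul, mul_comm m]; simp
    have e1 : sobolevNorm a b 1 (cplx (u t) - uN t) ≤ √C * (N ^ m)⁻¹ * N := by
      refine abs_le_of_sq_le_sq' ?_ (by positivity) |>.2
      refine (he 1 le_rfl).trans_eq ?_
      rw [mul_pow, mul_pow, hCsq, inv_pow, ← pow_mul, mul_comm m]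
    calc _ ≤ √C * (N ^ m)⁻¹ + N⁻¹ * (√C * (N ^ m)⁻¹ * N) := by gcongr
      _ = _ := by field_simp; ring

end FourierGalerkin

/-! ### The theorem for arbitrary regularity -/

theorem mainTheorem2 {d : ℕ} (hd : 1 ≤ d) (hd3 : d ≤ 3)
    (a b : Fin d → ℝ) (hab : ∀ i, a i < b i) (T : ℝ) (hT : 0 < T) (m : ℕ)
    (f : ℝ × ℝ × EuclideanSpace ℝ (Fin d) → ℝ)
    (hgrowth : FourierGalerkin.MildGrowth f)
    (hsmooth : FourierGalerkin.SmoothReaction T f)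
    (u₀ : EuclideanSpace ℝ (Fin d) → ℝ)
    (hu₀ : FourierGalerkin.MemHp a b m (FourierGalerkin.cplx u₀))
    (u : ℝ → EuclideanSpace ℝ (Fin d) → ℝ)
    (hu : FourierGalerkin.IsExactSolution a b T f u₀ u)
    (hum : ∀ t ∈ Set.Icc 0 T, FourierGalerkin.MemHp a b m (FourierGalerkin.cplx (u t)))
    (hreg : ∃ M : ℝ, ∀ t ∈ Set.Icc 0 T,
      FourierGalerkin.sobolevNorm a b m (FourierGalerkin.cplx (u t)) ≤ M)
    (κ : ℝ) (hκ : 1 ≤ κ) :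
    ∃ (N₀ : ℕ) (C : ℝ), 0 < N₀ ∧ 0 < C ∧
      ∀ Nv : Fin d → ℕ, (∀ j, 0 < Nv j ∧ Even (Nv j)) →
        (∀ j, (FourierGalerkin.gridSize Nv : ℝ) ≤ κ * (Nv j : ℝ)) →
        N₀ ≤ FourierGalerkin.gridSize Nv →
        (∃ uN, FourierGalerkin.IsGalerkinSolution a b T f u₀ Nv uN) ∧
        ∀ uN, FourierGalerkin.IsGalerkinSolution a b T f u₀ Nv uN → ∀ t ∈ Set.Icc 0 T,
          FourierGalerkin.sobolevNorm a b 0 (FourierGalerkin.cplx (u t) - uN t)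
            + (FourierGalerkin.gridSize Nv : ℝ)⁻¹
              * FourierGalerkin.sobolevNorm a b 1 (FourierGalerkin.cplx (u t) - uN t)
          ≤ C * ((FourierGalerkin.gridSize Nv : ℝ) ^ m)⁻¹ := by
  obtain ⟨n, L, hn, hL, hf⟩ := FourierGalerkin.exists_lipschitzGrowth hd3 hgrowth
    (hsmooth.1.of_le one_le_two)
  have hstrong := hu.strongSolution hd hd3 hab hn hL hsmooth.1.continuous hf
  -- The exponent is raised to m' = max(m, 2): below 2, continuity in H² already provides a uniform
  -- bound, and N^{−m'} ≤ N^{−m}.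
  obtain ⟨m', M', hmm, h2, hm, hM⟩ : ∃ (m' : ℕ) (M' : ℝ), m ≤ m' ∧ 2 ≤ m' ∧
      (∀ t ∈ Set.Icc 0 T, FourierGalerkin.Hmem a b m'
        (FourierGalerkin.fc a b (FourierGalerkin.cplx (u t)))) ∧
      ∀ t ∈ Set.Icc 0 T, FourierGalerkin.hs a b m'
        (FourierGalerkin.fc a b (FourierGalerkin.cplx (u t))) ≤ M' := by
    rcases le_total m 2 with h | h
    · obtain ⟨M', -, hM'⟩ := hstrong.exists_hs_le
      exact ⟨2, M', h, le_rfl, hstrong.hmem, hM'⟩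
    · obtain ⟨M, hM⟩ := hreg
      have hV := FourierGalerkin.boxVol_pos hab
      refine ⟨m, (1 + d) ^ (m + 1) * (FourierGalerkin.boxVol a b)⁻¹ * M ^ 2, le_rfl, h,
        fun t ht => ((hum t ht).hs_le hab).1, fun t ht => ((hum t ht).hs_le hab).2.trans ?_⟩
      exact mul_le_mul_of_nonneg_left (pow_le_pow_left₀ (Real.sqrt_nonneg _) (hM t ht) 2)
        (by positivity)
  obtain ⟨N₀, C, hC, hmain⟩ := hu.exists_galerkin_error_le hd hd3 hab hn hL hf hT hsmooth
    hu₀.memLp hκ h2 hm hM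
  refine ⟨N₀ + 1, C, N₀.succ_pos, hC, fun Nv hNv hNκ hN => ?_⟩
  obtain ⟨hex, herr⟩ := hmain Nv ⟨hNv, hNκ⟩ (by omega)
  refine ⟨hex, fun uN huN t ht => (herr uN huN t ht).trans ?_⟩
  have hN1 : (1 : ℝ) ≤ FourierGalerkin.gridSize Nv := by
    have : 1 ≤ FourierGalerkin.gridSize Nv := by omega
    exact_mod_cast this
  exact mul_le_mul_of_nonneg_left (inv_anti₀ (by positivity) (pow_le_pow_right₀ hN1 hmm)) hC.le
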